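/- **Setting.** Let $d\ge 1$, let $\mathcal M$ be the set of probability measures on the $2d$ unit vectors of $\mathbb Z^d$, and let $\Omega=\mathcal M^{\mathbb Z^d}$; write $\omega=(\omega_x)_{x\in\mathbb Z^d}=\{\omega(x,e)\}$ for its elements (environments). Let $P$ be a probability measure on $\Omega$, stationary under the shifts of $\mathbb Z^d$, such that * (uniform ellipticity) for some $\kappa\in(0,\frac1{2d})$, $P$-a.s. $\omega(o,e)>\kappa$ for all unit vectors $e$; * ($r$-Markov) for some real $r\ge1$, for every finite $V\subset\mathbb Z^d$, $P((\omega_x)_{x\in V}\in\cdot\mid\mathcal F_{V^c})=P((\omega_x)_{x\in V}\in\cdot\mid\mathcal F_{\partial_rV})$ $P$-a.s., where $\mathcal F_\Lambda=\sigma(\omega_x:x\in\Lambda)$, $\partial_rV=\{x\notin V:d(x,V)\le r\}$ and $d(\cdot,\cdot)$ is the $\ell^1$-distance; * (mixing condition $(*)$) there are $\gamma>0$ and $C<\infty$ such that for all finite $\Delta\subset V\subset\mathbb Z^d$ with $d(\Delta,V^c)\ge r$ and all $A\subset V^c$, $$\frac{dP((\omega_x)_{x\in\Delta}\in\cdot\mid\eta)}{dP((\omega_x)_{x\in\Delta}\in\cdot\mid\eta')}\le\exp\Big(C\sum_{x\in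 A,\,y\in\Delta}e^{-\gamma d(x,y)}\Big)$$ for $P$-almost all pairs $\eta,\eta'\in\mathcal M^{V^c}$ which agree on $V^c\setminus A$ (that is, for all such pairs in some set of configurations of full measure), where $P(\cdot\mid\eta)$ is the regular conditional law given $(\omega_x)_{x\in V^c}=\eta$. For $\omega\in\Omega$ the walk $(X_n)$ starts at the origin $o$ and jumps from $y$ to $y+e$ with probability $\omega(y,e)$. Its law averaged over $P$ is denoted $\mathbf P$. Let $A_{e_1}=\{\lim_n X_n\cdot e_1=\infty\}$. The velocity $v_{e_1}$ is the deterministic number with $\lim_nX_n\cdot e_1/n=v_{e_1}$ $\mathbf P$-a.s. on $A_{e_1}$, with $v_{e_1}=0$ if $\mathbf P(A_{e_1})=0$. **Coins.** Let $\epsilon=(\epsilon_{i,x})_{i\ge0,x\in\mathbb Z^d}$ be iid, independent of $\omega$, equal to $1$ with probability $d\kappa$ and to $0$ otherwise. Given $(\omega,\epsilon)$, let $(X_n)$ be the Markov chain with $X_0=o$ which at time $n$ jumps from $z$ to $z+e$ with probability $$\frac{1_{\epsilon_{n,z}=1}}{2d}+\frac{1_{\epsilon_{n,z}=0}}{1-d\kappa}\Big[\omega(z,e)-\frac\kappa2\Big].$$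 Let $\bar{\mathbf P}$ be the joint law of $(\omega,\epsilon,X_\cdot)$; under it $X_\cdot$ has law $\mathbf P$. **Regeneration times.** Let $D=\inf\{n\ge1:X_n\cdot e_1\le X_0\cdot e_1\}$ and, for a constant $c_5$, $$R=\inf\Big\{n\ge0:\#\{0\le i\le n:X_i\cdot e_1=X_0\cdot e_1+j\}>c_5(j+1)^2\text{ for some integer }j\ge0\Big\}\wedge D .$$ Let $\theta_n$ denote the time shift by $n$ of the path and of the coins. For $L\in\mathbb N$ let $R_0=0$ and, for $k\ge0$, let $S_{k+1}$ be the least $n\ge\max(R_k,L)$ such that $X_{n-L}\cdot e_1>X_m\cdot e_1$ for all $0\le m<n-L$, and $\epsilon_{n-i,X_{n-i}}=1$, $X_{n-i+1}-X_{n-i}=e_1$ for all $1\le i\le L$; let $R_{k+1}=R\circ\theta_{S_{k+1}}+S_{k+1}$. Let $\tau_1=S_K$ with $K=\inf\{k\ge1:S_k<\infty,\,R_k=\infty\}$, $\tau_0=0$, and $\tau_{k+1}=\tau_1\circ\theta_{\tau_k}+\tau_k$ (times that do not exist are $+\infty$). When $\mathbf P(R=\infty)>0$, let $\hat{\mathbf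 P}(\cdot)=\bar{\mathbf P}(\cdot\mid R=\infty)$, and for $n\ge1$, $x\in\mathbb Z^d$ let $$Q(n,x)=\hat{\mathbf P}\big(x\text{ is visited during }[\tau_{n-1},\tau_n)\big).$$ **Theorem (heat kernel estimate).** Assume $v_{e_1}>0$. Then there is a constant $c_5>0$ with $\mathbf P(R=\infty)>0$. For every $c_5$ with $\mathbf P(R=\infty)>0$ there is $L_0$ such that for every fixed $L\ge L_0$ the times $\tau_n$ are all $\hat{\mathbf P}$-a.s. finite, $E_{\hat{\mathbf P}}\tau_1<\infty$, and there is a finite constant $C>0$ (not depending on $n$ or $x$) such that for all $n\ge1$ $$\hat{\mathbf P}(X_{\tau_n}=x)\le Cn^{-d/2}\quad\text{for all }x\in\mathbb Z^d,\qquad\qquad \sum_{x\in\mathbb Z^d}Q(n,x)^2\le C\,(E_{\hat{\mathbf P}}\tau_1)^2\,n^{-d/2}.$$ -/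

import Mathlib

open MeasureTheory ProbabilityTheory Filter Topology
open scoped ENNReal

noncomputable section

namespace RWRE

/-! ### Lattice, environments, environment measures -/

/-- The lattice `ℤ^d`. The basis vector `e₁` has index `0 : Fin d`, so `x · e₁` is `x 0`. -/
abbrev Site (d : ℕ) : Type := Fin d → ℤ

/-- The `2d` unit vectors of `ℤ^d`: `(i, true)` stands for `+e_i` and `(i, false)` for `-e_i`. -/
abbrev Step (d : ℕ) : Type := Fin d × Bool

/-- The unit vector of `ℤ^d` named by an element of `Step d`. -/
def Step.vec {d : ℕ} (e : Step d) : Site d := if e.2 then Pi.single e.1 1 else -Pi.single e.1 1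

/-- The basis vector `e₁`. -/
def e₁ (d : ℕ) [NeZero d] : Site d := Pi.single 0 1

/-- The `ℓ¹` distance on `ℤ^d`. -/
def l1dist {d : ℕ} (x y : Site d) : ℝ := ∑ i, |((x i : ℝ) - (y i : ℝ))|

/-- Probability vectors on the set of unit vectors of `ℤ^d`. -/
abbrev SiteLaw (d : ℕ) : Type := stdSimplex ℝ (Step d)

/-- An environment: a probability vector on the unit vectors at each site. -/
abbrev Env (d : ℕ) : Type := Site d → SiteLaw d

instance (d : ℕ) : StandardBorelSpace (SiteLaw d) :=
  (isClosed_stdSimplex ℝ (Step d)).measurableSet.standardBorel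

instance (d : ℕ) [NeZero d] : Nonempty (SiteLaw d) :=
  ⟨⟨Pi.single (0, true) 1, single_mem_stdSimplex ℝ _⟩⟩

/-- `P` is invariant under the spatial shifts. -/
def Stationary {d : ℕ} (P : Measure (Env d)) : Prop :=
  ∀ z : Site d, P.map (fun ω x => ω (x + z)) = P

/-- `P` is uniformly elliptic with ellipticity constant `κ ∈ (0, 1/(2d))`. -/
def UniformlyElliptic {d : ℕ} (P : Measure (Env d)) (κ : ℝ) : Prop :=
  0 < κ ∧ κ < 1 / (2 * d) ∧ ∀ᵐ ω ∂P, ∀ e : Step d, κ < (ω 0 : Step d → ℝ) e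

/-- Configurations on the set of sites `Λ`. -/
abbrev Config {d : ℕ} (Λ : Set (Site d)) : Type := ↥Λ → SiteLaw d

/-- The configuration `(ω_x)_{x ∈ Λ}`. -/
def restr {d : ℕ} (Λ : Set (Site d)) (ω : Env d) : Config Λ := fun x => ω x

/-- The σ-algebra `F_Λ` generated by `(ω_x)_{x ∈ Λ}`. -/
abbrev sigmaAlg {d : ℕ} (Λ : Set (Site d)) : MeasurableSpace (Env d) :=
  MeasurableSpace.comap (restr Λ) inferInstance

/-- The `r`-boundary of `V`: the sites outside `V` at `ℓ¹` distance at most `r` from `V`. -/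
def rBoundary {d : ℕ} (r : ℝ) (V : Set (Site d)) : Set (Site d) :=
  {x | x ∉ V ∧ ∃ y ∈ V, l1dist x y ≤ r}

/-- The `r`-Markov property. -/
def IsMarkovEnv {d : ℕ} (P : Measure (Env d)) (r : ℝ) : Prop :=
  ∀ V : Finset (Site d), ∀ B : Set (Config (V : Set (Site d))), MeasurableSet B →
    P⟦restr (V : Set (Site d)) ⁻¹' B | sigmaAlg (V : Set (Site d))ᶜ⟧ =ᵐ[P]
      P⟦restr (V : Set (Site d)) ⁻¹' B | sigmaAlg (rBoundary r (V : Set (Site d)))⟧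

/-- The mixing condition `(*)`. Here `P((ω_x)_{x ∈ Δ} ∈ · | η)` is the regular conditional
distribution `condDistrib`. The bound on the density of one conditional law with respect to
another is the inequality between the two measures. "For `P`-almost all pairs" which agree off `A`
means: for all pairs of elements of some set `G` of full measure which agree off `A`. -/
def MixingCondition {d : ℕ} [NeZero d] (P : Measure (Env d)) [IsFiniteMeasure P] (r : ℝ) : Prop :=
  ∃ γ C : ℝ, 0 < γ ∧ ∀ Δ V : Finset (Site d), Δ ⊆ V →
    (∀ x ∈ Δ, ∀ y, y ∉ V → r ≤ l1dist x y) →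
    ∀ A : Set (Site d), A ⊆ (V : Set (Site d))ᶜ →
      ∃ G : Set (Config (V : Set (Site d))ᶜ),
        (∀ᵐ ω ∂P, restr (V : Set (Site d))ᶜ ω ∈ G) ∧
        ∀ η ∈ G, ∀ η' ∈ G,
          (∀ x : ↥(V : Set (Site d))ᶜ, (x : Site d) ∉ A → η x = η' x) →
          condDistrib (restr (Δ : Set (Site d))) (restr (V : Set (Site d))ᶜ) P η ≤
            ENNReal.ofReal (Real.exp (C * ∑ y ∈ Δ, ∑' x : A, Real.exp (-γ * l1dist (x : Site d) y)))
              • condDistrib (restr (Δ : Set (Site d))) (restr (V : Set (Site d))ᶜ) P η'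

/-! ### Nearest-neighbour walks with given transition weights -/

/-- Walks in `ℤ^d`, indexed by time. -/
abbrev Walk (d : ℕ) : Type := ℕ → Site d

/-- The law of `z + e`, where the unit vector `e` is drawn with the weights `w`. Weights that are
not a probability vector (which almost surely do not occur below) make the walk stay put. -/
def stepLaw {d : ℕ} (w : Step d → ℝ) (z : Site d) : Measure (Site d) :=
  open scoped Classical in
  if w ∈ stdSimplex ℝ (Step d) then ∑ e : Step d, ENNReal.ofReal (w e) • Measure.dirac (z + e.vec)
  else Measure.dirac z

lemma isProbabilityMeasure_stepLaw {d : ℕ} (w : Step d → ℝ) (z : Site d) :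
    IsProbabilityMeasure (stepLaw w z) := by
  unfold stepLaw
  split_ifs with h
  · refine ⟨?_⟩
    simp only [Measure.coe_finsetSum, Finset.sum_apply, Measure.smul_apply, measure_univ,
      smul_eq_mul, mul_one]
    rw [← ENNReal.ofReal_sum_of_nonneg fun e _ => h.1 e, h.2, ENNReal.ofReal_one]
  · infer_instance

lemma measurable_stepLaw {d : ℕ} (z : Site d) : Measurable fun w : Step d → ℝ => stepLaw w z := by
  classical
  unfold stepLaw
  refine Measurable.ite (isClosed_stdSimplex ℝ (Step d)).measurableSet ?_ measurable_const
  refine Measure.measurable_of_measurable_coe _ fun s _ => ?_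
  simp only [Measure.coe_finsetSum, Finset.sum_apply, Measure.smul_apply, smul_eq_mul]
  fun_prop

/-- Measurable transition weights `w n θ z e`: the weight of a step `e` from the site `z` at time
`n`, given the value `θ` of a random parameter (the environment, or environment and coins). -/
structure Weights (d : ℕ) (Θ : Type) [MeasurableSpace Θ] where
  weight : ℕ → Θ → Site d → Step d → ℝ
  measurable_weight : ∀ n z, Measurable fun θ => weight n θ z

variable {d : ℕ} {Θ : Type} [MeasurableSpace Θ]

/-- One step of the walk at time `n`, as a kernel from (parameter, position) to position. -/
def stepKernel (w : Weights d Θ) (n : ℕ) : Kernel (Θ × Site d) (Site d) where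
  toFun p := stepLaw (w.weight n p.1 p.2) p.2
  measurable' := measurable_from_prod_countable_left fun z =>
    (measurable_stepLaw z).comp (w.measurable_weight n z)

instance (w : Weights d Θ) (n : ℕ) : IsMarkovKernel (stepKernel w n) :=
  ⟨fun _ => isProbabilityMeasure_stepLaw _ _⟩

/-- One step of the pair (parameter, position): the parameter is frozen. The kernel is viewed as
depending on the whole history, through the present state only. -/
def pairKernel (w : Weights d Θ) (n : ℕ) :
    Kernel ((_ : Finset.Iic n) → Θ × Site d) (Θ × Site d) :=
  ((Kernel.deterministic Prod.fst measurable_fst) ×ₖ stepKernel w n).comap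
    (fun h => h ⟨n, Finset.mem_Iic.2 le_rfl⟩) (measurable_pi_apply _)

instance (w : Weights d Θ) (n : ℕ) : IsMarkovKernel (pairKernel w n) := by
  unfold pairKernel; infer_instance

/-- The quenched law: the law of the time-inhomogeneous Markov chain started at `x` with the
transition weights `w · θ · ·`, as a kernel in `(θ, x)`. -/
def quenched (w : Weights d Θ) : Kernel (Θ × Site d) (Walk d) :=
  ((Kernel.traj (X := fun _ => Θ × Site d) (pairKernel w) 0).comap (fun p _ => p)
    (by fun_prop)).map (fun y n => (y n).2)

/-- The weights `ω(z, e)` of the random walk in the environment `ω`. -/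
def envWeights (d : ℕ) : Weights d (Env d) where
  weight _ ω z e := (ω z : Step d → ℝ) e
  measurable_weight _ z := measurable_subtype_coe.comp (measurable_pi_apply z)

/-- The annealed law `𝐏` of the walk started at the origin. -/
def annealed (P : Measure (Env d)) : Measure (Walk d) :=
  (quenched (envWeights d)).comap (fun ω => (ω, (0 : Site d))) (by fun_prop) ∘ₘ P

/-! ### The `ε`-coins -/

/-- The coins `ε_{i,x}`; `true` stands for the value `1`. -/
abbrev Coins (d : ℕ) : Type := ℕ × Site d → Bool

/-- The law `Q` of the coins: independent, with `Q(ε_{i,x} = 1) = dκ`. -/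
def coinLaw (d : ℕ) (κ : ℝ) : Measure (Coins d) :=
  Measure.infinitePi fun _ => ENNReal.ofReal (d * κ) • Measure.dirac true +
    ENNReal.ofReal (1 - d * κ) • Measure.dirac false

/-- The transition weights of the walk in the environment `ω` with coins `ε`. -/
def coinWeights (d : ℕ) (κ : ℝ) : Weights d (Env d × Coins d) where
  weight n θ z e := if θ.2 (n, z) = true then 1 / (2 * d)
    else 1 / (1 - d * κ) * ((θ.1 z : Step d → ℝ) e - κ / 2)
  measurable_weight n z := by
    have h1 : Measurable fun θ : Env d × Coins d => (θ.1 z : Step d → ℝ) :=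
      measurable_subtype_coe.comp ((measurable_pi_apply z).comp measurable_fst)
    have h2 : Measurable fun θ : Env d × Coins d => θ.2 (n, z) :=
      (measurable_pi_apply (n, z)).comp measurable_snd
    refine measurable_pi_lambda _ fun e => ?_
    refine Measurable.ite (h2 (measurableSet_singleton true)) measurable_const ?_
    exact (((measurable_pi_apply e).comp h1).sub_const _).const_mul _

/-- The joint law of environment, coins and the walk started at the origin. -/
def coinAnnealed (P : Measure (Env d)) (κ : ℝ) : Measure ((Env d × Coins d) × Walk d) :=
  (P.prod (coinLaw d κ)) ⊗ₘ
    (quenched (coinWeights d κ)).comap (fun θ => (θ, (0 : Site d))) (by fun_prop)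

/-! ### Random times -/

/-- The first time at which `p` holds; `⊤` if there is none. -/
def firstTime (p : ℕ → Prop) : ℕ∞ := ⨅ (n : ℕ) (_ : p n), (n : ℕ∞)

/-- `f ∘ θ_t + t`, where `f n` is the value of a time for the trajectory shifted by `n`. -/
def restart (t : ℕ∞) (f : ℕ → ℕ∞) : ℕ∞ := if t = ⊤ then ⊤ else f t.toNat + t

/-- Time shift of a path. -/
def shiftPath (n : ℕ) (X : Walk d) : Walk d := fun i => X (n + i)

/-- Time shift of the coins. -/
def shiftCoins (n : ℕ) (ε : Coins d) : Coins d := fun p => ε (n + p.1, p.2)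

section Times

variable [NeZero d]

/-- `D = inf {n ≥ 1 : X_n · e₁ ≤ X_0 · e₁}`. -/
def timeD (X : Walk d) : ℕ∞ := firstTime fun n => 1 ≤ n ∧ X n 0 ≤ X 0 0

/-- The number of visits up to time `n` to the level `j` above the starting point. -/
def visits (X : Walk d) (n j : ℕ) : ℕ :=
  ((Finset.range (n + 1)).filter fun i => X i 0 = X 0 0 + (j : ℤ)).card

/-- The stopping time `R`: the first time at which some level `j ≥ 0` has been visited more than
`c (j + 1)²` times, or `D` if this comes earlier. -/
def timeR (c : ℝ) (X : Walk d) : ℕ∞ :=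
  min (firstTime fun n => ∃ j : ℕ, c * ((j : ℝ) + 1) ^ 2 < (visits X n j : ℝ)) (timeD X)

/-- At time `n - L` the walk is at a strict record level in direction `e₁`, and in the following
`L` steps all coins used equal `1` and all steps equal `e₁`. -/
def IsAttempt (L : ℕ) (ε : Coins d) (X : Walk d) (n : ℕ) : Prop :=
  L ≤ n ∧ (∀ m < n - L, X m 0 < X (n - L) 0) ∧
    ∀ i, 1 ≤ i → i ≤ L → ε (n - i, X (n - i)) = true ∧ X (n - i + 1) - X (n - i) = e₁ d

/-- `S_{k+1}` as a function of `R_k`. -/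
def nextS (L : ℕ) (ε : Coins d) (X : Walk d) (Rk : ℕ∞) : ℕ∞ :=
  firstTime fun n => Rk ≤ (n : ℕ∞) ∧ IsAttempt L ε X n

/-- The times `R_k`: `R_0 = 0` and `R_{k+1} = R ∘ θ_{S_{k+1}} + S_{k+1}`. -/
def seqR (c : ℝ) (L : ℕ) (ε : Coins d) (X : Walk d) : ℕ → ℕ∞
  | 0 => 0
  | k + 1 => restart (nextS L ε X (seqR c L ε X k)) fun n => timeR c (shiftPath n X)

/-- The first regeneration time: `τ₁ = S_K`, where `K` is the least `k ≥ 1` with `S_k < ∞` and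
`R_k = ∞`; it is infinite if there is no such `k`. -/
def tau₁ (c : ℝ) (L : ℕ) (ε : Coins d) (X : Walk d) : ℕ∞ :=
  open scoped Classical in
  if h : ∃ k, nextS L ε X (seqR c L ε X k) < ⊤ ∧ seqR c L ε X (k + 1) = ⊤ then
    nextS L ε X (seqR c L ε X (Nat.find h))
  else ⊤

/-- The regeneration times: `τ_0 = 0` and `τ_{n+1} = τ₁ ∘ θ_{τ_n} + τ_n`. -/
def tau (c : ℝ) (L : ℕ) (ε : Coins d) (X : Walk d) : ℕ → ℕ∞
  | 0 => 0
  | n + 1 => restart (tau c L ε X n) fun m => tau₁ c L (shiftCoins m ε) (shiftPath m X)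

/-! ### Velocity, the conditional law, and the events of the heat kernel estimate -/

/-- `v` is the limiting velocity `v_{e₁}`: on the event `A_{e₁} = {X_n · e₁ → ∞}` one has
`X_n · e₁ / n → v` almost surely, and `v = 0` if `A_{e₁}` has probability `0`. -/
def IsVelocity (P : Measure (Env d)) (v : ℝ) : Prop :=
  (∀ᵐ X ∂annealed P, Tendsto (fun n => X n 0) atTop atTop →
    Tendsto (fun n : ℕ => (X n 0 : ℝ) / n) atTop (𝓝 v)) ∧
  (annealed P {X | Tendsto (fun n => X n 0) atTop atTop} = 0 → v = 0)

/-- The joint law of environment, coins and walk, conditioned on `R = ∞`. -/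
def hatP (P : Measure (Env d)) (κ c : ℝ) : Measure ((Env d × Coins d) × Walk d) :=
  ProbabilityTheory.cond (coinAnnealed P κ) {p | timeR c p.2 = ⊤}

/-- The `n`-th regeneration time as a random variable on the space of triples. -/
def regTime (c : ℝ) (L n : ℕ) (p : (Env d × Coins d) × Walk d) : ℕ∞ := tau c L p.1.2 p.2 n

/-- The event `{X_{τ_n} = x}`. -/
def regAt (c : ℝ) (L n : ℕ) (x : Site d) : Set ((Env d × Coins d) × Walk d) :=
  {p | ∃ m : ℕ, regTime c L n p = m ∧ p.2 m = x}

/-- The event that `x` is visited during `[τ_{n-1}, τ_n)`, for `n ≥ 1`. -/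
def visitedIn (c : ℝ) (L n : ℕ) (x : Site d) : Set ((Env d × Coins d) × Walk d) :=
  {p | ∃ m : ℕ, regTime c L (n - 1) p ≤ m ∧ (m : ℕ∞) < regTime c L n p ∧ p.2 m = x}

/-- The expectation of the first regeneration time under the conditioned law. -/
def meanTau (P : Measure (Env d)) (κ c : ℝ) (L : ℕ) : ℝ≥0∞ :=
  ∫⁻ p, (regTime c L 1 p : ℝ≥0∞) ∂hatP P κ c

end Times

end RWRE

end

open RWRE

set_option linter.unusedSectionVars false
set_option linter.unusedSimpArgs false
set_option linter.unusedVariables false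

noncomputable section

/-! Integrating out the coins merges a step and its coin into one letter, and the walk becomes a
random sequence over a finite alphabet. A letter with coin `1` has weight `κ/2` at every site, so it
says nothing about the environment; a letter with coin `0` has weight `ω(x,e) - κ/2` at elliptic
sites. Almost surely the events of the theorem are events of this sequence (`ae_letters`). Given `R
= ∞`, the regeneration times cut it into blocks, words that end with `L` steps `e₁` with coin `1`.
Whether a word is a block depends on the word alone, and a list of blocks has probability `Z⁻¹
E[weight × survival probability from its end]` with `Z = P(R = ∞)` (`blockProb_eq`).

Blocks are almost independent. The definition of `R` allows at most `c(j+1)²` visits to height `j`,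
so the exponent in the mixing condition is bounded uniformly over everything the walk can do after a
regeneration, and is at most `K e^{-ak}` when the boundary conditions being compared differ only at
depth `k` or more among the conditioned sites (`MixingCondition.ae_compare`). Each block raises the
walk by at least `L`, so old blocks matter exponentially little.

The core is the renewal equation `G(w) = U(w) + ½ ∑_{1≤j<n} U(w₁…w_j) G(w_{j+1}…w_n)` with `U ≥ 0`
(`GoodMix.exists_renewal_fun`). It says that after each block the process starts afresh with
probability `½`. To find `U`, take the first `j` blocks from one environment and the rest from an
independent one; on the first `k` blocks this spliced measure has a density `ρ_{jk}`
(`SpliceData.exists_density`). For each environment solve `v_k + ½ ∑_{1≤j<k} v_j ρ_{jk} = 1`,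
multiply by the block weights and the survival probability, and integrate: the terms with `ρ_{jk}`
factorise. Positivity of `v_k` is an argument of Kaluza type (`renewalSeq_nonneg`): mixing gives
`ρ_{j,k+1} ≤ (1 + ε_{k-j}) ρ_{jk}` with `∑ 5^m ε_m` small for large `L`.

For displacements the equation becomes a recursion for characteristic functions. By ellipticity one
block reaches each of two sites differing by `e_i` with probability at least `p`, so the first
characteristic function is at most `1 - s` with `s` of order `|θ|²`; the recursion then gives `(1 -
s/8)^n` for `n` blocks (`renewal_decay`), and integration over the box gives `n^{-d/2}`
(`renewal_local_bound`). For `Q(n,·)`, the last block is independent of the earlier ones up to a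
factor `2` (`GoodMix.blockProb_append`), so `Q(n,·)` is at most twice the convolution of a function
of mass at most `Eτ₁` with a law whose atoms are `O(n^{-d/2})`.

Positive speed gives the two remaining claims. A path with linear growth survives for some `c` after
its last time at level `≤ 0`, and countably many cases leave one of positive probability. For `Eτ₁ <
∞` put `g_k = E z^{τ_k}`: near independence gives `½ E(1 - z^{τ₁}) ∑ g_k ≤ 1`, while by time `aJ`
the expected number of regenerations is at least a multiple of `J`. With `z = J/(J+1)` this bounds
`J E(1 - z^{τ₁})` as `J → ∞` (`tsum_length_lt_top`). -/

namespace RWRE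

/-! ### Cylinder probabilities of the quenched law -/

section QuenchedCylinders

variable {d : ℕ} {Θ : Type} [MeasurableSpace Θ]

/-- The law of the frozen parameter together with the walk. -/
def pairTraj (w : Weights d Θ) (p : Θ × Site d) : Measure (ℕ → Θ × Site d) :=
  Kernel.traj (X := fun _ => Θ × Site d) (pairKernel w) 0 (fun _ => p)

instance (w : Weights d Θ) (p : Θ × Site d) : IsProbabilityMeasure (pairTraj w p) := by
  unfold pairTraj; infer_instance

lemma quenched_apply (w : Weights d Θ) (p : Θ × Site d) {S : Set (Walk d)}
    (hS : MeasurableSet S) :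
    quenched w p S = pairTraj w p {y | (fun n => (y n).2) ∈ S} := by
  unfold quenched
  rw [Kernel.map_apply' _ (by fun_prop) _ hS, Kernel.comap_apply]
  rfl

instance (w : Weights d Θ) : IsMarkovKernel (quenched w) := by
  unfold quenched
  exact Kernel.IsMarkovKernel.map _ (by fun_prop)

lemma lintegral_pairKernel (w : Weights d Θ) (n : ℕ) (y : (_ : Finset.Iic n) → Θ × Site d)
    {f : Θ × Site d → ℝ≥0∞} (hf : Measurable f) :
    ∫⁻ z, f z ∂pairKernel w n y =
      ∫⁻ x, f ((y ⟨n, Finset.mem_Iic.2 le_rfl⟩).1, x)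
        ∂stepLaw (w.weight n (y ⟨n, Finset.mem_Iic.2 le_rfl⟩).1
          (y ⟨n, Finset.mem_Iic.2 le_rfl⟩).2) (y ⟨n, Finset.mem_Iic.2 le_rfl⟩).2 := by
  unfold pairKernel
  rw [Kernel.comap_apply, Kernel.lintegral_deterministic_prod _ _ _ hf]
  rfl

/-- The trajectory law up to time `n + 1` is the law up to time `n` followed by one step of the
kernel; this is the one-step Markov property in integrated form. -/
lemma lintegral_pairTraj_succ (w : Weights d Θ) (p : Θ × Site d) (n : ℕ)
    {f : ((_ : Finset.Iic n) → Θ × Site d) × (Θ × Site d) → ℝ≥0∞} (hf : Measurable f) :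
    ∫⁻ y, f (fun i => y i, y (n + 1)) ∂pairTraj w p =
    ∫⁻ y, ∫⁻ x, f (fun i => y i, ((y n).1, x)) ∂stepLaw (w.weight n (y n).1 (y n).2) (y n).2
      ∂pairTraj w p := by
  have h := Kernel.partialTraj_compProd_eq_map_traj (X := fun _ => Θ × Site d)
    (κ := pairKernel w) (Nat.zero_le n) (x₀ := fun _ => p)
  have h2 : ∫⁻ q, f q ∂_ = ∫⁻ q, f q ∂_ := congrArg (fun μ => ∫⁻ q, f q ∂μ) h
  rw [lintegral_map hf (by fun_prop), Measure.lintegral_compProd hf,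
    ← Kernel.traj_map_frestrictLe_apply, lintegral_map _ (by fun_prop)] at h2
  · refine h2.symm.trans (lintegral_congr fun y => ?_)
    rw [lintegral_pairKernel w n _ (by fun_prop)]
    rfl
  · exact Measurable.lintegral_kernel_prod_right hf

lemma pairTraj_zero (w : Weights d Θ) (p : Θ × Site d) {f : Θ × Site d → ℝ≥0∞}
    (hf : Measurable f) : ∫⁻ y, f (y 0) ∂pairTraj w p = f p := by
  have h := Kernel.traj_map_frestrictLe_apply (X := fun _ => Θ × Site d)
    (κ := pairKernel w) 0 0 (fun _ => p)
  have h2 : ∫⁻ q : (_ : Finset.Iic 0) → Θ × Site d, f (q ⟨0, by simp⟩) ∂_ =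
      ∫⁻ q : (_ : Finset.Iic 0) → Θ × Site d, f (q ⟨0, by simp⟩) ∂_ :=
    congrArg (fun μ => ∫⁻ q : (_ : Finset.Iic 0) → Θ × Site d, f (q ⟨0, by simp⟩) ∂μ) h
  rw [lintegral_map (by fun_prop) (by fun_prop), Kernel.partialTraj_self, Kernel.id_apply,
    lintegral_dirac' _ (by fun_prop)] at h2
  exact h2

/-- Each step copies the parameter, so induction over the one-step identity keeps it at its initial
value. -/
lemma ae_pairTraj_fst [MeasurableSingletonClass Θ] (w : Weights d Θ) (p : Θ × Site d) (n : ℕ) :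
    ∀ᵐ y ∂pairTraj w p, (y n).1 = p.1 := by
  have hm : MeasurableSet {q : Θ × Site d | q.1 = p.1}ᶜ :=
    (measurable_fst (measurableSet_singleton p.1)).compl
  have key : ∀ n, pairTraj w p {y | (y n).1 = p.1}ᶜ =
      ∫⁻ y, ({q : Θ × Site d | q.1 = p.1}ᶜ).indicator 1 (y n) ∂pairTraj w p := fun n => by
    rw [← lintegral_indicator_one (by exact hm.preimage (measurable_pi_apply n))]; rfl
  have hf : Measurable (({q : Θ × Site d | q.1 = p.1}ᶜ).indicator (1 : Θ × Site d → ℝ≥0∞)) :=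
    measurable_one.indicator hm
  rw [ae_iff]
  change pairTraj w p {y | (y n).1 = p.1}ᶜ = 0
  induction n with
  | zero =>
    rw [key, pairTraj_zero w p hf]; simp
  | succ n ih =>
    rw [key]
    refine (lintegral_pairTraj_succ w p n (hf.comp measurable_snd)).trans ?_
    have : ∀ᵐ y ∂pairTraj w p, (y n).1 = p.1 := by rw [ae_iff]; exact ih
    rw [lintegral_congr_ae (g := 0)]
    · simp
    · filter_upwards [this] with y hy
      simp [hy]

/-- The cylinder is a product of indicators. Integrating out the last position gives a constant
factor, because the earlier indicators fix the position before it. -/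
lemma quenched_cylinder [MeasurableSingletonClass Θ] (w : Weights d Θ) (θ : Θ) (y : Walk d)
    (n : ℕ) :
    quenched w (θ, y 0) {X | ∀ t ∈ Finset.range (n + 1), X t = y t} =
      ∏ t ∈ Finset.range n, stepLaw (w.weight t θ (y t)) (y t) {y (t + 1)} := by
  classical
  have hcyl : MeasurableSet {X : Walk d | ∀ t ∈ Finset.range (n + 1), X t = y t} := by
    have : {X : Walk d | ∀ t ∈ Finset.range (n + 1), X t = y t} =
        ⋂ t ∈ Finset.range (n + 1), (fun X : Walk d => X t) ⁻¹' {y t} := by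
      ext X; simp
    rw [this]
    exact MeasurableSet.biInter (Set.to_countable _) fun t _ =>
      (measurable_pi_apply t) (measurableSet_singleton (y t))
  set I : ℕ → Θ × Site d → ℝ≥0∞ := fun t q => if q.2 = y t then 1 else 0 with hI
  have hIm : ∀ t, Measurable (I t) := fun t =>
    Measurable.ite (measurable_snd (measurableSet_singleton (y t))) measurable_const
      measurable_const
  have key : ∀ n, ∫⁻ z, ∏ t ∈ Finset.range (n + 1), I t (z t) ∂pairTraj w (θ, y 0) =
      ∏ t ∈ Finset.range n, stepLaw (w.weight t θ (y t)) (y t) {y (t + 1)} := by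
    intro n
    induction n with
    | zero =>
      simp only [zero_add, Finset.range_one, Finset.prod_singleton, Finset.range_zero,
        Finset.prod_empty]
      rw [pairTraj_zero w (θ, y 0) (hIm 0)]; simp [hI]
    | succ n ih =>
      have h := lintegral_pairTraj_succ w (θ, y 0) n
        (f := fun q => (∏ t ∈ (Finset.range (n + 1)).attach,
          I t (q.1 ⟨t, Finset.mem_Iic.2 (Nat.lt_succ_iff.1 (Finset.mem_range.1 t.2))⟩)) *
            I (n + 1) q.2) (by fun_prop)
      simp only at h
      have e : ∀ z : ℕ → Θ × Site d, ∏ t ∈ (Finset.range (n + 1)).attach, I t (z t) =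
          ∏ t ∈ Finset.range (n + 1), I t (z t) := fun z =>
        Finset.prod_attach (Finset.range (n + 1)) (fun t => I t (z t))
      simp only [e] at h
      simp_rw [Finset.prod_range_succ _ (n + 1)]
      rw [h, Finset.prod_range_succ, ← ih, ← lintegral_mul_const _ (by fun_prop)]
      refine lintegral_congr_ae ?_
      filter_upwards [ae_pairTraj_fst w (θ, y 0) n] with z hz
      rw [lintegral_const_mul _ (by fun_prop)]
      by_cases hzn : (z n).2 = y n
      · congr 1
        rw [hz, hzn, ← lintegral_indicator_one (measurableSet_singleton _)]
        simp [hI, Set.indicator]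
      · rw [Finset.prod_range_succ]
        simp [hI, hzn]
  rw [← key, quenched_apply _ _ hcyl, ← lintegral_indicator_one]
  · refine lintegral_congr fun z => ?_
    simp only [hI, Finset.prod_ite_zero, Finset.prod_const_one]
    simp [Set.indicator_apply]
  · exact (by fun_prop : Measurable fun z : ℕ → Θ × Site d => fun n => (z n).2) hcyl

end QuenchedCylinders

/-! ### Letters and the quenched weights of words -/

section Letters

variable {d : ℕ}

/-- A letter records one step of the walk and the coin used for it. -/
abbrev Letter (d : ℕ) : Type := Step d × Bool

lemma Step.vec_apply (e : Step d) (k : Fin d) :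
    e.vec k = if k = e.1 then (if e.2 = true then 1 else -1) else 0 := by
  unfold Step.vec
  split_ifs with h1 h2 h2 <;> simp [h2]

lemma Step.vec_injective : Function.Injective (Step.vec : Step d → Site d) := by
  rintro ⟨i, a⟩ ⟨j, b⟩ h
  have hi := congrFun h i
  simp only [Step.vec_apply, if_true] at hi
  by_cases hij : i = j
  · subst hij
    rcases a <;> rcases b <;> simp_all
  · rcases a <;> simp [hij] at hi

/-- Ellipticity of a single site law. -/
def Elliptic (κ : ℝ) (p : SiteLaw d) : Prop := ∀ e, κ ≤ (p : Step d → ℝ) e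

lemma measurableSet_elliptic (κ : ℝ) : MeasurableSet {p : SiteLaw d | Elliptic κ p} := by
  have : {p : SiteLaw d | Elliptic κ p} =
      ⋂ e, (fun p : SiteLaw d => (p : Step d → ℝ) e) ⁻¹' Set.Ici κ := by
    ext p; simp [Elliptic]
  rw [this]
  exact MeasurableSet.iInter fun e =>
    ((measurable_pi_apply e).comp measurable_subtype_coe) measurableSet_Ici

open scoped Classical in
/-- The quenched probability of a letter; it is replaced by a fixed probability vector at sites
where the environment is not elliptic. -/
def letterWeight (κ : ℝ) (a : Letter d) (p : SiteLaw d) : ℝ≥0∞ :=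
  if a.2 = true then ENNReal.ofReal (κ / 2)
  else if Elliptic κ p then ENNReal.ofReal ((p : Step d → ℝ) a.1 - κ / 2)
  else ENNReal.ofReal (1 / (2 * d) - κ / 2)

@[fun_prop]
lemma measurable_letterWeight (κ : ℝ) (a : Letter d) :
    Measurable (letterWeight κ a) := by
  unfold letterWeight
  refine Measurable.ite (by simp) measurable_const
    (Measurable.ite (measurableSet_elliptic κ) ?_ measurable_const)
  exact (((measurable_pi_apply a.1).comp measurable_subtype_coe).sub_const _).ennreal_ofReal

/-- The two letters with the same step add up to `p e`, or to `1/(2d)` at a non-elliptic site.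
Thanks to that fallback the identity holds for every environment and not only almost surely. -/
lemma sum_letterWeight [NeZero d] {κ : ℝ} (h0 : 0 < κ) (h1 : κ < 1 / (2 * d)) (p : SiteLaw d) :
    ∑ a : Letter d, letterWeight κ a p = 1 := by
  classical
  have hd : (0 : ℝ) < d := Nat.cast_pos.2 (NeZero.pos d)
  rw [Fintype.sum_prod_type]
  simp only [Fintype.sum_bool, letterWeight, if_true, Bool.false_eq_true, if_false]
  by_cases hp : Elliptic κ p
  · simp only [hp, if_true]
    rw [Finset.sum_congr rfl (g := fun e => ENNReal.ofReal ((p : Step d → ℝ) e)),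
      ← ENNReal.ofReal_sum_of_nonneg, show ∑ e, (p : Step d → ℝ) e = 1 from p.2.2,
      ENNReal.ofReal_one]
    · exact fun e _ => p.2.1 e
    · intro e _
      have := hp e
      rw [← ENNReal.ofReal_add (by linarith) (by linarith)]
      congr 1; ring
  · simp only [hp, if_false]
    rw [Finset.sum_congr rfl (g := fun e => ENNReal.ofReal (1 / (2 * (d : ℝ)))),
      ← ENNReal.ofReal_sum_of_nonneg]
    · rw [Finset.sum_const, Finset.card_univ, Fintype.card_prod, Fintype.card_fin,
        Fintype.card_bool, nsmul_eq_mul, Nat.cast_mul, Nat.cast_ofNat,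
        show (d : ℝ) * 2 * (1 / (2 * d)) = 1 by field_simp, ENNReal.ofReal_one]
    · intros; positivity
    · intro e _
      rw [← ENNReal.ofReal_add (by linarith) (by linarith)]
      congr 1; ring

/-- The displacement of a word. -/
def wordDisp (π : List (Letter d)) : Site d := (π.map fun a => a.1.vec).sum

@[simp] lemma wordDisp_nil : wordDisp ([] : List (Letter d)) = 0 := rfl
@[simp] lemma wordDisp_cons (a : Letter d) (π : List (Letter d)) :
    wordDisp (a :: π) = a.1.vec + wordDisp π := by simp [wordDisp]
@[simp] lemma wordDisp_append (π π' : List (Letter d)) :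
    wordDisp (π ++ π') = wordDisp π + wordDisp π' := by simp [wordDisp]

/-- The quenched probability that the walk started at `x` spells the word. -/
def wordWeight (κ : ℝ) : List (Letter d) → Site d → Env d → ℝ≥0∞
  | [], _, _ => 1
  | a :: π, x, ω => letterWeight κ a (ω x) * wordWeight κ π (x + a.1.vec) ω

@[fun_prop]
lemma measurable_wordWeight (κ : ℝ) (π : List (Letter d)) (x : Site d) :
    Measurable (wordWeight κ π x) := by
  induction π generalizing x with
  | nil => exact measurable_const
  | cons a π ih =>
    exact ((measurable_letterWeight κ a).comp (measurable_pi_apply x)).mul (ih _)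

lemma wordWeight_append (κ : ℝ) (π π' : List (Letter d)) (x : Site d) (ω : Env d) :
    wordWeight κ (π ++ π') x ω = wordWeight κ π x ω * wordWeight κ π' (x + wordDisp π) ω := by
  induction π generalizing x with
  | nil => simp [wordWeight]
  | cons a π ih => simp [wordWeight, ih, mul_assoc, add_assoc]

lemma wordWeight_shift (κ : ℝ) (π : List (Letter d)) (x z : Site d) (ω : Env d) :
    wordWeight κ π x (fun y => ω (y + z)) = wordWeight κ π (x + z) ω := by
  induction π generalizing x with
  | nil => simp [wordWeight]
  | cons a π ih => simp [wordWeight, ih, add_right_comm]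

lemma wordWeight_eq_prod (κ : ℝ) (π : List (Letter d)) (a₀ : Letter d) (x : Site d) (ω : Env d) :
    wordWeight κ π x ω = ∏ t ∈ Finset.range π.length,
      letterWeight κ (π.getD t a₀) (ω (x + wordDisp (π.take t))) := by
  induction π generalizing x with
  | nil => simp [wordWeight]
  | cons a π ih =>
    rw [List.length_cons, Finset.prod_range_succ']
    simp [wordWeight, ih, mul_comm, add_assoc]

lemma letterWeight_le_one [NeZero d] {κ : ℝ} (h0 : 0 < κ) (h1 : κ < 1 / (2 * d)) (a : Letter d)
    (p : SiteLaw d) : letterWeight κ a p ≤ 1 := by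
  rw [← sum_letterWeight h0 h1 p]
  exact Finset.single_le_sum (f := fun a => letterWeight κ a p) (fun _ _ => zero_le)
    (Finset.mem_univ a)

lemma wordWeight_le_one [NeZero d] {κ : ℝ} (h0 : 0 < κ) (h1 : κ < 1 / (2 * d))
    (π : List (Letter d)) (x : Site d) (ω : Env d) : wordWeight κ π x ω ≤ 1 := by
  induction π generalizing x with
  | nil => simp [wordWeight]
  | cons a π ih => exact mul_le_one' (letterWeight_le_one h0 h1 _ _) (ih _)

/-- Ellipticity in the form used below: `κ - κ/2 = κ/2`, and the fallback value respects the bound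
because `κ < 1/(2d)`. -/
lemma letterWeight_ge {κ : ℝ} (h1 : κ < 1 / (2 * d)) (a : Letter d)
    (p : SiteLaw d) : ENNReal.ofReal (κ / 2) ≤ letterWeight κ a p := by
  unfold letterWeight
  split_ifs with h h'
  · exact le_rfl
  · have := h' a.1
    exact ENNReal.ofReal_le_ofReal (by linarith)
  · exact ENNReal.ofReal_le_ofReal (by linarith)

lemma wordWeight_ge {κ : ℝ} (h1 : κ < 1 / (2 * d)) (π : List (Letter d)) (x : Site d)
    (ω : Env d) : ENNReal.ofReal (κ / 2) ^ π.length ≤ wordWeight κ π x ω := by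
  induction π generalizing x with
  | nil => simp [wordWeight]
  | cons a π ih =>
    rw [List.length_cons, pow_succ']
    exact mul_le_mul' (letterWeight_ge h1 a _) (ih _)

end Letters

/-! ### Integrals of products over independent coordinates -/

section Products

lemma lintegral_infinitePi_prod {ι : Type*} {X : ι → Type*} [∀ i, MeasurableSpace (X i)]
    (μ : ∀ i, Measure (X i)) [∀ i, IsProbabilityMeasure (μ i)] (s : Finset ι)
    (F : ∀ i, X i → ℝ≥0∞) (hF : ∀ i, Measurable (F i)) :
    ∫⁻ x, ∏ i ∈ s, F i (x i) ∂Measure.infinitePi μ = ∏ i ∈ s, ∫⁻ y, F i y ∂μ i := by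
  have h := iIndepFun_infinitePi (P := μ) hF
  refine (lintegral_prod_eq_prod_lintegral_of_indepFun s (fun i (x : ∀ i, X i) => F i (x i)) h
    (fun i => (hF i).comp (measurable_pi_apply i))).trans (Finset.prod_congr rfl fun i _ => ?_)
  rw [← Measure.infinitePi_map_eval μ i, lintegral_map (hF i) (measurable_pi_apply i)]

end Products

/-! ### The walk with coins, averaged over the coins -/

section CoinWalk

variable {d : ℕ} [NeZero d]

/-- The probability of a coin value. -/
def coinProb (d : ℕ) (κ : ℝ) (b : Bool) : ℝ≥0∞ :=
  if b = true then ENNReal.ofReal (d * κ) else ENNReal.ofReal (1 - d * κ)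

/-- The transition weights at a site, given the coin. -/
def coinStep (κ : ℝ) (b : Bool) (p : SiteLaw d) (e : Step d) : ℝ :=
  if b = true then 1 / (2 * d) else 1 / (1 - d * κ) * ((p : Step d → ℝ) e - κ / 2)

lemma mul_lt_half {κ : ℝ} (h1 : κ < 1 / (2 * d)) : d * κ < 1 / 2 := by
  have hd : (0 : ℝ) < d := Nat.cast_pos.2 (NeZero.pos d)
  rw [lt_div_iff₀ (by positivity)] at h1
  linarith

lemma coinStep_mem {κ : ℝ} (h0 : 0 < κ) (h1 : κ < 1 / (2 * d)) (b : Bool) {p : SiteLaw d}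
    (hp : Elliptic κ p) : coinStep κ b p ∈ stdSimplex ℝ (Step d) := by
  have hd : (0 : ℝ) < d := Nat.cast_pos.2 (NeZero.pos d)
  have h2 := mul_lt_half h1
  have hsum : ∑ e, (p : Step d → ℝ) e = 1 := p.2.2
  have hcard : (Fintype.card (Step d) : ℝ) = 2 * d := by simp [mul_comm]
  constructor
  · intro e
    unfold coinStep
    split_ifs
    · positivity
    · have := hp e
      exact mul_nonneg (by apply one_div_nonneg.2; linarith) (by linarith)
  · unfold coinStep
    cases b
    · simp only [Bool.false_eq_true, if_false, ← Finset.mul_sum, Finset.sum_sub_distrib, hsum,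
        Finset.sum_const, Finset.card_univ, nsmul_eq_mul, hcard]
      rw [show 2 * (d : ℝ) * (κ / 2) = d * κ by ring, one_div_mul_cancel]
      linarith
    · simp only [if_true, Finset.sum_const, Finset.card_univ, nsmul_eq_mul, hcard]
      exact mul_one_div_cancel (by positivity)

lemma stepLaw_singleton {w : Step d → ℝ} (hw : w ∈ stdSimplex ℝ (Step d)) (z z' : Site d) :
    stepLaw w z {z'} = ∑ e, ENNReal.ofReal (w e) * Set.indicator {z'} 1 (z + e.vec) := by
  unfold stepLaw
  rw [if_pos hw]
  simp

lemma stepLaw_step {w : Step d → ℝ} (hw : w ∈ stdSimplex ℝ (Step d)) (z : Site d) (e : Step d) :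
    stepLaw w z {z + e.vec} = ENNReal.ofReal (w e) := by
  rw [stepLaw_singleton hw, Finset.sum_eq_single e]
  · simp
  · intro e' _ hne
    simp [Step.vec_injective.eq_iff, hne]
  · simp

/-- For coin `1` the weight is `dκ · 1/(2d) = κ/2`; for coin `0` the probability `1 - dκ` cancels
the normalisation of the transition weights. -/
lemma coinProb_mul_stepLaw {κ : ℝ} (h0 : 0 < κ) (h1 : κ < 1 / (2 * d)) {p : SiteLaw d}
    (hp : Elliptic κ p) (z : Site d) (a : Letter d) :
    coinProb d κ a.2 * stepLaw (coinStep κ a.2 p) z {z + a.1.vec} = letterWeight κ a p := by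
  classical
  have hd : (0 : ℝ) < d := Nat.cast_pos.2 (NeZero.pos d)
  have h2 := mul_lt_half h1
  rw [stepLaw_step (coinStep_mem h0 h1 _ hp)]
  unfold coinProb coinStep letterWeight
  split_ifs
  · rw [← ENNReal.ofReal_mul (by positivity)]
    congr 1; field_simp
  · rw [← ENNReal.ofReal_mul (by linarith)]
    congr 1
    have : (1 - d * κ) ≠ 0 := by linarith
    field_simp

/-- Forgetting the coin restores `ω(z, e)`; this is why the walk with coins has the annealed law. -/
lemma sum_coinProb_mul_stepLaw {κ : ℝ} (h0 : 0 < κ) (h1 : κ < 1 / (2 * d)) {p : SiteLaw d}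
    (hp : Elliptic κ p) (z z' : Site d) :
    ∑ b, coinProb d κ b * stepLaw (coinStep κ b p) z {z'} = stepLaw (p : Step d → ℝ) z {z'} := by
  classical
  have hd : (0 : ℝ) < d := Nat.cast_pos.2 (NeZero.pos d)
  have h2 := mul_lt_half h1
  rw [stepLaw_singleton (w := (p : Step d → ℝ)) p.2]
  simp_rw [stepLaw_singleton (coinStep_mem h0 h1 _ hp), Finset.mul_sum, ← mul_assoc]
  rw [Finset.sum_comm]
  refine Finset.sum_congr rfl fun e _ => ?_
  rw [← Finset.sum_mul]
  congr 1
  have h := hp e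
  simp only [coinProb, coinStep, Fintype.sum_bool, if_true, Bool.false_eq_true, if_false]
  rw [← ENNReal.ofReal_mul (by positivity), ← ENNReal.ofReal_mul (by linarith),
    ← ENNReal.ofReal_add (by positivity)]
  · congr 1
    have : (1 - d * κ) ≠ 0 := by linarith
    field_simp
    ring
  · rw [← mul_assoc, mul_one_div_cancel (by linarith)]; linarith

/-- The law of a single coin. -/
def coinMeasure (d : ℕ) (κ : ℝ) : Measure Bool :=
  ENNReal.ofReal (d * κ) • Measure.dirac true + ENNReal.ofReal (1 - d * κ) • Measure.dirac false

lemma isProbabilityMeasure_coinMeasure {κ : ℝ} (h0 : 0 < κ) (h1 : κ < 1 / (2 * d)) :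
    IsProbabilityMeasure (coinMeasure d κ) := by
  have h2 := mul_lt_half h1
  refine ⟨?_⟩
  simp only [coinMeasure, Measure.coe_add, Measure.coe_smul, Pi.add_apply, Pi.smul_apply,
    measure_univ, smul_eq_mul, mul_one]
  rw [← ENNReal.ofReal_add (by positivity) (by linarith)]
  simp

lemma lintegral_coinMeasure (κ : ℝ) (F : Bool → ℝ≥0∞) :
    ∫⁻ b, F b ∂coinMeasure d κ = ∑ b, coinProb d κ b * F b := by
  simp [coinMeasure, coinProb, lintegral_add_measure]

lemma coinLaw_eq (κ : ℝ) : coinLaw d κ = Measure.infinitePi fun _ => coinMeasure d κ := rfl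

lemma isProbabilityMeasure_coinLaw {κ : ℝ} (h0 : 0 < κ) (h1 : κ < 1 / (2 * d)) :
    IsProbabilityMeasure (coinLaw d κ) := by
  have := isProbabilityMeasure_coinMeasure (d := d) h0 h1
  rw [coinLaw_eq]; infer_instance

/-- Along a fixed path every time uses a coin of its own, even if sites repeat. These coins are
therefore independent, and the average over them is a product over times. -/
lemma coinAnnealed_cylinder (P : Measure (Env d)) [IsProbabilityMeasure P] {κ : ℝ} (h0 : 0 < κ)
    (h1 : κ < 1 / (2 * d)) (y : Walk d) (hy : y 0 = 0) (n : ℕ) (B : ℕ → Set Bool) :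
    coinAnnealed P κ {p | (∀ t ∈ Finset.range (n + 1), p.2 t = y t) ∧
        ∀ t ∈ Finset.range n, p.1.2 (t, y t) ∈ B t} =
      ∫⁻ ω, ∏ t ∈ Finset.range n, ∑ b, coinProb d κ b * ((B t).indicator 1 b *
        stepLaw (coinStep κ b (ω (y t))) (y t) {y (t + 1)}) ∂P := by
  classical
  have := isProbabilityMeasure_coinMeasure (d := d) h0 h1
  have := isProbabilityMeasure_coinLaw (d := d) h0 h1
  have hset : {p : (Env d × Coins d) × Walk d | (∀ t ∈ Finset.range (n + 1), p.2 t = y t) ∧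
        ∀ t ∈ Finset.range n, p.1.2 (t, y t) ∈ B t} =
      (⋂ t ∈ Finset.range (n + 1),
        (fun p : (Env d × Coins d) × Walk d => p.2 t) ⁻¹' {y t}) ∩
      ⋂ t ∈ Finset.range n, (fun p : (Env d × Coins d) × Walk d => p.1.2 (t, y t)) ⁻¹' B t := by
    ext p; simp
  have hm : MeasurableSet {p : (Env d × Coins d) × Walk d |
      (∀ t ∈ Finset.range (n + 1), p.2 t = y t) ∧
        ∀ t ∈ Finset.range n, p.1.2 (t, y t) ∈ B t} := by
    rw [hset]
    refine MeasurableSet.inter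
      (MeasurableSet.biInter (Set.to_countable _) fun t _ => ?_)
      (MeasurableSet.biInter (Set.to_countable _) fun t _ => ?_)
    · exact ((measurable_pi_apply t).comp measurable_snd) (measurableSet_singleton _)
    · exact ((measurable_pi_apply (t, y t)).comp (measurable_snd.comp measurable_fst))
        (MeasurableSet.of_discrete)
  unfold coinAnnealed
  rw [Measure.compProd_apply hm, lintegral_prod _ (Kernel.measurable_kernel_prodMk_left hm).aemeasurable]
  refine lintegral_congr fun ω => ?_
  set F : ℕ × Site d → Bool → ℝ≥0∞ := fun i b => (B i.1).indicator 1 b *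
    stepLaw (coinStep κ b (ω (y i.1))) (y i.1) {y (i.1 + 1)} with hF
  have hstep : ∀ ε : Coins d, (quenched (coinWeights d κ)) ((ω, ε), 0)
      (Prod.mk (ω, ε) ⁻¹' {p : (Env d × Coins d) × Walk d |
        (∀ t ∈ Finset.range (n + 1), p.2 t = y t) ∧
        ∀ t ∈ Finset.range n, p.1.2 (t, y t) ∈ B t}) =
      ∏ i ∈ (Finset.range n).image (fun t => (t, y t)), F i (ε i) := by
    intro ε
    rw [Finset.prod_image (by intro a _ b _ h; exact (Prod.mk.inj h).1)]
    by_cases hε : ∀ t ∈ Finset.range n, ε (t, y t) ∈ B t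
    · have h := quenched_cylinder (coinWeights d κ) (ω, ε) y n
      rw [hy] at h
      have e : Prod.mk (ω, ε) ⁻¹' {p : (Env d × Coins d) × Walk d |
          (∀ t ∈ Finset.range (n + 1), p.2 t = y t) ∧
          ∀ t ∈ Finset.range n, p.1.2 (t, y t) ∈ B t} =
          {X : Walk d | ∀ t ∈ Finset.range (n + 1), X t = y t} := by
        ext X
        exact ⟨fun h => h.1, fun h => ⟨h, hε⟩⟩
      rw [e, h]
      refine Finset.prod_congr rfl fun t ht => ?_
      simp only [hF, Set.indicator_of_mem (hε t ht), Pi.one_apply, one_mul]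
      rfl
    · have e : Prod.mk (ω, ε) ⁻¹' {p : (Env d × Coins d) × Walk d |
          (∀ t ∈ Finset.range (n + 1), p.2 t = y t) ∧
          ∀ t ∈ Finset.range n, p.1.2 (t, y t) ∈ B t} = ∅ := by
        ext X
        exact ⟨fun h => hε h.2, fun h => h.elim⟩
      rw [e, measure_empty]
      push Not at hε
      obtain ⟨t, ht, htB⟩ := hε
      refine (Finset.prod_eq_zero ht ?_).symm
      simp [hF, htB]
  simp only [Kernel.comap_apply]
  rw [lintegral_congr hstep, coinLaw_eq, lintegral_infinitePi_prod _ _ F (fun i => .of_discrete),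
    Finset.prod_image (by intro a _ b _ h; exact (Prod.mk.inj h).1)]
  refine Finset.prod_congr rfl fun t _ => ?_
  rw [lintegral_coinMeasure]

lemma annealed_cylinder (P : Measure (Env d)) (y : Walk d) (hy : y 0 = 0) (n : ℕ) :
    annealed P {X | ∀ t ∈ Finset.range (n + 1), X t = y t} =
      ∫⁻ ω, ∏ t ∈ Finset.range n, stepLaw (ω (y t) : Step d → ℝ) (y t) {y (t + 1)} ∂P := by
  have hset : {X : Walk d | ∀ t ∈ Finset.range (n + 1), X t = y t} =
      ⋂ t ∈ Finset.range (n + 1), (fun X : Walk d => X t) ⁻¹' {y t} := by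
    ext X; simp
  have hcyl : MeasurableSet {X : Walk d | ∀ t ∈ Finset.range (n + 1), X t = y t} := by
    rw [hset]
    exact MeasurableSet.biInter (Set.to_countable _) fun t _ =>
      (measurable_pi_apply t) (measurableSet_singleton (y t))
  unfold annealed
  rw [Measure.bind_apply hcyl (Kernel.aemeasurable _)]
  refine lintegral_congr fun ω => ?_
  have h := quenched_cylinder (envWeights d) ω y n
  rw [hy] at h
  rw [Kernel.comap_apply, h]
  rfl

/-- Ellipticity is assumed at the origin only; stationarity carries it to each of the countably many
sites. -/
lemma ae_elliptic {P : Measure (Env d)} {κ : ℝ} (hstat : Stationary P)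
    (hell : UniformlyElliptic P κ) : ∀ᵐ ω ∂P, ∀ x, Elliptic κ (ω x) := by
  rw [ae_all_iff]
  intro x
  have h := hell.2.2
  rw [← hstat x] at h
  filter_upwards [ae_of_ae_map
    (measurable_pi_lambda _ fun _ => measurable_pi_apply _).aemeasurable h] with ω hω e
  have := hω e
  simp only [zero_add] at this
  exact this.le

end CoinWalk

/-! ### Words, and the law of the sequence of letters -/

section Words

variable {d : ℕ} [NeZero d]

/-- The first `n` letters of a sequence. -/
def prefixWord {α : Type*} (s : ℕ → α) (n : ℕ) : List α := (List.range n).map s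

@[simp] lemma length_prefixWord {α : Type*} (s : ℕ → α) (n : ℕ) : (prefixWord s n).length = n := by
  simp [prefixWord]

lemma prefixWord_add {α : Type*} (s : ℕ → α) (m n : ℕ) :
    prefixWord s (m + n) = prefixWord s m ++ prefixWord (fun t => s (m + t)) n := by
  simp [prefixWord, List.range_add, Function.comp_def]

lemma prefixWord_take {α : Type*} (s : ℕ → α) {m n : ℕ} (h : m ≤ n) :
    (prefixWord s n).take m = prefixWord s m := by
  obtain ⟨k, rfl⟩ := Nat.exists_eq_add_of_le h
  rw [prefixWord_add, List.take_left' (length_prefixWord s m)]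

lemma prefixWord_getD {α : Type*} (s : ℕ → α) (n t : ℕ) (h : t < n) (a : α) :
    (prefixWord s n).getD t a = s t := by
  simp [prefixWord, h]

lemma prefixWord_congr {α : Type*} {s s' : ℕ → α} {n : ℕ} (h : ∀ t < n, s t = s' t) :
    prefixWord s n = prefixWord s' n := by
  refine List.map_congr_left fun t ht => h t (List.mem_range.1 ht)

lemma prefixWord_eq_iff {α : Type*} {s s' : ℕ → α} {n : ℕ} :
    prefixWord s n = prefixWord s' n ↔ ∀ t < n, s t = s' t := by
  refine ⟨fun h t ht => ?_, prefixWord_congr⟩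
  rw [← prefixWord_getD s n t ht (s t), h, prefixWord_getD s' n t ht]

/-- The set of sequences which start with the given word. -/
def cyl {α : Type*} (π : List α) : Set (ℕ → α) := {s | prefixWord s π.length = π}

lemma mem_cyl {α : Type*} {π : List α} {s : ℕ → α} : s ∈ cyl π ↔ prefixWord s π.length = π :=
  Iff.rfl

lemma mem_cyl_prefixWord {α : Type*} (s : ℕ → α) (n : ℕ) : s ∈ cyl (prefixWord s n) := by
  rw [mem_cyl, length_prefixWord]

lemma mem_cyl_append {α : Type*} {π π' : List α} {s : ℕ → α} :
    s ∈ cyl (π ++ π') ↔ s ∈ cyl π ∧ (fun t => s (π.length + t)) ∈ cyl π' := by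
  rw [mem_cyl, List.length_append, prefixWord_add]
  refine ⟨fun h => ?_, fun h => by rw [mem_cyl.1 h.1, mem_cyl.1 h.2]⟩
  exact List.append_inj h (by simp)

lemma measurableSet_cyl {α : Type*} [MeasurableSpace α] [MeasurableSingletonClass α] (π : List α) :
    MeasurableSet (cyl π) := by
  rcases π with _ | ⟨a, π⟩
  · simp [cyl, prefixWord]
  · set π' := a :: π
    have : cyl π' = ⋂ t ∈ Finset.range π'.length, (fun s : ℕ → α => s t) ⁻¹' {π'.getD t a} := by
      ext s
      simp only [Set.mem_iInter, Finset.mem_range, Set.mem_preimage, Set.mem_singleton_iff]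
      refine ⟨fun h t ht => ?_, fun h => ?_⟩
      · rw [← mem_cyl.1 h, prefixWord_getD _ _ _ ht]
      · refine List.ext_getElem (by simp) fun t h1 h2 => ?_
        have := h t h2
        simpa [prefixWord, h2] using this
    rw [this]
    exact MeasurableSet.biInter (Set.to_countable _) fun t _ =>
      (measurable_pi_apply t) (measurableSet_singleton _)

/-- All words of length `n` over a finite alphabet. -/
def words (α : Type*) [Fintype α] (n : ℕ) : Finset (List α) :=
  (Finset.univ : Finset (Fin n → α)).map ⟨List.ofFn, List.ofFn_injective⟩

lemma mem_words {α : Type*} [Fintype α] {n : ℕ} {π : List α} :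
    π ∈ words α n ↔ π.length = n := by
  simp only [words, Finset.mem_map, Finset.mem_univ, true_and, Function.Embedding.coeFn_mk]
  constructor
  · rintro ⟨f, rfl⟩; simp
  · rintro rfl
    exact ⟨π.get, by simp⟩

lemma sum_words_succ {α M : Type*} [Fintype α] [AddCommMonoid M] (n : ℕ) (f : List α → M) :
    ∑ π ∈ words α (n + 1), f π = ∑ a, ∑ π ∈ words α n, f (a :: π) := by
  rw [← Finset.sum_product']
  symm
  refine Finset.sum_bij (fun p _ => p.1 :: p.2) ?_ ?_ ?_ ?_
  · intro p hp
    have := mem_words.1 (Finset.mem_product.1 hp).2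
    exact mem_words.2 (by simp [this])
  · rintro ⟨a, p⟩ _ ⟨b, q⟩ _ h
    simpa using h
  · intro π hπ
    have := mem_words.1 hπ
    rcases π with _ | ⟨a, π⟩
    · simp at this
    · exact ⟨(a, π), by simpa [mem_words] using this, rfl⟩
  · intros; rfl

lemma sum_words_zero {α M : Type*} [Fintype α] [AddCommMonoid M] (f : List α → M) :
    ∑ π ∈ words α 0, f π = f [] := by
  have : words α 0 = {[]} := by ext π; simp [mem_words]
  rw [this, Finset.sum_singleton]

lemma sum_wordWeight {κ : ℝ} (h0 : 0 < κ) (h1 : κ < 1 / (2 * d)) (n : ℕ) (x : Site d)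
    (ω : Env d) : ∑ π ∈ words (Letter d) n, wordWeight κ π x ω = 1 := by
  induction n generalizing x with
  | zero => rw [sum_words_zero]; rfl
  | succ n ih =>
    rw [sum_words_succ]
    simp only [wordWeight, ← Finset.mul_sum, ih, mul_one]
    exact sum_letterWeight h0 h1 _

/-- The walk from the origin which spells a sequence of letters. -/
def walkOf (s : ℕ → Letter d) : Walk d := fun n => wordDisp (prefixWord s n)

/-- Coins which show the recorded values. -/
def coinsOf (s : ℕ → Letter d) : Coins d := fun p => (s p.1).2

lemma walkOf_add (s : ℕ → Letter d) (m n : ℕ) :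
    walkOf s (m + n) = walkOf s m + walkOf (fun t => s (m + t)) n := by
  simp [walkOf, prefixWord_add]

@[simp] lemma walkOf_zero (s : ℕ → Letter d) : walkOf s 0 = 0 := by simp [walkOf, prefixWord]

lemma walkOf_succ (s : ℕ → Letter d) (n : ℕ) : walkOf s (n + 1) = walkOf s n + (s n).1.vec := by
  rw [walkOf_add]; simp [walkOf, prefixWord]

/-- The letters spelled by a walk with coins. -/
def letters (p : (Env d × Coins d) × Walk d) : ℕ → Letter d :=
  fun t => (Function.invFun Step.vec (p.2 (t + 1) - p.2 t), p.1.2 (t, p.2 t))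

lemma measurable_letters : Measurable (letters (d := d)) := by
  refine measurable_pi_lambda _ fun t => Measurable.prodMk ?_ ?_
  · have h1 : Measurable fun p : (Env d × Coins d) × Walk d => p.2 (t + 1) :=
      (measurable_pi_apply (t + 1)).comp measurable_snd
    have h2 : Measurable fun p : (Env d × Coins d) × Walk d => p.2 t :=
      (measurable_pi_apply t).comp measurable_snd
    have h3 : Measurable fun q : Site d × Site d => Function.invFun Step.vec (q.1 - q.2) :=
      measurable_of_countable _
    exact h3.comp (h1.prodMk h2)
  · have h : Measurable fun q : Site d × Coins d => q.2 (t, q.1) :=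
      measurable_from_prod_countable_right fun z => measurable_pi_apply (t, z)
    have h2 : Measurable fun p : (Env d × Coins d) × Walk d => (p.2 t, p.1.2) :=
      ((measurable_pi_apply t).comp measurable_snd).prodMk (measurable_snd.comp measurable_fst)
    exact h.comp h2

/-- The event that the walk with its coins spells a word. -/
def spells (π : List (Letter d)) : Set ((Env d × Coins d) × Walk d) :=
  {p | (∀ t ∈ Finset.range (π.length + 1), p.2 t = wordDisp (π.take t)) ∧
    ∀ t ∈ Finset.range π.length, p.1.2 (t, wordDisp (π.take t)) ∈ ({(π.getD t ((0, true), true)).2} : Set Bool)}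

lemma measurableSet_spells (π : List (Letter d)) : MeasurableSet (spells π) := by
  have hset : spells π =
      (⋂ t ∈ Finset.range (π.length + 1),
        (fun p : (Env d × Coins d) × Walk d => p.2 t) ⁻¹' {wordDisp (π.take t)}) ∩
      ⋂ t ∈ Finset.range π.length,
        (fun p : (Env d × Coins d) × Walk d => p.1.2 (t, wordDisp (π.take t))) ⁻¹'
          {(π.getD t ((0, true), true)).2} := by
    ext p; simp [spells]
  rw [hset]
  refine MeasurableSet.inter
    (MeasurableSet.biInter (Set.to_countable _) fun t _ => ?_)
    (MeasurableSet.biInter (Set.to_countable _) fun t _ => ?_)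
  · exact ((measurable_pi_apply t).comp measurable_snd) (measurableSet_singleton _)
  · exact ((measurable_pi_apply (t, _)).comp (measurable_snd.comp measurable_fst))
      (MeasurableSet.of_discrete)

lemma wordDisp_take_succ (π : List (Letter d)) (a : Letter d) {t : ℕ} (ht : t < π.length) :
    wordDisp (π.take (t + 1)) = wordDisp (π.take t) + (π.getD t a).1.vec := by
  rw [List.take_succ_eq_append_getElem ht, wordDisp_append]
  simp [ht, wordDisp]

lemma coinAnnealed_spells {P : Measure (Env d)} [IsProbabilityMeasure P] {κ : ℝ}
    (hstat : Stationary P) (hell : UniformlyElliptic P κ) (π : List (Letter d)) :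
    coinAnnealed P κ (spells π) = ∫⁻ ω, wordWeight κ π 0 ω ∂P := by
  have h := coinAnnealed_cylinder P hell.1 hell.2.1 (fun t => wordDisp (π.take t)) (by simp)
    π.length (fun t => {(π.getD t ((0, true), true)).2})
  refine h.trans (lintegral_congr_ae ?_)
  filter_upwards [ae_elliptic hstat hell] with ω hω
  rw [wordWeight_eq_prod κ π ((0, true), true)]
  refine Finset.prod_congr rfl fun t ht => ?_
  rw [Finset.sum_eq_single (π.getD t ((0, true), true)).2 (by
      intro b _ hb
      rw [Set.indicator_of_notMem (by simpa using hb), zero_mul, mul_zero]) (by simp),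
    wordDisp_take_succ π ((0, true), true) (Finset.mem_range.1 ht)]
  rw [zero_add, ← coinProb_mul_stepLaw hell.1 hell.2.1 (hω _) (wordDisp (π.take t))]
  simp

lemma prefixWord_letters_of_spells {π : List (Letter d)} {p : (Env d × Coins d) × Walk d}
    (hp : p ∈ spells π) : prefixWord (letters p) π.length = π := by
  refine List.ext_getElem (by simp) fun t h1 h2 => ?_
  have e1 := hp.1 (t + 1) (Finset.mem_range.2 (by omega))
  have e2 := hp.1 t (Finset.mem_range.2 (by omega))
  have e3 := hp.2 t (Finset.mem_range.2 (by omega))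
  simp only [prefixWord, List.getElem_map, List.getElem_range, letters]
  rw [e1, e2, wordDisp_take_succ π ((0, true), true) h2, add_sub_cancel_left,
    Function.leftInverse_invFun Step.vec_injective]
  refine Prod.ext ?_ ?_
  · simp [h2]
  · simpa [h2] using e3

/-- For each length the events `spells π` are disjoint, and their probabilities sum to `1` because
word weights do. So almost surely all increments are unit vectors and the recorded letters reproduce
the walk. -/
lemma ae_walk_eq {P : Measure (Env d)} [IsProbabilityMeasure P] {κ : ℝ}
    (hstat : Stationary P) (hell : UniformlyElliptic P κ) :
    ∀ᵐ p ∂coinAnnealed P κ, p.2 = walkOf (letters p) := by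
  have := isProbabilityMeasure_coinLaw (d := d) hell.1 hell.2.1
  have : IsProbabilityMeasure (coinAnnealed P κ) := by unfold coinAnnealed; infer_instance
  have key : ∀ n, ∀ᵐ p ∂coinAnnealed P κ, ∃ π ∈ words (Letter d) n, p ∈ spells π := by
    intro n
    have hm : MeasurableSet (⋃ π ∈ words (Letter d) n, spells π) :=
      Finset.measurableSet_biUnion _ fun π _ => measurableSet_spells π
    have h1 : coinAnnealed P κ (⋃ π ∈ words (Letter d) n, spells π) = 1 := by
      rw [measure_biUnion_finset]
      · simp_rw [coinAnnealed_spells hstat hell]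
        rw [← lintegral_finsetSum _ (fun π _ => measurable_wordWeight κ π 0)]
        simp [sum_wordWeight hell.1 hell.2.1]
      · intro π hπ π' hπ' hne
        refine Set.disjoint_left.2 fun p h h' => hne ?_
        rw [← prefixWord_letters_of_spells h, ← prefixWord_letters_of_spells h',
          mem_words.1 hπ, mem_words.1 hπ']
      · exact fun π _ => measurableSet_spells π
    rw [← prob_compl_eq_zero_iff hm] at h1
    have := measure_eq_zero_iff_ae_notMem.1 h1
    filter_upwards [this] with p hp
    simpa using hp
  rw [← ae_all_iff] at key
  filter_upwards [key] with p hp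
  funext n
  obtain ⟨π, hπ, h⟩ := hp n
  have hn := mem_words.1 hπ
  unfold walkOf
  rw [← hn, prefixWord_letters_of_spells h, h.1 _ (by simp), List.take_length]

lemma isProbabilityMeasure_coinAnnealed {P : Measure (Env d)} [IsProbabilityMeasure P] {κ : ℝ}
    (hell : UniformlyElliptic P κ) : IsProbabilityMeasure (coinAnnealed P κ) := by
  have := isProbabilityMeasure_coinLaw (d := d) hell.1 hell.2.1
  unfold coinAnnealed; infer_instance

/-- The averaged law of the sequence of letters. -/
def letterLaw (P : Measure (Env d)) (κ : ℝ) : Measure (ℕ → Letter d) :=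
  (coinAnnealed P κ).map letters

lemma isProbabilityMeasure_letterLaw {P : Measure (Env d)} [IsProbabilityMeasure P] {κ : ℝ}
    (hell : UniformlyElliptic P κ) : IsProbabilityMeasure (letterLaw P κ) := by
  have := isProbabilityMeasure_coinAnnealed (P := P) hell
  exact Measure.isProbabilityMeasure_map measurable_letters.aemeasurable

/-- Almost surely the walk starts at the origin and follows its letters, so the cylinder of `π` and
the event `spells π` coincide. -/
lemma letterLaw_cyl {P : Measure (Env d)} [IsProbabilityMeasure P] {κ : ℝ}
    (hstat : Stationary P) (hell : UniformlyElliptic P κ) (π : List (Letter d)) :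
    letterLaw P κ (cyl π) = ∫⁻ ω, wordWeight κ π 0 ω ∂P := by
  rw [letterLaw, Measure.map_apply measurable_letters (measurableSet_cyl π),
    ← coinAnnealed_spells hstat hell]
  refine measure_congr ?_
  filter_upwards [ae_walk_eq hstat hell] with p hp
  refine propext ⟨fun h => ?_, fun h => prefixWord_letters_of_spells h⟩
  have h : prefixWord (letters p) π.length = π := h
  have h1 : ∀ t ≤ π.length, p.2 t = wordDisp (π.take t) := by
    intro t ht
    rw [hp, walkOf, ← prefixWord_take _ ht, h]
  refine ⟨fun t ht => h1 t (by have := Finset.mem_range.1 ht; omega), fun t ht => ?_⟩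
  have ht := Finset.mem_range.1 ht
  rw [Set.mem_singleton_iff, ← h1 t ht.le]
  have := prefixWord_getD (letters p) π.length t ht ((0, true), true)
  rw [h] at this
  rw [this, letters]

end Words

/-! ### Measures on sequences and their values on cylinders -/

section Cylinders

lemma generateFrom_cyl {α : Type*} [MeasurableSpace α] [MeasurableSingletonClass α] [Countable α] :
    (MeasurableSpace.pi : MeasurableSpace (ℕ → α)) =
      MeasurableSpace.generateFrom (Set.range (cyl : List α → Set (ℕ → α))) := by
  refine le_antisymm ?_ ?_
  · refine iSup_le fun t => ?_
    rw [← measurable_iff_comap_le]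
    refine @measurable_to_countable' _ _ _ _ (MeasurableSpace.generateFrom _) _ fun a => ?_
    have : (fun s : ℕ → α => s t) ⁻¹' {a} =
        ⋃ π ∈ {π : List α | π.length = t + 1 ∧ π[t]? = some a}, cyl π := by
      ext s
      simp only [Set.mem_preimage, Set.mem_singleton_iff, Set.mem_iUnion]
      constructor
      · rintro rfl
        exact ⟨prefixWord s (t + 1), ⟨by simp, by simp [prefixWord]⟩, mem_cyl_prefixWord _ _⟩
      · rintro ⟨π, ⟨h1, h2⟩, h3⟩
        rw [← mem_cyl.1 h3, h1] at h2
        simpa [prefixWord] using h2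
    rw [this]
    exact @MeasurableSet.biUnion _ _ (MeasurableSpace.generateFrom _) _ _ (Set.to_countable _)
      fun π _ => MeasurableSpace.measurableSet_generateFrom ⟨π, rfl⟩
  · refine MeasurableSpace.generateFrom_le ?_
    rintro _ ⟨π, rfl⟩
    exact measurableSet_cyl π

lemma isPiSystem_cyl {α : Type*} : IsPiSystem (Set.range (cyl : List α → Set (ℕ → α))) := by
  rintro _ ⟨π, rfl⟩ _ ⟨π', rfl⟩ ⟨s, h1, h2⟩
  have key : ∀ {π π' : List α}, s ∈ cyl π → s ∈ cyl π' → π.length ≤ π'.length →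
      cyl π' ⊆ cyl π := by
    intro π π' h1 h2 hle x hx
    rw [mem_cyl] at *
    rw [← prefixWord_take x hle, hx, ← h2, prefixWord_take s hle, h1]
  rcases le_total π.length π'.length with h | h
  · exact ⟨π', (Set.inter_eq_self_of_subset_right (key h1 h2 h)).symm⟩
  · exact ⟨π, (Set.inter_eq_self_of_subset_left (key h2 h1 h)).symm⟩

lemma ext_of_cyl {α : Type*} [MeasurableSpace α] [MeasurableSingletonClass α] [Countable α]
    {μ ν : Measure (ℕ → α)} [IsFiniteMeasure μ] (h : ∀ π, μ (cyl π) = ν (cyl π)) : μ = ν := by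
  refine ext_of_generate_finite _ generateFrom_cyl isPiSystem_cyl ?_ ?_
  · rintro _ ⟨π, rfl⟩
    exact h π
  · have : (cyl [] : Set (ℕ → α)) = Set.univ := by ext; simp [cyl, prefixWord]
    rw [← this, h]

lemma measurableSet_prefixWord {α : Type*} [MeasurableSpace α] [MeasurableSingletonClass α]
    [Countable α] (n : ℕ) (T : Set (List α)) : MeasurableSet {s : ℕ → α | prefixWord s n ∈ T} := by
  have : {s : ℕ → α | prefixWord s n ∈ T} = ⋃ π ∈ {π : List α | π ∈ T ∧ π.length = n}, cyl π := by
    ext s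
    simp only [Set.mem_iUnion]
    constructor
    · intro h
      exact ⟨prefixWord s n, ⟨h, by simp⟩, mem_cyl_prefixWord _ _⟩
    · rintro ⟨π, ⟨h1, h2⟩, h3⟩
      rw [mem_cyl, h2] at h3
      change prefixWord s n ∈ T
      rwa [h3]
  rw [this]
  exact MeasurableSet.biUnion (Set.to_countable _) fun π _ => measurableSet_cyl π

lemma measure_prefixWord {α : Type*} [MeasurableSpace α] [MeasurableSingletonClass α] [Fintype α]
    (μ : Measure (ℕ → α)) (n : ℕ) (T : Set (List α)) [DecidablePred (· ∈ T)] :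
    μ {s : ℕ → α | prefixWord s n ∈ T} = ∑ π ∈ (words α n).filter (· ∈ T), μ (cyl π) := by
  have : {s : ℕ → α | prefixWord s n ∈ T} = ⋃ π ∈ (words α n).filter (· ∈ T), cyl π := by
    ext s
    simp only [Set.mem_iUnion, Finset.mem_filter, mem_words]
    constructor
    · intro h
      exact ⟨prefixWord s n, ⟨by simp, h⟩, mem_cyl_prefixWord _ _⟩
    · rintro ⟨π, ⟨h2, h1⟩, h3⟩
      rw [mem_cyl, h2] at h3
      change prefixWord s n ∈ T
      rwa [h3]
  rw [this, measure_biUnion_finset _ fun π _ => measurableSet_cyl π]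
  intro π hπ π' hπ' hne
  refine Set.disjoint_left.2 fun s h h' => hne ?_
  have e := mem_words.1 (Finset.mem_filter.1 hπ).1
  have e' := mem_words.1 (Finset.mem_filter.1 hπ').1
  rw [← mem_cyl.1 h, ← mem_cyl.1 h', e, e']

/-- Events depending on finitely many letters form an algebra that generates the σ-algebra, and each
is a finite disjoint union of cylinders of any greater length. The inequality holds on the algebra
and passes to all events by approximation. -/
lemma measure_le_of_cyl {α : Type*} [MeasurableSpace α] [MeasurableSingletonClass α] [Fintype α]
    {μ ν : Measure (ℕ → α)} [IsFiniteMeasure μ] [IsFiniteMeasure ν] (N : ℕ)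
    (h : ∀ π, N ≤ π.length → μ (cyl π) ≤ ν (cyl π)) {E : Set (ℕ → α)} (hE : MeasurableSet E) :
    μ E ≤ ν E := by
  classical
  set 𝒜 : Set (Set (ℕ → α)) :=
    {S | ∃ n, ∃ T : Set (List α), S = {s : ℕ → α | prefixWord s n ∈ T}} with h𝒜
  have hlift : ∀ n m (T : Set (List α)), n ≤ m → {s : ℕ → α | prefixWord s n ∈ T} =
      {s : ℕ → α | prefixWord s m ∈ {π : List α | π.take n ∈ T}} := by
    intro n m T hnm
    ext s
    change _ ↔ (prefixWord s m).take n ∈ T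
    rw [prefixWord_take s hnm]
    rfl
  have halg : IsSetAlgebra 𝒜 := by
    refine ⟨⟨0, ∅, by ext; simp⟩, ?_, ?_⟩
    · rintro _ ⟨n, T, rfl⟩
      exact ⟨n, Tᶜ, rfl⟩
    · rintro _ _ ⟨n, T, rfl⟩ ⟨m, T', rfl⟩
      refine ⟨max n m, {π | π.take n ∈ T} ∪ {π | π.take m ∈ T'}, ?_⟩
      rw [hlift n _ T (le_max_left n m), hlift m _ T' (le_max_right n m)]
      rfl
  have hgen : (MeasurableSpace.pi : MeasurableSpace (ℕ → α)) =
      MeasurableSpace.generateFrom 𝒜 := by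
    refine le_antisymm ?_ (MeasurableSpace.generateFrom_le ?_)
    · rw [generateFrom_cyl]
      refine MeasurableSpace.generateFrom_mono ?_
      rintro _ ⟨π, rfl⟩
      exact ⟨π.length, {π}, rfl⟩
    · rintro _ ⟨n, T, rfl⟩
      exact measurableSet_prefixWord n T
  have hle𝒜 : ∀ S ∈ 𝒜, μ S ≤ ν S := by
    rintro _ ⟨n, T, rfl⟩
    rw [hlift n (max n N) T (le_max_left _ _), measure_prefixWord, measure_prefixWord]
    refine Finset.sum_le_sum fun π hπ => h π ?_
    rw [mem_words.1 (Finset.mem_filter.1 hπ).1]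
    exact le_max_right _ _
  -- Approximating with respect to `μ + ν` controls the error for both measures at once.
  have hdense := Measure.MeasureDense.of_generateFrom_isSetAlgebra_finite (μ := μ + ν) halg hgen
  refine ENNReal.le_of_forall_pos_le_add fun ε hε _ => ?_
  obtain ⟨S, hS, hlt⟩ := hdense.approx E hE (measure_ne_top _ _) (ε / 2) (by positivity)
  have hμ : μ (symmDiff E S) ≤ ENNReal.ofReal (ε / 2) :=
    le_trans (Measure.le_add_right le_rfl _) hlt.le
  have hν : ν (symmDiff E S) ≤ ENNReal.ofReal (ε / 2) :=
    le_trans (Measure.le_add_left le_rfl _) hlt.le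
  have e1 : E ⊆ S ∪ symmDiff E S := fun x hx => by
    by_cases h : x ∈ S
    · exact Or.inl h
    · exact Or.inr (Or.inl ⟨hx, h⟩)
  have e2 : S ⊆ E ∪ symmDiff E S := fun x hx => by
    by_cases h : x ∈ E
    · exact Or.inl h
    · exact Or.inr (Or.inr ⟨hx, h⟩)
  have hε2 : ENNReal.ofReal (ε / 2) + ENNReal.ofReal (ε / 2) = ε := by
    rw [← ENNReal.ofReal_add (by positivity) (by positivity), add_halves, ENNReal.ofReal_coe_nnreal]
  calc μ E ≤ μ S + μ (symmDiff E S) := (measure_mono e1).trans (measure_union_le _ _)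
    _ ≤ ν S + ENNReal.ofReal (ε / 2) := add_le_add (hle𝒜 S hS) hμ
    _ ≤ (ν E + ν (symmDiff E S)) + ENNReal.ofReal (ε / 2) := by
        gcongr; exact (measure_mono e2).trans (measure_union_le _ _)
    _ ≤ (ν E + ENNReal.ofReal (ε / 2)) + ENNReal.ofReal (ε / 2) := by gcongr
    _ = ν E + ε := by rw [add_assoc, hε2]

/-- The shift of sequences. -/
def shiftSeq {α : Type*} (n : ℕ) (s : ℕ → α) : ℕ → α := fun t => s (n + t)

@[fun_prop]
lemma measurable_shiftSeq {α : Type*} [MeasurableSpace α] (n : ℕ) :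
    Measurable (shiftSeq n : (ℕ → α) → ℕ → α) :=
  measurable_pi_lambda _ fun t => measurable_pi_apply (n + t)

variable {d : ℕ} [NeZero d]

lemma lintegral_stationary {P : Measure (Env d)} (hstat : Stationary P) (z : Site d)
    {f : Env d → ℝ≥0∞} (hf : Measurable f) :
    ∫⁻ ω, f (fun x => ω (x + z)) ∂P = ∫⁻ ω, f ω ∂P := by
  conv_rhs => rw [← hstat z]
  have hm : Measurable fun (ω : Env d) x => ω (x + z) :=
    measurable_pi_lambda _ fun x => measurable_pi_apply (x + z)
  rw [lintegral_map hf hm]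

lemma lintegral_wordWeight {P : Measure (Env d)} (hstat : Stationary P) (κ : ℝ)
    (π : List (Letter d)) (x : Site d) :
    ∫⁻ ω, wordWeight κ π x ω ∂P = ∫⁻ ω, wordWeight κ π 0 ω ∂P := by
  rw [← lintegral_stationary hstat x (measurable_wordWeight κ π 0)]
  simp_rw [wordWeight_shift, zero_add]

/-- A substitute for the Markov property, which the averaged law lacks: after `π` the walk moves in
a translated environment with the additional weight of `π`, which is at most `1` and can be dropped;
stationarity removes the translation. -/
lemma letterLaw_cyl_shift_le {P : Measure (Env d)} [IsProbabilityMeasure P] {κ : ℝ}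
    (hstat : Stationary P) (hell : UniformlyElliptic P κ) (π : List (Letter d))
    {E : Set (ℕ → Letter d)} (hE : MeasurableSet E) :
    letterLaw P κ (cyl π ∩ shiftSeq π.length ⁻¹' E) ≤ letterLaw P κ E := by
  have := isProbabilityMeasure_letterLaw (P := P) hell
  have h := measure_le_of_cyl (μ := ((letterLaw P κ).restrict (cyl π)).map (shiftSeq π.length))
    (ν := letterLaw P κ) 0 ?_ hE
  · rwa [Measure.map_apply (by fun_prop) hE, Measure.restrict_apply (measurable_shiftSeq _ hE),
      Set.inter_comm] at h
  · intro π' _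
    rw [Measure.map_apply (by fun_prop) (measurableSet_cyl π'),
      Measure.restrict_apply (measurable_shiftSeq _ (measurableSet_cyl π')), Set.inter_comm]
    have : cyl π ∩ shiftSeq π.length ⁻¹' cyl π' = cyl (π ++ π') := by
      ext s; exact mem_cyl_append.symm
    rw [this, letterLaw_cyl hstat hell, letterLaw_cyl hstat hell,
      ← lintegral_wordWeight hstat κ π' (wordDisp π)]
    refine lintegral_mono fun ω => ?_
    rw [wordWeight_append, zero_add]
    exact mul_le_of_le_one_left' (wordWeight_le_one hell.1 hell.2.1 _ _ _)

/-- Summing the coins out of the path cylinders gives the annealed cylinders, and paths that do not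
start at the origin are null on both sides. -/
lemma annealed_eq_map {P : Measure (Env d)} [IsProbabilityMeasure P] {κ : ℝ}
    (hstat : Stationary P) (hell : UniformlyElliptic P κ) :
    annealed P = (letterLaw P κ).map walkOf := by
  have hw : Measurable (walkOf (d := d)) := by
    refine measurable_pi_lambda _ fun n => ?_
    refine measurable_to_countable' fun z => ?_
    exact measurableSet_prefixWord n {π | wordDisp π = z}
  have := isProbabilityMeasure_coinAnnealed (P := P) hell
  have h1 : (letterLaw P κ).map walkOf = (coinAnnealed P κ).map Prod.snd := by
    rw [letterLaw, Measure.map_map hw measurable_letters]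
    refine Measure.map_congr ?_
    filter_upwards [ae_walk_eq hstat hell] with p hp
    exact hp.symm
  have hprob : IsProbabilityMeasure (annealed P) := by
    unfold annealed; infer_instance
  rw [h1]
  refine ext_of_cyl fun π => ?_
  rw [Measure.map_apply measurable_snd (measurableSet_cyl π)]
  -- The path is forced to start at `0`; a word with another first site is treated separately, both
  -- of its probabilities being zero.
  set y : Walk d := fun t => if t = 0 then 0 else π.getD t 0 with hy
  by_cases h0 : π.getD 0 0 = 0
  · rcases π with _ | ⟨x, π⟩
    · have : (cyl [] : Set (ℕ → Site d)) = Set.univ := by ext; simp [cyl, prefixWord]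
      simp [this]
    · have e1 : cyl (x :: π) = {X : Walk d | ∀ t ∈ Finset.range (π.length + 1), X t = y t} := by
        ext X
        have hyx : ∀ t, y t = (x :: π).getD t 0 := fun t => by
          by_cases ht : t = 0
          · subst ht; simpa [hy] using h0.symm
          · simp [hy, ht]
        change prefixWord X (π.length + 1) = x :: π ↔ ∀ t ∈ Finset.range (π.length + 1), X t = y t
        constructor
        · intro h t ht
          rw [hyx, ← h, prefixWord_getD _ _ _ (Finset.mem_range.1 ht)]
        · intro h
          refine List.ext_getElem (by simp) fun t h1 h2 => ?_
          have := h t (Finset.mem_range.2 (by simpa using h2))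
          rw [hyx] at this
          rw [List.getD_eq_getElem _ _ h2] at this
          rw [← this]
          simp [prefixWord]
      rw [e1, annealed_cylinder P y (by simp [hy])]
      have h := coinAnnealed_cylinder P hell.1 hell.2.1 y (by simp [hy]) π.length
        (fun _ => Set.univ)
      simp only [Set.mem_univ, implies_true, and_true, Set.indicator_univ, Pi.one_apply,
        one_mul] at h
      refine Eq.trans (lintegral_congr_ae ?_) h.symm
      filter_upwards [ae_elliptic hstat hell] with ω hω
      exact Finset.prod_congr rfl fun t _ =>
        (sum_coinProb_mul_stepLaw hell.1 hell.2.1 (hω _) _ _).symm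
  · have hne : ∀ X : Walk d, X ∈ cyl π → X 0 ≠ 0 := by
      intro X hX hX0
      apply h0
      rcases π with _ | ⟨x, π⟩
      · rfl
      · rw [← mem_cyl.1 hX, prefixWord_getD _ _ _ (by simp), hX0]
    have z1 : annealed P (cyl π) = 0 := by
      have h := annealed_cylinder P 0 rfl 0
      simp only [zero_add, Finset.range_one, Finset.mem_singleton, forall_eq, Pi.zero_apply,
        Finset.range_zero, Finset.prod_empty, lintegral_one, measure_univ] at h
      have hm : MeasurableSet {X : Walk d | X 0 = 0} :=
        measurableSet_eq_fun (measurable_pi_apply 0) measurable_const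
      rw [← prob_compl_eq_zero_iff hm] at h
      exact measure_mono_null (fun X hX => hne X hX) h
    rw [z1]
    symm
    refine measure_eq_zero_iff_ae_notMem.2 ?_
    filter_upwards [ae_walk_eq hstat hell] with p hp hpc
    exact hne _ hpc (by rw [hp, walkOf_zero])

end Cylinders

/-! ### First times with values in `ℕ∞` -/

section FirstTime

lemma firstTime_le_iff {p : ℕ → Prop} {n : ℕ} : firstTime p ≤ n ↔ ∃ m ≤ n, p m := by
  constructor
  · intro h
    by_contra! hc
    have : ((n + 1 : ℕ) : ℕ∞) ≤ firstTime p := by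
      refine le_iInf fun m => le_iInf fun hm => ?_
      by_contra! hlt
      exact hc m (by have := Nat.cast_lt.1 hlt; omega) hm
    have := this.trans h
    exact absurd (Nat.cast_le.1 this) (by omega)
  · rintro ⟨m, hm, hp⟩
    exact (iInf₂_le m hp).trans (Nat.cast_le.2 hm)

lemma firstTime_eq_top_iff {p : ℕ → Prop} : firstTime p = ⊤ ↔ ∀ n, ¬ p n := by
  constructor
  · intro h n hn
    have := firstTime_le_iff.2 ⟨n, le_rfl, hn⟩
    rw [h] at this
    exact absurd this (by simp)
  · intro h
    simp [firstTime, h]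

lemma firstTime_eq_coe_iff {p : ℕ → Prop} {n : ℕ} :
    firstTime p = n ↔ p n ∧ ∀ m < n, ¬ p m := by
  constructor
  · intro h
    obtain ⟨m, hm, hp⟩ := firstTime_le_iff.1 h.le
    have hlt : ∀ m < n, ¬ p m := fun m hmn hpm => by
      have := firstTime_le_iff.2 ⟨m, le_rfl, hpm⟩
      rw [h] at this
      exact absurd (Nat.cast_le.1 this) (by omega)
    rcases hm.lt_or_eq with h' | h'
    · exact absurd hp (hlt m h')
    · exact ⟨h' ▸ hp, hlt⟩
  · rintro ⟨h1, h2⟩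
    refine le_antisymm (firstTime_le_iff.2 ⟨n, le_rfl, h1⟩) ?_
    refine le_iInf fun m => le_iInf fun hm => ?_
    by_contra! hlt
    exact h2 m (Nat.cast_lt.1 hlt) hm

lemma coe_lt_firstTime_iff {p : ℕ → Prop} {n : ℕ} :
    (n : ℕ∞) < firstTime p ↔ ∀ m ≤ n, ¬ p m := by
  rw [← not_le, firstTime_le_iff]; push Not; rfl

end FirstTime

/-! ### Regeneration described through finite pieces of the path -/

section Paths

variable {d : ℕ} [NeZero d]

lemma visits_mono (X : Walk d) {m n : ℕ} (h : m ≤ n) (j : ℕ) : visits X m j ≤ visits X n j := by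
  refine Finset.card_le_card fun i hi => ?_
  simp only [Finset.mem_filter, Finset.mem_range] at *
  exact ⟨by omega, hi.2⟩

/-- Up to time `m` the stopping time `R` has not occurred. -/
def OkUpTo (c : ℝ) (X : Walk d) (m : ℕ) : Prop :=
  (∀ n, 1 ≤ n → n ≤ m → X 0 0 < X n 0) ∧
    ∀ j : ℕ, (visits X m j : ℝ) ≤ c * ((j : ℝ) + 1) ^ 2

/-- Visit counts only increase in time, so an overflow before time `m` is still visible at time `m`.
-/
lemma okUpTo_iff {c : ℝ} {X : Walk d} {m : ℕ} : OkUpTo c X m ↔ (m : ℕ∞) < timeR c X := by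
  rw [timeR, timeD, lt_min_iff, coe_lt_firstTime_iff, coe_lt_firstTime_iff]
  constructor
  · rintro ⟨h1, h2⟩
    refine ⟨fun n hn ⟨j, hj⟩ => ?_, fun n hn ⟨h, h'⟩ => absurd (h1 n h hn) (by omega)⟩
    have : (visits X n j : ℝ) ≤ visits X m j := Nat.cast_le.2 (visits_mono X hn j)
    linarith [h2 j]
  · rintro ⟨h1, h2⟩
    refine ⟨fun n hn hnm => ?_, fun j => ?_⟩
    · by_contra! h
      exact h2 n hnm ⟨hn, h⟩
    · by_contra! h
      exact h1 m le_rfl ⟨j, h⟩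

lemma timeR_eq_top_iff {c : ℝ} {X : Walk d} : timeR c X = ⊤ ↔ ∀ m, OkUpTo c X m := by
  simp_rw [okUpTo_iff]
  constructor
  · intro h m
    rw [h]; exact ENat.natCast_lt_top m
  · intro h
    by_contra hne
    obtain ⟨n, hn⟩ := ENat.ne_top_iff_exists.1 hne
    exact absurd (h n) (by rw [← hn]; simp)

lemma OkUpTo.mono {c : ℝ} {X : Walk d} {m n : ℕ} (h : OkUpTo c X n) (hmn : m ≤ n) :
    OkUpTo c X m := by
  rw [okUpTo_iff] at *
  exact lt_of_le_of_lt (Nat.cast_le.2 hmn) h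

/-- The starting point itself is a visit to level `0`. Hence no lower bound on `c` has to be assumed
separately. -/
lemma OkUpTo.one_le {c : ℝ} {X : Walk d} {m : ℕ} (h : OkUpTo c X m) : 1 ≤ c := by
  have h1 := h.2 0
  have h2 : 1 ≤ visits X m 0 := by
    refine Finset.card_pos.2 ⟨0, ?_⟩
    simp
  have h3 : (1 : ℝ) ≤ visits X m 0 := by exact_mod_cast h2
  norm_num at h1
  linarith

lemma OkUpTo.level_le {c : ℝ} {X : Walk d} {m t : ℕ} (h : OkUpTo c X m) (ht : t ≤ m) :
    X 0 0 ≤ X t 0 := by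
  rcases Nat.eq_zero_or_pos t with rfl | h'
  · exact le_rfl
  · exact (h.1 t h' ht).le

/-- At a strict record time `m` the levels separate: those below `X m 0` are visited only before
`m`, the others only from `m` on. So each visit count comes from a single piece, and counting
heights from the lower start only relaxes the bound `c(j+1)²`. -/
lemma OkUpTo.concat {c : ℝ} {X : Walk d} {m k : ℕ} (hrec : ∀ i < m, X i 0 < X m 0)
    (h1 : OkUpTo c X m) (h2 : OkUpTo c (shiftPath m X) k) : OkUpTo c X (m + k) := by
  have hc := h1.one_le
  have hafter : ∀ i, m < i → i ≤ m + k → X m 0 < X i 0 := by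
    intro i hi hik
    have := h2.1 (i - m) (by omega) (by omega)
    simpa [shiftPath, Nat.add_sub_cancel' hi.le] using this
  have h0m : X 0 0 ≤ X m 0 := h1.level_le le_rfl
  refine ⟨fun n hn hnk => ?_, fun j => ?_⟩
  · rcases le_or_gt n m with h | h
    · exact h1.1 n hn h
    · exact h0m.trans_lt (hafter n h hnk)
  · rcases lt_or_ge (X 0 0 + (j : ℤ)) (X m 0) with h | h
    · have : visits X (m + k) j ≤ visits X m j := by
        refine Finset.card_le_card fun i hi => ?_
        simp only [Finset.mem_filter, Finset.mem_range] at *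
        refine ⟨?_, hi.2⟩
        by_contra hlt
        have := hafter i (by omega) (by omega)
        omega
      exact le_trans (Nat.cast_le.2 this) (h1.2 j)
    · set j' := (X 0 0 + (j : ℤ) - X m 0).toNat with hj'
      have hj'e : (j' : ℤ) = X 0 0 + (j : ℤ) - X m 0 := Int.toNat_of_nonneg (by omega)
      have hle : j' ≤ j := by omega
      have : visits X (m + k) j ≤ visits (shiftPath m X) k j' := by
        have hsub : (Finset.range (m + k + 1)).filter (fun i => X i 0 = X 0 0 + (j : ℤ)) ⊆
            ((Finset.range (k + 1)).filter
              fun i => shiftPath m X i 0 = shiftPath m X 0 0 + (j' : ℤ)).image (m + ·) := by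
          intro i hi
          simp only [Finset.mem_filter, Finset.mem_range, Finset.mem_image] at *
          have him : m ≤ i := by
            by_contra hlt
            have := hrec i (by omega)
            omega
          refine ⟨i - m, ⟨by omega, ?_⟩, by omega⟩
          simp only [shiftPath, Nat.add_sub_cancel' him, add_zero]
          omega
        exact (Finset.card_le_card hsub).trans Finset.card_image_le
      have hle' : ((j' : ℝ) + 1) ^ 2 ≤ ((j : ℝ) + 1) ^ 2 := by
        have : (j' : ℝ) ≤ j := Nat.cast_le.2 hle
        gcongr
      calc (visits X (m + k) j : ℝ) ≤ visits (shiftPath m X) k j' := Nat.cast_le.2 this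
        _ ≤ c * ((j' : ℝ) + 1) ^ 2 := h2.2 j'
        _ ≤ c * ((j : ℝ) + 1) ^ 2 := by gcongr

lemma IsAttempt.level {L : ℕ} {ε : Coins d} {X : Walk d} {n : ℕ} (h : IsAttempt L ε X n) {i : ℕ}
    (hi : i ≤ L) : X (n - L + i) 0 = X (n - L) 0 + i := by
  induction i with
  | zero => simp
  | succ i ih =>
    have h1 := (h.2.2 (L - i) (by omega) (by omega)).2
    have hn := h.1
    have e1 : n - (L - i) = n - L + i := by omega
    rw [e1] at h1
    have h2 := congrFun h1 0
    simp only [Pi.sub_apply, e₁, Pi.single_eq_same] at h2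
    rw [← add_assoc]
    push_cast
    have := ih (by omega)
    omega

lemma IsAttempt.level_end {L : ℕ} {ε : Coins d} {X : Walk d} {n : ℕ} (h : IsAttempt L ε X n) :
    X n 0 = X (n - L) 0 + L := by
  have := h.level (le_refl L)
  rwa [Nat.sub_add_cancel h.1] at this

lemma IsAttempt.level_lt {L : ℕ} {ε : Coins d} {X : Walk d} {n i : ℕ} (h : IsAttempt L ε X n)
    (hi : i < n - L) : X i 0 < X n 0 - L := by
  rw [h.level_end]
  have := h.2.1 i hi
  omega

lemma IsAttempt.record {L : ℕ} {ε : Coins d} {X : Walk d} {n i : ℕ} (h : IsAttempt L ε X n)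
    (hi : i < n) : X i 0 < X n 0 := by
  rcases lt_or_ge i (n - L) with h' | h'
  · have := h.level_lt h'
    omega
  · have h1 := h.1
    have := h.level (i := i - (n - L)) (by omega)
    rw [Nat.add_sub_cancel' h'] at this
    rw [this, h.level_end]
    omega

lemma shiftPath_shiftPath (m n : ℕ) (X : Walk d) :
    shiftPath n (shiftPath m X) = shiftPath (m + n) X := by
  funext i; simp [shiftPath, add_assoc]

/-- Regeneration: an attempt after which `R` never occurs. -/
def IsRegen (c : ℝ) (L : ℕ) (ε : Coins d) (X : Walk d) (n : ℕ) : Prop :=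
  IsAttempt L ε X n ∧ timeR c (shiftPath n X) = ⊤

lemma timeR_top_of_record {c : ℝ} {X : Walk d} {m : ℕ} (hrec : ∀ i < m, X i 0 < X m 0)
    (h1 : OkUpTo c X m) (h2 : timeR c (shiftPath m X) = ⊤) : timeR c X = ⊤ := by
  rw [timeR_eq_top_iff] at *
  exact fun k => (OkUpTo.concat hrec h1 (h2 k)).mono (by omega)

lemma isRegen_of_tau {c : ℝ} {L : ℕ} {ε : Coins d} {X : Walk d} {k : ℕ}
    (h1 : nextS L ε X (seqR c L ε X k) < ⊤) (h2 : seqR c L ε X (k + 1) = ⊤) :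
    ∃ S : ℕ, nextS L ε X (seqR c L ε X k) = S ∧ IsRegen c L ε X S := by
  obtain ⟨S, hS⟩ := ENat.ne_top_iff_exists.1 h1.ne
  refine ⟨S, hS.symm, (firstTime_eq_coe_iff.1 hS.symm).1.2, ?_⟩
  rw [seqR, ← hS, restart, if_neg (ENat.natCast_ne_top S)] at h2
  simpa using h2

lemma nextS_le_of_isRegen {c : ℝ} {L : ℕ} {ε : Coins d} {X : Walk d} {k n : ℕ}
    (hn : IsRegen c L ε X n) (hk : seqR c L ε X k ≤ n) :
    nextS L ε X (seqR c L ε X k) ≤ n :=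
  firstTime_le_iff.2 ⟨n, le_rfl, hk, hn.1⟩

/-- An attempt `S` before a regeneration `n` that fails must fail by time `n`: otherwise its
survival up to the record time `n` concatenates with the survival after `n`, and it never fails. -/
lemma seqR_succ_le_of_isRegen {c : ℝ} {L : ℕ} {ε : Coins d} {X : Walk d} {k n : ℕ}
    (hn : IsRegen c L ε X n) (hk : seqR c L ε X k ≤ n) (hne : seqR c L ε X (k + 1) ≠ ⊤) :
    seqR c L ε X (k + 1) ≤ n ∧ seqR c L ε X k + 1 ≤ seqR c L ε X (k + 1) := by
  have h1 := nextS_le_of_isRegen hn hk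
  obtain ⟨S, hS⟩ := ENat.ne_top_iff_exists.1 (ne_top_of_le_ne_top (ENat.natCast_ne_top n) h1)
  have hSn : S ≤ n := by rw [← hS] at h1; exact Nat.cast_le.1 h1
  rw [seqR, ← hS, restart, if_neg (ENat.natCast_ne_top S), ENat.toNat_natCast] at hne ⊢
  have hne' : timeR c (shiftPath S X) ≠ ⊤ := fun h => hne (by rw [h]; rfl)
  obtain ⟨t, ht⟩ := ENat.ne_top_iff_exists.1 hne'
  have hseq : seqR c L ε X k ≤ S := (firstTime_eq_coe_iff.1 hS.symm).1.1
  have hc : 1 ≤ c := (timeR_eq_top_iff.1 hn.2 0).one_le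
  have ht1 : 1 ≤ t := by
    have : OkUpTo c (shiftPath S X) 0 := by
      refine ⟨fun n h h' => by omega, fun j => ?_⟩
      have h1 : visits (shiftPath S X) 0 j ≤ 1 := by
        refine (Finset.card_filter_le _ _).trans ?_
        simp
      have h2 : (visits (shiftPath S X) 0 j : ℝ) ≤ 1 := by exact_mod_cast h1
      have h3 : (1 : ℝ) ≤ ((j : ℝ) + 1) ^ 2 := one_le_pow₀ (by linarith [Nat.cast_nonneg (α := ℝ) j])
      nlinarith
    rw [okUpTo_iff, ← ht] at this
    exact Nat.cast_lt.1 this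
  rw [← ht]
  constructor
  · by_contra! hlt
    have hlt' : n < t + S := by exact_mod_cast hlt
    refine hne' (timeR_top_of_record (m := n - S) ?_ ?_ ?_)
    · intro i hi
      simp only [shiftPath, Nat.add_sub_cancel' hSn]
      exact hn.1.record (by omega)
    · rw [okUpTo_iff, ← ht]
      exact Nat.cast_lt.2 (by omega)
    · rw [shiftPath_shiftPath, Nat.add_sub_cancel' hSn]
      exact hn.2
  · calc seqR c L ε X k + 1 ≤ (S : ℕ∞) + t := add_le_add hseq (by exact_mod_cast ht1)
      _ = t + S := add_comm _ _

/-- The recursion of the `S_k` and `R_k` skips no regeneration, since a finite `R_k` never passes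
one. The first regeneration time can thus be handled without the recursion. -/
lemma tau₁_eq_firstTime (c : ℝ) (L : ℕ) (ε : Coins d) (X : Walk d) :
    tau₁ c L ε X = firstTime (IsRegen c L ε X) := by
  classical
  unfold tau₁
  by_cases hex : ∃ n, IsRegen c L ε X n
  · obtain ⟨n₀, hn₀⟩ := hex
    have h : ∃ k, nextS L ε X (seqR c L ε X k) < ⊤ ∧ seqR c L ε X (k + 1) = ⊤ := by
      by_contra! hcon
      -- If no `k` qualified, the `R_k` would increase strictly and yet stay below the regeneration
      -- `n₀`.
      have key : ∀ k : ℕ, seqR c L ε X k ≤ n₀ ∧ (k : ℕ∞) ≤ seqR c L ε X k := by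
        intro k
        induction k with
        | zero => exact ⟨by simp [seqR], by simp⟩
        | succ k ih =>
          have h1 := lt_of_le_of_lt (nextS_le_of_isRegen hn₀ ih.1) (ENat.natCast_lt_top n₀)
          have h2 := seqR_succ_le_of_isRegen hn₀ ih.1 (hcon k h1)
          refine ⟨h2.1, le_trans ?_ h2.2⟩
          push_cast
          exact add_le_add ih.2 le_rfl
      have := (key (n₀ + 1)).2.trans (key (n₀ + 1)).1
      exact absurd (Nat.cast_le.1 this) (by omega)
    rw [dif_pos h]
    obtain ⟨S, hS, hreg⟩ := isRegen_of_tau (Nat.find_spec h).1 (Nat.find_spec h).2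
    rw [hS]
    symm
    refine firstTime_eq_coe_iff.2 ⟨hreg, fun m hm hmreg => ?_⟩
    have key : ∀ k ≤ Nat.find h, seqR c L ε X k ≤ m := by
      intro k
      induction k with
      | zero => intro; simp [seqR]
      | succ k ih =>
        intro hk
        have h1 := ih (by omega)
        refine (seqR_succ_le_of_isRegen hmreg h1 fun htop => ?_).1
        exact Nat.find_min h (m := k) (by omega)
          ⟨lt_of_le_of_lt (nextS_le_of_isRegen hmreg h1) (ENat.natCast_lt_top m), htop⟩
    have := nextS_le_of_isRegen hmreg (key _ le_rfl)
    rw [hS] at this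
    exact absurd (Nat.cast_le.1 this) (by omega)
  · rw [dif_neg]
    · symm
      exact firstTime_eq_top_iff.2 (not_exists.1 hex)
    · rintro ⟨k, h1, h2⟩
      obtain ⟨S, _, hreg⟩ := isRegen_of_tau h1 h2
      exact hex ⟨S, hreg⟩

lemma IsAttempt.congr {L : ℕ} {ε ε' : Coins d} {X : Walk d} {n : ℕ}
    (h : ∀ t, ε (t, X t) = ε' (t, X t)) (hA : IsAttempt L ε X n) : IsAttempt L ε' X n :=
  ⟨hA.1, hA.2.1, fun i h1 h2 => ⟨by rw [← h]; exact (hA.2.2 i h1 h2).1, (hA.2.2 i h1 h2).2⟩⟩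

lemma isAttempt_congr {L : ℕ} {ε ε' : Coins d} {X : Walk d} {n : ℕ}
    (h : ∀ t, ε (t, X t) = ε' (t, X t)) : IsAttempt L ε X n ↔ IsAttempt L ε' X n :=
  ⟨fun hA => hA.congr h, fun hA => hA.congr fun t => (h t).symm⟩

lemma tau₁_congr (c : ℝ) {L : ℕ} {ε ε' : Coins d} {X : Walk d}
    (h : ∀ t, ε (t, X t) = ε' (t, X t)) : tau₁ c L ε X = tau₁ c L ε' X := by
  rw [tau₁_eq_firstTime, tau₁_eq_firstTime]
  congr 1
  funext n
  simp only [IsRegen, isAttempt_congr h]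

/-- Only the coins met by the path matter, so the given coins may be replaced by `coinsOf`, which do
not depend on the site and are therefore compatible with translations. -/
lemma tau_congr (c : ℝ) {L : ℕ} {ε ε' : Coins d} {X : Walk d}
    (h : ∀ t, ε (t, X t) = ε' (t, X t)) (n : ℕ) : tau c L ε X n = tau c L ε' X n := by
  induction n with
  | zero => rfl
  | succ n ih =>
    rw [tau, tau, ih]
    congr 1
    funext m
    exact tau₁_congr c fun t => h (m + t)

lemma timeR_add (c : ℝ) (v : Site d) (X : Walk d) : timeR c (fun n => v + X n) = timeR c X := by
  simp [timeR, timeD, visits, add_assoc]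

lemma isAttempt_add {L : ℕ} {ε : Coins d} (hε : ∀ t x y, ε (t, x) = ε (t, y)) (v : Site d)
    (X : Walk d) (n : ℕ) : IsAttempt L ε (fun n => v + X n) n ↔ IsAttempt L ε X n := by
  unfold IsAttempt
  simp only [Pi.add_apply, add_lt_add_iff_left, add_sub_add_left_eq_sub]
  simp only [fun t => hε t (v + X t) (X t)]

end Paths

/-! ### Blocks between regeneration times -/

section Symbolic

variable {d : ℕ} [NeZero d]

lemma shiftSeq_shiftSeq {α : Type*} (m n : ℕ) (s : ℕ → α) :
    shiftSeq n (shiftSeq m s) = shiftSeq (m + n) s := by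
  funext i; simp [shiftSeq, add_assoc]

@[simp] lemma shiftSeq_zero {α : Type*} (s : ℕ → α) : shiftSeq 0 s = s := by
  funext i; simp [shiftSeq]

lemma shiftPath_walkOf (m : ℕ) (s : ℕ → Letter d) :
    shiftPath m (walkOf s) = fun n => walkOf s m + walkOf (shiftSeq m s) n := by
  funext n; exact walkOf_add s m n

lemma walkOf_eq_wordDisp {s : ℕ → Letter d} {π : List (Letter d)} (hs : s ∈ cyl π) {t : ℕ}
    (ht : t ≤ π.length) : walkOf s t = wordDisp (π.take t) := by
  rw [walkOf, ← prefixWord_take s ht, mem_cyl.1 hs]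

lemma walkOf_congr {s s' : ℕ → Letter d} {n : ℕ} (h : prefixWord s n = prefixWord s' n) {t : ℕ}
    (ht : t ≤ n) : walkOf s t = walkOf s' t := by
  rw [walkOf, walkOf, ← prefixWord_take s ht, h, prefixWord_take s' ht]

lemma OkUpTo.congr {c : ℝ} {X X' : Walk d} {m : ℕ} (h : ∀ i ≤ m, X i = X' i)
    (hX : OkUpTo c X m) : OkUpTo c X' m := by
  refine ⟨fun n h1 h2 => ?_, fun j => ?_⟩
  · rw [← h n h2, ← h 0 (Nat.zero_le _)]; exact hX.1 n h1 h2
  · have : visits X' m j = visits X m j := by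
      unfold visits
      congr 1
      refine Finset.filter_congr fun i hi => ?_
      rw [h i (by have := Finset.mem_range.1 hi; omega), h 0 (Nat.zero_le _)]
    rw [this]; exact hX.2 j

lemma okUpTo_add {c : ℝ} {v : Site d} {X : Walk d} {m : ℕ} :
    OkUpTo c (fun n => v + X n) m ↔ OkUpTo c X m := by
  rw [okUpTo_iff, okUpTo_iff, timeR_add]

/-- The sequences of letters for which `R` never occurs. -/
def neverR (c : ℝ) : Set (ℕ → Letter d) := {s | timeR c (walkOf s) = ⊤}

lemma mem_neverR {c : ℝ} {s : ℕ → Letter d} : s ∈ neverR c ↔ ∀ m, OkUpTo c (walkOf s) m :=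
  timeR_eq_top_iff

lemma timeR_shiftPath_walkOf (c : ℝ) (m : ℕ) (s : ℕ → Letter d) :
    timeR c (shiftPath m (walkOf s)) = timeR c (walkOf (shiftSeq m s)) := by
  rw [shiftPath_walkOf, timeR_add]

lemma okUpTo_shiftPath_walkOf {c : ℝ} {m k : ℕ} {s : ℕ → Letter d} :
    OkUpTo c (shiftPath m (walkOf s)) k ↔ OkUpTo c (walkOf (shiftSeq m s)) k := by
  rw [shiftPath_walkOf, okUpTo_add]

/-- A word along which `R` does not occur. -/
def OkWord (c : ℝ) (π : List (Letter d)) : Prop :=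
  OkUpTo c (fun t => wordDisp (π.take t)) π.length

lemma okWord_iff {c : ℝ} {π : List (Letter d)} {s : ℕ → Letter d} (hs : s ∈ cyl π) :
    OkWord c π ↔ OkUpTo c (walkOf s) π.length :=
  ⟨fun h => h.congr fun i hi => (walkOf_eq_wordDisp hs hi).symm,
    fun h => h.congr fun i hi => walkOf_eq_wordDisp hs hi⟩

lemma okWord_prefixWord {c : ℝ} {s : ℕ → Letter d} {n : ℕ} :
    OkWord c (prefixWord s n) ↔ OkUpTo c (walkOf s) n := by
  rw [okWord_iff (mem_cyl_prefixWord s n), length_prefixWord]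

lemma measurableSet_neverR (c : ℝ) : MeasurableSet (neverR c : Set (ℕ → Letter d)) := by
  have : (neverR c : Set (ℕ → Letter d)) =
      ⋂ n, {s : ℕ → Letter d | prefixWord s n ∈ ({π | OkWord c π} : Set (List (Letter d)))} := by
    ext s
    rw [mem_neverR, Set.mem_iInter]
    exact forall_congr' fun n => okWord_prefixWord.symm
  rw [this]
  exact MeasurableSet.iInter fun n => measurableSet_prefixWord n _

/-- An attempt, for a sequence of letters. -/
def AttemptSeq (L : ℕ) (s : ℕ → Letter d) (n : ℕ) : Prop := IsAttempt L (coinsOf s) (walkOf s) n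

lemma AttemptSeq.congr {L n : ℕ} {s s' : ℕ → Letter d} (h : prefixWord s n = prefixWord s' n)
    (hs : AttemptSeq L s n) : AttemptSeq L s' n := by
  have hl := prefixWord_eq_iff.1 h
  have hw : ∀ t ≤ n, walkOf s t = walkOf s' t := fun t ht => walkOf_congr h ht
  obtain ⟨h1, h2, h3⟩ := hs
  refine ⟨h1, fun m hm => ?_, fun i hi hiL => ⟨?_, ?_⟩⟩
  · rw [← hw m (by omega), ← hw (n - L) (by omega)]; exact h2 m hm
  · have := (h3 i hi hiL).1
    simp only [coinsOf] at this ⊢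
    rw [← hl (n - i) (by omega)]; exact this
  · rw [← hw (n - i) (by omega), ← hw (n - i + 1) (by omega)]; exact (h3 i hi hiL).2

/-- The beginning up to time `m` looks like the part up to the first regeneration time. -/
def BlockSeq (c : ℝ) (L : ℕ) (s : ℕ → Letter d) (m : ℕ) : Prop :=
  OkUpTo c (walkOf s) m ∧ AttemptSeq L s m ∧
    ∀ n < m, AttemptSeq L s n → ¬ OkUpTo c (walkOf (shiftSeq n s)) (m - n)

lemma BlockSeq.congr {c : ℝ} {L m : ℕ} {s s' : ℕ → Letter d}
    (h : prefixWord s m = prefixWord s' m) (hs : BlockSeq c L s m) : BlockSeq c L s' m := by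
  refine ⟨hs.1.congr fun i hi => walkOf_congr h hi, hs.2.1.congr h, fun n hn h1 h2 => ?_⟩
  have hn' : prefixWord s' n = prefixWord s n := by
    rw [← prefixWord_take s hn.le, h, prefixWord_take s' hn.le]
  refine hs.2.2 n hn (h1.congr hn') (h2.congr fun i hi => walkOf_congr (n := m - n) ?_ hi)
  have hl := prefixWord_eq_iff.1 h
  exact prefixWord_eq_iff.2 fun t ht => (hl (n + t) (by omega)).symm

/-- Regeneration for a sequence of letters. -/
def RegenSeq (c : ℝ) (L : ℕ) (s : ℕ → Letter d) (n : ℕ) : Prop :=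
  AttemptSeq L s n ∧ shiftSeq n s ∈ neverR c

lemma neverR_of_attempt {c : ℝ} {L m : ℕ} {s : ℕ → Letter d} (h1 : OkUpTo c (walkOf s) m)
    (h2 : RegenSeq c L s m) : s ∈ neverR c := by
  refine timeR_top_of_record (fun i hi => h2.1.record hi) h1 ?_
  rw [timeR_shiftPath_walkOf]; exact h2.2

lemma AttemptSeq.shift {L m n : ℕ} {s : ℕ → Letter d} (hn : AttemptSeq L s n)
    (hm : AttemptSeq L s m) (hnm : n ≤ m) {i : ℕ} (hi : i < m - n) :
    walkOf (shiftSeq n s) i 0 < walkOf (shiftSeq n s) (m - n) 0 := by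
  have e1 := congrFun (walkOf_add s n i) 0
  have e2 := congrFun (walkOf_add s n (m - n)) 0
  have := hm.record (i := n + i) (by omega)
  rw [Nat.add_sub_cancel' hnm] at e2
  simp only [Pi.add_apply] at e1 e2
  change walkOf (fun t => s (n + t)) i 0 < walkOf (fun t => s (n + t)) (m - n) 0
  omega

/-- An earlier regeneration would be an attempt that survives up to time `m`, which the block
property excludes. -/
lemma BlockSeq.firstTime_eq {c : ℝ} {L m : ℕ} {s : ℕ → Letter d} (h1 : BlockSeq c L s m)
    (h2 : shiftSeq m s ∈ neverR c) : s ∈ neverR c ∧ firstTime (RegenSeq c L s) = m := by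
  refine ⟨neverR_of_attempt h1.1 ⟨h1.2.1, h2⟩, firstTime_eq_coe_iff.2 ⟨⟨h1.2.1, h2⟩, ?_⟩⟩
  exact fun n hn hreg => h1.2.2 n hn hreg.1 (mem_neverR.1 hreg.2 _)

/-- With `BlockSeq.firstTime_eq` this splits the event of a first regeneration at `m` into a
condition on the first `m` letters and survival afterwards. An earlier attempt still alive at the
record time `m` would survive for ever by concatenation, against minimality. -/
lemma blockSeq_of_firstTime_eq {c : ℝ} {L m : ℕ} {s : ℕ → Letter d} (h1 : s ∈ neverR c)
    (h2 : firstTime (RegenSeq c L s) = m) : BlockSeq c L s m ∧ shiftSeq m s ∈ neverR c := by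
  obtain ⟨hreg, hmin⟩ := firstTime_eq_coe_iff.1 h2
  refine ⟨⟨mem_neverR.1 h1 m, hreg.1, fun n hn hA hok => hmin n hn ⟨hA, ?_⟩⟩, hreg.2⟩
  refine timeR_top_of_record (m := m - n) (fun i hi => hA.shift hreg.1 hn.le hi) hok ?_
  rw [timeR_shiftPath_walkOf, shiftSeq_shiftSeq, Nat.add_sub_cancel' hn.le]
  exact hreg.2

/-- The regeneration times of a sequence of letters. -/
def regenTime (c : ℝ) (L : ℕ) (s : ℕ → Letter d) : ℕ → ℕ∞
  | 0 => 0
  | n + 1 => restart (regenTime c L s n) fun m => firstTime (RegenSeq c L (shiftSeq m s))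

lemma tau_coinsOf_walkOf (c : ℝ) (L : ℕ) (s : ℕ → Letter d) (n : ℕ) :
    tau c L (coinsOf s) (walkOf s) n = regenTime c L s n := by
  induction n with
  | zero => rfl
  | succ n ih =>
    rw [tau, regenTime, ih]
    congr 1
    funext m
    rw [tau₁_eq_firstTime]
    congr 1
    funext k
    simp only [IsRegen, RegenSeq, AttemptSeq, shiftPath_walkOf m]
    rw [show shiftCoins m (coinsOf s) = coinsOf (shiftSeq m s) from rfl,
      isAttempt_add (fun _ _ _ => rfl)]
    have : shiftPath k (fun n => walkOf s m + walkOf (shiftSeq m s) n) =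
        fun n => walkOf s m + shiftPath k (walkOf (shiftSeq m s)) n := rfl
    rw [this, timeR_add, timeR_shiftPath_walkOf]
    rfl

/-- Words which can be the part of the path up to the first regeneration time. -/
def IsBlock (c : ℝ) (L : ℕ) (ξ : List (Letter d)) : Prop := ∃ s ∈ cyl ξ, BlockSeq c L s ξ.length

lemma IsBlock.blockSeq {c : ℝ} {L : ℕ} {ξ : List (Letter d)} (h : IsBlock c L ξ)
    {s : ℕ → Letter d} (hs : s ∈ cyl ξ) : BlockSeq c L s ξ.length := by
  obtain ⟨s', hs', hb⟩ := h
  exact hb.congr (by rw [mem_cyl.1 hs', mem_cyl.1 hs])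

lemma BlockSeq.isBlock {c : ℝ} {L m : ℕ} {s : ℕ → Letter d} (h : BlockSeq c L s m) :
    IsBlock c L (prefixWord s m) :=
  ⟨s, mem_cyl_prefixWord s m, by rwa [length_prefixWord]⟩

/-- The blocks between regeneration times. -/
abbrev Block (d : ℕ) [NeZero d] (c : ℝ) (L : ℕ) : Type := {ξ : List (Letter d) // IsBlock c L ξ}

variable {c : ℝ} {L : ℕ}

/-- The concatenation of a list of blocks. -/
def flat (w : List (Block d c L)) : List (Letter d) := (w.map Subtype.val).flatten

@[simp] lemma flat_nil : flat ([] : List (Block d c L)) = [] := rfl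

@[simp] lemma flat_cons (b : Block d c L) (w : List (Block d c L)) :
    flat (b :: w) = b.1 ++ flat w := rfl

@[simp] lemma flat_append (w w' : List (Block d c L)) : flat (w ++ w') = flat w ++ flat w' := by
  simp [flat]

/-- The path starts with the given blocks, and regenerates after them. -/
def blockEvent (w : List (Block d c L)) : Set (ℕ → Letter d) :=
  cyl (flat w) ∩ shiftSeq (flat w).length ⁻¹' neverR c

lemma measurableSet_blockEvent (w : List (Block d c L)) : MeasurableSet (blockEvent w) :=
  (measurableSet_cyl _).inter (measurable_shiftSeq _ (measurableSet_neverR c))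

lemma mem_blockEvent_append {w w' : List (Block d c L)} {s : ℕ → Letter d} :
    s ∈ blockEvent (w ++ w') ↔ s ∈ cyl (flat w) ∧ shiftSeq (flat w).length s ∈ blockEvent w' := by
  simp only [blockEvent, flat_append, Set.mem_inter_iff, Set.mem_preimage, mem_cyl_append,
    List.length_append, shiftSeq_shiftSeq, and_assoc]
  rfl

/-- Blocks end at records, so survival after the last block propagates backwards through all of
them. -/
lemma mem_neverR_of_mem_blockEvent {w : List (Block d c L)} {s : ℕ → Letter d}
    (hs : s ∈ blockEvent w) : s ∈ neverR c := by
  induction w generalizing s with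
  | nil => simpa [blockEvent] using hs.2
  | cons b w ih =>
    obtain ⟨h1, h2⟩ := (mem_blockEvent_append (w := [b])).1 hs
    simp only [flat_cons, flat_nil, List.append_nil] at h1 h2
    exact ((b.2.blockSeq h1).firstTime_eq (ih h2)).1

lemma blockEvent_append_subset (w w' : List (Block d c L)) :
    blockEvent (w ++ w') ⊆ blockEvent w := by
  intro s hs
  have h := mem_blockEvent_append.1 hs
  have h2 := mem_neverR_of_mem_blockEvent h.2
  rw [blockEvent]
  exact Set.mem_inter h.1 h2

lemma regenTime_eq_of_mem_blockEvent {w : List (Block d c L)} {s : ℕ → Letter d}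
    (hs : s ∈ blockEvent w) : regenTime c L s w.length = (flat w).length := by
  induction w using List.reverseRecOn with
  | nil => rfl
  | append_singleton w b ih =>
    obtain ⟨h1, h2⟩ := mem_blockEvent_append.1 hs
    have h3 := ih (blockEvent_append_subset _ _ hs)
    rw [List.length_append, List.length_singleton, regenTime, h3, restart,
      if_neg (ENat.natCast_ne_top _), ENat.toNat_natCast]
    obtain ⟨h4, h5⟩ := h2
    simp only [flat_cons, flat_nil, List.append_nil, Set.mem_preimage] at h4 h5
    rw [((b.2.blockSeq h4).firstTime_eq h5).2]
    simp [add_comm]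

lemma exists_blockEvent {n m : ℕ} {s : ℕ → Letter d} (hs : s ∈ neverR c)
    (h : regenTime c L s n = m) : ∃ w : List (Block d c L), w.length = n ∧ s ∈ blockEvent w := by
  induction n generalizing m with
  | zero => exact ⟨[], rfl, by simpa [blockEvent, cyl, prefixWord] using hs⟩
  | succ n ih =>
    rw [regenTime, restart] at h
    split_ifs at h with htop
    · exact absurd h (by simp)
    · obtain ⟨k, hk⟩ := ENat.ne_top_iff_exists.1 htop
      obtain ⟨w, hw, hsw⟩ := ih hk.symm
      have hk' := regenTime_eq_of_mem_blockEvent hsw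
      rw [hw, ← hk] at hk'
      have hkl : k = (flat w).length := by exact_mod_cast hk'
      rw [← hk, ENat.toNat_natCast] at h
      obtain ⟨l, hl⟩ : ∃ l : ℕ, firstTime (RegenSeq c L (shiftSeq k s)) = l := by
        have : firstTime (RegenSeq c L (shiftSeq k s)) ≠ ⊤ := by
          intro h'; rw [h'] at h; simp at h
        obtain ⟨l, hl⟩ := ENat.ne_top_iff_exists.1 this
        exact ⟨l, hl.symm⟩
      have hs' : shiftSeq k s ∈ neverR c := by rw [hkl]; exact hsw.2
      obtain ⟨h1, h2⟩ := blockSeq_of_firstTime_eq hs' hl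
      refine ⟨w ++ [⟨prefixWord (shiftSeq k s) l, h1.isBlock⟩], by simp [hw], ?_⟩
      rw [mem_blockEvent_append, ← hkl]
      refine ⟨hsw.1, ?_⟩
      simp only [blockEvent, flat_cons, flat_nil, List.append_nil, length_prefixWord]
      exact ⟨mem_cyl_prefixWord _ _, h2⟩

/-- The sequence determines its first regeneration time, hence the first block, hence by induction
all of them. This makes block events of equal length disjoint. -/
lemma eq_of_mem_blockEvent {w w' : List (Block d c L)} {s : ℕ → Letter d}
    (hs : s ∈ blockEvent w) (hs' : s ∈ blockEvent w') (hlen : w.length = w'.length) : w = w' := by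
  induction w generalizing w' s with
  | nil => exact (List.length_eq_zero_iff.1 hlen.symm).symm
  | cons b w ih =>
    rcases w' with _ | ⟨b', w'⟩
    · simp at hlen
    obtain ⟨h1, h2⟩ := (mem_blockEvent_append (w := [b])).1 hs
    obtain ⟨h1', h2'⟩ := (mem_blockEvent_append (w := [b'])).1 hs'
    simp only [flat_cons, flat_nil, List.append_nil] at h1 h2 h1' h2'
    have e := ((b.2.blockSeq h1).firstTime_eq (mem_neverR_of_mem_blockEvent h2)).2
    have e' := ((b'.2.blockSeq h1').firstTime_eq (mem_neverR_of_mem_blockEvent h2')).2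
    have hl : b.1.length = b'.1.length := by rw [e] at e'; exact_mod_cast e'
    have hb : b = b' := by
      refine Subtype.ext ?_
      rw [← mem_cyl.1 h1, ← mem_cyl.1 h1', hl]
    subst hb
    rw [ih h2 h2' (by simpa using hlen)]

end Symbolic

/-! ### Quenched survival probabilities -/

section Survival

lemma sum_words_add {α M : Type*} [Fintype α] [AddCommMonoid M] (m n : ℕ) (f : List α → M) :
    ∑ π ∈ words α (m + n), f π = ∑ π ∈ words α m, ∑ π' ∈ words α n, f (π ++ π') := by
  induction m generalizing f with
  | zero => rw [sum_words_zero, zero_add]; rfl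
  | succ m ih =>
    rw [show m + 1 + n = (m + n) + 1 by omega, sum_words_succ, sum_words_succ]
    refine Finset.sum_congr rfl fun a _ => ?_
    exact ih fun π => f (a :: π)

variable {d : ℕ} [NeZero d]

open scoped Classical in
/-- The quenched probability that `R` does not occur in the first `N` steps from `x`. -/
def surviveN (κ c : ℝ) (N : ℕ) (x : Site d) (ω : Env d) : ℝ≥0∞ :=
  ∑ v ∈ words (Letter d) N with OkWord c v, wordWeight κ v x ω

/-- The quenched probability that `R` never occurs for the walk from `x`. -/
def survive (κ c : ℝ) (x : Site d) (ω : Env d) : ℝ≥0∞ := ⨅ N, surviveN κ c N x ω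

@[fun_prop]
lemma measurable_surviveN (κ c : ℝ) (N : ℕ) (x : Site d) :
    Measurable (surviveN (d := d) κ c N x) :=
  Finset.measurable_fun_sum _ fun v _ => measurable_wordWeight κ v x

@[fun_prop]
lemma measurable_survive (κ c : ℝ) (x : Site d) : Measurable (survive (d := d) κ c x) :=
  Measurable.iInf fun N => measurable_surviveN κ c N x

variable {κ c : ℝ}

lemma OkWord.of_append {π π' : List (Letter d)} (h : OkWord c (π ++ π')) : OkWord c π := by
  refine (h.mono (m := π.length) (by simp)).congr fun i hi => ?_
  rw [List.take_append_of_le_length hi]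

lemma surviveN_le_one (h0 : 0 < κ) (h1 : κ < 1 / (2 * d)) (N : ℕ) (x : Site d) (ω : Env d) :
    surviveN κ c N x ω ≤ 1 := by
  classical
  rw [← sum_wordWeight h0 h1 N x ω]
  exact Finset.sum_le_sum_of_subset (Finset.filter_subset _ _)

/-- A surviving word of length `N + 1` extends a surviving word of length `N`, and the weights of
the extensions sum to `1`. -/
lemma antitone_surviveN (h0 : 0 < κ) (h1 : κ < 1 / (2 * d)) (x : Site d) (ω : Env d) :
    Antitone fun N => surviveN κ c N x ω := by
  classical
  refine antitone_nat_of_succ_le fun N => ?_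
  simp only [surviveN, Finset.sum_filter]
  rw [sum_words_add]
  refine Finset.sum_le_sum fun π _ => ?_
  split_ifs with h
  · calc _ ≤ ∑ π' ∈ words (Letter d) 1, wordWeight κ (π ++ π') x ω :=
          Finset.sum_le_sum fun π' _ => by split_ifs <;> simp
      _ = wordWeight κ π x ω := by
          simp_rw [wordWeight_append, ← Finset.mul_sum, sum_wordWeight h0 h1, mul_one]
  · refine (Finset.sum_eq_zero fun π' _ => ?_).le
    rw [if_neg fun h' => h h'.of_append]

lemma survive_le_one (h0 : 0 < κ) (h1 : κ < 1 / (2 * d)) (x : Site d) (ω : Env d) :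
    survive κ c x ω ≤ 1 :=
  (iInf_le _ 0).trans (surviveN_le_one h0 h1 0 x ω)

lemma survive_shift (x z : Site d) (ω : Env d) :
    survive κ c x (fun y => ω (y + z)) = survive κ c (x + z) ω := by
  simp only [survive, surviveN, wordWeight_shift]

variable {P : Measure (Env d)} [IsProbabilityMeasure P]

lemma letterLaw_cyl_surviveN (hstat : Stationary P) (hell : UniformlyElliptic P κ)
    (π : List (Letter d)) (N : ℕ) :
    letterLaw P κ (cyl π ∩ shiftSeq π.length ⁻¹' {s | OkWord c (prefixWord s N)}) =
      ∫⁻ ω, wordWeight κ π 0 ω * surviveN κ c N (wordDisp π) ω ∂P := by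
  classical
  have hset : cyl π ∩ shiftSeq π.length ⁻¹' {s : ℕ → Letter d | OkWord c (prefixWord s N)} =
      {s | prefixWord s (π.length + N) ∈
        {ρ | ρ.take π.length = π ∧ OkWord c (ρ.drop π.length)}} := by
    ext s
    simp only [Set.mem_inter_iff, Set.mem_preimage, Set.mem_ofPred_eq, mem_cyl, prefixWord_add,
      List.take_left' (length_prefixWord s _), List.drop_left' (length_prefixWord s _)]
    rfl
  rw [hset, measure_prefixWord, Finset.sum_filter, sum_words_add]
  simp only [letterLaw_cyl hstat hell]
  have : ∀ π' ∈ words (Letter d) π.length, (∑ v ∈ words (Letter d) N,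
      if π' ++ v ∈ {ρ | ρ.take π.length = π ∧ OkWord c (ρ.drop π.length)} then
        ∫⁻ ω, wordWeight κ (π' ++ v) 0 ω ∂P else 0) = if π' = π then
        ∑ v ∈ words (Letter d) N with OkWord c v, ∫⁻ ω, wordWeight κ (π ++ v) 0 ω ∂P else 0 := by
    intro π' hπ'
    have hl := mem_words.1 hπ'
    simp only [Set.mem_ofPred_eq, List.take_left' hl, List.drop_left' hl]
    split_ifs with h
    · rw [h]
      simp [Finset.sum_filter]
    · simp [h]
  rw [Finset.sum_congr rfl this, Finset.sum_ite_eq', if_pos (mem_words.2 rfl),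
    ← lintegral_finsetSum _ fun v _ => measurable_wordWeight κ _ 0]
  refine lintegral_congr fun ω => ?_
  simp only [wordWeight_append, zero_add, ← Finset.mul_sum, surviveN]

lemma neverR_eq_iInter : (neverR c : Set (ℕ → Letter d)) =
    ⋂ N, {s | OkWord c (prefixWord s N)} := by
  ext s
  rw [mem_neverR, Set.mem_iInter]
  exact forall_congr' fun n => okWord_prefixWord.symm

/-- The identity for survival up to `N` sums over finite continuations; then `N → ∞`, by continuity
from above on one side and monotone convergence on the other. -/
lemma letterLaw_cyl_neverR (hstat : Stationary P) (hell : UniformlyElliptic P κ)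
    (π : List (Letter d)) :
    letterLaw P κ (cyl π ∩ shiftSeq π.length ⁻¹' neverR c) =
      ∫⁻ ω, wordWeight κ π 0 ω * survive κ c (wordDisp π) ω ∂P := by
  have := isProbabilityMeasure_letterLaw (P := P) hell
  have hanti : Antitone fun N => cyl π ∩
      shiftSeq π.length ⁻¹' {s : ℕ → Letter d | OkWord c (prefixWord s N)} := by
    intro m n hmn s hs
    refine ⟨hs.1, ?_⟩
    have h2 := hs.2
    simp only [Set.mem_preimage, Set.mem_ofPred_eq, okWord_prefixWord] at h2 ⊢
    exact h2.mono hmn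
  rw [neverR_eq_iInter, Set.preimage_iInter, Set.inter_iInter, hanti.measure_iInter]
  · simp_rw [letterLaw_cyl_surviveN hstat hell]
    rw [← lintegral_iInf]
    · refine lintegral_congr fun ω => ?_
      have hne : wordWeight κ π 0 ω ≠ ∞ := ?_
      · rw [survive, ENNReal.mul_iInf fun h => absurd h hne]
      · exact ne_top_of_le_ne_top ENNReal.one_ne_top (wordWeight_le_one hell.1 hell.2.1 _ _ _)
    · intro N
      exact (measurable_wordWeight κ π 0).mul (measurable_surviveN κ c N _)
    · intro m n hmn ω
      exact mul_le_mul_right (antitone_surviveN hell.1 hell.2.1 _ _ hmn) _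
    · refine ne_top_of_le_ne_top (b := 1) ENNReal.one_ne_top ?_
      refine (lintegral_mono fun ω => mul_le_one' (wordWeight_le_one hell.1 hell.2.1 _ _ _) (surviveN_le_one hell.1 hell.2.1 _ _ _)).trans ?_
      simp
  · intro N
    exact ((measurableSet_cyl π).inter (measurable_shiftSeq _
      (measurableSet_prefixWord N {v | OkWord c v}))).nullMeasurableSet
  · exact ⟨0, measure_ne_top _ _⟩

lemma lintegral_survive (hstat : Stationary P) (hell : UniformlyElliptic P κ) (x : Site d) :
    ∫⁻ ω, survive κ c x ω ∂P = letterLaw P κ (neverR c) := by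
  have h := letterLaw_cyl_neverR (c := c) hstat hell ([] : List (Letter d))
  have e : (cyl [] : Set (ℕ → Letter d)) = Set.univ := by ext; simp [cyl, prefixWord]
  have e' : shiftSeq ([] : List (Letter d)).length ⁻¹' (neverR c) = (neverR c : Set (ℕ → Letter d)) := by
    ext s; simp
  rw [e, e', Set.univ_inter] at h
  rw [h]
  refine Eq.trans (lintegral_congr fun ω => ?_)
    (lintegral_stationary hstat x (f := fun ω => wordWeight κ [] 0 ω * survive κ c 0 ω)
      (by fun_prop))
  simp [survive_shift, wordWeight]

lemma measurableSet_okUpTo (c : ℝ) (m : ℕ) : MeasurableSet {X : Walk d | OkUpTo c X m} := by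
  have hm : Measurable fun (X : Walk d) (i : Fin (m + 1)) => X i :=
    measurable_pi_lambda _ fun i => measurable_pi_apply _
  have : {X : Walk d | OkUpTo c X m} = (fun (X : Walk d) (i : Fin (m + 1)) => X i) ⁻¹'
      {Y | OkUpTo c (fun n => if h : n < m + 1 then Y ⟨n, h⟩ else 0) m} := by
    ext X
    have key : ∀ i ≤ m, X i = (fun n => if h : n < m + 1 then X n else 0) i := by
      intro i hi; simp [Nat.lt_succ_of_le hi]
    exact ⟨fun h => h.congr key, fun h => OkUpTo.congr (fun i hi => (key i hi).symm) h⟩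
  rw [this]
  exact hm .of_discrete

lemma measurableSet_timeR_eq_top (c : ℝ) : MeasurableSet {X : Walk d | timeR c X = ⊤} := by
  have : {X : Walk d | timeR c X = ⊤} = ⋂ m, {X : Walk d | OkUpTo c X m} := by
    ext X; rw [Set.mem_iInter]; exact timeR_eq_top_iff
  rw [this]
  exact MeasurableSet.iInter fun m => measurableSet_okUpTo c m

lemma measurable_walkOf : Measurable (walkOf (d := d)) := by
  refine measurable_pi_lambda _ fun n => ?_
  refine measurable_to_countable' fun z => ?_
  exact measurableSet_prefixWord n {π | wordDisp π = z}

lemma annealed_timeR (hstat : Stationary P) (hell : UniformlyElliptic P κ) :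
    annealed P {X | timeR c X = ⊤} = letterLaw P κ (neverR c) := by
  rw [annealed_eq_map hstat hell, Measure.map_apply measurable_walkOf
    (measurableSet_timeR_eq_top c)]
  rfl

end Survival

/-! ### Conditional laws of the environment -/

section CondKernel

variable {d : ℕ} [NeZero d]

lemma measurable_restr (Γ : Set (Site d)) : Measurable (restr Γ) :=
  measurable_pi_lambda _ fun x => measurable_pi_apply _

/-- The conditional law of the environment given its restriction to `Γ`. -/
def envCond (P : Measure (Env d)) [IsFiniteMeasure P] (Γ : Set (Site d)) :
    Kernel (Env d) (Env d) :=
  (condDistrib id (restr Γ) P).comap (restr Γ) (measurable_restr Γ)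

variable {P : Measure (Env d)} [IsProbabilityMeasure P]

instance (Γ : Set (Site d)) : IsMarkovKernel (envCond P Γ) := by unfold envCond; infer_instance

lemma envCond_congr {Γ : Set (Site d)} {ω ω' : Env d} (h : restr Γ ω = restr Γ ω') :
    envCond P Γ ω = envCond P Γ ω' := by
  simp [envCond, Kernel.comap_apply, h]

lemma lintegral_envCond {Γ : Set (Site d)} {F : Config Γ × Env d → ℝ≥0∞} (hF : Measurable F) :
    ∫⁻ ω, ∫⁻ η, F (restr Γ ω, η) ∂envCond P Γ ω ∂P = ∫⁻ ω, F (restr Γ ω, ω) ∂P := by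
  have h := compProd_map_condDistrib (mβ := inferInstance) (μ := P) (X := restr Γ) (Y := id) aemeasurable_id
  have h1 := Measure.lintegral_compProd (μ := P.map (restr Γ))
    (κ := condDistrib id (restr Γ) P) hF
  rw [h, lintegral_map hF ((measurable_restr Γ).prodMk measurable_id),
    lintegral_map (Measurable.lintegral_kernel_prod_right' hF) (measurable_restr Γ)] at h1
  exact h1.symm

lemma ae_envCond_restr_eq (Γ : Set (Site d)) :
    ∀ᵐ ω ∂P, ∀ᵐ η ∂envCond P Γ ω, restr Γ η = restr Γ ω := by
  have hS : MeasurableSet {p : Config Γ × Env d | restr Γ p.2 = p.1}ᶜ :=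
    (measurableSet_eq_fun ((measurable_restr Γ).comp measurable_snd) measurable_fst).compl
  have h := lintegral_envCond (P := P) (Γ := Γ) (F := Set.indicator _ 1)
    (measurable_one.indicator hS)
  have h0 : ∫⁻ ω, Set.indicator {p : Config Γ × Env d | restr Γ p.2 = p.1}ᶜ
      (1 : Config Γ × Env d → ℝ≥0∞) (restr Γ ω, ω) ∂P = 0 := by simp
  rw [h0, lintegral_eq_zero_iff] at h
  · filter_upwards [h] with ω hω
    have hm : Measurable fun η : Env d => Set.indicator {p : Config Γ × Env d | restr Γ p.2 = p.1}ᶜ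
        (1 : Config Γ × Env d → ℝ≥0∞) (restr Γ ω, η) :=
      (measurable_one.indicator hS).comp (measurable_const.prodMk measurable_id)
    rw [Pi.zero_apply, lintegral_eq_zero_iff hm] at hω
    filter_upwards [hω] with η hη
    by_contra hne
    simp [Set.indicator, hne] at hη
  · have := (Measurable.lintegral_kernel_prod_right' (κ := condDistrib id (restr Γ) P)
      (measurable_one.indicator hS)).comp (measurable_restr Γ)
    exact this

lemma ae_envCond_of_ae (Γ : Set (Site d)) {p : Env d → Prop} (h : ∀ᵐ ω ∂P, p ω) :
    ∀ᵐ ω ∂P, ∀ᵐ η ∂envCond P Γ ω, p η := by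
  refine Measure.ae_ae_of_ae_comp (κ := envCond P Γ) ?_
  have : envCond P Γ ∘ₘ P = P := by
    ext S hS
    rw [Measure.bind_apply hS (Kernel.aemeasurable _)]
    have h := lintegral_envCond (P := P) (Γ := Γ) (F := fun p => S.indicator 1 p.2)
      ((measurable_one.indicator hS).comp measurable_snd)
    simpa [lintegral_indicator_one hS] using h
  rwa [this]

/-- Tower property: conditioning on the larger set `W` and averaging given `b` produces the right
joint law of the restrictions to `b` and `Δ`, so uniqueness of conditional distributions applies. -/
lemma ae_envCond_map_eq {b W : Set (Site d)} (hbW : b ⊆ W) (Δ : Set (Site d)) :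
    ∀ᵐ ω ∂P, ∀ S, MeasurableSet S → envCond P b ω (restr Δ ⁻¹' S) =
      ∫⁻ η, condDistrib (restr Δ) (restr W) P (restr W η) S ∂envCond P b ω := by
  set D := condDistrib (restr Δ) (restr W) P
  have h1 := condDistrib_comp (mβ := inferInstance) (μ := P) (restr b) (Y := id) aemeasurable_id (measurable_restr Δ)
  have h2 := condDistrib_ae_eq_of_measure_eq_compProd (μ := P) (restr b) (Y := restr Δ)
    (measurable_restr Δ).aemeasurable
    (κ := (D.comap (restr W) (measurable_restr W)) ∘ₖ condDistrib id (restr b) P) ?_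
  · have h3 := ae_of_ae_map (measurable_restr b).aemeasurable (h1.symm.trans h2)
    filter_upwards [h3] with ω hω S hS
    have := congrArg (fun μ => μ S) hω
    simp only [Kernel.map_apply' _ (measurable_restr Δ) _ hS, Kernel.comp_apply' _ _ _ hS] at this
    exact this
  · refine Measure.ext_prod fun {s t} hs ht => ?_
    rw [Measure.compProd_apply_prod hs ht, Measure.map_apply
      ((measurable_restr b).prodMk (measurable_restr Δ)) (hs.prod ht), setLIntegral_map hs
      (Kernel.measurable_coe _ ht) (measurable_restr b)]
    have hF : Measurable fun p : Config b × Env d =>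
        s.indicator 1 p.1 * D (restr W p.2) t :=
      ((measurable_one.indicator hs).comp measurable_fst).mul
        (((Kernel.measurable_coe D ht).comp (measurable_restr W)).comp measurable_snd)
    have h := lintegral_envCond (P := P) hF
    have e1 : ∫⁻ ω in restr b ⁻¹' s, ((D.comap (restr W) (measurable_restr W)) ∘ₖ
        condDistrib id (restr b) P) (restr b ω) t ∂P =
        ∫⁻ ω, ∫⁻ η, s.indicator 1 (restr b ω) * D (restr W η) t ∂envCond P b ω ∂P := by
      rw [← lintegral_indicator (measurable_restr b hs)]
      refine lintegral_congr fun ω => ?_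
      have hD : Measurable fun η => D (restr W η) t :=
        (Kernel.measurable_coe D ht).comp (measurable_restr W)
      rw [lintegral_const_mul _ hD]
      by_cases hω : restr b ω ∈ s
      · rw [Set.indicator_of_mem (by exact hω), Set.indicator_of_mem hω, Pi.one_apply, one_mul,
          Kernel.comp_apply' _ _ _ ht]
        rfl
      · rw [Set.indicator_of_notMem (by exact hω), Set.indicator_of_notMem hω, zero_mul]
    rw [e1, h]
    have hb : MeasurableSet[MeasurableSpace.comap (restr W) inferInstance] (restr b ⁻¹' s) := by
      refine ⟨(fun η : Config W => fun x : b => η ⟨x, hbW x.2⟩) ⁻¹' s, ?_, rfl⟩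
      exact (measurable_pi_lambda _ fun x => measurable_pi_apply _) hs
    have h4 := setLIntegral_condDistrib_of_measurableSet (μ := P) (measurable_restr W)
      (measurable_restr Δ).aemeasurable ht hb
    rw [Set.mk_preimage_prod, ← h4, ← lintegral_indicator (measurable_restr b hs)]
    refine lintegral_congr fun ω => ?_
    by_cases hω : restr b ω ∈ s
    · rw [Set.indicator_of_mem (by exact hω), Set.indicator_of_mem hω, Pi.one_apply, one_mul]
    · rw [Set.indicator_of_notMem (by exact hω), Set.indicator_of_notMem hω, zero_mul]

lemma lintegral_le_of_ae_le {α : Type*} [MeasurableSpace α] {μ ν : Measure α}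
    [IsProbabilityMeasure μ] [IsProbabilityMeasure ν] {f : α → ℝ≥0∞} {θ : ℝ≥0∞} (hf : Measurable f)
    (h : ∀ᵐ x ∂μ, ∀ᵐ y ∂ν, f x ≤ θ * f y) : ∫⁻ x, f x ∂μ ≤ θ * ∫⁻ y, f y ∂ν := by
  calc ∫⁻ x, f x ∂μ ≤ ∫⁻ _, (θ * ∫⁻ y, f y ∂ν) ∂μ := by
        refine lintegral_mono_ae ?_
        filter_upwards [h] with x hx
        calc f x = ∫⁻ _, f x ∂ν := by simp
          _ ≤ ∫⁻ y, θ * f y ∂ν := lintegral_mono_ae hx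
          _ = _ := lintegral_const_mul _ hf
    _ = _ := by simp

/-- By the tower property both laws are averages of conditional laws given `W`, over configurations
which almost surely lie in `G` and agree with `ω` on `b`. Any two of them may be compared, and
averaging keeps the constant. -/
lemma ae_envCond_compare {b b' W : Set (Site d)} (hb : b ⊆ b') (hbW : b' ⊆ W) (Δ : Set (Site d))
    {θ : ℝ≥0∞} {G : Set (Config W)} (hG : ∀ᵐ ω ∂P, restr W ω ∈ G)
    (h : ∀ η ∈ G, ∀ η' ∈ G, (∀ x : W, (x : Site d) ∈ b → η x = η' x) →
      condDistrib (restr Δ) (restr W) P η ≤ θ • condDistrib (restr Δ) (restr W) P η') :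
    ∀ᵐ ω ∂P, ∀ S, MeasurableSet S →
      envCond P b ω (restr Δ ⁻¹' S) ≤ θ * envCond P b' ω (restr Δ ⁻¹' S) ∧
      envCond P b' ω (restr Δ ⁻¹' S) ≤ θ * envCond P b ω (restr Δ ⁻¹' S) := by
  filter_upwards [ae_envCond_map_eq (P := P) (hb.trans hbW) Δ, ae_envCond_map_eq (P := P) hbW Δ,
    ae_envCond_restr_eq (P := P) b, ae_envCond_restr_eq (P := P) b', ae_envCond_of_ae b hG,
    ae_envCond_of_ae b' hG] with ω h1 h2 h3 h4 h5 h6 S hS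
  rw [h1 S hS, h2 S hS]
  have hm : Measurable fun η : Env d => condDistrib (restr Δ) (restr W) P (restr W η) S :=
    (Kernel.measurable_coe _ hS).comp (measurable_restr W)
  constructor
  · refine lintegral_le_of_ae_le hm ?_
    filter_upwards [h3, h5] with η e1 e2
    filter_upwards [h4, h6] with η' e3 e4
    refine h _ e2 _ e4 (fun x hx => ?_) S
    exact (congrFun e1 ⟨x, hx⟩).trans (congrFun e3 ⟨x, hb hx⟩).symm
  · refine lintegral_le_of_ae_le hm ?_
    filter_upwards [h4, h6] with η' e3 e4
    filter_upwards [h3, h5] with η e1 e2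
    refine h _ e4 _ e2 (fun x hx => ?_) S
    exact (congrFun e3 ⟨x, hb hx⟩).trans (congrFun e1 ⟨x, hx⟩).symm

end CondKernel

/-! ### Distances and sparse sets -/

section Geometry

lemma l1dist_comm {d : ℕ} (x y : Site d) : l1dist x y = l1dist y x := by
  simp [l1dist, abs_sub_comm]

/-- After translation to `y = 0` the sum is a product over coordinates of two-sided geometric
series. -/
lemma summable_exp_l1dist {d : ℕ} {a : ℝ} (ha : 0 < a) (y : Site d) :
    Summable fun x : Site d => Real.exp (-a * l1dist x y) := by
  have h0 : Summable fun x : Site d => Real.exp (-a * l1dist x 0) := by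
    have h1 : Summable fun z : ℤ => Real.exp (-a * |(z : ℝ)|) := by
      have hn : Summable fun n : ℕ => Real.exp (-a * n) := by
        simpa [mul_comm] using Real.summable_exp_nat_mul_iff.2 (show -a < 0 by linarith)
      refine Summable.of_nat_of_neg ?_ ?_
      · simpa using hn
      · simpa using hn
    induction d with
    | zero => exact Summable.of_finite
    | succ n ih =>
      have e : (fun p : ℤ × (Fin n → ℤ) => Real.exp (-a * |(p.1 : ℝ)|) *
          Real.exp (-a * l1dist p.2 0)) =
          (fun x : Site (n + 1) => Real.exp (-a * l1dist x 0)) ∘ (Fin.consEquiv fun _ => ℤ) := by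
        funext p
        rw [← Real.exp_add]
        simp [l1dist, Fin.sum_univ_succ, mul_add]
      rw [← Equiv.summable_iff (Fin.consEquiv fun _ => ℤ), ← e]
      exact h1.mul_of_nonneg (ih 0) (fun _ => (Real.exp_pos _).le) fun _ => (Real.exp_pos _).le
  rw [← Equiv.summable_iff (Equiv.addRight y)]
  convert h0 using 2 with x
  simp [l1dist]

lemma tsum_exp_l1dist {d : ℕ} (a : ℝ) (y : Site d) :
    ∑' x : Site d, Real.exp (-a * l1dist x y) = ∑' x : Site d, Real.exp (-a * l1dist x 0) := by
  rw [← Equiv.tsum_eq (Equiv.addRight y)]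
  simp [l1dist]

variable {d : ℕ} [NeZero d]

lemma abs_sub_le_l1dist (x y : Site d) : |(x 0 : ℝ) - y 0| ≤ l1dist x y :=
  Finset.single_le_sum (f := fun i => |((x i : ℝ) - (y i : ℝ))|) (fun _ _ => abs_nonneg _)
    (Finset.mem_univ 0)

/-- Finite sets above the level `ℓ`, with at most `c (j + 1)²` sites in the level `ℓ + j`. -/
def Sparse (c : ℝ) (ℓ : ℤ) (Δ : Finset (Site d)) : Prop :=
  (∀ x ∈ Δ, ℓ ≤ x 0) ∧
    ∀ j : ℕ, ((Δ.filter fun x => x 0 = ℓ + j).card : ℝ) ≤ c * ((j : ℝ) + 1) ^ 2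

/-- Sum level by level: at most `c(j+1)²` sites carry the weight `e^{-aj}`. The bound does not
depend on `Δ`, and this is the purpose of the visit counts in the definition of `R`. -/
lemma Sparse.sum_le {c : ℝ} {ℓ : ℤ} {Δ : Finset (Site d)} (h : Sparse c ℓ Δ) {a : ℝ}
    (ha : 0 < a) : ∑ y ∈ Δ, Real.exp (-a * (y 0 - ℓ)) ≤
      ∑' j : ℕ, c * ((j : ℝ) + 1) ^ 2 * Real.exp (-a * j) := by
  have hc : 0 ≤ c := by
    have := (Nat.cast_nonneg _).trans (h.2 0)
    simpa using this
  have hs : Summable fun j : ℕ => c * ((j : ℝ) + 1) ^ 2 * Real.exp (-a * j) := by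
    have h1 := Real.summable_pow_mul_exp_neg_nat_mul 2 ha
    have h2 := (summable_nat_add_iff 1).2 h1
    refine ((h2.mul_left (c * Real.exp a))).congr fun j => ?_
    have : Real.exp (-a * j) = Real.exp a * Real.exp (-a * ((j + 1 : ℕ) : ℝ)) := by
      rw [← Real.exp_add]; congr 1; push_cast; ring
    rw [this]; push_cast; ring
  have e : ∑ y ∈ Δ, Real.exp (-a * (y 0 - ℓ)) = ∑ j ∈ Δ.image fun y => (y 0 - ℓ).toNat,
      ∑ y ∈ Δ with (y 0 - ℓ).toNat = j, Real.exp (-a * (y 0 - ℓ)) :=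
    (Finset.sum_fiberwise_of_maps_to (fun y hy => Finset.mem_image_of_mem _ hy) _).symm
  rw [e]
  refine le_trans (Finset.sum_le_sum fun j _ => ?_)
    (hs.sum_le_tsum (Δ.image fun y => (y 0 - ℓ).toNat) fun j _ => by positivity)
  have e2 : Δ.filter (fun y => (y 0 - ℓ).toNat = j) = Δ.filter fun x => x 0 = ℓ + j := by
    refine Finset.filter_congr fun y hy => ?_
    have := h.1 y hy
    omega
  rw [e2]
  calc ∑ y ∈ Δ with y 0 = ℓ + j, Real.exp (-a * (y 0 - ℓ))
      = ∑ y ∈ Δ with y 0 = ℓ + j, Real.exp (-a * j) := by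
        refine Finset.sum_congr rfl fun y hy => ?_
        rw [(Finset.mem_filter.1 hy).2]; push_cast; ring_nf
    _ = (Δ.filter fun x => x 0 = ℓ + j).card * Real.exp (-a * j) := by simp
    _ ≤ _ := mul_le_mul_of_nonneg_right (h.2 j) (Real.exp_pos _).le

/-- The sites whose distance to `y ∈ Δ` is less than `k` plus the height of `y` above `ℓ`. -/
def vicinity (ℓ : ℤ) (k : ℕ) (Δ : Finset (Site d)) : Finset (Site d) :=
  open scoped Classical in
  Δ.biUnion fun y => (Finset.Icc (fun i => y i - (k + |y 0 - ℓ|)) fun i => y i + (k + |y 0 - ℓ|)).filter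
    fun x => l1dist x y < k + (y 0 - ℓ)

lemma mem_vicinity {ℓ : ℤ} {k : ℕ} {Δ : Finset (Site d)} {x : Site d} :
    x ∈ vicinity ℓ k Δ ↔ ∃ y ∈ Δ, l1dist x y < k + (y 0 - ℓ) := by
  simp only [vicinity, Finset.mem_biUnion, Finset.mem_filter, Finset.mem_Icc]
  refine exists_congr fun y => and_congr_right fun _ => ⟨fun h => h.2, fun h => ⟨?_, h⟩⟩
  have key : ∀ i, |x i - y i| ≤ k + |y 0 - ℓ| := by
    intro i
    have h1 : |(x i : ℝ) - y i| ≤ l1dist x y :=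
      Finset.single_le_sum (f := fun i => |((x i : ℝ) - (y i : ℝ))|) (fun _ _ => abs_nonneg _)
        (Finset.mem_univ i)
    have h2 : ((|x i - y i| : ℤ) : ℝ) < ((k + (y 0 - ℓ) : ℤ) : ℝ) := by
      push_cast; linarith
    have h3 : |x i - y i| < k + (y 0 - ℓ) := by exact_mod_cast h2
    have := le_abs_self (y 0 - ℓ)
    omega
  constructor <;> intro i <;> have := abs_le.1 (key i) <;> simp only <;> omega

end Geometry

/-! ### The mixing condition on sparse sets -/

section Mixing

variable {d : ℕ} [NeZero d] {P : Measure (Env d)} [IsProbabilityMeasure P]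

lemma l1dist_self {d : ℕ} (x : Site d) : l1dist x x = 0 := by simp [l1dist]

/-- The conditional laws given the environments on two sets, of which the larger one has only far
sites in addition, are close on sparse sets. -/
lemma MixingCondition.ae_compare {r : ℝ} (hmix : MixingCondition P r) (c : ℝ) :
    ∃ K a : ℝ, 0 ≤ K ∧ 0 < a ∧ ∀ (b Γ : Finset (Site d)) (ℓ : ℤ) (g k : ℕ), b ⊆ Γ → 1 ≤ g →
      1 ≤ k → r ≤ g → r ≤ k → (∀ x ∈ Γ, x 0 + g ≤ ℓ) → (∀ x ∈ Γ, x ∉ b → x 0 + k ≤ ℓ) →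
      ∀ᵐ ω ∂P, ∀ Δ : Finset (Site d), Sparse c ℓ Δ → ∀ S, MeasurableSet S →
        envCond P b ω (restr (Δ : Set (Site d)) ⁻¹' S) ≤
          ENNReal.ofReal (Real.exp (K * Real.exp (-a * k))) *
            envCond P Γ ω (restr (Δ : Set (Site d)) ⁻¹' S) ∧
        envCond P Γ ω (restr (Δ : Set (Site d)) ⁻¹' S) ≤
          ENNReal.ofReal (Real.exp (K * Real.exp (-a * k))) *
            envCond P b ω (restr (Δ : Set (Site d)) ⁻¹' S) := by
  classical
  obtain ⟨γ, C, hγ, h⟩ := hmix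
  set S₁ := ∑' x : Site d, Real.exp (-(γ / 2) * l1dist x 0) with hS₁
  set S₂ := ∑' j : ℕ, |c| * ((j : ℝ) + 1) ^ 2 * Real.exp (-(γ / 2) * j) with hS₂
  have hS₁0 : 0 ≤ S₁ := tsum_nonneg fun _ => (Real.exp_pos _).le
  have hS₂0 : 0 ≤ S₂ := tsum_nonneg fun _ => by positivity
  -- Half of the rate `γ` makes the sum over the boundary sites converge; the other half pays for
  -- the depth `k` and for the height of `y` above `ℓ`.
  refine ⟨|C| * (S₁ * S₂), γ / 2, by positivity, by positivity, ?_⟩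
  intro b Γ ℓ g k hb hg1 hk1 hrg hrk hΓg hΓk
  rw [ae_all_iff]
  intro Δ
  by_cases hΔ : Sparse c ℓ Δ
  swap
  · exact Eventually.of_forall fun ω h => absurd h hΔ
  have hΔ' : Sparse |c| ℓ Δ := ⟨hΔ.1, fun j => (hΔ.2 j).trans (by gcongr; exact le_abs_self c)⟩
  -- `V` takes in every site near `Δ` except those of `Γ`, so the sites outside `V` and `Γ` are at
  -- distance at least `k` plus the height.
  set V : Finset (Site d) := vicinity ℓ k Δ \ Γ with hV
  have hdisj : ∀ y ∈ Δ, y ∉ Γ := fun y hy hyΓ => by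
    have := hΓg y hyΓ; have := hΔ.1 y hy; omega
  have hΔV : Δ ⊆ V := by
    intro y hy
    rw [hV, Finset.mem_sdiff, mem_vicinity]
    refine ⟨⟨y, hy, ?_⟩, hdisj y hy⟩
    rw [l1dist_self]
    have h1 : (ℓ : ℝ) ≤ y 0 := by exact_mod_cast hΔ.1 y hy
    have h2 : (1 : ℝ) ≤ k := by exact_mod_cast hk1
    linarith
  have hfar : ∀ x, x ∉ V → x ∉ Γ → ∀ y ∈ Δ, (k : ℝ) + (y 0 - ℓ) ≤ l1dist x y := by
    intro x hx hxΓ y hy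
    by_contra! hlt
    exact hx (Finset.mem_sdiff.2 ⟨mem_vicinity.2 ⟨y, hy, hlt⟩, hxΓ⟩)
  have hlevel : ∀ x y : Site d, ∀ t : ℕ, x 0 + t ≤ ℓ → (t : ℝ) + (y 0 - ℓ) ≤ l1dist x y := by
    intro x y t ht
    refine le_trans ?_ (abs_sub_le_l1dist x y)
    refine le_trans ?_ (neg_le_abs _)
    have h1 : (x 0 : ℝ) + t ≤ ℓ := by exact_mod_cast ht
    linarith
  have hpos : ∀ y ∈ Δ, (0 : ℝ) ≤ y 0 - ℓ := by
    intro y hy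
    have h1 : (ℓ : ℝ) ≤ y 0 := by exact_mod_cast hΔ.1 y hy
    linarith
  have hdist : ∀ x ∈ Δ, ∀ y, y ∉ V → r ≤ l1dist x y := by
    intro y hy x hx
    rw [l1dist_comm]
    have h0 := hpos y hy
    by_cases hxΓ : x ∈ Γ
    · linarith [hlevel x y g (hΓg x hxΓ)]
    · linarith [hfar x hx hxΓ y hy]
  -- Boundary conditions may differ anywhere off `b`: in `Γ` such sites are deep by hypothesis,
  -- elsewhere they are far by the choice of `V`.
  set A : Set (Site d) := (V : Set (Site d))ᶜ \ b with hA
  have hAdist : ∀ x ∈ A, ∀ y ∈ Δ, (k : ℝ) + (y 0 - ℓ) ≤ l1dist x y := by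
    intro x hx y hy
    by_cases hxΓ : x ∈ Γ
    · exact hlevel x y k (hΓk x hxΓ hx.2)
    · exact hfar x hx.1 hxΓ y hy
  obtain ⟨G, hG, hGc⟩ := h Δ V hΔV hdist A Set.sdiff_subset
  have hsum : C * ∑ y ∈ Δ, ∑' x : A, Real.exp (-γ * l1dist (x : Site d) y) ≤
      |C| * (S₁ * S₂) * Real.exp (-(γ / 2) * k) := by
    have h1 : ∀ y ∈ Δ, ∑' x : A, Real.exp (-γ * l1dist (x : Site d) y) ≤
        Real.exp (-(γ / 2) * k) * Real.exp (-(γ / 2) * (y 0 - ℓ)) * S₁ := by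
      intro y hy
      have hsm := summable_exp_l1dist (d := d) (half_pos hγ) y
      have hsm' := (hsm.subtype A).mul_left
        (Real.exp (-(γ / 2) * k) * Real.exp (-(γ / 2) * (y 0 - ℓ)))
      have hle : ∀ x : A, Real.exp (-γ * l1dist (x : Site d) y) ≤
          Real.exp (-(γ / 2) * k) * Real.exp (-(γ / 2) * (y 0 - ℓ)) *
            Real.exp (-(γ / 2) * l1dist (x : Site d) y) := by
        intro x
        rw [← Real.exp_add, ← Real.exp_add, Real.exp_le_exp]
        have := hAdist x x.2 y hy
        nlinarith
      calc _ ≤ ∑' x : A, Real.exp (-(γ / 2) * k) * Real.exp (-(γ / 2) * (y 0 - ℓ)) *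
            Real.exp (-(γ / 2) * l1dist (x : Site d) y) :=
            Summable.tsum_le_tsum hle
              (hsm'.of_nonneg_of_le (fun _ => (Real.exp_pos _).le) hle) hsm'
        _ = Real.exp (-(γ / 2) * k) * Real.exp (-(γ / 2) * (y 0 - ℓ)) *
            ∑' x : A, Real.exp (-(γ / 2) * l1dist (x : Site d) y) := tsum_mul_left
        _ ≤ _ := by
            refine mul_le_mul_of_nonneg_left ?_ (by positivity)
            rw [hS₁, ← tsum_exp_l1dist (γ / 2) y]
            exact hsm.tsum_subtype_le _ A (fun _ => (Real.exp_pos _).le)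
    have h2 : ∑ y ∈ Δ, ∑' x : A, Real.exp (-γ * l1dist (x : Site d) y) ≤
        Real.exp (-(γ / 2) * k) * S₁ * S₂ := by
      calc _ ≤ ∑ y ∈ Δ, Real.exp (-(γ / 2) * k) * Real.exp (-(γ / 2) * (y 0 - ℓ)) * S₁ :=
            Finset.sum_le_sum h1
        _ = Real.exp (-(γ / 2) * k) * S₁ * ∑ y ∈ Δ, Real.exp (-(γ / 2) * (y 0 - ℓ)) := by
            rw [Finset.mul_sum]; exact Finset.sum_congr rfl fun y _ => by ring
        _ ≤ _ := mul_le_mul_of_nonneg_left (hΔ'.sum_le (half_pos hγ)) (by positivity)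
    have h3 : 0 ≤ ∑ y ∈ Δ, ∑' x : A, Real.exp (-γ * l1dist (x : Site d) y) :=
      Finset.sum_nonneg fun y _ => tsum_nonneg fun x => (Real.exp_pos _).le
    calc _ ≤ |C| * ∑ y ∈ Δ, ∑' x : A, Real.exp (-γ * l1dist (x : Site d) y) :=
          mul_le_mul_of_nonneg_right (le_abs_self C) h3
      _ ≤ |C| * (Real.exp (-(γ / 2) * k) * S₁ * S₂) :=
          mul_le_mul_of_nonneg_left h2 (abs_nonneg C)
      _ = _ := by ring
  have hΓV : (Γ : Set (Site d)) ⊆ (V : Set (Site d))ᶜ := by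
    intro x hx hxV
    exact (Finset.mem_sdiff.1 (Finset.mem_coe.1 hxV)).2 hx
  have := ae_envCond_compare (P := P) (b := (b : Set (Site d))) (b' := (Γ : Set (Site d)))
    (W := (V : Set (Site d))ᶜ) (Finset.coe_subset.2 hb) hΓV (Δ : Set (Site d))
    (θ := ENNReal.ofReal (Real.exp (|C| * (S₁ * S₂) * Real.exp (-(γ / 2) * k)))) hG ?_
  · filter_upwards [this] with ω hω _
    exact hω
  · intro η hη η' hη' hagree
    refine (hGc η hη η' hη' fun x hx => hagree x ?_).trans ?_
    · by_contra hxb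
      exact hx ⟨x.2, hxb⟩
    · intro S
      simp only [Measure.smul_apply, smul_eq_mul]
      gcongr

end Mixing

/-! ### Splicing two independent environments -/

section Splice

variable {d : ℕ} [NeZero d]

open scoped Classical in
/-- The environment which is `ω` on `Γ` and `η` off `Γ`. -/
def splice (Γ : Set (Site d)) (ω η : Env d) : Env d := fun x => if x ∈ Γ then ω x else η x

lemma splice_of_mem {Γ : Set (Site d)} {x : Site d} (h : x ∈ Γ) (ω η : Env d) :
    splice Γ ω η x = ω x := if_pos h

lemma splice_of_notMem {Γ : Set (Site d)} {x : Site d} (h : x ∉ Γ) (ω η : Env d) :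
    splice Γ ω η x = η x := if_neg h

lemma splice_self (Γ : Set (Site d)) (ω : Env d) : splice Γ ω ω = ω := by
  funext x; simp [splice]

lemma measurable_splice (Γ : Set (Site d)) :
    Measurable fun p : Env d × Env d => splice Γ p.1 p.2 := by
  classical
  refine measurable_pi_lambda _ fun x => ?_
  by_cases h : x ∈ Γ
  · simpa only [splice_of_mem h] using! (measurable_pi_apply x).comp measurable_fst
  · simpa only [splice_of_notMem h] using! (measurable_pi_apply x).comp measurable_snd

lemma apply_splice {Γ Γ' : Set (Site d)} {β : Type*} {f : Env d → β} (hf : DependsOn f Γ')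
    (h : Γ' ⊆ Γ) (ω η : Env d) : f (splice Γ ω η) = f ω :=
  hf fun x hx => splice_of_mem (h hx) ω η

lemma apply_splice' {Γ Γ' : Set (Site d)} {β : Type*} {f : Env d → β} (hf : DependsOn f Γ')
    (h : Disjoint Γ' Γ) (ω η : Env d) : f (splice Γ ω η) = f η :=
  hf fun x hx => splice_of_notMem (Set.disjoint_left.1 h hx) ω η

variable {P : Measure (Env d)} [IsProbabilityMeasure P]

/-- Disintegration along the environment on `Γ`. -/
lemma lintegral_envCond_of_dependsOn {Γ : Set (Site d)} {Φ : Env d × Env d → ℝ≥0∞}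
    (hΦ : Measurable Φ) (hdep : ∀ η, DependsOn (fun ω => Φ (ω, η)) Γ) :
    ∫⁻ ω, ∫⁻ η, Φ (ω, η) ∂envCond P Γ ω ∂P = ∫⁻ ω, Φ (ω, ω) ∂P := by
  classical
  set ext : Config Γ → Env d := fun c x => if h : x ∈ Γ then c ⟨x, h⟩ else Classical.arbitrary _
  have hext : Measurable ext := by
    refine measurable_pi_lambda _ fun x => ?_
    by_cases h : x ∈ Γ
    · simpa only [ext, dif_pos h] using! measurable_pi_apply _
    · simpa only [ext, dif_neg h] using! measurable_const
  have e : ∀ ω η, Φ (ext (restr Γ ω), η) = Φ (ω, η) := fun ω η =>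
    hdep η fun x hx => by simp [ext, hx, restr]
  have h := lintegral_envCond (P := P) (Γ := Γ) (F := fun p => Φ (ext p.1, p.2))
    (hΦ.comp ((hext.comp measurable_fst).prodMk measurable_snd))
  simpa only [e] using h

/-- The integral of `F` for two independent environments, spliced along `Γ`, with weights. -/
def spliceInt (P : Measure (Env d)) (Γ : Set (Site d)) (H H' F : Env d → ℝ≥0∞) : ℝ≥0∞ :=
  ∫⁻ ω, H ω * ∫⁻ ω', F (splice Γ ω ω') * H' ω' ∂P ∂P

/-- Turns `spliceInt` into integration against a measure, so that Radon–Nikodym derivatives are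
available. The outer splice freezes the sites outside `Γ'`, which functions of `Γ'` do not see. -/
lemma spliceInt_eq_lintegral {Γ Γ' : Set (Site d)} {H H' F : Env d → ℝ≥0∞} (hH : Measurable H)
    (hH' : Measurable H') (hF : Measurable F) (hdep : DependsOn F Γ') :
    spliceInt P Γ H H' F = ∫⁻ ω, F ω ∂(((P.withDensity H).prod (P.withDensity H')).map
      fun p => splice Γ' (splice Γ p.1 p.2) fun _ => Classical.arbitrary _) := by
  have hs := measurable_splice (d := d)
  have hm : Measurable fun p : Env d × Env d =>
      splice Γ' (splice Γ p.1 p.2) fun _ => Classical.arbitrary (SiteLaw d) :=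
    (hs Γ').comp ((hs Γ).prodMk measurable_const)
  rw [lintegral_map hF hm]
  simp only [apply_splice hdep subset_rfl]
  have hFm : Measurable fun p : Env d × Env d => F (splice Γ p.1 p.2) := hF.comp (hs Γ)
  rw [lintegral_prod _ hFm.aemeasurable]
  rw [lintegral_withDensity_eq_lintegral_mul _ hH]
  · refine lintegral_congr fun ω => ?_
    have : Measurable fun ω' => F (splice Γ ω ω') :=
      (hF.comp (hs Γ)).comp (measurable_const.prodMk measurable_id)
    rw [Pi.mul_apply, lintegral_withDensity_eq_lintegral_mul _ hH' this]
    simp only [Pi.mul_apply, mul_comm]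
  · exact (hF.comp (hs Γ)).lintegral_prod_right'

/-- One step of the comparison of spliced environments with the original one. -/
lemma spliceInt_step {Γ₀ Γ₁ Γ D : Set (Site d)} (hΓ : Γ = Γ₀ ∪ Γ₁) (hdisj : Disjoint Γ₁ Γ₀)
    {H₀ H H' : Env d → ℝ≥0∞} (hH₀ : Measurable H₀) (hH : Measurable H) (hH' : Measurable H')
    (hH1 : ∀ ω, H ω ≤ 1)
    {θ Z : ℝ≥0∞} {ρ : Env d → ℝ≥0∞} (hρ : Measurable ρ) (hρd : DependsOn ρ Γ)
    (hI : ∀ F : Env d → ℝ≥0∞, Measurable F → DependsOn F Γ →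
      spliceInt P Γ₀ H₀ H F = Z * ∫⁻ ω, F ω * ρ ω * H ω ∂P)
    (hpos : ∀ᵐ ω ∂P, ∫⁻ η, H η ∂envCond P Γ₁ ω ≠ 0)
    (hpos' : ∀ᵐ ω ∂P, ∫⁻ η, H η ∂envCond P Γ ω ≠ 0)
    (hcmp : ∀ᵐ ω ∂P, ∫⁻ η, H η ∂envCond P Γ ω ≤ θ * ∫⁻ η, H η ∂envCond P Γ₁ ω)
    (hcmp' : ∀ᵐ ω ∂P, ∀ g : Env d → ℝ≥0∞, Measurable g → DependsOn g D → (∀ η, g η ≤ 1) →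
      ∫⁻ η, g η * H' η ∂envCond P Γ₁ ω ≤ θ * ∫⁻ η, g η * H' η ∂envCond P Γ ω)
    {F : Env d → ℝ≥0∞} (hF : Measurable F) (hFd : DependsOn F (Γ ∪ D)) (hF1 : ∀ ω, F ω ≤ 1) :
    spliceInt P Γ₀ H₀ H' F ≤ Z * ∫⁻ ω, F ω * (θ ^ 2 * ρ ω) * H' ω ∂P := by
  have hs := measurable_splice (d := d)
  set b : Env d → ℝ≥0∞ := fun ω => ∫⁻ η, H η ∂envCond P Γ₁ ω with hb
  set b' : Env d → ℝ≥0∞ := fun ω => ∫⁻ η, H η ∂envCond P Γ ω with hb'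
  set a : Env d → ℝ≥0∞ := fun ω => ∫⁻ η, F (splice Γ ω η) * H' η ∂envCond P Γ₁ ω with ha
  set a' : Env d → ℝ≥0∞ := fun ω => ∫⁻ η, F (splice Γ ω η) * H' η ∂envCond P Γ ω with ha'
  have hFs : Measurable fun p : Env d × Env d => F (splice Γ p.1 p.2) * H' p.2 :=
    (hF.comp (hs Γ)).mul (hH'.comp measurable_snd)
  have hbm : Measurable b := (hH.comp measurable_snd).lintegral_kernel_prod_right'
  have hb'm : Measurable b' := (hH.comp measurable_snd).lintegral_kernel_prod_right'
  have ham : Measurable a := hFs.lintegral_kernel_prod_right'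
  have ha'm : Measurable a' := hFs.lintegral_kernel_prod_right'
  have hbd : DependsOn b Γ₁ := fun ω ω' h => by
    simp only [hb]; rw [envCond_congr (P := P) (funext fun x => h x x.2)]
  have had : DependsOn a Γ := fun ω ω' h => by
    simp only [ha]
    rw [envCond_congr (P := P) (Γ := Γ₁) (ω' := ω')
      (funext fun x => h x (hΓ ▸ Or.inr x.2))]
    have : ∀ η, splice Γ ω η = splice Γ ω' η := fun η => by
      funext x
      by_cases hx : x ∈ Γ
      · rw [splice_of_mem hx, splice_of_mem hx, h x hx]
      · rw [splice_of_notMem hx, splice_of_notMem hx]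
    simp only [this]
  have hΓ₁ : Γ₁ ⊆ Γ := hΓ ▸ Set.subset_union_right
  have hΓ₀ : Γ₀ ⊆ Γ := hΓ ▸ Set.subset_union_left
  have hbd' : DependsOn b Γ := fun ω ω' h => hbd fun x hx => h x (hΓ₁ hx)
  -- The mean of `F H'` given `Γ₁`, with the sites of `Γ` held fixed in `F`, relative to the mean of
  -- `H`. It depends on `Γ` only, so the hypothesis `hI` on the smaller set applies to it.
  set q : Env d → ℝ≥0∞ := fun ω => a ω / b ω with hq
  have hqm : Measurable q := ham.div hbm
  have hqd : DependsOn q Γ := fun ω ω' h => by simp only [hq, had h, hbd' h]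
  have hle1 : ∀ (Λ : Set (Site d)) (ω : Env d), ∫⁻ η, H η ∂envCond P Λ ω ≠ ∞ := fun Λ ω =>
    ne_top_of_le_ne_top ENNReal.one_ne_top ((lintegral_mono fun η => hH1 η).trans (by simp))
  -- the inner integrals
  have hinner : ∀ ω, ∫⁻ ω', F (splice Γ₀ ω ω') * H' ω' ∂P =
      ∫⁻ ω', q (splice Γ₀ ω ω') * H ω' ∂P := by
    intro ω
    have hsω : Measurable fun ω' => splice Γ₀ ω ω' :=
      (hs Γ₀).comp (measurable_const.prodMk measurable_id)
    have h1 := lintegral_envCond_of_dependsOn (P := P) (Γ := Γ₁)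
      (Φ := fun p => F (splice Γ₀ ω (splice Γ₁ p.1 p.2)) * H' p.2)
      ((hF.comp (hsω.comp (hs Γ₁))).mul (hH'.comp measurable_snd)) ?_
    · simp only [splice_self] at h1
      rw [← h1]
      have e1 : ∀ ω' η, splice Γ₀ ω (splice Γ₁ ω' η) = splice Γ (splice Γ₀ ω ω') η := by
        intro ω' η
        funext x
        by_cases hx0 : x ∈ Γ₀
        · rw [splice_of_mem hx0, splice_of_mem (hΓ₀ hx0), splice_of_mem hx0]
        · rw [splice_of_notMem hx0]
          by_cases hx1 : x ∈ Γ₁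
          · rw [splice_of_mem hx1, splice_of_mem (hΓ₁ hx1), splice_of_notMem hx0]
          · rw [splice_of_notMem hx1, splice_of_notMem (fun h => by
              rw [hΓ] at h; exact h.elim hx0 hx1)]
      have e2 : ∀ ω', envCond P Γ₁ ω' = envCond P Γ₁ (splice Γ₀ ω ω') := fun ω' =>
        envCond_congr (funext fun x => (splice_of_notMem (Set.disjoint_left.1 hdisj x.2) _ _).symm)
      have h2 : ∀ ω', ∫⁻ η, F (splice Γ₀ ω (splice Γ₁ ω' η)) * H' η ∂envCond P Γ₁ ω' =
          a (splice Γ₀ ω ω') := fun ω' => by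
        simp only [e1, ha]; rw [e2 ω']
      simp only [h2]
      have h3 := lintegral_envCond_of_dependsOn (P := P) (Γ := Γ₁)
        (Φ := fun p => q (splice Γ₀ ω p.1) * H p.2)
        (((hqm.comp hsω).comp measurable_fst).mul (hH.comp measurable_snd)) ?_
      · rw [← h3]
        refine lintegral_congr_ae ?_
        filter_upwards [hpos] with ω' hω'
        rw [lintegral_const_mul _ hH]
        have : b (splice Γ₀ ω ω') = b ω' := apply_splice' hbd hdisj ω ω'
        simp only [hq]
        rw [this, ENNReal.div_mul_cancel hω' (hle1 _ _)]
      · intro η ω' ω'' h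
        have : q (splice Γ₀ ω ω') = q (splice Γ₀ ω ω'') := by
          refine hqd fun x hx => ?_
          by_cases hx0 : x ∈ Γ₀
          · rw [splice_of_mem hx0, splice_of_mem hx0]
          · rw [splice_of_notMem hx0, splice_of_notMem hx0]
            rw [hΓ] at hx
            exact h x (hx.resolve_left hx0)
        simp only [this]
    · intro η ω' ω'' h
      have : splice Γ₁ ω' η = splice Γ₁ ω'' η := by
        funext x
        by_cases hx : x ∈ Γ₁
        · rw [splice_of_mem hx, splice_of_mem hx, h x hx]
        · rw [splice_of_notMem hx, splice_of_notMem hx]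
      simp only [this]
  -- No loss so far: off `Γ₀` the splice sees only the second environment, so conditioning that one
  -- on `Γ₁` is enough.
  have hstep : spliceInt P Γ₀ H₀ H' F = spliceInt P Γ₀ H₀ H q := by
    simp only [spliceInt, hinner]
  rw [hstep, hI q hqm hqd]
  gcongr Z * ?_
  have h4 := lintegral_envCond_of_dependsOn (P := P) (Γ := Γ)
    (Φ := fun p => q p.1 * ρ p.1 * H p.2)
    (((hqm.comp measurable_fst).mul (hρ.comp measurable_fst)).mul (hH.comp measurable_snd))
    (fun η ω ω' h => by simp only [hqd h, hρd h])
  have h5 := lintegral_envCond_of_dependsOn (P := P) (Γ := Γ)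
    (Φ := fun p => θ ^ 2 * ρ p.1 * (F (splice Γ p.1 p.2) * H' p.2))
    (((hρ.comp measurable_fst).const_mul _).mul hFs)
    (fun η ω ω' h => by
      have : splice Γ ω η = splice Γ ω' η := by
        funext x
        by_cases hx : x ∈ Γ
        · rw [splice_of_mem hx, splice_of_mem hx, h x hx]
        · rw [splice_of_notMem hx, splice_of_notMem hx]
      simp only [this, hρd h])
  simp only [splice_self] at h5
  rw [← h4, show ∫⁻ ω, F ω * (θ ^ 2 * ρ ω) * H' ω ∂P = ∫⁻ ω, θ ^ 2 * ρ ω * (F ω * H' ω) ∂P from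
    lintegral_congr fun ω => by ring, ← h5]
  refine lintegral_mono_ae ?_
  filter_upwards [hpos, hpos', hcmp, hcmp'] with ω p1 p2 p3 p4
  have hFω : Measurable fun η => F (splice Γ ω η) * H' η :=
    hFs.comp (measurable_const.prodMk measurable_id)
  rw [lintegral_const_mul _ hH, lintegral_const_mul _ hFω]
  have p5 : a ω ≤ θ * a' ω := by
    refine p4 (fun η => F (splice Γ ω η)) ((hF.comp (hs Γ)).comp
      (measurable_const.prodMk measurable_id)) (fun η η' h => hFd fun x hx => ?_) fun η => hF1 _
    by_cases hxΓ : x ∈ Γ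
    · rw [splice_of_mem hxΓ, splice_of_mem hxΓ]
    · rw [splice_of_notMem hxΓ, splice_of_notMem hxΓ]
      exact h x (hx.resolve_left hxΓ)
  change a ω / b ω * ρ ω * b' ω ≤ θ ^ 2 * ρ ω * a' ω
  -- Passing from `Γ₁` to `Γ` costs `θ` for the mean of `F H'` and, in the opposite direction, `θ`
  -- for the mean of `H`; hence `θ²`.
  calc a ω / b ω * ρ ω * b' ω ≤ (θ * a' ω) / b ω * ρ ω * (θ * b ω) := by gcongr
    _ = θ ^ 2 * ρ ω * a' ω * (b ω / b ω) := by
        simp only [div_eq_mul_inv]; ring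
    _ = _ := by simp only [hb, ENNReal.div_self p1 (hle1 _ _), mul_one]

end Splice

/-! ### Densities of spliced environments -/

section Density

variable {d : ℕ} [NeZero d] {P : Measure (Env d)} [IsProbabilityMeasure P]

/-- The density of spliced environments, extended by one more set of sites. -/
lemma spliceInt_density_step {Γ₀ Γ₁ Γ D : Set (Site d)} (hΓ : Γ = Γ₀ ∪ Γ₁) (hdisj : Disjoint Γ₁ Γ₀)
    {H₀ H H' : Env d → ℝ≥0∞} (hH₀ : Measurable H₀) (hH : Measurable H) (hH' : Measurable H')
    (hH₀1 : ∀ ω, H₀ ω ≤ 1) (hH1 : ∀ ω, H ω ≤ 1) (hH'1 : ∀ ω, H' ω ≤ 1)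
    {θ Z : ℝ≥0∞} (hZ : Z ≠ 0) (hZ' : Z ≠ ∞)
    {ρ : Env d → ℝ≥0∞} (hρ : Measurable ρ) (hρd : DependsOn ρ Γ)
    (hI : ∀ F : Env d → ℝ≥0∞, Measurable F → DependsOn F Γ →
      spliceInt P Γ₀ H₀ H F = Z * ∫⁻ ω, F ω * ρ ω * H ω ∂P)
    (hpos : ∀ᵐ ω ∂P, ∫⁻ η, H η ∂envCond P Γ₁ ω ≠ 0)
    (hpos' : ∀ᵐ ω ∂P, ∫⁻ η, H η ∂envCond P Γ ω ≠ 0)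
    (hcmp : ∀ᵐ ω ∂P, ∫⁻ η, H η ∂envCond P Γ ω ≤ θ * ∫⁻ η, H η ∂envCond P Γ₁ ω)
    (hcmp' : ∀ᵐ ω ∂P, ∀ g : Env d → ℝ≥0∞, Measurable g → DependsOn g D → (∀ η, g η ≤ 1) →
      ∫⁻ η, g η * H' η ∂envCond P Γ₁ ω ≤ θ * ∫⁻ η, g η * H' η ∂envCond P Γ ω) :
    ∃ ρ' : Env d → ℝ≥0∞, Measurable ρ' ∧ DependsOn ρ' (Γ ∪ D) ∧ (∀ ω, ρ' ω ≤ θ ^ 2 * ρ ω) ∧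
      ∀ F : Env d → ℝ≥0∞, Measurable F → DependsOn F (Γ ∪ D) →
        spliceInt P Γ₀ H₀ H' F = Z * ∫⁻ ω, F ω * ρ' ω * H' ω ∂P := by
  have hs := measurable_splice (d := d)
  -- Freezing the sites outside `Γ ∪ D` yields a density that depends on `Γ ∪ D` only.
  set mask : Env d → Env d := fun ω => splice (Γ ∪ D) ω fun _ => Classical.arbitrary _ with hmask
  have hmm : Measurable mask := (hs _).comp (measurable_id.prodMk measurable_const)
  have hmaskE : ∀ {F : Env d → ℝ≥0∞}, DependsOn F (Γ ∪ D) → ∀ ω, F (mask ω) = F ω :=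
    fun hF ω => apply_splice hF subset_rfl _ _
  have hfin : ∀ {G : Env d → ℝ≥0∞}, (∀ ω, G ω ≤ 1) → IsFiniteMeasure (P.withDensity G) := by
    intro G hG
    refine isFiniteMeasure_withDensity (ne_top_of_le_ne_top ENNReal.one_ne_top
      ((lintegral_mono hG).trans ?_))
    simp
  have hf0 := hfin hH₀1
  have hf' := hfin hH'1
  have hρd' : DependsOn ρ (Γ ∪ D) := fun ω ω' h => hρd fun x hx => h x (Or.inl hx)
  set N : Measure (Env d) := ((P.withDensity H₀).prod (P.withDensity H')).map
      fun p => splice (Γ ∪ D) (splice Γ₀ p.1 p.2) fun _ => Classical.arbitrary _ with hN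
  have hNm : Measurable fun p : Env d × Env d =>
      splice (Γ ∪ D) (splice Γ₀ p.1 p.2) fun _ => Classical.arbitrary (SiteLaw d) :=
    hmm.comp (hs Γ₀)
  have hNfin : IsFiniteMeasure N := by rw [hN]; infer_instance
  set M : Measure (Env d) := (P.withDensity H').map mask with hM
  have hNint : ∀ F : Env d → ℝ≥0∞, Measurable F → DependsOn F (Γ ∪ D) →
      spliceInt P Γ₀ H₀ H' F = ∫⁻ ω, F ω ∂N := fun F hF hFd =>
    spliceInt_eq_lintegral hH₀ hH' hF hFd
  have hMint : ∀ F : Env d → ℝ≥0∞, Measurable F →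
      ∫⁻ ω, F ω ∂M = ∫⁻ ω, F (mask ω) * H' ω ∂P := fun F hF => by
    have hFm : Measurable fun ω => F (mask ω) := hF.comp hmm
    rw [hM, lintegral_map hF hmm, lintegral_withDensity_eq_lintegral_mul _ hH' hFm]
    simp only [Pi.mul_apply, mul_comm]
  have hmaskmask : ∀ ω, mask (mask ω) = mask ω := by
    intro ω; funext x
    by_cases hx : x ∈ Γ ∪ D
    · simp only [hmask, splice_of_mem hx]
    · simp only [hmask, splice_of_notMem hx]
  have hmaskd : DependsOn mask (Γ ∪ D) := by
    intro ω ω' h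
    funext x
    by_cases hx : x ∈ Γ ∪ D
    · simp only [hmask, splice_of_mem hx, h x hx]
    · simp only [hmask, splice_of_notMem hx]
  -- comparison of the measures
  have hle : ∀ S, MeasurableSet S → N S ≤ ∫⁻ ω in S, Z * (θ ^ 2 * ρ ω) ∂M := by
    intro S hS
    have hFm : Measurable fun ω => S.indicator (1 : Env d → ℝ≥0∞) (mask ω) :=
      (measurable_one.indicator hS).comp hmm
    have hFd : DependsOn (fun ω => S.indicator (1 : Env d → ℝ≥0∞) (mask ω)) (Γ ∪ D) :=
      fun ω ω' h => by simp only [hmaskd h]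
    have h1 := spliceInt_step hΓ hdisj hH₀ hH hH' hH1 hρ hρd hI hpos hpos' hcmp hcmp' hFm hFd
      (fun ω => Set.indicator_le_self' (by simp) _ |>.trans (by simp))
    rw [hNint _ hFm hFd] at h1
    have e1 : ∫⁻ ω, S.indicator (1 : Env d → ℝ≥0∞) (mask ω) ∂N = N S := by
      rw [← lintegral_indicator_one hS, hN, lintegral_map hFm hNm,
        lintegral_map (measurable_one.indicator hS) hNm]
      refine lintegral_congr fun p => ?_
      exact congrArg _ (hmaskmask _)
    rw [e1] at h1
    refine h1.trans (le_of_eq ?_)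
    have hm2 : Measurable fun ω => Z * (θ ^ 2 * ρ ω) := (hρ.const_mul _).const_mul _
    rw [← lintegral_indicator hS, hMint _ (hm2.indicator hS), ← lintegral_const_mul]
    · refine lintegral_congr fun ω => ?_
      by_cases hω : mask ω ∈ S
      · rw [Set.indicator_of_mem hω, Set.indicator_of_mem hω, hmaskE hρd']
        simp only [Pi.one_apply]; ring
      · rw [Set.indicator_of_notMem hω, Set.indicator_of_notMem hω]; simp
    · exact (hFm.mul (hρ.const_mul _)).mul hH'
  have hMfin : IsFiniteMeasure M := by rw [hM]; infer_instance
  have hac : N ≪ M := by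
    refine Measure.AbsolutelyContinuous.mk fun S hS h0 => ?_
    refine le_antisymm ((hle S hS).trans ?_) zero_le
    rw [Measure.restrict_eq_zero.2 h0]; simp
  obtain ⟨R, hRm, hR⟩ : ∃ R : Env d → ℝ≥0∞, Measurable R ∧ M.withDensity R = N := by
    have : N.HaveLebesgueDecomposition M := Measure.haveLebesgueDecomposition_of_sigmaFinite N M
    exact ⟨N.rnDeriv M, Measure.measurable_rnDeriv N M, Measure.withDensity_rnDeriv_eq N M hac⟩
  have hRle : R ≤ᵐ[M] fun ω => Z * (θ ^ 2 * ρ ω) := by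
    refine ae_le_of_forall_setLIntegral_le_of_sigmaFinite hRm fun S hS _ => ?_
    rw [← withDensity_apply _ hS, hR]
    exact hle S hS
  have hRmask : Measurable fun ω => R (mask ω) := hRm.comp hmm
  have hmin : Measurable fun ω => min (Z⁻¹ * R (mask ω)) (θ ^ 2 * ρ ω) :=
    (hRmask.const_mul _).min (hρ.const_mul _)
  -- The minimum makes the almost sure bound hold for every environment. It changes the density only
  -- on a null set and where `H'` vanishes, which the integral does not notice.
  refine ⟨fun ω => min (Z⁻¹ * R (mask ω)) (θ ^ 2 * ρ ω), hmin, ?_, fun ω => min_le_right _ _, ?_⟩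
  · intro ω ω' h
    simp only [hmaskd h, hρd' h]
  · intro F hF hFd
    have hm3 : Measurable fun ω => F ω * min (Z⁻¹ * R (mask ω)) (θ ^ 2 * ρ ω) * H' ω :=
      (hF.mul hmin).mul hH'
    rw [hNint F hF hFd, ← hR, lintegral_withDensity_eq_lintegral_mul _ hRm hF,
      hMint _ (hRm.mul hF), ← lintegral_const_mul _ hm3]
    have h2 : ∀ᵐ ω ∂P, H' ω ≠ 0 → R (mask ω) ≤ Z * (θ ^ 2 * ρ ω) := by
      have := ae_of_ae_map hmm.aemeasurable hRle
      rw [ae_withDensity_iff hH'] at this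
      filter_upwards [this] with ω hω h0
      have := hω h0
      rwa [hmaskE hρd'] at this
    refine lintegral_congr_ae ?_
    filter_upwards [h2] with ω hω
    by_cases h0 : H' ω = 0
    · simp [h0]
    · have h3 := hω h0
      have h4 : Z⁻¹ * R (mask ω) ≤ θ ^ 2 * ρ ω := by
        calc _ ≤ Z⁻¹ * (Z * (θ ^ 2 * ρ ω)) := by gcongr
          _ = _ := by rw [← mul_assoc, ENNReal.inv_mul_cancel hZ hZ', one_mul]
      simp only [min_eq_left h4, Pi.mul_apply, hmaskE hFd]
      calc _ = (Z * Z⁻¹) * (R (mask ω) * F ω * H' ω) := by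
            rw [ENNReal.mul_inv_cancel hZ hZ', one_mul]
        _ = _ := by ring

/-- The sites of the blocks from `j` up to `k - 1`. -/
def sitesBetween (D : ℕ → Finset (Site d)) (j k : ℕ) : Finset (Site d) :=
  open scoped Classical in (Finset.Ico j k).biUnion D

lemma mem_sitesBetween {D : ℕ → Finset (Site d)} {j k : ℕ} {x : Site d} :
    x ∈ sitesBetween D j k ↔ ∃ i, j ≤ i ∧ i < k ∧ x ∈ D i := by
  simp [sitesBetween, and_assoc]

/-- The conditions under which the densities of spliced environments are constructed. -/
structure SpliceData (P : Measure (Env d)) [IsFiniteMeasure P] (n : ℕ) (D : ℕ → Finset (Site d))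
    (H : ℕ → Env d → ℝ≥0∞) (θ : ℕ → ℝ≥0∞) (Z : ℝ≥0∞) : Prop where
  disj : ∀ i k, i < k → k < n → Disjoint (D i) (D k)
  meas : ∀ k, Measurable (H k)
  le_one : ∀ k ω, H k ω ≤ 1
  int : ∀ k, ∫⁻ ω, H k ω ∂P = Z
  ne_zero : Z ≠ 0
  pos : ∀ j k, j ≤ k → k ≤ n →
    ∀ᵐ ω ∂P, ∫⁻ η, H k η ∂envCond P (sitesBetween D j k : Set (Site d)) ω ≠ 0
  cmp : ∀ j k, j ≤ k → k ≤ n →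
    ∀ᵐ ω ∂P, ∫⁻ η, H k η ∂envCond P (sitesBetween D 0 k : Set (Site d)) ω ≤
      θ (k - j) * ∫⁻ η, H k η ∂envCond P (sitesBetween D j k : Set (Site d)) ω
  cmp' : ∀ j k, j ≤ k → k < n →
    ∀ᵐ ω ∂P, ∀ g : Env d → ℝ≥0∞, Measurable g → DependsOn g (D k : Set (Site d)) →
      (∀ η, g η ≤ 1) →
      ∫⁻ η, g η * H (k + 1) η ∂envCond P (sitesBetween D j k : Set (Site d)) ω ≤
        θ (k - j) * ∫⁻ η, g η * H (k + 1) η ∂envCond P (sitesBetween D 0 k : Set (Site d)) ω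

/-- Induction on `k`. For `k = j` only the first environment is read and the density is `1`. Adding
block `m` compares conditioning on the blocks from `j` on, which is what the second environment
knows, with conditioning on all earlier blocks. -/
lemma SpliceData.exists_density {n : ℕ} {D : ℕ → Finset (Site d)} {H : ℕ → Env d → ℝ≥0∞}
    {θ : ℕ → ℝ≥0∞} {Z : ℝ≥0∞} (h : SpliceData P n D H θ Z) {j : ℕ} (hj : j ≤ n) :
    ∃ ρ : ℕ → Env d → ℝ≥0∞, (∀ k, j ≤ k → k ≤ n → Measurable (ρ k) ∧
      DependsOn (ρ k) (sitesBetween D 0 k : Set (Site d)) ∧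
      ∀ F : Env d → ℝ≥0∞, Measurable F → DependsOn F (sitesBetween D 0 k : Set (Site d)) →
        spliceInt P (sitesBetween D 0 j : Set (Site d)) (H j) (H k) F =
          Z * ∫⁻ ω, F ω * ρ k ω * H k ω ∂P) ∧
      (∀ ω, ρ j ω = 1) ∧ ∀ k, j ≤ k → k < n → ∀ ω, ρ (k + 1) ω ≤ θ (k - j) ^ 2 * ρ k ω := by
  classical
  have hZ' : Z ≠ ∞ := by
    rw [← h.int 0]
    exact ne_top_of_le_ne_top ENNReal.one_ne_top ((lintegral_mono (h.le_one 0)).trans (by simp))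
  suffices H' : ∀ m, j ≤ m → m ≤ n → ∃ ρ : ℕ → Env d → ℝ≥0∞, (∀ k, j ≤ k → k ≤ m →
      Measurable (ρ k) ∧ DependsOn (ρ k) (sitesBetween D 0 k : Set (Site d)) ∧
      ∀ F : Env d → ℝ≥0∞, Measurable F → DependsOn F (sitesBetween D 0 k : Set (Site d)) →
        spliceInt P (sitesBetween D 0 j : Set (Site d)) (H j) (H k) F =
          Z * ∫⁻ ω, F ω * ρ k ω * H k ω ∂P) ∧
      (∀ ω, ρ j ω = 1) ∧ ∀ k, j ≤ k → k < m → ∀ ω, ρ (k + 1) ω ≤ θ (k - j) ^ 2 * ρ k ω from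
    H' n hj le_rfl
  intro m hjm
  induction m, hjm using Nat.le_induction with
  | base =>
    intro _
    refine ⟨fun _ _ => 1, fun k h1 h2 => ⟨measurable_const, fun _ _ _ => rfl, fun F hF hFd => ?_⟩,
      fun _ => rfl, fun k h1 h2 => by omega⟩
    obtain rfl : k = j := le_antisymm h2 h1
    simp only [spliceInt, apply_splice hFd subset_rfl, mul_one]
    have : ∀ ω, ∫⁻ ω', F ω * H k ω' ∂P = F ω * Z := fun ω => by
      rw [lintegral_const_mul _ (h.meas k), h.int k]
    simp only [this]
    have hm : Measurable fun ω => F ω * H k ω := hF.mul (h.meas k)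
    rw [← lintegral_const_mul _ hm]
    exact lintegral_congr fun ω => by ring
  | succ m hjm ih =>
    intro hmn
    obtain ⟨ρ, h1, h2, h3⟩ := ih (by omega)
    obtain ⟨hm1, hm2, hm3⟩ := h1 m hjm le_rfl
    have hunion : (sitesBetween D 0 m : Set (Site d)) =
        (sitesBetween D 0 j : Set (Site d)) ∪ (sitesBetween D j m : Set (Site d)) := by
      ext x
      simp only [Set.mem_union, Finset.mem_coe, mem_sitesBetween]
      constructor
      · rintro ⟨i, -, hi, hx⟩
        rcases lt_or_ge i j with h' | h'
        · exact Or.inl ⟨i, Nat.zero_le _, h', hx⟩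
        · exact Or.inr ⟨i, h', hi, hx⟩
      · rintro (⟨i, -, hi, hx⟩ | ⟨i, -, hi, hx⟩)
        · exact ⟨i, Nat.zero_le _, by omega, hx⟩
        · exact ⟨i, Nat.zero_le _, hi, hx⟩
    have hdisj : Disjoint (sitesBetween D j m : Set (Site d))
        (sitesBetween D 0 j : Set (Site d)) := by
      refine Set.disjoint_left.2 fun x hx hx' => ?_
      obtain ⟨i, hi1, hi2, hi⟩ := mem_sitesBetween.1 (Finset.mem_coe.1 hx)
      obtain ⟨i', hi1', hi2', hi'⟩ := mem_sitesBetween.1 (Finset.mem_coe.1 hx')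
      exact Finset.disjoint_left.1 (h.disj i' i (by omega) (by omega)) hi' hi
    have hsucc : (sitesBetween D 0 (m + 1) : Set (Site d)) =
        (sitesBetween D 0 m : Set (Site d)) ∪ (D m : Set (Site d)) := by
      ext x
      simp only [Set.mem_union, Finset.mem_coe, mem_sitesBetween]
      constructor
      · rintro ⟨i, -, hi, hx⟩
        rcases Nat.lt_succ_iff_lt_or_eq.1 hi with h' | rfl
        · exact Or.inl ⟨i, Nat.zero_le _, h', hx⟩
        · exact Or.inr hx
      · rintro (⟨i, -, hi, hx⟩ | hx)
        · exact ⟨i, Nat.zero_le _, by omega, hx⟩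
        · exact ⟨m, Nat.zero_le _, by omega, hx⟩
    obtain ⟨ρ', hρ1, hρ2, hρ3, hρ4⟩ := spliceInt_density_step hunion hdisj (h.meas j) (h.meas m)
      (h.meas (m + 1)) (h.le_one j) (h.le_one m) (h.le_one (m + 1)) h.ne_zero hZ' hm1 hm2 hm3
      (h.pos j m hjm (by omega)) (h.pos 0 m (Nat.zero_le _) (by omega)) (h.cmp j m hjm (by omega))
      (h.cmp' j m hjm (by omega))
    refine ⟨Function.update ρ (m + 1) ρ', fun k hk1 hk2 => ?_, fun ω => ?_, fun k hk1 hk2 ω => ?_⟩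
    · rcases Nat.le_succ_iff.1 hk2 with h' | rfl
      · rw [Function.update_of_ne (by omega)]
        exact h1 k hk1 h'
      · rw [Function.update_self, hsucc]
        exact ⟨hρ1, hρ2, hρ4⟩
    · rw [Function.update_of_ne (by omega)]; exact h2 ω
    · rcases Nat.lt_succ_iff_lt_or_eq.1 hk2 with h' | rfl
      · rw [Function.update_of_ne (by omega), Function.update_of_ne (by omega)]
        exact h3 k hk1 h' ω
      · rw [Function.update_self, Function.update_of_ne (by omega)]
        exact hρ3 ω

end Density

/-! ### Positivity of Kaluza type, and the renewal equation -/

section Kaluza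

/-- The solution of `v k + ½ ∑_{1 ≤ j < k} v j ρ j k = 1`. -/
def renewalSeq (ρ : ℕ → ℕ → ℝ) (k : ℕ) : ℝ :=
  1 - 1 / 2 * ∑ j : Fin k, if 1 ≤ (j : ℕ) then renewalSeq ρ j * ρ j k else 0
termination_by k
decreasing_by exact j.2

lemma renewalSeq_eq (ρ : ℕ → ℕ → ℝ) (k : ℕ) :
    renewalSeq ρ k = 1 - 1 / 2 * ∑ j ∈ Finset.Ico 1 k, renewalSeq ρ j * ρ j k := by
  rw [renewalSeq, Finset.sum_fin_eq_sum_range]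
  congr 2
  rw [← Finset.sum_subset (s₁ := Finset.Ico 1 k) (s₂ := Finset.range k)]
  · refine Finset.sum_congr rfl fun j hj => ?_
    have := Finset.mem_Ico.1 hj
    rw [dif_pos this.2, if_pos this.1]
  · intro j hj
    exact Finset.mem_range.2 (Finset.mem_Ico.1 hj).2
  · intro j hj hj'
    rw [dif_pos (Finset.mem_range.1 hj), if_neg]
    intro h
    exact hj' (Finset.mem_Ico.2 ⟨h, Finset.mem_range.1 hj⟩)

/-- A version of Kaluza's theorem: the renewal sequence is nonnegative. -/
lemma renewalSeq_nonneg {n : ℕ} {ρ : ℕ → ℕ → ℝ} {ε : ℕ → ℝ} (hε : ∀ m, 0 ≤ ε m)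
    (hε4 : ∀ m, ε m ≤ 1 / 4) (hsum : ∀ N, ∑ m ∈ Finset.range N, 5 ^ m * ε m ≤ 1 / 2)
    (h0 : ∀ j k, 0 ≤ ρ j k) (h1 : ∀ j ≤ n, ρ j j = 1)
    (hstep : ∀ j k, 1 ≤ j → j ≤ k → k < n → ρ j (k + 1) ≤ (1 + ε (k - j)) * ρ j k) :
    ∀ k, 1 ≤ k → k ≤ n → 0 ≤ renewalSeq ρ k := by
  -- Positivity alone does not propagate. The second bound controls every error `ε_{k-j} v_j ρ_{jk}`
  -- by a multiple of `v_k`.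
  suffices H : ∀ k, 1 ≤ k → k ≤ n → 0 ≤ renewalSeq ρ k ∧
      ∀ j, 1 ≤ j → j ≤ k → 0 ≤ renewalSeq ρ j ∧
        renewalSeq ρ j * ρ j k ≤ 5 ^ (k - j) * renewalSeq ρ k from
    fun k hk hkn => (H k hk hkn).1
  intro k hk
  induction k, hk using Nat.le_induction with
  | base =>
    intro hn
    have e : renewalSeq ρ 1 = 1 := by rw [renewalSeq_eq]; simp
    refine ⟨by rw [e]; norm_num, fun j hj hj' => ?_⟩
    obtain rfl : j = 1 := le_antisymm hj' hj
    rw [e, h1 1 hn]; norm_num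
  | succ k hk ih =>
    intro hkn
    obtain ⟨hv, hb⟩ := ih (by omega)
    set v := renewalSeq ρ with hvdef
    have e1 : v (k + 1) = 1 - 1 / 2 * ∑ j ∈ Finset.Ico 1 k, v j * ρ j (k + 1) -
        1 / 2 * (v k * ρ k (k + 1)) := by
      rw [hvdef, renewalSeq_eq, Finset.sum_Ico_succ_top hk]; ring
    have e2 : v k = 1 - 1 / 2 * ∑ j ∈ Finset.Ico 1 k, v j * ρ j k := renewalSeq_eq ρ k
    have b1 : ∀ j ∈ Finset.Ico 1 k, v j * ρ j (k + 1) ≤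
        v j * ρ j k + 5 ^ (k - j) * ε (k - j) * v k := by
      intro j hj
      obtain ⟨hj1, hjk⟩ := Finset.mem_Ico.1 hj
      obtain ⟨hvj, hbj⟩ := hb j hj1 hjk.le
      calc v j * ρ j (k + 1) ≤ v j * ((1 + ε (k - j)) * ρ j k) :=
            mul_le_mul_of_nonneg_left (hstep j k hj1 hjk.le (by omega)) hvj
        _ = v j * ρ j k + ε (k - j) * (v j * ρ j k) := by ring
        _ ≤ v j * ρ j k + ε (k - j) * (5 ^ (k - j) * v k) := by
            have := mul_le_mul_of_nonneg_left hbj (hε (k - j)); linarith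
        _ = _ := by ring
    have b2 : v k * ρ k (k + 1) ≤ v k + ε 0 * v k := by
      have := hstep k k hk le_rfl (by omega)
      rw [h1 k (by omega), Nat.sub_self] at this
      nlinarith
    have b3 : ∑ j ∈ Finset.Ico 1 k, 5 ^ (k - j) * ε (k - j) + ε 0 ≤ 1 / 2 := by
      refine le_trans (le_of_eq ?_) (hsum k)
      have hr : ∑ j ∈ Finset.Ico 1 k, 5 ^ (k - j) * ε (k - j) =
          ∑ m ∈ Finset.Ico 1 k, 5 ^ m * ε m := by
        refine Finset.sum_bij' (fun j _ => k - j) (fun m _ => k - m) ?_ ?_ ?_ ?_ ?_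
        all_goals
          intro j hj
          have := Finset.mem_Ico.1 hj
          first | exact Finset.mem_Ico.2 ⟨by omega, by omega⟩ | omega | rfl
      rw [hr, Finset.range_eq_Ico, Finset.sum_eq_sum_Ico_succ_bot (show 0 < k by omega)]
      simp [add_comm]
    -- Subtract the equations for `k` and `k + 1`: the new term costs `½(1 + ε₀) v_k` and the growth
    -- of the old ones `½ ∑ 5^m ε_m v_k`, together at most `¾ v_k`.
    have key : 1 / 4 * v k ≤ v (k + 1) := by
      have s1 := Finset.sum_le_sum b1
      rw [Finset.sum_add_distrib, ← Finset.sum_mul] at s1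
      have s2 := mul_le_mul_of_nonneg_right b3 hv
      rw [e1]
      nlinarith
    have hv1 : 0 ≤ v (k + 1) := by linarith
    refine ⟨hv1, fun j hj1 hjk => ?_⟩
    rcases Nat.le_succ_iff.1 hjk with hjk | rfl
    · obtain ⟨hvj, hbj⟩ := hb j hj1 hjk
      refine ⟨hvj, ?_⟩
      have p : (0 : ℝ) ≤ 5 ^ (k - j) := by positivity
      have hs := hstep j k hj1 hjk (by omega)
      have hr0 := h0 j k
      calc v j * ρ j (k + 1) ≤ v j * ((1 + ε (k - j)) * ρ j k) :=
            mul_le_mul_of_nonneg_left hs hvj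
        _ = (1 + ε (k - j)) * (v j * ρ j k) := by ring
        -- The factor `5` is `5/4 · 4`: in one step `ρ` grows by at most `5/4` and `v` drops by at
        -- most `1/4`.
        _ ≤ (5 / 4) * (5 ^ (k - j) * v k) := by
            refine mul_le_mul ?_ hbj (mul_nonneg hvj hr0) (by norm_num)
            linarith [hε4 (k - j)]
        _ ≤ 5 ^ (k + 1 - j) * v (k + 1) := by
            rw [Nat.succ_sub hjk, pow_succ]
            nlinarith
    · refine ⟨hv1, ?_⟩
      rw [h1 _ hkn]; simp

variable {d : ℕ} [NeZero d] {P : Measure (Env d)} [IsProbabilityMeasure P]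

/-- The renewal equation with nonnegative `u`, for one sequence of blocks. -/
lemma SpliceData.renewal {n : ℕ} {D : ℕ → Finset (Site d)} {H : ℕ → Env d → ℝ≥0∞}
    {θ : ℕ → ℝ≥0∞} {Z : ℝ≥0∞} (h : SpliceData P n D H θ Z) {ε : ℕ → ℝ} (hε : ∀ m, 0 ≤ ε m)
    (hε4 : ∀ m, ε m ≤ 1 / 4) (hsum : ∀ N, ∑ m ∈ Finset.range N, 5 ^ m * ε m ≤ 1 / 2)
    (hθ : ∀ m, θ m ^ 2 ≤ ENNReal.ofReal (1 + ε m)) {f : ℕ → Env d → ℝ≥0∞}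
    (hf : ∀ i, Measurable (f i)) (hfd : ∀ i, DependsOn (f i) (D i : Set (Site d))) :
    ∃ u : ℕ → ℝ≥0∞, ∀ k, 1 ≤ k → k ≤ n →
      Z⁻¹ * ∫⁻ ω, (∏ i ∈ Finset.Ico 0 k, f i ω) * H k ω ∂P =
        u k + 2⁻¹ * ∑ j ∈ Finset.Ico 1 k,
          u j * (Z⁻¹ * ∫⁻ ω, (∏ i ∈ Finset.Ico j k, f i ω) * H k ω ∂P) := by
  classical
  have hZ' : Z ≠ ∞ := by
    rw [← h.int 0]
    exact ne_top_of_le_ne_top ENNReal.one_ne_top ((lintegral_mono (h.le_one 0)).trans (by simp))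
  have hd : ∀ j, ∃ ρ : ℕ → Env d → ℝ≥0∞, j ≤ n → (∀ k, j ≤ k → k ≤ n → Measurable (ρ k) ∧
      DependsOn (ρ k) (sitesBetween D 0 k : Set (Site d)) ∧
      ∀ F : Env d → ℝ≥0∞, Measurable F → DependsOn F (sitesBetween D 0 k : Set (Site d)) →
        spliceInt P (sitesBetween D 0 j : Set (Site d)) (H j) (H k) F =
          Z * ∫⁻ ω, F ω * ρ k ω * H k ω ∂P) ∧
      (∀ ω, ρ j ω = 1) ∧ ∀ k, j ≤ k → k < n → ∀ ω, ρ (k + 1) ω ≤ θ (k - j) ^ 2 * ρ k ω := by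
    intro j
    by_cases hj : j ≤ n
    · obtain ⟨ρ, hρ⟩ := h.exists_density hj
      exact ⟨ρ, fun _ => hρ⟩
    · exact ⟨fun _ _ => 0, fun h => absurd h hj⟩
  choose ρ hρ using hd
  have hfin : ∀ j k, j ≤ k → k ≤ n → ∀ ω, ρ j k ω ≠ ∞ := by
    intro j k hjk
    induction k, hjk using Nat.le_induction with
    | base => intro hj ω; rw [(hρ j hj).2.1 ω]; exact ENNReal.one_ne_top
    | succ k hjk ih =>
      intro hk ω
      refine ne_top_of_le_ne_top (ENNReal.mul_ne_top ?_ (ih (by omega) ω))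
        ((hρ j (by omega)).2.2 k hjk (by omega) ω)
      exact ne_top_of_le_ne_top ENNReal.ofReal_ne_top (hθ _)
  set r : Env d → ℕ → ℕ → ℝ := fun ω j k => (ρ j k ω).toReal with hr
  set v : ℕ → Env d → ℝ := fun k ω => renewalSeq (r ω) k with hv
  have hv0 : ∀ k, 1 ≤ k → k ≤ n → ∀ ω, 0 ≤ v k ω := by
    intro k hk1 hkn ω
    refine renewalSeq_nonneg (n := n) hε hε4 hsum (fun _ _ => ENNReal.toReal_nonneg)
      (fun j hj => ?_) (fun j k hj1 hjk hk => ?_) k hk1 hkn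
    · simp only [hr, (hρ j hj).2.1 ω, ENNReal.toReal_one]
    · have h1 := ((hρ j (by omega)).2.2 k hjk hk ω).trans
        (mul_le_mul_left (hθ (k - j)) (ρ j k ω))
      have h2 := ENNReal.toReal_mono (ENNReal.mul_ne_top ENNReal.ofReal_ne_top
        (hfin j k hjk hk.le ω)) h1
      rwa [ENNReal.toReal_mul, ENNReal.toReal_ofReal (by linarith [hε (k - j)])] at h2
  have hvm : ∀ k, k ≤ n → Measurable (v k) ∧
      DependsOn (v k) (sitesBetween D 0 k : Set (Site d)) := by
    intro k
    induction k using Nat.strong_induction_on with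
    | _ k ih =>
      intro hk
      have e : v k = fun ω => 1 - 1 / 2 * ∑ j ∈ Finset.Ico 1 k, v j ω * r ω j k :=
        funext fun ω => renewalSeq_eq _ k
      rw [e]
      constructor
      · refine measurable_const.sub (Measurable.const_mul ?_ _)
        refine Finset.measurable_fun_sum _ fun j hj => ?_
        have := Finset.mem_Ico.1 hj
        exact (ih j this.2 (by omega)).1.mul (((hρ j (by omega)).1 k this.2.le hk).1.ennreal_toReal)
      · intro ω ω' hω
        simp only
        congr 2
        refine Finset.sum_congr rfl fun j hj => ?_
        have hj' := Finset.mem_Ico.1 hj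
        have e1 : v j ω = v j ω' := by
          refine (ih j hj'.2 (by omega)).2 fun x hx => hω x ?_
          obtain ⟨i, h1, h2, h3⟩ := mem_sitesBetween.1 (Finset.mem_coe.1 hx)
          exact mem_sitesBetween.2 ⟨i, h1, by omega, h3⟩
        have e2 : ρ j k ω = ρ j k ω' := ((hρ j (by omega)).1 k hj'.2.le hk).2.1 hω
        simp only [hr, e1, e2]
  have hprodm : ∀ s : Finset ℕ, Measurable fun ω => ∏ i ∈ s, f i ω := fun s =>
    Finset.measurable_fun_prod s fun i _ => hf i
  refine ⟨fun k => Z⁻¹ * ∫⁻ ω, ENNReal.ofReal (v k ω) * (∏ i ∈ Finset.Ico 0 k, f i ω) * H k ω ∂P,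
    fun k hk1 hkn => ?_⟩
  -- the pointwise identity
  have hpt : ∀ ω, (1 : ℝ≥0∞) = ENNReal.ofReal (v k ω) +
      2⁻¹ * ∑ j ∈ Finset.Ico 1 k, ENNReal.ofReal (v j ω) * ρ j k ω := by
    intro ω
    have e := renewalSeq_eq (r ω) k
    have e1 : ∑ j ∈ Finset.Ico 1 k, ENNReal.ofReal (v j ω) * ρ j k ω =
        ENNReal.ofReal (∑ j ∈ Finset.Ico 1 k, v j ω * r ω j k) := by
      rw [ENNReal.ofReal_sum_of_nonneg]
      · refine Finset.sum_congr rfl fun j hj => ?_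
        have hj' := Finset.mem_Ico.1 hj
        rw [ENNReal.ofReal_mul (hv0 j hj'.1 (by omega) ω), hr,
          ENNReal.ofReal_toReal (hfin j k hj'.2.le hkn ω)]
      · intro j hj
        have hj' := Finset.mem_Ico.1 hj
        exact mul_nonneg (hv0 j hj'.1 (by omega) ω) ENNReal.toReal_nonneg
    have hs0 : 0 ≤ ∑ j ∈ Finset.Ico 1 k, v j ω * r ω j k := by
      refine Finset.sum_nonneg fun j hj => ?_
      have hj' := Finset.mem_Ico.1 hj
      exact mul_nonneg (hv0 j hj'.1 (by omega) ω) ENNReal.toReal_nonneg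
    have e2 : (2⁻¹ : ℝ≥0∞) = ENNReal.ofReal (1 / 2) := by
      rw [one_div, ENNReal.ofReal_inv_of_pos (by norm_num)]; simp
    rw [e1, e2, ← ENNReal.ofReal_mul (by norm_num), ← ENNReal.ofReal_add (hv0 k hk1 hkn ω)
      (by positivity), ← ENNReal.ofReal_one]
    congr 1
    change 1 = renewalSeq (r ω) k + _
    rw [e]
    simp only [hv]
    ring
  -- Read backwards, the density `ρ j k` restores the splice: `v j` and the first `j` factors see
  -- one environment, the later factors the other, and the integral is a product.
  have hterm : ∀ j ∈ Finset.Ico 1 k, Z⁻¹ * ∫⁻ ω, ENNReal.ofReal (v j ω) * ρ j k ω *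
      ((∏ i ∈ Finset.Ico 0 k, f i ω) * H k ω) ∂P =
      (Z⁻¹ * ∫⁻ ω, ENNReal.ofReal (v j ω) * (∏ i ∈ Finset.Ico 0 j, f i ω) * H j ω ∂P) *
        (Z⁻¹ * ∫⁻ ω, (∏ i ∈ Finset.Ico j k, f i ω) * H k ω ∂P) := by
    intro j hj
    obtain ⟨hj1, hjk⟩ := Finset.mem_Ico.1 hj
    obtain ⟨hvjm, hvjd⟩ := hvm j (by omega)
    have hvje : Measurable fun ω => ENNReal.ofReal (v j ω) := hvjm.ennreal_ofReal
    obtain ⟨hm1, hm2, hm3⟩ := (hρ j (by omega)).1 k hjk.le hkn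
    have hsub : (sitesBetween D 0 j : Set (Site d)) ⊆ (sitesBetween D 0 k : Set (Site d)) := by
      intro x hx
      obtain ⟨i, h1, h2, h3⟩ := mem_sitesBetween.1 (Finset.mem_coe.1 hx)
      exact mem_sitesBetween.2 ⟨i, h1, by omega, h3⟩
    have hFd : DependsOn (fun ω => ENNReal.ofReal (v j ω) * ∏ i ∈ Finset.Ico 0 k, f i ω)
        (sitesBetween D 0 k : Set (Site d)) := by
      intro ω ω' hω
      simp only
      rw [hvjd fun x hx => hω x (hsub hx)]
      congr 1
      refine Finset.prod_congr rfl fun i hi => hfd i fun x hx => hω x ?_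
      exact mem_sitesBetween.2 ⟨i, Nat.zero_le _, (Finset.mem_Ico.1 hi).2, hx⟩
    have hFm : Measurable fun ω => ENNReal.ofReal (v j ω) * ∏ i ∈ Finset.Ico 0 k, f i ω :=
      hvje.mul (hprodm _)
    have hmain := hm3 _ hFm hFd
    have hsplit : ∀ ω ω', ENNReal.ofReal (v j (splice (sitesBetween D 0 j : Set (Site d)) ω ω')) *
        ∏ i ∈ Finset.Ico 0 k, f i (splice (sitesBetween D 0 j : Set (Site d)) ω ω') =
        (ENNReal.ofReal (v j ω) * ∏ i ∈ Finset.Ico 0 j, f i ω) *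
          ∏ i ∈ Finset.Ico j k, f i ω' := by
      intro ω ω'
      rw [apply_splice hvjd subset_rfl, ← Finset.prod_Ico_consecutive _ (Nat.zero_le j) hjk.le,
        mul_assoc]
      congr 2
      · refine Finset.prod_congr rfl fun i hi => apply_splice (hfd i) (fun x hx => ?_) _ _
        exact mem_sitesBetween.2 ⟨i, Nat.zero_le _, (Finset.mem_Ico.1 hi).2, hx⟩
      · refine Finset.prod_congr rfl fun i hi => apply_splice' (hfd i) ?_ _ _
        obtain ⟨hi1, hi2⟩ := Finset.mem_Ico.1 hi
        refine Set.disjoint_left.2 fun x hx hx' => ?_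
        obtain ⟨i', -, h2, h3⟩ := mem_sitesBetween.1 (Finset.mem_coe.1 hx')
        exact Finset.disjoint_left.1 (h.disj i' i (by omega) (by omega)) h3 hx
    have hA : Measurable fun ω => ENNReal.ofReal (v j ω) * ∏ i ∈ Finset.Ico 0 j, f i ω :=
      hvje.mul (hprodm _)
    have hB : Measurable fun ω => (∏ i ∈ Finset.Ico j k, f i ω) * H k ω :=
      (hprodm _).mul (h.meas k)
    have hsi : spliceInt P (sitesBetween D 0 j : Set (Site d)) (H j) (H k)
        (fun ω => ENNReal.ofReal (v j ω) * ∏ i ∈ Finset.Ico 0 k, f i ω) =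
        (∫⁻ ω, ENNReal.ofReal (v j ω) * (∏ i ∈ Finset.Ico 0 j, f i ω) * H j ω ∂P) *
          ∫⁻ ω, (∏ i ∈ Finset.Ico j k, f i ω) * H k ω ∂P := by
      simp only [spliceInt, hsplit, mul_assoc]
      rw [← lintegral_mul_const]
      · refine lintegral_congr fun ω => ?_
        rw [lintegral_const_mul, lintegral_const_mul _ hB]
        · ring
        · exact hB.const_mul _
      · exact hvje.mul ((hprodm _).mul (h.meas j))
    have hcomm : ∫⁻ ω, ENNReal.ofReal (v j ω) * ρ j k ω *
        ((∏ i ∈ Finset.Ico 0 k, f i ω) * H k ω) ∂P = ∫⁻ ω, ENNReal.ofReal (v j ω) *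
        (∏ i ∈ Finset.Ico 0 k, f i ω) * ρ j k ω * H k ω ∂P :=
      lintegral_congr fun ω => by ring
    rw [hcomm]
    rw [hsi] at hmain
    set I := ∫⁻ ω, ENNReal.ofReal (v j ω) * (∏ i ∈ Finset.Ico 0 k, f i ω) * ρ j k ω * H k ω ∂P
    set A := ∫⁻ ω, ENNReal.ofReal (v j ω) * (∏ i ∈ Finset.Ico 0 j, f i ω) * H j ω ∂P
    set B := ∫⁻ ω, (∏ i ∈ Finset.Ico j k, f i ω) * H k ω ∂P
    calc Z⁻¹ * I = Z⁻¹ * (Z⁻¹ * Z) * I := by rw [ENNReal.inv_mul_cancel h.ne_zero hZ', mul_one]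
      _ = Z⁻¹ * Z⁻¹ * (Z * I) := by ring
      _ = _ := by rw [← hmain]; ring
  have hfHm : Measurable fun ω => (∏ i ∈ Finset.Ico 0 k, f i ω) * H k ω :=
    (hprodm _).mul (h.meas k)
  have hvk : Measurable fun ω => ENNReal.ofReal (v k ω) := (hvm k hkn).1.ennreal_ofReal
  have hmj : ∀ j ∈ Finset.Ico 1 k, Measurable fun ω => ENNReal.ofReal (v j ω) * ρ j k ω *
      ((∏ i ∈ Finset.Ico 0 k, f i ω) * H k ω) := by
    intro j hj
    obtain ⟨hj1, hjk⟩ := Finset.mem_Ico.1 hj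
    exact (((hvm j (by omega)).1.ennreal_ofReal).mul ((hρ j (by omega)).1 k hjk.le hkn).1).mul hfHm
  calc Z⁻¹ * ∫⁻ ω, (∏ i ∈ Finset.Ico 0 k, f i ω) * H k ω ∂P
      = Z⁻¹ * ∫⁻ ω, (ENNReal.ofReal (v k ω) * (∏ i ∈ Finset.Ico 0 k, f i ω) * H k ω +
          2⁻¹ * ∑ j ∈ Finset.Ico 1 k, ENNReal.ofReal (v j ω) * ρ j k ω *
            ((∏ i ∈ Finset.Ico 0 k, f i ω) * H k ω)) ∂P := by
        congr 1
        refine lintegral_congr fun ω => ?_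
        rw [← Finset.sum_mul, ← mul_assoc, mul_assoc (ENNReal.ofReal _), ← add_mul, ← hpt ω, one_mul]
    _ = Z⁻¹ * (∫⁻ ω, ENNReal.ofReal (v k ω) * (∏ i ∈ Finset.Ico 0 k, f i ω) * H k ω ∂P +
          2⁻¹ * ∑ j ∈ Finset.Ico 1 k, ∫⁻ ω, ENNReal.ofReal (v j ω) * ρ j k ω *
            ((∏ i ∈ Finset.Ico 0 k, f i ω) * H k ω) ∂P) := by
        rw [lintegral_add_left, lintegral_const_mul, lintegral_finsetSum _ hmj]
        · exact Finset.measurable_fun_sum _ hmj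
        · exact (hvk.mul (hprodm _)).mul (h.meas k)
    _ = _ := by
        rw [mul_add]
        congr 1
        rw [mul_left_comm, Finset.mul_sum, Finset.sum_congr rfl hterm]

end Kaluza

/-! ### The sites a word reads -/

section WordSites

variable {d : ℕ} [NeZero d]

open scoped Classical in
/-- The sites at which the letters of a word depend on the environment. -/
def wordSites : List (Letter d) → Site d → Finset (Site d)
  | [], _ => ∅
  | a :: π, x => if a.2 = true then wordSites π (x + a.1.vec) else
      insert x (wordSites π (x + a.1.vec))

lemma mem_wordSites {π : List (Letter d)} {x y : Site d} :
    y ∈ wordSites π x ↔ ∃ t a, π[t]? = some a ∧ a.2 = false ∧ y = x + wordDisp (π.take t) := by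
  induction π generalizing x with
  | nil => simp [wordSites]
  | cons b π ih =>
    have key : (∃ t a, (b :: π)[t]? = some a ∧ a.2 = false ∧ y = x + wordDisp ((b :: π).take t)) ↔
        (b.2 = false ∧ y = x) ∨
        ∃ t a, π[t]? = some a ∧ a.2 = false ∧ y = x + b.1.vec + wordDisp (π.take t) := by
      constructor
      · rintro ⟨t, a, h1, h2, h3⟩
        rcases t with _ | t
        · simp only [List.getElem?_cons_zero, Option.some.injEq] at h1
          subst h1
          exact Or.inl ⟨h2, by simpa using h3⟩
        · exact Or.inr ⟨t, a, by simpa using h1, h2, by simpa [add_assoc] using h3⟩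
      · rintro (⟨h1, h2⟩ | ⟨t, a, h1, h2, h3⟩)
        · exact ⟨0, b, by simp, h1, by simpa using h2⟩
        · exact ⟨t + 1, a, by simpa using h1, h2, by simpa [add_assoc] using h3⟩
    rw [key, ← ih, wordSites]
    split_ifs with hb
    · simp [hb]
    · simp [hb]

lemma wordSites_append (π π' : List (Letter d)) (x : Site d) :
    (wordSites (π ++ π') x : Set (Site d)) =
      (wordSites π x : Set (Site d)) ∪ (wordSites π' (x + wordDisp π) : Set (Site d)) := by
  induction π generalizing x with
  | nil => simp [wordSites]
  | cons a π ih =>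
    rw [List.cons_append, wordSites, wordSites]
    split_ifs with h
    · rw [ih]; simp [add_assoc]
    · rw [Finset.coe_insert, Finset.coe_insert, ih]; simp [add_assoc, Set.insert_union]

lemma dependsOn_wordWeight (κ : ℝ) (π : List (Letter d)) (x : Site d) :
    DependsOn (wordWeight κ π x) (wordSites π x : Set (Site d)) := by
  induction π generalizing x with
  | nil => intro _ _ _; rfl
  | cons a π ih =>
    intro ω ω' h
    simp only [wordWeight]
    rw [wordSites] at h
    split_ifs at h with ha
    · rw [ih _ h]; simp [letterWeight, ha]
    · rw [ih _ fun y hy => h y (by simp [Finset.mem_coe.1 hy]), h x (by simp)]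

/-- The number of distinct sites read at a level is at most the number of visits to it. -/
lemma OkWord.sparse {c : ℝ} {π : List (Letter d)} (h : OkWord c π) (x : Site d) :
    Sparse c (x 0) (wordSites π x) := by
  constructor
  · intro y hy
    obtain ⟨t, a, h1, -, rfl⟩ := mem_wordSites.1 hy
    have ht : t < π.length := (List.getElem?_eq_some_iff.1 h1).1
    have := OkUpTo.level_le h ht.le
    simp only [List.take_zero, wordDisp_nil, Pi.zero_apply] at this
    simp only [Pi.add_apply]
    omega
  · intro j
    refine le_trans (Nat.cast_le.2 ?_) (h.2 j)
    have hsub : (wordSites π x).filter (fun y => y 0 = x 0 + j) ⊆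
        ((Finset.range (π.length + 1)).filter fun i => wordDisp (π.take i) 0 =
          wordDisp (π.take 0) 0 + (j : ℤ)).image fun t => x + wordDisp (π.take t) := by
      intro y hy
      obtain ⟨hy1, hy2⟩ := Finset.mem_filter.1 hy
      obtain ⟨t, a, h1, -, rfl⟩ := mem_wordSites.1 hy1
      have ht : t < π.length := (List.getElem?_eq_some_iff.1 h1).1
      refine Finset.mem_image.2 ⟨t, Finset.mem_filter.2 ⟨Finset.mem_range.2 (by omega), ?_⟩, rfl⟩
      simp only [Pi.add_apply] at hy2
      simp only [List.take_zero, wordDisp_nil, Pi.zero_apply]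
      omega
    exact (Finset.card_le_card hsub).trans Finset.card_image_le

/-- A sequence of letters which starts with the given word. -/
def extWord (π : List (Letter d)) : ℕ → Letter d := fun t => π.getD t ((0, true), true)

lemma extWord_mem_cyl (π : List (Letter d)) : extWord π ∈ cyl π := by
  refine List.ext_getElem (by simp) fun t h1 h2 => ?_
  simp [prefixWord, extWord, h2]

variable {c : ℝ} {L : ℕ}

lemma IsBlock.okWord_append {ξ v : List (Letter d)} (hξ : IsBlock c L ξ) (hv : OkWord c v) :
    OkWord c (ξ ++ v) := by
  obtain ⟨h1, h2⟩ := mem_cyl_append.1 (extWord_mem_cyl (ξ ++ v))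
  rw [okWord_iff (extWord_mem_cyl (ξ ++ v)), List.length_append]
  have hb := hξ.blockSeq h1
  refine OkUpTo.concat (fun i hi => hb.2.1.record hi) hb.1 ?_
  rw [okUpTo_shiftPath_walkOf]
  exact (okWord_iff h2).1 hv

lemma IsBlock.okWord {ξ : List (Letter d)} (hξ : IsBlock c L ξ) : OkWord c ξ := by
  rw [okWord_iff (extWord_mem_cyl ξ)]
  exact (hξ.blockSeq (extWord_mem_cyl ξ)).1

lemma IsBlock.disp_ge {ξ : List (Letter d)} (hξ : IsBlock c L ξ) : (L : ℤ) ≤ wordDisp ξ 0 := by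
  have hb := hξ.blockSeq (extWord_mem_cyl ξ)
  have h1 := hb.2.1.level_end
  have h2 := hb.1.level_le (t := ξ.length - L) (by omega)
  rw [walkOf_eq_wordDisp (extWord_mem_cyl ξ) le_rfl, List.take_length] at h1
  simp only [walkOf_zero, Pi.zero_apply] at h2
  omega

/-- The last `L` letters have coin `1` and read no site, and all earlier positions lie strictly
below the record from which these steps start. This gap separates the past from the future of a
regeneration. -/
lemma IsBlock.sites_level {ξ : List (Letter d)} (hξ : IsBlock c L ξ) {x y : Site d}
    (hy : y ∈ wordSites ξ x) : y 0 + (L + 1 : ℕ) ≤ (x + wordDisp ξ) 0 := by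
  obtain ⟨t, a, h1, h2, rfl⟩ := mem_wordSites.1 hy
  obtain ⟨ht, hta⟩ := List.getElem?_eq_some_iff.1 h1
  have hA := (hξ.blockSeq (extWord_mem_cyl ξ)).2.1
  have htL : t < ξ.length - L := by
    by_contra hlt
    have := (hA.2.2 (ξ.length - t) (by omega) (by omega)).1
    rw [show ξ.length - (ξ.length - t) = t by omega] at this
    simp only [coinsOf, extWord, List.getD_eq_getElem?_getD, h1, Option.getD_some] at this
    rw [h2] at this
    exact absurd this (by simp)
  have := hA.level_lt htL
  rw [walkOf_eq_wordDisp (extWord_mem_cyl ξ) ht.le,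
    walkOf_eq_wordDisp (extWord_mem_cyl ξ) le_rfl, List.take_length] at this
  simp only [Pi.add_apply]
  push_cast
  omega

end WordSites

/-! ### Comparing integrals under nearby conditional laws -/

section Compare

variable {d : ℕ} [NeZero d]

lemma lintegral_le_of_dependsOn {μ ν : Measure (Env d)} {θ : ℝ≥0∞} {Δ : Finset (Site d)}
    (h : ∀ S, MeasurableSet S →
      μ (restr (Δ : Set (Site d)) ⁻¹' S) ≤ θ * ν (restr (Δ : Set (Site d)) ⁻¹' S))
    {f : Env d → ℝ≥0∞} (hf : Measurable f) (hfd : DependsOn f (Δ : Set (Site d))) :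
    ∫⁻ ω, f ω ∂μ ≤ θ * ∫⁻ ω, f ω ∂ν := by
  classical
  set ext : Config (Δ : Set (Site d)) → Env d :=
    fun c x => if h : x ∈ (Δ : Set (Site d)) then c ⟨x, h⟩ else Classical.arbitrary _
  have hext : Measurable ext := by
    refine measurable_pi_lambda _ fun x => ?_
    by_cases h : x ∈ (Δ : Set (Site d))
    · simpa only [ext, dif_pos h] using! measurable_pi_apply _
    · simpa only [ext, dif_neg h] using! measurable_const
  have e : ∀ ω, f ω = f (ext (restr (Δ : Set (Site d)) ω)) := fun ω =>
    hfd fun x hx => by simp only [ext, dif_pos hx, restr]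
  have hfe : Measurable fun c => f (ext c) := hf.comp hext
  have hr := measurable_restr (Δ : Set (Site d))
  have hle : μ.map (restr (Δ : Set (Site d))) ≤ θ • ν.map (restr (Δ : Set (Site d))) := by
    refine Measure.le_iff.2 fun S hS => ?_
    rw [Measure.smul_apply, smul_eq_mul, Measure.map_apply hr hS, Measure.map_apply hr hS]
    exact h S hS
  calc ∫⁻ ω, f ω ∂μ = ∫⁻ c, f (ext c) ∂μ.map (restr (Δ : Set (Site d))) := by
        rw [lintegral_map hfe hr]; exact lintegral_congr e
    _ ≤ ∫⁻ c, f (ext c) ∂(θ • ν.map (restr (Δ : Set (Site d)))) := lintegral_mono' hle le_rfl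
    _ = θ * ∫⁻ ω, f ω ∂ν := by
        rw [lintegral_smul_measure, lintegral_map hfe hr, smul_eq_mul]
        congr 1; exact (lintegral_congr e).symm

/-- Survival for ever involves infinitely many sites, but survival up to `N` is a sum over words,
each reading a sparse set. The constant is the same for all of them, so it persists as `N → ∞`. -/
lemma lintegral_survive_le {κ c : ℝ} (h0 : 0 < κ) (h1 : κ < 1 / (2 * d)) {μ ν : Measure (Env d)}
    [IsFiniteMeasure ν] {θ : ℝ≥0∞} (hθ : θ ≠ ∞) {ℓ : ℤ}
    (h : ∀ Δ : Finset (Site d), Sparse c ℓ Δ → ∀ S, MeasurableSet S →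
      μ (restr (Δ : Set (Site d)) ⁻¹' S) ≤ θ * ν (restr (Δ : Set (Site d)) ⁻¹' S))
    {D : Finset (Site d)} {x : Site d}
    (hD : ∀ v, OkWord c v → ∃ Δ, Sparse c ℓ Δ ∧ D ⊆ Δ ∧ wordSites v x ⊆ Δ)
    {g : Env d → ℝ≥0∞} (hg : Measurable g) (hgd : DependsOn g (D : Set (Site d)))
    (hg1 : ∀ ω, g ω ≤ 1) :
    ∫⁻ ω, g ω * survive κ c x ω ∂μ ≤ θ * ∫⁻ ω, g ω * survive κ c x ω ∂ν := by
  classical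
  have hN : ∀ N, ∫⁻ ω, g ω * surviveN κ c N x ω ∂μ ≤ θ * ∫⁻ ω, g ω * surviveN κ c N x ω ∂ν := by
    intro N
    simp only [surviveN, Finset.mul_sum]
    have hm : ∀ v ∈ (words (Letter d) N).filter (OkWord c),
        Measurable fun ω => g ω * wordWeight κ v x ω := fun v _ =>
      hg.mul (measurable_wordWeight κ v x)
    rw [lintegral_finsetSum _ hm, lintegral_finsetSum _ hm, Finset.mul_sum]
    refine Finset.sum_le_sum fun v hv => ?_
    obtain ⟨Δ, hΔ, hDΔ, hvΔ⟩ := hD v (Finset.mem_filter.1 hv).2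
    refine lintegral_le_of_dependsOn (h Δ hΔ) (hm v hv) fun ω ω' hω => ?_
    rw [hgd fun y hy => hω y (hDΔ hy), dependsOn_wordWeight κ v x fun y hy => hω y (hvΔ hy)]
  have hinf : ∫⁻ ω, g ω * survive κ c x ω ∂ν = ⨅ N, ∫⁻ ω, g ω * surviveN κ c N x ω ∂ν := by
    rw [← lintegral_iInf]
    · refine lintegral_congr fun ω => ?_
      have hne : g ω ≠ ∞ := ne_top_of_le_ne_top ENNReal.one_ne_top (hg1 ω)
      rw [survive, ENNReal.mul_iInf fun h => absurd h hne]
    · exact fun N => hg.mul (measurable_surviveN κ c N x)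
    · exact fun m n hmn ω => mul_le_mul_right (antitone_surviveN h0 h1 x ω hmn) _
    · refine ne_top_of_le_ne_top (b := ν Set.univ) (measure_ne_top ν _) ?_
      calc _ ≤ ∫⁻ _, 1 ∂ν := lintegral_mono fun ω =>
            mul_le_one' (hg1 ω) (surviveN_le_one h0 h1 _ _ _)
        _ = _ := by simp
  rw [hinf, ENNReal.mul_iInf fun h => absurd h hθ]
  refine le_iInf fun N => le_trans (lintegral_mono fun ω => ?_) (hN N)
  exact mul_le_mul_right (iInf_le _ N) _

lemma lintegral_envCond_empty {P : Measure (Env d)} [IsProbabilityMeasure P] {f : Env d → ℝ≥0∞}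
    (hf : Measurable f) (ω : Env d) :
    ∫⁻ η, f η ∂envCond P (∅ : Set (Site d)) ω = ∫⁻ η, f η ∂P := by
  have h := lintegral_envCond (P := P) (Γ := (∅ : Set (Site d))) (F := fun p => f p.2)
    (hf.comp measurable_snd)
  rw [← h]
  have : ∀ ω', envCond P (∅ : Set (Site d)) ω' = envCond P ∅ ω := fun ω' =>
    envCond_congr (funext fun x => absurd x.2 (Set.notMem_empty _))
  simp [this]

end Compare

/-! ### The law of the blocks -/

section BlockLaw

variable {d : ℕ} [NeZero d] {P : Measure (Env d)} [IsProbabilityMeasure P] {κ c : ℝ} {L : ℕ}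

/-- The probability that the path, conditioned on `R = ∞`, starts with the given blocks. -/
def blockProb (P : Measure (Env d)) (κ : ℝ) (w : List (Block d c L)) : ℝ≥0∞ :=
  (letterLaw P κ (neverR c))⁻¹ * letterLaw P κ (blockEvent w)

/-- Stationarity leaves the starting point `x` free, so the same blocks can be evaluated wherever
they occur inside a longer list. -/
lemma blockProb_eq (hstat : Stationary P) (hell : UniformlyElliptic P κ)
    (w : List (Block d c L)) (x : Site d) :
    blockProb P κ w = (letterLaw P κ (neverR c))⁻¹ *
      ∫⁻ ω, wordWeight κ (flat w) x ω * survive κ c (x + wordDisp (flat w)) ω ∂P := by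
  have hm : Measurable fun ω : Env d =>
      wordWeight κ (flat w) 0 ω * survive κ c (wordDisp (flat w)) ω := by fun_prop
  rw [blockProb, blockEvent, letterLaw_cyl_neverR hstat hell, ← lintegral_stationary hstat x hm]
  simp only [wordWeight_shift, survive_shift, zero_add, add_comm x]

/-- The conditional laws given the environments of a finite set of sites are close. -/
structure MixBound (P : Measure (Env d)) [IsFiniteMeasure P] (c : ℝ) (L : ℕ) (θ : ℕ → ℝ≥0∞) :
    Prop where
  pos : 1 ≤ L
  ne_top : ∀ m, θ m ≠ ∞
  ne_zero : ∀ m, θ m ≠ 0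
  compare : ∀ (b Γ : Finset (Site d)) (ℓ : ℤ) (m : ℕ), b ⊆ Γ → (∀ x ∈ Γ, x 0 + (L + 1 : ℕ) ≤ ℓ) →
    (∀ x ∈ Γ, x ∉ b → x 0 + ((m + 1) * L : ℕ) ≤ ℓ) →
      ∀ᵐ ω ∂P, ∀ Δ : Finset (Site d), Sparse c ℓ Δ → ∀ S, MeasurableSet S →
        envCond P b ω (restr (Δ : Set (Site d)) ⁻¹' S) ≤
          θ m * envCond P Γ ω (restr (Δ : Set (Site d)) ⁻¹' S) ∧
        envCond P Γ ω (restr (Δ : Set (Site d)) ⁻¹' S) ≤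
          θ m * envCond P b ω (restr (Δ : Set (Site d)) ⁻¹' S)

lemma sparse_of_okWord (x : Site d) (v : List (Letter d)) (hv : OkWord c v) :
    ∃ Δ, Sparse c (x 0) Δ ∧ (∅ : Finset (Site d)) ⊆ Δ ∧ wordSites v x ⊆ Δ :=
  ⟨_, hv.sparse x, Finset.empty_subset _, subset_rfl⟩

lemma sparse_of_append {π : List (Letter d)} (hπ : ∀ v, OkWord c v → OkWord c (π ++ v))
    (x : Site d) (v : List (Letter d)) (hv : OkWord c v) :
    ∃ Δ, Sparse c (x 0) Δ ∧ wordSites π x ⊆ Δ ∧ wordSites v (x + wordDisp π) ⊆ Δ := by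
  refine ⟨_, (hπ v hv).sparse x, ?_, ?_⟩ <;> rw [← Finset.coe_subset, wordSites_append]
  · exact Set.subset_union_left
  · exact Set.subset_union_right

/-- Comparison with the empty conditioning set: a vanishing conditional survival probability would
force `Z = 0`. -/
lemma MixBound.survive_ne_zero {θ : ℕ → ℝ≥0∞} (hθ : MixBound P c L θ)
    (hstat : Stationary P) (hell : UniformlyElliptic P κ)
    (hZ : letterLaw P κ (neverR c) ≠ 0) {Γ : Finset (Site d)} {x : Site d}
    (hΓ : ∀ y ∈ Γ, y 0 + (L + 1 : ℕ) ≤ x 0) :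
    ∀ᵐ ω ∂P, ∫⁻ η, survive κ c x η ∂envCond P (Γ : Set (Site d)) ω ≠ 0 := by
  have h := hθ.compare ∅ Γ (x 0) 0 (Finset.empty_subset _) hΓ fun y hy _ => by
    have := hΓ y hy; push_cast at *; omega
  filter_upwards [h] with ω hω h0
  have := lintegral_survive_le (κ := κ) hell.1 hell.2.1 (μ := envCond P (∅ : Finset (Site d)) ω)
    (ν := envCond P (Γ : Set (Site d)) ω) (hθ.ne_top 0) (fun Δ hΔ S hS => (hω Δ hΔ S hS).1)
    (D := ∅) (x := x) (sparse_of_okWord x) (g := fun _ => 1) measurable_const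
    (fun _ _ _ => rfl) (fun _ => le_rfl)
  simp only [one_mul, h0, mul_zero, Finset.coe_empty] at this
  rw [lintegral_envCond_empty (measurable_survive κ c x), lintegral_survive hstat hell] at this
  exact hZ (le_antisymm this zero_le)

/-- The positions at the ends of the blocks. -/
def blockPos (w : List (Block d c L)) (k : ℕ) : Site d := wordDisp (flat (w.take k))

/-- The blocks as words, and `[]` after the last one. -/
def nthBlock (w : List (Block d c L)) (i : ℕ) : List (Letter d) := (w.map Subtype.val).getD i []

lemma nthBlock_eq (w : List (Block d c L)) {i : ℕ} (hi : i < w.length) :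
    nthBlock w i = (w[i]).1 := by
  simp [nthBlock, hi]

lemma isBlock_nthBlock (w : List (Block d c L)) {i : ℕ} (hi : i < w.length) :
    IsBlock c L (nthBlock w i) := by
  rw [nthBlock_eq w hi]; exact (w[i]).2

lemma blockPos_succ (w : List (Block d c L)) {k : ℕ} (hk : k < w.length) :
    blockPos w (k + 1) = blockPos w k + wordDisp (nthBlock w k) := by
  rw [blockPos, blockPos, List.take_succ_eq_append_getElem hk, flat_append, wordDisp_append,
    nthBlock_eq w hk]
  simp

lemma blockPos_level (w : List (Block d c L)) {j k : ℕ} (hjk : j ≤ k) (hk : k ≤ w.length) :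
    blockPos w j 0 + ((k - j) * L : ℕ) ≤ blockPos w k 0 := by
  induction k, hjk using Nat.le_induction with
  | base => simp
  | succ k hjk ih =>
    have h1 := ih (by omega)
    have h2 := (isBlock_nthBlock w (i := k) (by omega)).disp_ge
    rw [blockPos_succ w (by omega), Pi.add_apply, Nat.succ_sub hjk, Nat.succ_mul]
    push_cast at *
    omega

lemma prod_wordWeight_nthBlock (w : List (Block d c L)) (ω : Env d) {j k : ℕ} (hjk : j ≤ k)
    (hk : k ≤ w.length) :
    ∏ i ∈ Finset.Ico j k, wordWeight κ (nthBlock w i) (blockPos w i) ω =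
      wordWeight κ (flat ((w.take k).drop j)) (blockPos w j) ω ∧
    blockPos w j + wordDisp (flat ((w.take k).drop j)) = blockPos w k := by
  induction k, hjk using Nat.le_induction with
  | base =>
    have : (w.take j).drop j = [] := by simp
    simp [this, wordWeight]
  | succ k hjk ih =>
    obtain ⟨h1, h2⟩ := ih (by omega)
    have e : (w.take (k + 1)).drop j = (w.take k).drop j ++ [w[k]] := by
      rw [List.take_succ_eq_append_getElem (by omega),
        List.drop_append_of_le_length (by simp; omega)]
    rw [Finset.prod_Ico_succ_top hjk, h1, e, flat_append, wordWeight_append, h2, wordDisp_append,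
      ← add_assoc, h2, blockPos_succ w (by omega), nthBlock_eq w (by omega)]
    simp

/-- Successive blocks read disjoint slabs. Seen from the end of block `k - 1`, the sites of a block
before `j` are at depth more than `(k-j+1)L`: each of the `k - j` blocks in between rises by at
least `L`, and every block leaves its own gap. This matches the index `k - j` of `θ`. -/
lemma MixBound.spliceData {θ : ℕ → ℝ≥0∞} (hθ : MixBound P c L θ) (hstat : Stationary P)
    (hell : UniformlyElliptic P κ) (hZ : letterLaw P κ (neverR c) ≠ 0) (w : List (Block d c L)) :
    SpliceData P w.length (fun i => wordSites (nthBlock w i) (blockPos w i))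
      (fun k => survive κ c (blockPos w k)) θ (letterLaw P κ (neverR c)) := by
  have hlow : ∀ i < w.length, ∀ x ∈ wordSites (nthBlock w i) (blockPos w i),
      blockPos w i 0 ≤ x 0 := fun i hi x hx =>
    ((isBlock_nthBlock w hi).okWord.sparse _).1 x hx
  have hup : ∀ i < w.length, ∀ x ∈ wordSites (nthBlock w i) (blockPos w i),
      x 0 + (L + 1 : ℕ) ≤ blockPos w (i + 1) 0 := fun i hi x hx => by
    rw [blockPos_succ w hi]; exact (isBlock_nthBlock w hi).sites_level hx
  have hΓ : ∀ j k, k ≤ w.length → ∀ x ∈ sitesBetween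
      (fun i => wordSites (nthBlock w i) (blockPos w i)) j k,
      x 0 + (L + 1 : ℕ) ≤ blockPos w k 0 := by
    intro j k hk x hx
    obtain ⟨i, h1, h2, h3⟩ := mem_sitesBetween.1 hx
    have := hup i (by omega) x h3
    have := blockPos_level w (j := i + 1) (k := k) (by omega) hk
    push_cast at *
    have : (0 : ℤ) ≤ ((k - (i + 1) : ℕ) : ℤ) * L := by positivity
    omega
  have hcmp : ∀ j k, j ≤ k → k ≤ w.length → ∀ᵐ ω ∂P, ∀ Δ : Finset (Site d),
      Sparse c (blockPos w k 0) Δ → ∀ S, MeasurableSet S →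
        envCond P (sitesBetween (fun i => wordSites (nthBlock w i) (blockPos w i)) j k) ω
          (restr (Δ : Set (Site d)) ⁻¹' S) ≤ θ (k - j) *
        envCond P (sitesBetween (fun i => wordSites (nthBlock w i) (blockPos w i)) 0 k) ω
          (restr (Δ : Set (Site d)) ⁻¹' S) ∧
        envCond P (sitesBetween (fun i => wordSites (nthBlock w i) (blockPos w i)) 0 k) ω
          (restr (Δ : Set (Site d)) ⁻¹' S) ≤ θ (k - j) *
        envCond P (sitesBetween (fun i => wordSites (nthBlock w i) (blockPos w i)) j k) ω
          (restr (Δ : Set (Site d)) ⁻¹' S) := by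
    intro j k hjk hk
    refine hθ.compare _ _ _ (k - j) (fun x hx => ?_) (hΓ 0 k hk) fun x hx hxb => ?_
    · obtain ⟨i, h1, h2, h3⟩ := mem_sitesBetween.1 hx
      exact mem_sitesBetween.2 ⟨i, Nat.zero_le _, h2, h3⟩
    · obtain ⟨i, h1, h2, h3⟩ := mem_sitesBetween.1 hx
      have hij : i < j := by
        by_contra hij
        exact hxb (mem_sitesBetween.2 ⟨i, by omega, h2, h3⟩)
      have e1 := hup i (by omega) x h3
      have e2 := blockPos_level w (j := i + 1) (k := k) (by omega) hk
      have e3 : (k - j) * L ≤ (k - (i + 1)) * L := Nat.mul_le_mul_right L (by omega)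
      have e4 : ((k - j + 1) * L : ℕ) = (k - j) * L + L := by ring
      rw [e4]
      push_cast at *
      have e3' : ((k - j : ℕ) : ℤ) * L ≤ ((k - (i + 1) : ℕ) : ℤ) * L := by exact_mod_cast e3
      omega
  refine ⟨fun i k hik hk => ?_, fun k => measurable_survive κ c _,
    fun k ω => survive_le_one hell.1 hell.2.1 _ _, fun k => lintegral_survive hstat hell _, hZ,
    fun j k hjk hk => hθ.survive_ne_zero hstat hell hZ (hΓ j k hk), fun j k hjk hk => ?_,
    fun j k hjk hk => ?_⟩
  · refine Finset.disjoint_left.2 fun x hx hx' => ?_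
    have e1 := hup i (by omega) x hx
    have e2 := hlow k hk x hx'
    have e3 := blockPos_level w (j := i + 1) (k := k) (by omega) hk.le
    push_cast at *
    have : (0 : ℤ) ≤ ((k - (i + 1) : ℕ) : ℤ) * L := by positivity
    omega
  · filter_upwards [hcmp j k hjk hk] with ω hω
    have := lintegral_survive_le (κ := κ) hell.1 hell.2.1 (hθ.ne_top (k - j))
      (fun Δ hΔ S hS => (hω Δ hΔ S hS).2)
      (D := ∅) (x := blockPos w k) (sparse_of_okWord _) (g := fun _ => 1) measurable_const
      (fun _ _ _ => rfl) (fun _ => le_rfl)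
    simpa only [one_mul] using this
  · filter_upwards [hcmp j k hjk hk.le] with ω hω g hg hgd hg1
    refine lintegral_survive_le (κ := κ) hell.1 hell.2.1 (hθ.ne_top (k - j))
      (fun Δ hΔ S hS => (hω Δ hΔ S hS).1) (fun v hv => ?_) hg hgd hg1
    rw [blockPos_succ w hk]
    exact sparse_of_append (fun v hv => (isBlock_nthBlock w hk).okWord_append hv) _ v hv

/-- The renewal equation for the blocks. -/
lemma MixBound.exists_renewal {θ : ℕ → ℝ≥0∞} (hθ : MixBound P c L θ) (hstat : Stationary P)
    (hell : UniformlyElliptic P κ) (hZ : letterLaw P κ (neverR c) ≠ 0)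
    {ε : ℕ → ℝ} (hε : ∀ m, 0 ≤ ε m) (hε4 : ∀ m, ε m ≤ 1 / 4)
    (hsum : ∀ N, ∑ m ∈ Finset.range N, 5 ^ m * ε m ≤ 1 / 2)
    (hθε : ∀ m, θ m ^ 2 ≤ ENNReal.ofReal (1 + ε m)) (w : List (Block d c L)) :
    ∃ u : ℕ → ℝ≥0∞, ∀ k, 1 ≤ k → k ≤ w.length → blockProb P κ (w.take k) =
      u k + 2⁻¹ * ∑ j ∈ Finset.Ico 1 k, u j * blockProb P κ ((w.take k).drop j) := by
  obtain ⟨u, hu⟩ := (hθ.spliceData hstat hell hZ w).renewal hε hε4 hsum hθε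
    (f := fun i => wordWeight κ (nthBlock w i) (blockPos w i))
    (fun i => measurable_wordWeight κ _ _) (fun i => dependsOn_wordWeight κ _ _)
  have key : ∀ j k, j ≤ k → k ≤ w.length → (letterLaw P κ (neverR c))⁻¹ *
      ∫⁻ ω, (∏ i ∈ Finset.Ico j k, wordWeight κ (nthBlock w i) (blockPos w i) ω) *
        survive κ c (blockPos w k) ω ∂P = blockProb P κ ((w.take k).drop j) := by
    intro j k hjk hk
    rw [blockProb_eq hstat hell _ (blockPos w j)]
    congr 1
    refine lintegral_congr fun ω => ?_
    obtain ⟨h1, h2⟩ := prod_wordWeight_nthBlock (κ := κ) w ω hjk hk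
    rw [h1, h2]
  refine ⟨u, fun k hk1 hk => ?_⟩
  have h := hu k hk1 hk
  rw [key 0 k (Nat.zero_le _) hk, List.drop_zero] at h
  rw [h]
  congr 2
  refine Finset.sum_congr rfl fun j hj => ?_
  rw [key j k (Finset.mem_Ico.1 hj).2.le hk]

/-- Near independence of past and future: given the sites of `Γ` the integral of the future is
within a factor `θ 0` of its mean, by comparison with the empty set. -/
lemma MixBound.lintegral_mul_survive {θ : ℕ → ℝ≥0∞} (hθ : MixBound P c L θ) (hstat : Stationary P)
    (hell : UniformlyElliptic P κ) {Γ : Finset (Site d)} {x : Site d}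
    (hΓ : ∀ y ∈ Γ, y 0 + (L + 1 : ℕ) ≤ x 0) {A : Env d → ℝ≥0∞} (hA : Measurable A)
    (hAd : DependsOn A (Γ : Set (Site d))) {π : List (Letter d)}
    (hπ : ∀ v, OkWord c v → OkWord c (π ++ v)) :
    ∫⁻ ω, A ω * (wordWeight κ π x ω * survive κ c (x + wordDisp π) ω) ∂P ≤
      θ 0 * ((∫⁻ ω, A ω ∂P) *
        ∫⁻ ω, wordWeight κ π x ω * survive κ c (x + wordDisp π) ω ∂P) ∧
    (∫⁻ ω, A ω ∂P) * ∫⁻ ω, wordWeight κ π x ω * survive κ c (x + wordDisp π) ω ∂P ≤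
      θ 0 * ∫⁻ ω, A ω * (wordWeight κ π x ω * survive κ c (x + wordDisp π) ω) ∂P := by
  set F : Env d → ℝ≥0∞ := fun ω => wordWeight κ π x ω * survive κ c (x + wordDisp π) ω with hF
  have hFm : Measurable F := by fun_prop
  have h := hθ.compare ∅ Γ (x 0) 0 (Finset.empty_subset _) hΓ fun y hy _ => by
    have := hΓ y hy; push_cast at *; omega
  have hle : ∀ᵐ ω ∂P, ∫⁻ η, F η ∂P ≤ θ 0 * ∫⁻ η, F η ∂envCond P (Γ : Set (Site d)) ω ∧
      ∫⁻ η, F η ∂envCond P (Γ : Set (Site d)) ω ≤ θ 0 * ∫⁻ η, F η ∂P := by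
    filter_upwards [h] with ω hω
    have hD := sparse_of_append hπ x
    have hw := dependsOn_wordWeight κ π x
    constructor
    · have := lintegral_survive_le (κ := κ) hell.1 hell.2.1
        (μ := envCond P (∅ : Finset (Site d)) ω) (ν := envCond P (Γ : Set (Site d)) ω)
        (hθ.ne_top 0) (fun Δ hΔ S hS => (hω Δ hΔ S hS).1)
        hD (measurable_wordWeight κ π x) hw (wordWeight_le_one hell.1 hell.2.1 π x)
      simp only [Finset.coe_empty] at this
      rwa [lintegral_envCond_empty hFm] at this
    · have := lintegral_survive_le (κ := κ) hell.1 hell.2.1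
        (μ := envCond P (Γ : Set (Site d)) ω) (ν := envCond P (∅ : Finset (Site d)) ω)
        (hθ.ne_top 0) (fun Δ hΔ S hS => (hω Δ hΔ S hS).2)
        hD (measurable_wordWeight κ π x) hw (wordWeight_le_one hell.1 hell.2.1 π x)
      simp only [Finset.coe_empty] at this
      rwa [lintegral_envCond_empty hFm] at this
  have hdis := lintegral_envCond_of_dependsOn (P := P) (Γ := (Γ : Set (Site d)))
    (Φ := fun p => A p.1 * F p.2) ((hA.comp measurable_fst).mul (hFm.comp measurable_snd))
    (fun η ω ω' hω => by simp only [hAd hω])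
  have hdis' : ∫⁻ ω, A ω * F ω ∂P =
      ∫⁻ ω, A ω * ∫⁻ η, F η ∂envCond P (Γ : Set (Site d)) ω ∂P := by
    rw [← hdis]
    exact lintegral_congr fun ω => lintegral_const_mul (A ω) hFm
  change ∫⁻ ω, A ω * F ω ∂P ≤ θ 0 * ((∫⁻ ω, A ω ∂P) * ∫⁻ ω, F ω ∂P) ∧
    (∫⁻ ω, A ω ∂P) * ∫⁻ ω, F ω ∂P ≤ θ 0 * ∫⁻ ω, A ω * F ω ∂P
  rw [hdis', ← lintegral_mul_const _ hA]
  have hkm : Measurable fun ω => ∫⁻ η, F η ∂envCond P (Γ : Set (Site d)) ω :=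
    (hFm.comp measurable_snd).lintegral_kernel_prod_right'
  have hAk : Measurable fun ω => A ω * ∫⁻ η, F η ∂envCond P (Γ : Set (Site d)) ω := hA.mul hkm
  rw [← lintegral_const_mul _ (hA.mul_const _), ← lintegral_const_mul _ hAk]
  constructor <;> refine lintegral_mono_ae ?_ <;> filter_upwards [hle] with ω hω
  · calc _ ≤ A ω * (θ 0 * ∫⁻ η, F η ∂P) := by gcongr; exact hω.2
      _ = _ := by ring
  · calc _ ≤ A ω * (θ 0 * ∫⁻ η, F η ∂envCond P (Γ : Set (Site d)) ω) := by gcongr; exact hω.1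
      _ = _ := by ring

end BlockLaw

/-! ### The renewal equation and near independence of blocks -/

section BlockRenewal

variable {d : ℕ} [NeZero d] {P : Measure (Env d)} [IsProbabilityMeasure P] {κ c : ℝ} {L : ℕ}

/-- Bounds on the conditional laws which are good enough for the renewal equation. -/
structure GoodMix (P : Measure (Env d)) [IsFiniteMeasure P] (c : ℝ) (L : ℕ) (θ : ℕ → ℝ≥0∞)
    (ε : ℕ → ℝ) : Prop extends MixBound P c L θ where
  nonneg : ∀ m, 0 ≤ ε m
  le_quarter : ∀ m, ε m ≤ 1 / 4
  sum_le : ∀ N, ∑ m ∈ Finset.range N, 5 ^ m * ε m ≤ 1 / 2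
  sq_le : ∀ m, θ m ^ 2 ≤ ENNReal.ofReal (1 + ε m)

/-- Depth `(m+1)L` gives `θ m = exp(K q^(m+1))` with `q = e^{-aL}`, and `ε m = θ m ^ 2 - 1` is at
most `4K q^(m+1)`. For `L` large, `q ≤ 1/10` and `Kq ≤ 1/32`, so that `5^m ε m` is dominated by `⅛ ·
2^{-m}`. -/
lemma MixingCondition.exists_goodMix {r : ℝ} (hmix : MixingCondition P r) (c : ℝ) :
    ∃ L₀ : ℕ, ∀ L : ℕ, L₀ ≤ L → ∃ θ ε, GoodMix P c L θ ε := by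
  obtain ⟨K, a, hK, ha, h⟩ := hmix.ae_compare c
  have hlim : Tendsto (fun L : ℕ => Real.exp (-a * L)) atTop (𝓝 0) := by
    refine Real.tendsto_exp_atBot.comp ?_
    exact tendsto_natCast_atTop_atTop.const_mul_atTop_of_neg (by linarith)
  have hev : ∀ᶠ L : ℕ in atTop, Real.exp (-a * L) < min (1 / 10) (1 / (32 * (K + 1))) :=
    hlim.eventually_lt_const (by positivity)
  obtain ⟨L₁, hL₁⟩ := eventually_atTop.1 hev
  refine ⟨max L₁ (max 1 ⌈r⌉₊), fun L hL => ?_⟩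
  have hL1 : 1 ≤ L := by omega
  have hLr : r ≤ L := (Nat.le_ceil r).trans (Nat.cast_le.2 (by omega))
  have hq := hL₁ L (by omega)
  set q := Real.exp (-a * L) with hqdef
  have hq0 : 0 < q := Real.exp_pos _
  have hq10 : q ≤ 1 / 10 := (hq.trans_le (min_le_left _ _)).le
  have hKq : K * q ≤ 1 / 32 := by
    have h1 : q ≤ 1 / (32 * (K + 1)) := (hq.trans_le (min_le_right _ _)).le
    rw [le_div_iff₀ (by positivity)] at h1
    nlinarith
  have hexp : ∀ m : ℕ, Real.exp (-a * ((m + 1) * L : ℕ)) = q ^ (m + 1) := by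
    intro m
    rw [hqdef, ← Real.exp_nat_mul]
    congr 1; push_cast; ring
  set ε : ℕ → ℝ := fun m => Real.exp (2 * (K * q ^ (m + 1))) - 1 with hε
  have hx0 : ∀ m : ℕ, 0 ≤ K * q ^ (m + 1) := fun m => by positivity
  have hεle : ∀ m, ε m ≤ 4 * (K * q ^ (m + 1)) := by
    intro m
    have h1 : K * q ^ (m + 1) ≤ 1 / 32 := by
      rw [pow_succ]
      have : q ^ m ≤ 1 := pow_le_one₀ hq0.le (by linarith)
      nlinarith [mul_nonneg hK hq0.le]
    have h2 := Real.abs_exp_sub_one_le (x := 2 * (K * q ^ (m + 1)))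
      (by rw [abs_of_nonneg (by linarith [hx0 m])]; linarith)
    rw [abs_of_nonneg (by linarith [hx0 m] : 0 ≤ 2 * (K * q ^ (m + 1)))] at h2
    have := le_abs_self (Real.exp (2 * (K * q ^ (m + 1))) - 1)
    simp only [hε]
    linarith
  have hsum : ∀ N, ∑ m ∈ Finset.range N, 5 ^ m * ε m ≤ 1 / 4 := by
    intro N
    have h1 : ∀ m ∈ Finset.range N, 5 ^ m * ε m ≤ 1 / 8 * (1 / 2) ^ m := by
      intro m _
      have h5 : (5 * q) ^ m ≤ (1 / 2) ^ m :=
        pow_le_pow_left₀ (by positivity) (by linarith) m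
      have h5' : 0 ≤ (5 * q) ^ m := by positivity
      calc 5 ^ m * ε m ≤ 5 ^ m * (4 * (K * q ^ (m + 1))) := by gcongr; exact hεle m
        _ = 4 * (K * q) * (5 * q) ^ m := by rw [mul_pow, pow_succ]; ring
        _ ≤ 1 / 8 * (1 / 2) ^ m := mul_le_mul (by linarith) h5 h5' (by norm_num)
    refine (Finset.sum_le_sum h1).trans ?_
    rw [← Finset.mul_sum, geom_sum_eq (by norm_num)]
    have h0 : (0 : ℝ) ≤ (1 / 2) ^ N := by positivity
    have h2 : (((1 : ℝ) / 2) ^ N - 1) / (1 / 2 - 1) = 2 * (1 - (1 / 2) ^ N) := by ring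
    rw [h2]
    linarith
  have hε0 : ∀ m, 0 ≤ ε m := fun m => by
    have := Real.add_one_le_exp (2 * (K * q ^ (m + 1)))
    simp only [hε]; linarith [hx0 m]
  refine ⟨fun m => ENNReal.ofReal (Real.exp (K * q ^ (m + 1))), ε, ⟨hL1,
    fun m => ENNReal.ofReal_ne_top, fun m => by simp [Real.exp_pos], ?_⟩, hε0, fun m => ?_,
    fun N => (hsum N).trans (by norm_num), fun m => ?_⟩
  · intro b Γ ℓ m hb hΓ hΓb
    have hLm : L ≤ (m + 1) * L := Nat.le_mul_of_pos_left L (by omega)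
    have := h b Γ ℓ (L + 1) ((m + 1) * L) hb (by omega) (by omega) (by push_cast; linarith)
      (hLr.trans (Nat.cast_le.2 hLm)) hΓ hΓb
    rwa [hexp] at this
  · have h1 := hsum (m + 1)
    rw [Finset.sum_range_succ] at h1
    have h2 : 0 ≤ ∑ m ∈ Finset.range m, 5 ^ m * ε m :=
      Finset.sum_nonneg fun i _ => mul_nonneg (by positivity) (hε0 i)
    have h3 : (1 : ℝ) ≤ 5 ^ m := one_le_pow₀ (by norm_num)
    nlinarith [hε0 m]
  · rw [← ENNReal.ofReal_pow (Real.exp_pos _).le, ← Real.exp_nat_mul]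
    refine ENNReal.ofReal_le_ofReal (le_of_eq ?_)
    simp [hε]

lemma GoodMix.zero_sq_le {θ : ℕ → ℝ≥0∞} {ε : ℕ → ℝ} (h : GoodMix P c L θ ε) : θ 0 ^ 2 ≤ 2 := by
  refine (h.sq_le 0).trans ?_
  rw [show (2 : ℝ≥0∞) = ENNReal.ofReal 2 by simp]
  exact ENNReal.ofReal_le_ofReal (by linarith [h.le_quarter 0])

lemma flat_sites_level (w : List (Block d c L)) {y : Site d} (x : Site d)
    (hy : y ∈ wordSites (flat w) x) : y 0 + (L + 1 : ℕ) ≤ (x + wordDisp (flat w)) 0 := by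
  induction w using List.reverseRecOn with
  | nil => simp [wordSites] at hy
  | append_singleton w b ih =>
    rw [flat_append, ← Finset.mem_coe, wordSites_append] at hy
    rw [flat_append, wordDisp_append, ← add_assoc]
    simp only [flat_cons, flat_nil, List.append_nil] at hy ⊢
    rcases hy with hy | hy
    · have h1 := ih hy
      have h2 := b.2.disp_ge
      rw [Pi.add_apply]
      omega
    · exact b.2.sites_level hy

lemma blockProb_le_one (hell : UniformlyElliptic P κ)
    (hZ : letterLaw P κ (neverR c) ≠ 0) (w : List (Block d c L)) : blockProb P κ w ≤ 1 := by
  have := isProbabilityMeasure_letterLaw (P := P) hell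
  rw [← ENNReal.inv_mul_cancel hZ (measure_ne_top _ _), blockProb]
  gcongr
  exact fun s hs => mem_neverR_of_mem_blockEvent hs

/-- Both quantities are compared with the mean weight of `w` times the mean of the new block with
its survival. Each comparison costs a factor `θ 0`, and `θ 0 ^ 2 ≤ 2`. -/
lemma GoodMix.blockProb_append {θ : ℕ → ℝ≥0∞} {ε : ℕ → ℝ} (h : GoodMix P c L θ ε)
    (hstat : Stationary P) (hell : UniformlyElliptic P κ)
    (hZ : letterLaw P κ (neverR c) ≠ 0) (w : List (Block d c L)) (b : Block d c L) :
    blockProb P κ (w ++ [b]) ≤ 2 * (blockProb P κ w * blockProb P κ [b]) ∧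
    blockProb P κ w * blockProb P κ [b] ≤ 2 * blockProb P κ (w ++ [b]) := by
  have := isProbabilityMeasure_letterLaw (P := P) hell
  set Z := letterLaw P κ (neverR c) with hZdef
  have hZ' : Z ≠ ∞ := measure_ne_top _ _
  set A : Env d → ℝ≥0∞ := wordWeight κ (flat w) 0
  set x := wordDisp (flat w)
  have hA : Measurable A := measurable_wordWeight κ _ _
  have hAd := dependsOn_wordWeight κ (flat w) 0
  have hΓ : ∀ y ∈ wordSites (flat w) 0, y 0 + (L + 1 : ℕ) ≤ x 0 := fun y hy => by
    simpa using! flat_sites_level w 0 hy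
  have h1 := h.toMixBound.lintegral_mul_survive hstat hell hΓ hA hAd (π := b.1)
    (fun v hv => b.2.okWord_append hv)
  have h2 := h.toMixBound.lintegral_mul_survive hstat hell hΓ hA hAd (π := [])
    (fun v hv => hv)
  simp only [wordWeight, wordDisp_nil, add_zero, one_mul, lintegral_survive hstat hell] at h2
  have e1 : blockProb P κ (w ++ [b]) = Z⁻¹ *
      ∫⁻ ω, A ω * (wordWeight κ b.1 x ω * survive κ c (x + wordDisp b.1) ω) ∂P := by
    rw [blockProb_eq hstat hell _ 0]
    congr 1
    refine lintegral_congr fun ω => ?_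
    rw [flat_append, wordWeight_append, wordDisp_append]
    simp only [flat_cons, flat_nil, List.append_nil, zero_add, mul_assoc]
    rfl
  have e2 : blockProb P κ w = Z⁻¹ * ∫⁻ ω, A ω * survive κ c x ω ∂P := by
    rw [blockProb_eq hstat hell _ 0]; simp only [zero_add]; rfl
  have e3 : blockProb P κ [b] = Z⁻¹ *
      ∫⁻ ω, wordWeight κ b.1 x ω * survive κ c (x + wordDisp b.1) ω ∂P := by
    rw [blockProb_eq hstat hell _ x]
    simp only [flat_cons, flat_nil, List.append_nil]
    rfl
  rw [← hZdef] at h2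
  rw [e1, e2, e3]
  set I := ∫⁻ ω, A ω ∂P
  set F := ∫⁻ ω, wordWeight κ b.1 x ω * survive κ c (x + wordDisp b.1) ω ∂P
  set AF := ∫⁻ ω, A ω * (wordWeight κ b.1 x ω * survive κ c (x + wordDisp b.1) ω) ∂P
  set AH := ∫⁻ ω, A ω * survive κ c x ω ∂P
  have hsq := h.zero_sq_le
  have hzz : Z⁻¹ * Z = 1 := ENNReal.inv_mul_cancel hZ hZ'
  constructor
  · calc Z⁻¹ * AF ≤ Z⁻¹ * (θ 0 * (I * F)) := mul_le_mul_right h1.1 _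
      _ = Z⁻¹ * (Z⁻¹ * Z) * (θ 0 * (I * F)) := by rw [hzz, mul_one]
      _ = Z⁻¹ * Z⁻¹ * θ 0 * (I * Z) * F := by ring
      _ ≤ Z⁻¹ * Z⁻¹ * θ 0 * (θ 0 * AH) * F :=
        mul_le_mul_left (mul_le_mul_right h2.2 _) _
      _ = θ 0 ^ 2 * (Z⁻¹ * AH * (Z⁻¹ * F)) := by ring
      _ ≤ _ := by gcongr
  · calc Z⁻¹ * AH * (Z⁻¹ * F) ≤ Z⁻¹ * (θ 0 * (I * Z)) * (Z⁻¹ * F) :=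
        mul_le_mul_left (mul_le_mul_right h2.1 _) _
      _ = Z⁻¹ * (Z⁻¹ * Z) * θ 0 * (I * F) := by ring
      _ = Z⁻¹ * θ 0 * (I * F) := by rw [hzz, mul_one]
      _ ≤ Z⁻¹ * θ 0 * (θ 0 * AF) := mul_le_mul_right h1.2 _
      _ = θ 0 ^ 2 * (Z⁻¹ * AF) := by ring
      _ ≤ _ := by gcongr

/-- The equation determines `u w k` recursively from block probabilities, so it depends only on the
first `k` blocks of `w`; the separate solutions then fit into one function. -/
lemma GoodMix.exists_renewal_fun {θ : ℕ → ℝ≥0∞} {ε : ℕ → ℝ} (h : GoodMix P c L θ ε)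
    (hstat : Stationary P) (hell : UniformlyElliptic P κ)
    (hZ : letterLaw P κ (neverR c) ≠ 0) :
    ∃ U : List (Block d c L) → ℝ≥0∞, ∀ w, 1 ≤ w.length → blockProb P κ w =
      U w + 2⁻¹ * ∑ j ∈ Finset.Ico 1 w.length, U (w.take j) * blockProb P κ (w.drop j) := by
  have hex := fun w : List (Block d c L) => h.toMixBound.exists_renewal hstat hell hZ h.nonneg
    h.le_quarter h.sum_le h.sq_le w
  choose u hu using hex
  have key : ∀ k w, 1 ≤ k → k ≤ w.length → u w k = u (w.take k) k := by
    intro k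
    induction k using Nat.strong_induction_on with
    | _ k ih =>
      intro w hk1 hk
      have h1 := hu w k hk1 hk
      have h2 := hu (w.take k) k hk1 (by simp [hk])
      rw [List.take_take, min_self, h1] at h2
      have hs : ∑ j ∈ Finset.Ico 1 k, u w j * blockProb P κ ((w.take k).drop j) =
          ∑ j ∈ Finset.Ico 1 k, u (w.take k) j * blockProb P κ ((w.take k).drop j) := by
        refine Finset.sum_congr rfl fun j hj => ?_
        obtain ⟨hj1, hj2⟩ := Finset.mem_Ico.1 hj
        rw [ih j hj2 w hj1 (by omega), ih j hj2 (w.take k) hj1 (by simp; omega), List.take_take,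
          min_eq_left hj2.le]
      rw [hs] at h2
      refine (ENNReal.add_left_inj ?_).1 h2
      refine ne_top_of_le_ne_top ENNReal.one_ne_top (le_trans ?_ (blockProb_le_one hell hZ (w.take k)))
      rw [h1, hs]
      exact le_add_self
  refine ⟨fun w => u w w.length, fun w hw => ?_⟩
  have h1 := hu w w.length hw le_rfl
  rw [List.take_length] at h1
  rw [h1]
  congr 2
  refine Finset.sum_congr rfl fun j hj => ?_
  obtain ⟨hj1, hj2⟩ := Finset.mem_Ico.1 hj
  have h2 : (w.take j).length = j := by rw [List.length_take, min_eq_left hj2.le]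
  simp only [h2]
  rw [key j w hj1 hj2.le]

end BlockRenewal

/-! ### Fourier analysis on `ℤ^d` and a scalar recursion -/

section Fourier

variable {d : ℕ}

/-- The character `x ↦ e^{iθ·x}` of `ℤ^d`. -/
def character (θ : Fin d → ℝ) (x : Site d) : ℂ := Complex.exp ((∑ k, θ k * x k : ℝ) * Complex.I)

lemma norm_character (θ : Fin d → ℝ) (x : Site d) : ‖character θ x‖ = 1 :=
  Complex.norm_exp_ofReal_mul_I _

lemma character_add (θ : Fin d → ℝ) (x y : Site d) :
    character θ (x + y) = character θ x * character θ y := by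
  rw [character, character, character, ← Complex.exp_add, ← add_mul, ← Complex.ofReal_add,
    ← Finset.sum_add_distrib]
  simp [mul_add]

lemma character_eq_prod (θ : Fin d → ℝ) (x : Site d) :
    character θ x = ∏ k, Complex.exp ((θ k * x k : ℝ) * Complex.I) := by
  rw [character, ← Complex.exp_sum]
  congr 1
  push_cast
  rw [Finset.sum_mul]

lemma character_single (θ : Fin d → ℝ) (i : Fin d) :
    character θ (Pi.single i 1) = Complex.exp (θ i * Complex.I) := by
  rw [character]
  congr 2
  norm_cast
  rw [Finset.sum_eq_single i]
  · simp
  · intro j _ hj; simp [Pi.single_eq_of_ne hj]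
  · simp

lemma integrable_character (μ : Measure (Site d)) [IsFiniteMeasure μ] (θ : Fin d → ℝ) :
    Integrable (character θ) μ :=
  Integrable.of_bound (C := 1) (measurable_of_countable _).aestronglyMeasurable
    (ae_of_all _ fun x => (norm_character θ x).le)

lemma norm_integral_character_le (μ : Measure (Site d)) [IsFiniteMeasure μ] (θ : Fin d → ℝ) :
    ‖∫ x, character θ x ∂μ‖ ≤ μ.real Set.univ := by
  have := norm_integral_le_of_norm_le_const (μ := μ) (C := 1)
    (ae_of_all _ fun x => (norm_character θ x).le)
  simpa using this

lemma integral_character_conv (μ ν : Measure (Site d)) [IsFiniteMeasure μ] [IsFiniteMeasure ν]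
    (θ : Fin d → ℝ) : ∫ x, character θ x ∂(μ.conv ν) =
      (∫ x, character θ x ∂μ) * ∫ x, character θ x ∂ν := by
  rw [integral_conv (integrable_character _ θ)]
  simp [character_add, integral_const_mul, integral_mul_const]

lemma integral_exp_int_mul (m : ℤ) :
    ∫ t in Set.Ioc (-Real.pi) Real.pi, Complex.exp ((t * m : ℝ) * Complex.I) =
      if m = 0 then (2 * Real.pi : ℂ) else 0 := by
  have hpi := Real.pi_pos
  rw [← intervalIntegral.integral_of_le (by linarith)]
  split_ifs with h
  · subst h
    simp
    ring
  · have h1 : (fun t : ℝ => Complex.exp ((t * m : ℝ) * Complex.I)) =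
        fun t : ℝ => Complex.exp ((m * Complex.I) * t) := by
      ext t; push_cast; ring_nf
    rw [h1, integral_exp_mul_complex (by simp [h])]
    have h2 : Complex.exp (m * Complex.I * (Real.pi : ℝ)) =
        Complex.exp (m * Complex.I * (-Real.pi : ℝ)) := by
      rw [Complex.exp_eq_exp_iff_exists_int]
      exact ⟨m, by push_cast; ring⟩
    rw [h2, sub_self, zero_div]

/-- Lebesgue measure on the box `(-π, π]^d`. -/
def boxMeasure (d : ℕ) : Measure (Fin d → ℝ) :=
  Measure.pi fun _ => volume.restrict (Set.Ioc (-Real.pi) Real.pi)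

instance : IsFiniteMeasure (boxMeasure d) := by unfold boxMeasure; infer_instance

lemma ae_boxMeasure : ∀ᵐ θ ∂boxMeasure d, ∀ i, |θ i| ≤ Real.pi := by
  have h : boxMeasure d = (volume : Measure (Fin d → ℝ)).restrict
      (Set.univ.pi fun _ => Set.Ioc (-Real.pi) Real.pi) := by
    rw [volume_pi, Measure.restrict_pi_pi]; rfl
  rw [h]
  refine (ae_restrict_mem (MeasurableSet.univ_pi fun _ => measurableSet_Ioc)).mono fun θ hθ i => ?_
  have := hθ i trivial
  exact abs_le.2 ⟨this.1.le, this.2⟩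

lemma integral_boxMeasure_character (x : Site d) :
    ∫ θ, character θ x ∂boxMeasure d = if x = 0 then (2 * Real.pi : ℂ) ^ d else 0 := by
  simp only [character_eq_prod, boxMeasure]
  rw [integral_fintype_prod_eq_prod (fun k (t : ℝ) => Complex.exp ((t * x k : ℝ) * Complex.I))]
  simp only [integral_exp_int_mul]
  split_ifs with h
  · simp [h]
  · obtain ⟨k, hk⟩ := Function.ne_iff.1 h
    exact Finset.prod_eq_zero (Finset.mem_univ k) (if_neg hk)

lemma measurable_character : Measurable fun p : (Fin d → ℝ) × Site d => character p.1 p.2 := by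
  refine measurable_from_prod_countable_left fun x => ?_
  simp only [character]
  fun_prop

/-- Fourier inversion, with the modulus taken inside the integral. -/
lemma measure_singleton_le_integral (μ : Measure (Site d)) [IsFiniteMeasure μ] (x : Site d) :
    (2 * Real.pi) ^ d * μ.real {x} ≤ ∫ θ, ‖∫ z, character θ z ∂μ‖ ∂boxMeasure d := by
  have hint : Integrable (fun p : (Fin d → ℝ) × Site d => character p.1 (p.2 - x))
      ((boxMeasure d).prod μ) := by
    refine Integrable.of_bound (C := 1) ?_ (ae_of_all _ fun p => (norm_character _ _).le)
    exact (measurable_character.comp (measurable_fst.prodMk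
      ((measurable_of_countable fun z : Site d => z - x).comp measurable_snd))).aestronglyMeasurable
  have h1 : ∫ θ, ∫ z, character θ (z - x) ∂μ ∂boxMeasure d = (2 * Real.pi : ℂ) ^ d * μ.real {x} := by
    rw [integral_integral_swap hint]
    simp only [integral_boxMeasure_character, sub_eq_zero]
    have : (fun z => if z = x then (2 * Real.pi : ℂ) ^ d else 0) =
        Set.indicator {x} fun _ => (2 * Real.pi : ℂ) ^ d := by
      ext z; simp [Set.indicator_apply]
    rw [this, integral_indicator_const _ (measurableSet_singleton x)]
    simp [mul_comm]
  have h2 : ∀ θ : Fin d → ℝ, ‖∫ z, character θ (z - x) ∂μ‖ = ‖∫ z, character θ z ∂μ‖ := by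
    intro θ
    simp only [sub_eq_add_neg, character_add, integral_mul_const, norm_mul, norm_character, mul_one]
  have h3 := norm_integral_le_integral_norm (μ := boxMeasure d)
    (fun θ => ∫ z, character θ (z - x) ∂μ)
  rw [h1] at h3
  simp only [h2] at h3
  refine le_trans (le_of_eq ?_) h3
  rw [norm_mul, norm_pow, norm_mul]
  simp [abs_of_pos Real.pi_pos, abs_of_nonneg (measureReal_nonneg (μ := μ) (s := {x}))]

/-- With `x = t²/π²`, the squared modulus `2 + 2 cos t` is at most `4 - 4x`, hence at most `(2 -
x)²`. -/
lemma norm_one_add_exp_le {t : ℝ} (ht : |t| ≤ Real.pi) :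
    ‖1 + Complex.exp (t * Complex.I)‖ ≤ 2 - t ^ 2 / Real.pi ^ 2 := by
  have hpi := Real.pi_pos
  have h1 : ‖1 + Complex.exp (t * Complex.I)‖ ^ 2 = 2 + 2 * Real.cos t := by
    rw [← Complex.normSq_eq_norm_sq, Complex.normSq_apply]
    simp only [Complex.add_re, Complex.one_re, Complex.exp_ofReal_mul_I_re, Complex.add_im,
      Complex.one_im, Complex.exp_ofReal_mul_I_im]
    nlinarith [Real.sin_sq_add_cos_sq t]
  have h2 := Real.cos_le_one_sub_mul_cos_sq ht
  have h3 : t ^ 2 / Real.pi ^ 2 ≤ 1 := by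
    rw [div_le_one (by positivity)]; exact sq_le_sq' (abs_le.1 ht).1 (abs_le.1 ht).2
  refine abs_le_of_sq_le_sq' ?_ (by linarith) |>.2
  rw [h1]
  have : 2 / Real.pi ^ 2 * t ^ 2 = 2 * (t ^ 2 / Real.pi ^ 2) := by ring
  nlinarith [sq_nonneg (t ^ 2 / Real.pi ^ 2)]

/-- A mass `p` at each of the two neighbours contributes `p |1 + e^{iθ_i}|`, which falls short of
`2p` quadratically; everything else contributes at most its mass. -/
lemma norm_integral_character_le_of_two_points (μ : Measure (Site d)) [IsProbabilityMeasure μ]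
    {p : ℝ} (hp : 0 ≤ p) {x : Site d} {i : Fin d} (hx : p ≤ μ.real {x})
    (hx' : p ≤ μ.real {x + Pi.single i 1}) {θ : Fin d → ℝ} (hθ : |θ i| ≤ Real.pi) :
    ‖∫ z, character θ z ∂μ‖ ≤ 1 - p * (θ i ^ 2 / Real.pi ^ 2) := by
  set y := x + Pi.single i 1 with hy
  have hxy : x ≠ y := fun h => by
    have := congrFun h i
    simp [hy] at this
  set a := μ.real {x}
  set b := μ.real {y}
  have hab : μ.real ({x, y} : Set (Site d)) = a + b := by
    rw [Set.insert_eq, measureReal_union (by simpa using hxy) (measurableSet_singleton y)]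
  have hm : MeasurableSet ({x, y} : Set (Site d)) := (Set.toFinite _).measurableSet
  have hc : μ.real ({x, y} : Set (Site d))ᶜ = 1 - (a + b) := by
    rw [measureReal_compl hm, hab]; simp
  have h1 : ∫ z in ({x, y} : Set (Site d)), character θ z ∂μ =
      a * character θ x + b * character θ y := by
    rw [Set.insert_eq, setIntegral_union (by simpa using hxy) (measurableSet_singleton y)
      (integrable_character μ θ).integrableOn (integrable_character μ θ).integrableOn]
    simp [a, b, Measure.real]
  have h2 : ‖∫ z in ({x, y} : Set (Site d))ᶜ, character θ z ∂μ‖ ≤ 1 - (a + b) := by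
    have := norm_integral_character_le (μ.restrict ({x, y} : Set (Site d))ᶜ) θ
    rwa [measureReal_restrict_apply MeasurableSet.univ, Set.univ_inter, hc] at this
  have h3 : ‖(a : ℂ) * character θ x + b * character θ y‖ ≤
      p * (2 - θ i ^ 2 / Real.pi ^ 2) + (a - p) + (b - p) := by
    have e : (a : ℂ) * character θ x + b * character θ y =
        p * (character θ x * (1 + Complex.exp (θ i * Complex.I))) + (a - p : ℝ) * character θ x
          + (b - p : ℝ) * character θ y := by
      rw [hy, character_add, character_single]; push_cast; ring
    rw [e]
    refine (norm_add₃_le).trans ?_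
    simp only [norm_mul, norm_character, one_mul, mul_one, Complex.norm_real, Real.norm_eq_abs]
    rw [abs_of_nonneg hp, abs_of_nonneg (sub_nonneg.2 hx), abs_of_nonneg (sub_nonneg.2 hx')]
    gcongr
    exact norm_one_add_exp_le hθ
  rw [← integral_add_compl hm (integrable_character μ θ), h1]
  refine (norm_add_le _ _).trans ((add_le_add h3 h2).trans (le_of_eq ?_))
  ring

/-- A renewal inequality of geometric type: if all terms are at most `1 - s` at time `1`, then they
decay geometrically. -/
lemma renewal_decay {y : ℕ → ℝ} {s : ℝ} (hs0 : 0 ≤ s) (hs1 : s ≤ 1) (hy0 : ∀ n, 0 ≤ y n)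
    (hy1 : y 1 ≤ 1 - s)
    (hy : ∀ n, 2 ≤ n → y n ≤ (1 / 2) ^ (n - 1) + 1 / 2 * ((1 - s) * y (n - 1) +
      ∑ j ∈ Finset.Ico 2 n, (1 / 2) ^ (j - 1) * y (n - j))) {n : ℕ} (hn : 1 ≤ n) :
    y n ≤ (1 - s / 8) ^ n := by
  set l := 1 - s / 8 with hl
  have hl0 : 0 < l := by linarith
  -- The coefficient `1/2 + 3s/8` equals `l - (1 - s)/2`, just what the main induction leaves for
  -- these terms. The negative term is kept to make this induction close.
  have hS : ∀ n, 2 ≤ n → (1 / 2 : ℝ) ^ (n - 1) + 1 / 2 *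
      ∑ j ∈ Finset.Ico 2 n, (1 / 2) ^ (j - 1) * l ^ (n - j) ≤
        l ^ (n - 1) * (1 / 2 + 3 * s / 8) - s / 3 * (1 / 2) ^ n := by
    intro n hn
    induction n, hn using Nat.le_induction with
    | base => norm_num; nlinarith
    | succ n hn ih =>
      obtain ⟨m, rfl⟩ : ∃ m, n = m + 1 := ⟨n - 1, by omega⟩
      rw [Finset.sum_Ico_succ_top hn]
      have e : ∑ j ∈ Finset.Ico 2 (m + 1), (1 / 2 : ℝ) ^ (j - 1) * l ^ (m + 1 + 1 - j) =
          l * ∑ j ∈ Finset.Ico 2 (m + 1), (1 / 2 : ℝ) ^ (j - 1) * l ^ (m + 1 - j) := by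
        rw [Finset.mul_sum]
        refine Finset.sum_congr rfl fun j hj => ?_
        have := (Finset.mem_Ico.1 hj).2
        rw [show m + 1 + 1 - j = (m + 1 - j) + 1 by omega, pow_succ]; ring
      rw [e]
      simp only [Nat.add_sub_cancel, Nat.add_sub_cancel_left] at ih ⊢
      have h1 := mul_le_mul_of_nonneg_left ih hl0.le
      have hp : (0 : ℝ) < (1 / 2) ^ m := by positivity
      have h2 : 0 ≤ (1 - s) * (s * (1 / 2 : ℝ) ^ m) :=
        mul_nonneg (by linarith) (mul_nonneg hs0 hp.le)
      have e2 : (1 / 2 : ℝ) ^ (m + 1 + 1) = (1 / 2) ^ m * (1 / 4) := by ring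
      have e1 : (1 / 2 : ℝ) ^ (m + 1) = (1 / 2) ^ m * (1 / 2) := by ring
      rw [e1] at h1 ⊢
      rw [e2, pow_one, pow_succ l m]
      generalize (1 / 2 : ℝ) ^ m = h at *
      generalize l ^ m = t at *
      generalize ∑ j ∈ Finset.Ico 2 (m + 1), (1 / 2 : ℝ) ^ (j - 1) * l ^ (m + 1 - j) = T at *
      have e3 : l * h = h - s / 8 * h := by rw [hl]; ring
      have e4 : l * (s * h) = s * h - s * (s * h) / 8 := by rw [hl]; ring
      nlinarith
  induction n using Nat.strong_induction_on with
  | _ n ih =>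
    rcases Nat.lt_or_ge n 2 with h | h
    · obtain rfl : n = 1 := by omega
      rw [pow_one]; linarith
    · have h1 := hy n h
      have h2 := hS n h
      have h3 : ∑ j ∈ Finset.Ico 2 n, (1 / 2 : ℝ) ^ (j - 1) * y (n - j) ≤
          ∑ j ∈ Finset.Ico 2 n, (1 / 2 : ℝ) ^ (j - 1) * l ^ (n - j) := by
        refine Finset.sum_le_sum fun j hj => ?_
        obtain ⟨hj1, hj2⟩ := Finset.mem_Ico.1 hj
        exact mul_le_mul_of_nonneg_left (ih (n - j) (by omega) (by omega)) (by positivity)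
      have h4 := mul_le_mul_of_nonneg_left (ih (n - 1) (by omega) (by omega))
        (by linarith : 0 ≤ 1 - s)
      have h5 : l ^ n = l ^ (n - 1) * l := by rw [← pow_succ]; congr 1; omega
      have h6 : 0 ≤ s / 3 * (1 / 2 : ℝ) ^ n := by positivity
      rw [h5]
      have e : l ^ (n - 1) * l = l ^ (n - 1) * (1 / 2 + 3 * s / 8) +
        1 / 2 * ((1 - s) * l ^ (n - 1)) := by rw [hl]; ring
      rw [e]
      nlinarith

end Fourier

/-! ### The local limit bound -/

section LocalBound

variable {d : ℕ}

lemma integral_boxMeasure_gaussian_le {a : ℝ} (ha : 0 < a) :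
    ∫ θ, Real.exp (-a * ∑ i, θ i ^ 2) ∂boxMeasure d ≤ √(Real.pi / a) ^ d := by
  have h1 : ∀ θ : Fin d → ℝ, Real.exp (-a * ∑ i, θ i ^ 2) = ∏ i, Real.exp (-a * θ i ^ 2) := by
    intro θ
    rw [← Real.exp_sum, Finset.mul_sum]
  simp only [h1, boxMeasure]
  rw [integral_fintype_prod_eq_prod (fun _ (t : ℝ) => Real.exp (-a * t ^ 2))]
  have h2 : ∫ t in Set.Ioc (-Real.pi) Real.pi, Real.exp (-a * t ^ 2) ≤ √(Real.pi / a) := by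
    rw [← integral_gaussian]
    exact setIntegral_le_integral (integrable_exp_neg_mul_sq ha)
      (ae_of_all _ fun t => (Real.exp_pos _).le)
  refine (Finset.prod_le_prod (fun i _ => integral_nonneg fun t => (Real.exp_pos _).le)
    fun i _ => h2).trans ?_
  simp

/-- Total masses satisfy `u_n + ½ ∑_{1≤j<n} u_j = 1`, and subtracting consecutive equations gives
`u_{n+1} = u_n / 2`. So the first fresh start has a geometric distribution. -/
lemma renewal_mass {G U : ℕ → Measure (Site d)} (hG : ∀ n, 1 ≤ n → IsProbabilityMeasure (G n))
    (hU : ∀ n, 1 ≤ n → IsFiniteMeasure (U n))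
    (hren : ∀ n, 1 ≤ n → G n = U n +
      (2⁻¹ : ℝ≥0∞) • ∑ j ∈ Finset.Ico 1 n, (U j).conv (G (n - j))) {n : ℕ} (hn : 1 ≤ n) :
    (U n).real Set.univ = (1 / 2) ^ (n - 1) := by
  have hconv : ∀ n j, 1 ≤ n → j ∈ Finset.Ico 1 n →
      ((U j).conv (G (n - j))) Set.univ = U j Set.univ := by
    intro n j hn hj
    obtain ⟨hj1, hj2⟩ := Finset.mem_Ico.1 hj
    have := hG (n - j) (by omega)
    have := hU j hj1
    rw [Measure.conv, Measure.map_apply measurable_add MeasurableSet.univ, Set.preimage_univ,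
      ← Set.univ_prod_univ, Measure.prod_prod, measure_univ (μ := G (n - j)),
      mul_one]
  have key : ∀ n, 1 ≤ n →
      (U n).real Set.univ + 1 / 2 * ∑ j ∈ Finset.Ico 1 n, (U j).real Set.univ = 1 := by
    intro n hn
    have h1 := congrArg (fun μ : Measure (Site d) => μ Set.univ) (hren n hn)
    have := hG n hn
    have := hU n hn
    simp only [measure_univ, Measure.add_apply, Measure.smul_apply, Measure.coe_finsetSum,
      Finset.sum_apply, smul_eq_mul] at h1
    rw [Finset.sum_congr rfl fun j hj => hconv n j hn hj] at h1
    have h2 := congrArg ENNReal.toReal h1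
    have hf : ∀ j ∈ Finset.Ico 1 n, U j Set.univ ≠ ∞ := fun j hj => by
      have := hU j (Finset.mem_Ico.1 hj).1
      exact measure_ne_top _ _
    rw [ENNReal.toReal_add (measure_ne_top _ _)
      (ENNReal.mul_ne_top (by simp) (ENNReal.sum_ne_top.2 hf)), ENNReal.toReal_mul,
      ENNReal.toReal_sum hf] at h2
    simp only [ENNReal.toReal_one, ENNReal.toReal_inv, ENNReal.toReal_ofNat] at h2
    simp only [Measure.real]
    rw [one_div]
    exact h2.symm
  induction n, hn using Nat.le_induction with
  | base => simpa using key 1 le_rfl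
  | succ n hn ih =>
    have h1 := key n hn
    have h2 := key (n + 1) (by omega)
    rw [Finset.sum_Ico_succ_top hn] at h2
    obtain ⟨m, rfl⟩ : ∃ m, n = m + 1 := ⟨n - 1, by omega⟩
    simp only [Nat.add_sub_cancel] at ih ⊢
    rw [pow_succ]
    linarith

/-- The local limit bound for a renewal structure of geometric type. -/
theorem renewal_local_bound [NeZero d] {G U : ℕ → Measure (Site d)}
    (hG : ∀ n, 1 ≤ n → IsProbabilityMeasure (G n)) (hU : ∀ n, 1 ≤ n → IsFiniteMeasure (U n))
    (hren : ∀ n, 1 ≤ n → G n = U n +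
      (2⁻¹ : ℝ≥0∞) • ∑ j ∈ Finset.Ico 1 n, (U j).conv (G (n - j)))
    {p : ℝ} (hp : 0 < p)
    (hG1 : ∀ i, ∃ x, p ≤ (G 1).real {x} ∧ p ≤ (G 1).real {x + Pi.single i 1}) :
    ∃ C : ℝ, 0 < C ∧ ∀ n, 1 ≤ n → ∀ x,
      G n {x} ≤ ENNReal.ofReal (C * (n : ℝ) ^ (-(d : ℝ) / 2)) := by
  have hpi := Real.pi_pos
  have hd : (0 : ℝ) < d := by exact_mod_cast Nat.pos_of_ne_zero (NeZero.ne d)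
  have hG1' := hG 1 le_rfl
  have hp1 : p ≤ 1 := by
    obtain ⟨x, hx, -⟩ := hG1 0
    exact hx.trans measureReal_le_one
  set a := p / (8 * d * Real.pi ^ 2) with ha
  have ha0 : 0 < a := by positivity
  have hchar : ∀ θ : Fin d → ℝ, (∀ i, |θ i| ≤ Real.pi) → ∀ n, 1 ≤ n →
      ‖∫ z, character θ z ∂G n‖ ≤ Real.exp (-(n * a) * ∑ i, θ i ^ 2) := by
    intro θ hθ
    set s := p * (∑ i, θ i ^ 2) / (d * Real.pi ^ 2) with hs
    have hs0 : 0 ≤ s := by positivity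
    have hsum : ∑ i, θ i ^ 2 ≤ d * Real.pi ^ 2 := by
      refine (Finset.sum_le_sum fun i _ => sq_le_sq' (abs_le.1 (hθ i)).1 (abs_le.1 (hθ i)).2).trans ?_
      simp
    have hs1 : s ≤ 1 := by
      rw [hs, div_le_one (by positivity)]
      have : 0 ≤ ∑ i, θ i ^ 2 := by positivity
      nlinarith
    -- Average of the bounds for the `d` coordinate directions.
    have hy1 : ‖∫ z, character θ z ∂G 1‖ ≤ 1 - s := by
      have h1 : ∀ i, ‖∫ z, character θ z ∂G 1‖ ≤ 1 - p * (θ i ^ 2 / Real.pi ^ 2) := fun i => by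
        obtain ⟨x, hx, hx'⟩ := hG1 i
        exact norm_integral_character_le_of_two_points (G 1) hp.le hx hx' (hθ i)
      have h2 := Finset.sum_le_sum fun i (_ : i ∈ Finset.univ) => h1 i
      rw [Finset.sum_sub_distrib, ← Finset.mul_sum, ← Finset.sum_div] at h2
      simp only [Finset.sum_const, Finset.card_univ, Fintype.card_fin, nsmul_eq_mul, mul_one] at h2
      have h3 : d * s = p * ((∑ i, θ i ^ 2) / Real.pi ^ 2) := by
        rw [hs]; field_simp
      rw [← h3, ← mul_one_sub] at h2
      exact le_of_mul_le_mul_left h2 hd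
    have hU1 : ‖∫ z, character θ z ∂U 1‖ ≤ 1 - s := by
      have : G 1 = U 1 := by simpa using hren 1 le_rfl
      rwa [← this]
    have hrec : ∀ n, 2 ≤ n → ‖∫ z, character θ z ∂G n‖ ≤ (1 / 2) ^ (n - 1) + 1 / 2 *
        ((1 - s) * ‖∫ z, character θ z ∂G (n - 1)‖ +
        ∑ j ∈ Finset.Ico 2 n, (1 / 2) ^ (j - 1) * ‖∫ z, character θ z ∂G (n - j)‖) := by
      intro n hn
      have hfin : ∀ j ∈ Finset.Ico 1 n, IsFiniteMeasure (U j) ∧ IsFiniteMeasure (G (n - j)) := by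
        intro j hj
        obtain ⟨hj1, hj2⟩ := Finset.mem_Ico.1 hj
        have := hG (n - j) (by omega)
        exact ⟨hU j hj1, inferInstance⟩
      have hUn := hU n (by omega)
      have hint : ∀ j ∈ Finset.Ico 1 n, Integrable (character θ) ((U j).conv (G (n - j))) := by
        intro j hj
        have := (hfin j hj).1
        have := (hfin j hj).2
        exact integrable_character _ θ
      have e : ∫ z, character θ z ∂G n = (∫ z, character θ z ∂U n) + 1 / 2 *
          ∑ j ∈ Finset.Ico 1 n, (∫ z, character θ z ∂U j) * ∫ z, character θ z ∂G (n - j) := by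
        rw [hren n (by omega), integral_add_measure (integrable_character _ θ)
          ((integrable_finsetSum_measure.2 hint).smul_measure (by simp)), integral_smul_measure,
          integral_finsetSum_measure hint]
        have hs : ∀ j ∈ Finset.Ico 1 n, ∫ z, character θ z ∂((U j).conv (G (n - j))) =
            (∫ z, character θ z ∂U j) * ∫ z, character θ z ∂G (n - j) := fun j hj => by
          have := (hfin j hj).1
          have := (hfin j hj).2
          exact integral_character_conv _ _ θ
        rw [Finset.sum_congr rfl hs]
        simp
      have hUle : ∀ j, 1 ≤ j → ‖∫ z, character θ z ∂U j‖ ≤ (1 / 2) ^ (j - 1) := fun j hj => by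
        have := hU j hj
        exact (norm_integral_character_le (U j) θ).trans (renewal_mass hG hU hren hj).le
      -- The term `j = 1` keeps the gain `1 - s`, because `U 1 = G 1`; for all other terms the mass
      -- bound is enough.
      rw [e, Finset.sum_eq_sum_Ico_succ_bot (by omega : 1 < n)]
      refine (norm_add_le _ _).trans (add_le_add (hUle n (by omega)) ?_)
      rw [norm_mul]
      have : ‖(1 / 2 : ℂ)‖ = 1 / 2 := by norm_num
      rw [this]
      refine mul_le_mul_of_nonneg_left ((norm_add_le _ _).trans (add_le_add ?_ ?_)) (by norm_num)
      · rw [norm_mul]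
        exact mul_le_mul_of_nonneg_right hU1 (norm_nonneg _)
      · refine (norm_sum_le _ _).trans (Finset.sum_le_sum fun j hj => ?_)
        rw [norm_mul]
        exact mul_le_mul_of_nonneg_right (hUle j (by have := (Finset.mem_Ico.1 hj).1; omega))
          (norm_nonneg _)
    intro n hn
    refine (renewal_decay (y := fun n => ‖∫ z, character θ z ∂G n‖) hs0 hs1 (fun n => norm_nonneg _) hy1 hrec hn).trans ?_
    have h1 : 1 - s / 8 ≤ Real.exp (-(s / 8)) := by
      have := Real.add_one_le_exp (-(s / 8)); linarith
    refine (pow_le_pow_left₀ (by linarith) h1 n).trans (le_of_eq ?_)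
    rw [← Real.exp_nat_mul]
    congr 1
    rw [hs, ha]
    field_simp
  refine ⟨√(Real.pi / a) ^ d / (2 * Real.pi) ^ d, by positivity, fun n hn x => ?_⟩
  have hn0 : (0 : ℝ) < n := by exact_mod_cast hn
  have := hG n hn
  have h1 := measure_singleton_le_integral (G n) x
  have h2 : ∫ θ, ‖∫ z, character θ z ∂G n‖ ∂boxMeasure d ≤
      ∫ θ, Real.exp (-(n * a) * ∑ i, θ i ^ 2) ∂boxMeasure d := by
    refine integral_mono_of_nonneg (ae_of_all _ fun θ => norm_nonneg _) ?_ ?_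
    · refine Integrable.of_bound (C := 1)
        (Measurable.aestronglyMeasurable (by fun_prop)) (ae_of_all _ fun θ => ?_)
      rw [Real.norm_eq_abs, abs_of_pos (Real.exp_pos _), Real.exp_le_one_iff]
      have : 0 ≤ n * a * ∑ i, θ i ^ 2 := by positivity
      linarith
    · exact ae_boxMeasure.mono fun θ hθ => hchar θ hθ n hn
  have h3 := h1.trans (h2.trans (integral_boxMeasure_gaussian_le (mul_pos hn0 ha0)))
  rw [mul_comm, ← le_div_iff₀ (by positivity)] at h3
  refine (ENNReal.le_ofReal_iff_toReal_le (measure_ne_top _ _) (by positivity)).2 (h3.trans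
    (le_of_eq ?_))
  have h4 : √(Real.pi / (n * a)) = √(Real.pi / a) * (n : ℝ) ^ (-(1 : ℝ) / 2) := by
    rw [show Real.pi / (n * a) = Real.pi / a * (n : ℝ)⁻¹ by field_simp,
      Real.sqrt_mul (by positivity), Real.sqrt_eq_rpow (n : ℝ)⁻¹, Real.inv_rpow hn0.le,
      ← Real.rpow_neg hn0.le]
    norm_num
  rw [h4, mul_pow, ← Real.rpow_natCast ((n : ℝ) ^ (-(1 : ℝ) / 2)), ← Real.rpow_mul hn0.le]
  rw [show -(1 : ℝ) / 2 * d = -d / 2 by ring]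
  ring

end LocalBound

/-! ### Almost sure regeneration -/

section Regeneration

variable {d : ℕ} [NeZero d] {P : Measure (Env d)} [IsProbabilityMeasure P] {κ c : ℝ} {L : ℕ}

lemma Step.abs_vec_apply_le (e : Step d) (k : Fin d) : |e.vec k| ≤ 1 := by
  rw [Step.vec_apply]; split_ifs <;> simp

lemma walkOf_succ_le (s : ℕ → Letter d) (n : ℕ) : walkOf s (n + 1) 0 ≤ walkOf s n 0 + 1 := by
  rw [walkOf_succ, Pi.add_apply]
  have := (abs_le.1 (Step.abs_vec_apply_le (s n).1 0)).2
  omega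

lemma walkOf_le (s : ℕ → Letter d) (n : ℕ) : walkOf s n 0 ≤ n := by
  induction n with
  | zero => simp
  | succ n ih => have := walkOf_succ_le s n; push_cast; omega

/-- Going up `L` times with coins showing `1`. -/
def upWord (d : ℕ) [NeZero d] (L : ℕ) : List (Letter d) := List.replicate L ((0, true), true)

lemma mem_cyl_replicate {α : Type*} {n : ℕ} {a : α} {s : ℕ → α} :
    s ∈ cyl (List.replicate n a) ↔ ∀ t < n, s t = a := by
  rw [mem_cyl, List.length_replicate, List.eq_replicate_iff]
  simp [prefixWord]

@[simp] lemma length_upWord : (upWord d L).length = L := by simp [upWord]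

lemma wordDisp_upWord : wordDisp (upWord d L) 0 = L := by
  induction L with
  | zero => simp [upWord]
  | succ L ih =>
    rw [upWord, List.replicate_succ, wordDisp_cons, Pi.add_apply]
    rw [upWord] at ih
    rw [ih, Step.vec_apply]
    simp [add_comm]

lemma wordWeight_upWord (x : Site d) (ω : Env d) :
    wordWeight κ (upWord d L) x ω = ENNReal.ofReal (κ / 2) ^ L := by
  induction L generalizing x with
  | zero => simp [upWord, wordWeight]
  | succ L ih =>
    rw [upWord] at ih
    rw [upWord, List.replicate_succ, wordWeight, ih, pow_succ', letterWeight, if_pos rfl]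

/-- The words at the end of which the walk reaches the level `M` for the first time. -/
def HitWord (M : ℕ) (π : List (Letter d)) : Prop :=
  wordDisp π 0 = M ∧ ∀ t < π.length, wordDisp (π.take t) 0 < M

lemma attemptSeq_of_mem_cyl {M : ℕ} {π : List (Letter d)} (hπ : HitWord M π) {s : ℕ → Letter d}
    (hs : s ∈ cyl (π ++ upWord d L)) : AttemptSeq L s (π ++ upWord d L).length := by
  obtain ⟨h1, h2⟩ := mem_cyl_append.1 hs
  rw [upWord, mem_cyl_replicate] at h2
  rw [List.length_append, length_upWord]
  refine ⟨by omega, fun m hm => ?_, fun i hi hiL => ?_⟩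
  · rw [Nat.add_sub_cancel] at hm ⊢
    rw [walkOf_eq_wordDisp h1 hm.le, walkOf_eq_wordDisp h1 le_rfl, List.take_length, hπ.1]
    exact hπ.2 m hm
  · have e : s (π.length + L - i) = ((0, true), true) := by
      rw [← h2 (L - i) (by omega)]
      congr 1; omega
    refine ⟨?_, ?_⟩
    · simp only [coinsOf, e]
    · rw [walkOf_succ, e, add_sub_cancel_left]
      rfl

/-- The forced steps cost `(κ/2)^L` in every environment and lift the walk more than `L` above all
sites read by `π`; from there survival is independent of the past up to `θ 0`. -/
lemma letterLaw_cyl_upWord_ge {θ : ℕ → ℝ≥0∞} (hθ : MixBound P c L θ) (hstat : Stationary P)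
    (hell : UniformlyElliptic P κ) {M : ℕ} {π : List (Letter d)} (hπ : HitWord M π) :
    ENNReal.ofReal (κ / 2) ^ L * letterLaw P κ (neverR c) * (θ 0)⁻¹ * letterLaw P κ (cyl π) ≤
      letterLaw P κ (cyl (π ++ upWord d L) ∩ shiftSeq (π ++ upWord d L).length ⁻¹' neverR c) := by
  have hsites : ∀ y ∈ wordSites π 0,
      y 0 + (L + 1 : ℕ) ≤ (wordDisp π + wordDisp (upWord d L)) 0 := by
    intro y hy
    obtain ⟨t, a, h1, -, rfl⟩ := mem_wordSites.1 hy
    have ht := (List.getElem?_eq_some_iff.1 h1).1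
    have := hπ.2 t ht
    rw [zero_add, Pi.add_apply, wordDisp_upWord, hπ.1]
    push_cast
    omega
  have h := (hθ.lintegral_mul_survive hstat hell hsites (measurable_wordWeight κ π 0)
    (dependsOn_wordWeight κ π 0) (π := []) (fun v hv => hv)).2
  simp only [wordWeight, wordDisp_nil, add_zero, one_mul, lintegral_survive hstat hell] at h
  rw [letterLaw_cyl_neverR hstat hell, letterLaw_cyl hstat hell, wordDisp_append]
  simp only [wordWeight_append, wordWeight_upWord]
  have e : ∫⁻ ω, wordWeight κ π 0 ω * ENNReal.ofReal (κ / 2) ^ L *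
      survive κ c (wordDisp π + wordDisp (upWord d L)) ω ∂P =
      ENNReal.ofReal (κ / 2) ^ L * ∫⁻ ω, wordWeight κ π 0 ω *
        survive κ c (wordDisp π + wordDisp (upWord d L)) ω ∂P := by
    have hm : Measurable fun ω : Env d => wordWeight κ π 0 ω *
        survive κ c (wordDisp π + wordDisp (upWord d L)) ω := by fun_prop
    rw [← lintegral_const_mul _ hm]
    refine lintegral_congr fun ω => by ring
  rw [e]
  set I := ∫⁻ ω, wordWeight κ π 0 ω ∂P
  set Z := letterLaw P κ (neverR c)
  calc ENNReal.ofReal (κ / 2) ^ L * Z * (θ 0)⁻¹ * I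
      = ENNReal.ofReal (κ / 2) ^ L * ((θ 0)⁻¹ * (I * Z)) := by ring
    _ ≤ ENNReal.ofReal (κ / 2) ^ L * ((θ 0)⁻¹ * (θ 0 * _)) :=
        mul_le_mul_right (mul_le_mul_right h _) _
    _ = _ := by
        rw [← mul_assoc (θ 0)⁻¹, ENNReal.inv_mul_cancel (hθ.ne_zero 0) (hθ.ne_top 0), one_mul]

/-- Level `j` is visited at most `c(j+1)²` times, so the total time spent below `M` is bounded. -/
lemma finite_level_lt {s : ℕ → Letter d} (hs : s ∈ neverR c) (M : ℕ) :
    {t | walkOf s t 0 < M}.Finite := by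
  by_contra hinf
  rw [mem_neverR] at hs
  obtain ⟨K, hK⟩ := exists_nat_gt (∑ j ∈ Finset.range M, c * ((j : ℝ) + 1) ^ 2)
  obtain ⟨T, hT, hTK⟩ := Set.Infinite.exists_subset_card_eq hinf K
  obtain ⟨m, hm⟩ := T.exists_nat_subset_range
  have hmaps : ∀ i ∈ T, (walkOf s i 0).toNat ∈ Finset.range M := fun i hi => by
    have : walkOf s i 0 < M := hT hi
    have h0 := (hs i).level_le le_rfl
    simp only [walkOf_zero, Pi.zero_apply] at h0
    rw [Finset.mem_range]; omega
  have h1 := Finset.card_eq_sum_card_fiberwise hmaps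
  have h2 : ∀ j ∈ Finset.range M,
      ((T.filter fun i => (walkOf s i 0).toNat = j).card : ℝ) ≤ c * ((j : ℝ) + 1) ^ 2 := by
    intro j _
    refine le_trans (Nat.cast_le.2 (Finset.card_le_card fun i hi => ?_)) ((hs m).2 j)
    simp only [Finset.mem_filter, Finset.mem_range] at hi ⊢
    have h0 := (hs i).level_le le_rfl
    simp only [walkOf_zero, Pi.zero_apply, zero_add] at h0 ⊢
    have := Finset.mem_range.1 (hm hi.1)
    exact ⟨by omega, by omega⟩
  have h3 := Finset.sum_le_sum h2
  have h4 := congrArg (Nat.cast (R := ℝ)) h1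
  rw [Nat.cast_sum, hTK] at h4
  linarith

lemma exists_level_ge {s : ℕ → Letter d} (hs : s ∈ neverR c) (M : ℕ) :
    ∃ t, (M : ℤ) ≤ walkOf s t 0 := by
  by_contra! hlt
  exact Set.infinite_univ ((finite_level_lt hs M).subset fun t _ => hlt t)

lemma exists_hitWord {s : ℕ → Letter d} {M t : ℕ} (h : (M : ℤ) ≤ walkOf s t 0) :
    ∃ n, HitWord M (prefixWord s n) := by
  classical
  have hex : ∃ t, (M : ℤ) ≤ walkOf s t 0 := ⟨t, h⟩
  have hlt : ∀ t < Nat.find hex, walkOf s t 0 < M := fun t ht => not_le.1 (Nat.find_min hex ht)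
  have hge := Nat.find_spec hex
  set n := Nat.find hex
  refine ⟨n, ?_, fun t ht => ?_⟩
  · rcases Nat.eq_zero_or_pos n with h0 | h0
    · rw [h0] at hge ⊢
      simp only [walkOf_zero, Pi.zero_apply] at hge
      simp [prefixWord]; omega
    · obtain ⟨k, hk⟩ : ∃ k, n = k + 1 := ⟨n - 1, by omega⟩
      have h1 := hlt k (by omega)
      have h2 := walkOf_succ_le s k
      rw [← hk] at h2
      change walkOf s n 0 = M
      omega
  · rw [length_prefixWord] at ht
    rw [prefixWord_take s ht.le]
    exact hlt t ht

lemma HitWord.eq {M : ℕ} {π π' : List (Letter d)} (h : HitWord M π) (h' : HitWord M π')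
    {s : ℕ → Letter d} (hs : s ∈ cyl π) (hs' : s ∈ cyl π') : π = π' := by
  have key : ∀ {π π' : List (Letter d)}, HitWord M π → HitWord M π' → s ∈ cyl π → s ∈ cyl π' →
      π'.length ≤ π.length := by
    intro π π' h h' hs hs'
    by_contra! hlt
    have := h'.2 _ hlt
    rw [← walkOf_eq_wordDisp hs' hlt.le, walkOf_eq_wordDisp hs le_rfl, List.take_length, h.1] at this
    omega
  rw [← mem_cyl.1 hs, ← mem_cyl.1 hs', le_antisymm (key h h' hs hs') (key h' h hs' hs)]

lemma HitWord.le_length {M : ℕ} {π : List (Letter d)} (h : HitWord M π) : M ≤ π.length := by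
  have h1 := walkOf_le (extWord π) π.length
  rw [walkOf_eq_wordDisp (extWord_mem_cyl π) le_rfl, List.take_length, h.1] at h1
  omega

/-- The first hitting words of level `M` partition the sequences that reach `M`, so it suffices to
argue on each of them. -/
lemma measure_le_of_hitWord {μ ν : Measure (ℕ → Letter d)} (M : ℕ) {E F : Set (ℕ → Letter d)}
    (hE : ∀ s ∈ E, ∃ t, (M : ℤ) ≤ walkOf s t 0) (hF : MeasurableSet F)
    (h : ∀ π, HitWord M π → μ (E ∩ cyl π) ≤ ν (F ∩ cyl π)) : μ E ≤ ν F := by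
  have h1 : E ⊆ ⋃ π : {π : List (Letter d) // HitWord M π}, E ∩ cyl π.1 := by
    intro s hs
    obtain ⟨t, ht⟩ := hE s hs
    obtain ⟨n, hn⟩ := exists_hitWord ht
    exact Set.mem_iUnion.2 ⟨⟨_, hn⟩, hs, mem_cyl_prefixWord s n⟩
  have h2 : ν (⋃ π : {π : List (Letter d) // HitWord M π}, F ∩ cyl π.1) =
      ∑' π : {π : List (Letter d) // HitWord M π}, ν (F ∩ cyl π.1) := by
    refine measure_iUnion (fun π π' hne => ?_) fun π => hF.inter (measurableSet_cyl _)
    refine Set.disjoint_left.2 fun s hs hs' => hne (Subtype.ext ?_)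
    exact π.2.eq π'.2 hs.2 hs'.2
  refine (measure_mono h1).trans ((measure_iUnion_le _).trans ?_)
  refine (ENNReal.tsum_le_tsum fun π : {π : List (Letter d) // HitWord M π} => h π.1 π.2).trans ?_
  rw [← h2]
  exact measure_mono (Set.iUnion_subset fun π => Set.inter_subset_left)

lemma measurableSet_attemptSeq (L n : ℕ) : MeasurableSet {s : ℕ → Letter d | AttemptSeq L s n} := by
  have : {s : ℕ → Letter d | AttemptSeq L s n} =
      {s | prefixWord s n ∈ {π | ∃ s', AttemptSeq L s' n ∧ prefixWord s' n = π}} := by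
    ext s
    exact ⟨fun h => ⟨s, h, rfl⟩, fun ⟨s', h, h'⟩ => h.congr h'⟩
  rw [this]
  exact measurableSet_prefixWord n _

lemma measurableSet_regenSeq (c : ℝ) (L n : ℕ) :
    MeasurableSet {s : ℕ → Letter d | RegenSeq c L s n} := by
  have e : {s : ℕ → Letter d | RegenSeq c L s n} =
      {s | AttemptSeq L s n} ∩ shiftSeq n ⁻¹' neverR c := by
    ext s
    rw [Set.mem_inter_iff, Set.mem_preimage]
    exact Iff.rfl
  rw [e]
  exact (measurableSet_attemptSeq L n).inter (measurable_shiftSeq n (measurableSet_neverR c))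

/-- An argument in the manner of the zero-one law. On each first hitting of a level, immediate
regeneration has conditional probability at least `ρ`, so the event `N` of no regeneration fills at
most `1 - ρ` of every such cylinder, hence of every event. Taking the event to be `N` itself forces
`N` to be null. -/
lemma letterLaw_no_regen {θ : ℕ → ℝ≥0∞} (hθ : MixBound P c L θ) (hstat : Stationary P)
    (hell : UniformlyElliptic P κ) (hZ : letterLaw P κ (neverR c) ≠ 0) :
    letterLaw P κ {s | s ∈ neverR c ∧ ∀ n, ¬ RegenSeq c L s n} = 0 := by
  have := isProbabilityMeasure_letterLaw (P := P) hell
  have hNm : MeasurableSet {s : ℕ → Letter d | s ∈ neverR c ∧ ∀ n, ¬ RegenSeq c L s n} := by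
    have : {s : ℕ → Letter d | s ∈ neverR c ∧ ∀ n, ¬ RegenSeq c L s n} =
        neverR c ∩ ⋂ n, {s : ℕ → Letter d | RegenSeq c L s n}ᶜ := by ext; simp
    rw [this]
    exact (measurableSet_neverR c).inter
      (MeasurableSet.iInter fun n => (measurableSet_regenSeq c L n).compl)
  have hN1 : ∀ s ∈ {s : ℕ → Letter d | s ∈ neverR c ∧ ∀ n, ¬ RegenSeq c L s n}, s ∈ neverR c :=
    fun s hs => hs.1
  have hN2 : ∀ s ∈ {s : ℕ → Letter d | s ∈ neverR c ∧ ∀ n, ¬ RegenSeq c L s n},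
    ∀ n, ¬ RegenSeq c L s n := fun s hs => hs.2
  generalize {s : ℕ → Letter d | s ∈ neverR c ∧ ∀ n, ¬ RegenSeq c L s n} = N at *
  set ρ := ENNReal.ofReal (κ / 2) ^ L * letterLaw P κ (neverR c) * (θ 0)⁻¹ with hρ
  have hρ0 : ρ ≠ 0 := by
    have := hell.1
    refine mul_ne_zero (mul_ne_zero (pow_ne_zero _ ?_) hZ) (ENNReal.inv_ne_zero.2 (hθ.ne_top 0))
    simpa using this
  have hρt : ρ ≠ ∞ := ENNReal.mul_ne_top (ENNReal.mul_ne_top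
    (ENNReal.pow_ne_top ENNReal.ofReal_ne_top) (measure_ne_top _ _))
    (ENNReal.inv_ne_top.2 (hθ.ne_zero 0))
  have hhit : ∀ M π, HitWord M π → letterLaw P κ (N ∩ cyl π) ≤
      ((1 - ρ) • letterLaw P κ) (cyl π) := by
    intro M π hπ
    set B := cyl (π ++ upWord d L) ∩ shiftSeq (π ++ upWord d L).length ⁻¹' neverR c
    have hB : MeasurableSet B :=
      (measurableSet_cyl _).inter (measurable_shiftSeq _ (measurableSet_neverR c))
    have hdisj : Disjoint (N ∩ cyl π) B := by
      refine Set.disjoint_left.2 fun s hs hs' => hN2 s hs.1 _ ⟨attemptSeq_of_mem_cyl hπ hs'.1, hs'.2⟩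
    have h1 : letterLaw P κ (N ∩ cyl π) + letterLaw P κ B ≤ letterLaw P κ (cyl π) := by
      rw [← measure_union hdisj hB]
      exact measure_mono (Set.union_subset Set.inter_subset_right
        fun s hs => (mem_cyl_append.1 hs.1).1)
    have h2 := letterLaw_cyl_upWord_ge hθ hstat hell hπ
    rw [Measure.smul_apply, smul_eq_mul, ENNReal.sub_mul fun _ _ => measure_ne_top _ _, one_mul]
    exact ENNReal.le_sub_of_add_le_right (ENNReal.mul_ne_top hρt (measure_ne_top _ _))
      ((add_le_add_right h2 _).trans h1)
  have hcyl : ∀ π, 0 ≤ π.length →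
      ((letterLaw P κ).restrict N) (cyl π) ≤ ((1 - ρ) • letterLaw P κ) (cyl π) := by
    intro π _
    rw [Measure.restrict_apply (measurableSet_cyl π), Set.inter_comm]
    -- Reaching level `π.length + 1` takes more than `π.length` steps, so each hitting word either
    -- extends `π` or is incompatible with it.
    refine measure_le_of_hitWord (π.length + 1)
      (fun s hs => exists_level_ge (hN1 s hs.1) _) (measurableSet_cyl π) fun π' hπ' => ?_
    by_cases hpre : cyl π' ⊆ cyl π
    · rw [Set.inter_eq_self_of_subset_right hpre]
      exact (measure_mono (Set.inter_subset_inter_left _ Set.inter_subset_left)).trans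
        (hhit _ π' hπ')
    · have : N ∩ cyl π ∩ cyl π' = ∅ := by
        by_contra hne
        obtain ⟨s, ⟨-, hs⟩, hs'⟩ := Set.nonempty_iff_ne_empty.2 hne
        refine hpre fun s₁ hs₁ => ?_
        have hl := hπ'.le_length
        have h1 : prefixWord s₁ π'.length = prefixWord s π'.length := by
          rw [mem_cyl.1 hs₁, mem_cyl.1 hs']
        rw [mem_cyl, ← mem_cyl.1 hs, length_prefixWord, ← prefixWord_take s₁ (by omega : π.length ≤ π'.length),
          h1, prefixWord_take s (by omega)]
      rw [this, measure_empty]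
      exact zero_le
  have hfin : IsFiniteMeasure ((1 - ρ) • letterLaw P κ) :=
    Measure.smul_finite _ (ne_top_of_le_ne_top ENNReal.one_ne_top tsub_le_self)
  have h := measure_le_of_cyl 0 hcyl hNm
  rw [Measure.restrict_apply_self, Measure.smul_apply, smul_eq_mul] at h
  by_contra h0
  have hlt : 1 - ρ < 1 := ENNReal.sub_lt_self ENNReal.one_ne_top one_ne_zero hρ0
  have := ENNReal.mul_lt_mul_left h0 (measure_ne_top _ _) hlt
  rw [one_mul] at this
  exact absurd h (not_le.2 this)

end Regeneration

/-! ### Regeneration times and regeneration levels -/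

section RegenerationTimes

variable {d : ℕ} [NeZero d] {P : Measure (Env d)} [IsProbabilityMeasure P] {κ c : ℝ} {L : ℕ}

/-- If the last finite regeneration time is the `n`-th, the shifted sequence survives without
regenerating. There are countably many pasts, and each contributes a null event. -/
lemma letterLaw_regenTime_eq_top {θ : ℕ → ℝ≥0∞} (hθ : MixBound P c L θ) (hstat : Stationary P)
    (hell : UniformlyElliptic P κ) (hZ : letterLaw P κ (neverR c) ≠ 0) (n : ℕ) :
    letterLaw P κ {s | s ∈ neverR c ∧ regenTime c L s n = ⊤} = 0 := by
  induction n with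
  | zero =>
    have : {s : ℕ → Letter d | s ∈ neverR c ∧ regenTime c L s 0 = ⊤} = ∅ := by
      ext s; simp [regenTime]
    rw [this, measure_empty]
  | succ n ih =>
    have hm : MeasurableSet {s : ℕ → Letter d | s ∈ neverR c ∧ ∀ n, ¬ RegenSeq c L s n} := by
      have : {s : ℕ → Letter d | s ∈ neverR c ∧ ∀ n, ¬ RegenSeq c L s n} =
          neverR c ∩ ⋂ n, {s : ℕ → Letter d | RegenSeq c L s n}ᶜ := by ext; simp
      rw [this]
      exact (measurableSet_neverR c).inter
        (MeasurableSet.iInter fun n => (measurableSet_regenSeq c L n).compl)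
    have hN0 := letterLaw_no_regen hθ hstat hell hZ
    refine measure_mono_null (t := {s | s ∈ neverR c ∧ regenTime c L s n = ⊤} ∪
      ⋃ π : List (Letter d), cyl π ∩ shiftSeq π.length ⁻¹'
        {s | s ∈ neverR c ∧ ∀ n, ¬ RegenSeq c L s n}) ?_ (measure_union_null ih
      (measure_iUnion_null fun π => le_antisymm
        ((letterLaw_cyl_shift_le hstat hell π hm).trans hN0.le) zero_le))
    rintro s ⟨hs, h⟩
    by_cases htop : regenTime c L s n = ⊤
    · exact Or.inl ⟨hs, htop⟩
    · obtain ⟨m, hm⟩ := ENat.ne_top_iff_exists.1 htop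
      obtain ⟨w, -, hw⟩ := exists_blockEvent hs hm.symm
      obtain ⟨w', hw'l, hw'⟩ := exists_blockEvent hs hm.symm
      have e := regenTime_eq_of_mem_blockEvent hw'
      rw [hw'l, ← hm] at e
      have e : m = (flat w').length := by exact_mod_cast e
      refine Or.inr (Set.mem_iUnion.2 ⟨prefixWord s m, mem_cyl_prefixWord s m, ?_⟩)
      rw [Set.mem_preimage, length_prefixWord]
      refine ⟨by rw [e]; exact hw'.2, fun k hk => ?_⟩
      rw [regenTime, ← hm, restart, if_neg (ENat.natCast_ne_top m), ENat.toNat_natCast] at h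
      have : firstTime (RegenSeq c L (shiftSeq m s)) ≤ k := by
        rw [firstTime]; exact iInf₂_le k hk
      have h2 : firstTime (RegenSeq c L (shiftSeq m s)) ≠ ⊤ :=
        ne_top_of_le_ne_top (ENat.natCast_ne_top k) this
      exact (WithTop.add_ne_top.2 ⟨h2, ENat.natCast_ne_top m⟩) h

/-- Concatenation of lists of given lengths. -/
def appendEquiv (α : Type*) (j k : ℕ) :
    {a : List α // a.length = j} × {b : List α // b.length = k} ≃ {w : List α // w.length = j + k} where
  toFun p := ⟨p.1.1 ++ p.2.1, by simp [p.1.2, p.2.2]⟩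
  invFun w := ⟨⟨w.1.take j, by simp [w.2]⟩, ⟨w.1.drop j, by simp [w.2]⟩⟩
  left_inv p := by
    refine Prod.ext (Subtype.ext ?_) (Subtype.ext ?_)
    · exact List.take_left' p.1.2
    · exact List.drop_left' p.1.2
  right_inv w := Subtype.ext (List.take_append_drop j w.1)

/-- Almost surely a sequence that starts with `w` and survives has `n` further blocks, and these are
unique. -/
lemma tsum_blockProb_append {θ : ℕ → ℝ≥0∞} (hθ : MixBound P c L θ) (hstat : Stationary P)
    (hell : UniformlyElliptic P κ) (hZ : letterLaw P κ (neverR c) ≠ 0) (w : List (Block d c L))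
    (n : ℕ) : ∑' v : {v : List (Block d c L) // v.length = n}, blockProb P κ (w ++ v.1) =
      blockProb P κ w := by
  simp only [blockProb]
  rw [ENNReal.tsum_mul_left, ← measure_iUnion]
  · congr 1
    refine measure_congr ?_
    have h := letterLaw_regenTime_eq_top hθ hstat hell hZ (w.length + n)
    have h' : ∀ᵐ s ∂letterLaw P κ, ¬ (s ∈ neverR c ∧ regenTime c L s (w.length + n) = ⊤) := by
      rw [ae_iff]; simpa using h
    filter_upwards [h'] with s hs
    refine propext ⟨fun h1 => ?_, fun h1 => ?_⟩
    · obtain ⟨v, hv⟩ := Set.mem_iUnion.1 h1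
      exact blockEvent_append_subset _ _ hv
    · have hR := mem_neverR_of_mem_blockEvent h1
      have hne : regenTime c L s (w.length + n) ≠ ⊤ := fun h2 => hs ⟨hR, h2⟩
      obtain ⟨m, hm⟩ := ENat.ne_top_iff_exists.1 hne
      obtain ⟨u, hu, hsu⟩ := exists_blockEvent hR hm.symm
      have e : u.take w.length ++ u.drop w.length = u := List.take_append_drop _ _
      rw [← e] at hsu
      have e2 : u.take w.length = w := eq_of_mem_blockEvent (blockEvent_append_subset _ _ hsu) h1
        (by simp [hu])
      refine Set.mem_iUnion.2 ⟨⟨u.drop w.length, by simp [hu]⟩, ?_⟩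
      rwa [e2] at hsu
  · intro v v' hne
    refine Set.disjoint_left.2 fun s hs hs' => hne (Subtype.ext ?_)
    have := eq_of_mem_blockEvent hs hs' (by simp [v.2, v'.2])
    exact List.append_cancel_left this
  · exact fun v => measurableSet_blockEvent _

lemma blockProb_nil (hell : UniformlyElliptic P κ) (hZ : letterLaw P κ (neverR c) ≠ 0) :
    blockProb P κ ([] : List (Block d c L)) = 1 := by
  have := isProbabilityMeasure_letterLaw (P := P) hell
  rw [blockProb]
  have : blockEvent ([] : List (Block d c L)) = neverR c := by
    ext s
    simp [blockEvent, cyl, prefixWord]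
  rw [this]
  exact ENNReal.inv_mul_cancel hZ (measure_ne_top _ _)

lemma tsum_blockProb {θ : ℕ → ℝ≥0∞} (hθ : MixBound P c L θ) (hstat : Stationary P)
    (hell : UniformlyElliptic P κ) (hZ : letterLaw P κ (neverR c) ≠ 0) (n : ℕ) :
    ∑' v : {v : List (Block d c L) // v.length = n}, blockProb P κ v.1 = 1 := by
  have := tsum_blockProb_append hθ hstat hell hZ [] n
  rwa [blockProb_nil hell hZ] at this

/-- A walk that stays within one unit of full speed visits level `0` once and every other level at
most twice, and `2 ≤ c(j+1)²` for `j ≥ 1`. -/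
lemma okUpTo_of_level {X : Walk d} {m : ℕ} (hc : 1 ≤ c)
    (h : ∀ t, 1 ≤ t → t ≤ m →
      X 0 0 + 1 ≤ X t 0 ∧ X 0 0 + t ≤ X t 0 + 1 ∧ X t 0 ≤ X 0 0 + t) : OkUpTo c X m := by
  refine ⟨fun n hn hnm => by have := h n hn hnm; omega, fun j => ?_⟩
  rcases Nat.eq_zero_or_pos j with rfl | hj
  · have : visits X m 0 ≤ 1 := by
      refine (Finset.card_le_card (t := {0}) fun i hi => ?_).trans (by simp)
      simp only [Finset.mem_filter, Finset.mem_range, Finset.mem_singleton] at hi ⊢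
      by_contra h0
      have := h i (by omega) (by omega)
      have := hi.2
      push_cast at this
      omega
    have : (visits X m 0 : ℝ) ≤ 1 := by exact_mod_cast this
    push_cast
    linarith
  · have : visits X m j ≤ 2 := by
      refine (Finset.card_le_card (t := {j, j + 1}) fun i hi => ?_).trans Finset.card_le_two
      simp only [Finset.mem_filter, Finset.mem_range, Finset.mem_singleton,
        Finset.mem_insert] at hi ⊢
      rcases Nat.eq_zero_or_pos i with rfl | hi0
      · omega
      · have := h i hi0 (by omega)
        omega
    have h2 : (visits X m j : ℝ) ≤ 2 := by exact_mod_cast this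
    have hj1 : (1 : ℝ) ≤ j := by exact_mod_cast hj
    nlinarith

lemma okUpTo_upWord {s : ℕ → Letter d} (hc : 1 ≤ c) (hs : s ∈ cyl (upWord d L)) :
    OkUpTo c (walkOf s) L := by
  refine okUpTo_of_level hc fun t ht htL => ?_
  have : walkOf s t 0 = t := by
    rw [walkOf_eq_wordDisp hs (by simpa using htL), upWord, List.take_replicate, min_eq_left htL]
    exact wordDisp_upWord
  rw [walkOf_zero, this]
  simp only [Pi.zero_apply]
  omega

lemma RegenSeq.shiftSeq {s : ℕ → Letter d} {n m : ℕ} (h : RegenSeq c L s m) (hn : n ≤ m - L) :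
    RegenSeq c L (shiftSeq n s) (m - n) := by
  obtain ⟨⟨h1, h2, h3⟩, h4⟩ := h
  have key : ∀ i, walkOf s (n + i) = walkOf s n + walkOf (RWRE.shiftSeq n s) i :=
    fun i => walkOf_add s n i
  refine ⟨⟨by omega, fun i hi => ?_, fun i hi hiL => ?_⟩, ?_⟩
  · have e1 := congrFun (key i) 0
    have e2 := congrFun (key (m - n - L)) 0
    have := h2 (n + i) (by omega)
    rw [show n + (m - n - L) = m - L by omega] at e2
    simp only [Pi.add_apply] at e1 e2
    omega
  · obtain ⟨h5, h6⟩ := h3 i hi hiL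
    have e1 := key (m - n - i)
    have e2 := key (m - n - i + 1)
    rw [show n + (m - n - i) = m - i by omega] at e1
    rw [show n + (m - n - i + 1) = m - i + 1 by omega] at e2
    refine ⟨?_, ?_⟩
    · simp only [coinsOf, RWRE.shiftSeq] at h5 ⊢
      rwa [show n + (m - n - i) = m - i by omega]
    · rw [e1, e2, add_sub_add_left_eq_sub] at h6
      exact h6
  · rwa [shiftSeq_shiftSeq, Nat.add_sub_cancel' (by omega)]

/-- The walk regenerates at the level `M`. -/
def regenAtLevel (c : ℝ) (L M : ℕ) : Set (ℕ → Letter d) :=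
  neverR c ∩ ⋃ n, {s | RegenSeq c L s n} ∩ {s | walkOf s n 0 = M}

lemma measurableSet_regenAtLevel (c : ℝ) (L M : ℕ) :
    MeasurableSet (regenAtLevel c L M : Set (ℕ → Letter d)) := by
  refine (measurableSet_neverR c).inter (MeasurableSet.iUnion fun n =>
    (measurableSet_regenSeq c L n).inter ?_)
  exact measurableSet_eq_fun ((measurable_pi_apply 0).comp
    ((measurable_pi_apply n).comp measurable_walkOf)) measurable_const

/-- A surviving path reaches level `M`; inserting the forced steps at that moment, followed by
survival, regenerates at level `M + L` at a fixed cost, whatever `M` is. -/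
lemma letterLaw_regenAtLevel_ge {θ : ℕ → ℝ≥0∞} (hθ : MixBound P c L θ) (hstat : Stationary P)
    (hell : UniformlyElliptic P κ) (M : ℕ) :
    ENNReal.ofReal (κ / 2) ^ L * letterLaw P κ (neverR c) * (θ 0)⁻¹ * letterLaw P κ (neverR c) ≤
      letterLaw P κ (regenAtLevel c L (M + L)) := by
  set ρ := ENNReal.ofReal (κ / 2) ^ L * letterLaw P κ (neverR c) * (θ 0)⁻¹
  refine measure_le_of_hitWord (μ := ρ • letterLaw P κ) M (fun s hs => exists_level_ge hs M)
    (measurableSet_regenAtLevel c L _) fun π hπ => ?_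
  rw [Measure.smul_apply, smul_eq_mul]
  by_cases hok : OkWord c π
  · refine (mul_le_mul_right (measure_mono Set.inter_subset_right) _).trans
      ((letterLaw_cyl_upWord_ge hθ hstat hell hπ).trans (measure_mono fun s hs => ?_))
    obtain ⟨h1, h2⟩ := mem_cyl_append.1 hs.1
    have hA := attemptSeq_of_mem_cyl hπ hs.1
    have hreg : RegenSeq c L s (π ++ upWord d L).length := ⟨hA, hs.2⟩
    have hok1 := (okWord_iff h1).1 hok
    have hok2 : OkUpTo c (walkOf s) (π ++ upWord d L).length := by
      rw [List.length_append, length_upWord]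
      refine OkUpTo.concat (fun i hi => ?_) hok1 ?_
      · rw [walkOf_eq_wordDisp h1 hi.le, walkOf_eq_wordDisp h1 le_rfl, List.take_length, hπ.1]
        exact hπ.2 i hi
      · rw [okUpTo_shiftPath_walkOf]
        exact okUpTo_upWord hok1.one_le h2
    refine ⟨⟨neverR_of_attempt hok2 hreg, Set.mem_iUnion.2 ⟨_, hreg, ?_⟩⟩, h1⟩
    rw [Set.mem_ofPred_eq, walkOf_eq_wordDisp hs.1 le_rfl, List.take_length, wordDisp_append,
      Pi.add_apply, wordDisp_upWord, hπ.1]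
    push_cast
    rfl
  · have : neverR c ∩ cyl π = ∅ := by
      by_contra hne
      obtain ⟨s, hs, hs'⟩ := Set.nonempty_iff_ne_empty.2 hne
      exact hok ((okWord_iff hs').2 (mem_neverR.1 hs _))
    rw [this, measure_empty, mul_zero]
    exact zero_le

-- An attempt that ends at level `(j+1)L` starts at level `jL`. A regeneration already counted, at
-- level at most `jL`, is not later than that start, so the attempt remains a regeneration of the
-- shifted path. Hence every good level accounts for a further regeneration.
open scoped Classical in
lemma regenTime_card_le {s : ℕ → Letter d} (hs : s ∈ neverR c) (J : ℕ) :
    ∃ n : ℕ, regenTime c L s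
      ((Finset.range J).filter fun j => s ∈ regenAtLevel c L (j * L + L)).card = n ∧
        walkOf s n 0 ≤ (J * L : ℕ) := by
  induction J with
  | zero => exact ⟨0, rfl, by simp⟩
  | succ J ih =>
    obtain ⟨n, hn, hnl⟩ := ih
    rw [Finset.range_add_one, Finset.filter_insert]
    split_ifs with hJ
    · rw [Finset.card_insert_of_notMem (by simp), regenTime, hn, restart,
        if_neg (ENat.natCast_ne_top n), ENat.toNat_natCast]
      obtain ⟨-, hJ⟩ := hJ
      obtain ⟨n', hreg, hlev⟩ := Set.mem_iUnion.1 hJ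
      rw [Set.mem_ofPred_eq] at hlev
      have hA : AttemptSeq L s n' := hreg.1
      have hend := hA.level_end
      -- After the start of the attempt the walk is strictly above that level, whereas at time `n`
      -- it is not.
      have hle : n ≤ n' - L := by
        by_contra! hlt
        have h1 : walkOf s (n' - L) 0 < walkOf s n 0 := by
          rcases le_or_gt n n' with h | h
          · have := hA.level (i := n - (n' - L)) (by omega)
            rw [Nat.add_sub_cancel' hlt.le] at this
            omega
          · have h2 := (mem_neverR.1 hreg.2 (n - n')).1 (n - n') (by omega) le_rfl
            have h3 := walkOf_add s n' (n - n')
            rw [Nat.add_sub_cancel' h.le] at h3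
            have h4 := congrFun h3 0
            rw [Pi.add_apply] at h4
            change walkOf (fun t => s (n' + t)) 0 0 < walkOf (fun t => s (n' + t)) (n - n') 0 at h2
            rw [walkOf_zero, Pi.zero_apply] at h2
            omega
        push_cast at *
        omega
      have hL := hA.1
      have hreg' := hreg.shiftSeq hle
      obtain ⟨k, hk, hkle⟩ : ∃ k : ℕ, firstTime (RegenSeq c L (shiftSeq n s)) = k ∧ k ≤ n' - n := by
        have h1 : firstTime (RegenSeq c L (shiftSeq n s)) ≤ (n' - n : ℕ) := by
          rw [firstTime]; exact iInf₂_le _ hreg'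
        obtain ⟨k, hk⟩ := ENat.ne_top_iff_exists.1 (ne_top_of_le_ne_top (ENat.natCast_ne_top _) h1)
        exact ⟨k, hk.symm, by rw [← hk] at h1; exact_mod_cast h1⟩
      refine ⟨k + n, by rw [hk]; push_cast; rfl, ?_⟩
      rcases (show k + n ≤ n' by omega).eq_or_lt with h | h
      · rw [h, hlev]; push_cast; linarith
      · have := hA.record h
        rw [hlev] at this
        push_cast at *
        linarith
    · exact ⟨n, hn, hnl.trans (by push_cast; nlinarith)⟩

end RegenerationTimes

/-! ### Positive speed and positive probability of survival -/

section Speed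

variable {d : ℕ} [NeZero d] {P : Measure (Env d)} [IsProbabilityMeasure P] {κ c v : ℝ} {L : ℕ}

lemma tendsto_of_mem_neverR {s : ℕ → Letter d} (hs : s ∈ neverR c) :
    Tendsto (fun n => walkOf s n 0) atTop atTop := by
  refine tendsto_atTop.2 fun b => ?_
  obtain ⟨m, hm⟩ := (finite_level_lt hs b.toNat).bddAbove
  filter_upwards [eventually_gt_atTop m] with n hn
  by_contra! hlt
  have : n ≤ m := hm (show walkOf s n 0 < (b.toNat : ℤ) by omega)
  omega

lemma measurableSet_transient :
    MeasurableSet {X : Walk d | Tendsto (fun n => X n 0) atTop atTop} := by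
  have : {X : Walk d | Tendsto (fun n => X n 0) atTop atTop} =
      ⋂ b : ℤ, ⋃ N : ℕ, ⋂ n : ℕ, ⋂ _ : N ≤ n, {X : Walk d | b ≤ X n 0} := by
    ext X
    simp [tendsto_atTop, eventually_atTop]
  rw [this]
  refine MeasurableSet.iInter fun b => MeasurableSet.iUnion fun N => MeasurableSet.iInter fun n =>
    MeasurableSet.iInter fun _ => measurableSet_le measurable_const ?_
  exact (measurable_pi_apply 0).comp (measurable_pi_apply n)

lemma eventually_linear {s : ℕ → Letter d} (hv : 0 < v)
    (h : Tendsto (fun n : ℕ => (walkOf s n 0 : ℝ) / n) atTop (𝓝 v)) :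
    ∃ m : ℕ, ∀ n, m ≤ n → n * (v / 2) < (walkOf s n 0 : ℝ) := by
  have h1 := (h.eventually (lt_mem_nhds (by linarith : v / 2 < v))).and (eventually_gt_atTop 0)
  obtain ⟨m, hm⟩ := eventually_atTop.1 h1
  refine ⟨m, fun n hn => ?_⟩
  obtain ⟨h2, h3⟩ := hm n hn
  have h3 : (0 : ℝ) < n := by exact_mod_cast h3
  rw [lt_div_iff₀ h3] at h2
  linarith

lemma IsVelocity.ae_tendsto (hv : IsVelocity P v) (hstat : Stationary P)
    (hell : UniformlyElliptic P κ) : ∀ᵐ s ∂letterLaw P κ,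
      Tendsto (fun n => walkOf s n 0) atTop atTop →
        Tendsto (fun n : ℕ => (walkOf s n 0 : ℝ) / n) atTop (𝓝 v) := by
  have h := hv.1
  rw [annealed_eq_map hstat hell] at h
  exact ae_of_ae_map measurable_walkOf.aemeasurable h

/-- After the last time at level `≤ 0` the path stays strictly above, and linear growth allows only
`O(j + 1)` visits to height `j`. -/
lemma exists_neverR_of_linear {s : ℕ → Letter d} (hv : 0 < v) {m : ℕ}
    (h : ∀ n, m ≤ n → n * (v / 2) < (walkOf s n 0 : ℝ)) :
    ∃ k C : ℕ, 0 < C ∧ shiftSeq k s ∈ neverR (C : ℝ) := by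
  have hfin : {t | walkOf s t 0 ≤ 0}.Finite := by
    refine (Set.finite_lt_nat m).subset fun t ht => ?_
    by_contra hlt
    have h1 := h t (not_lt.1 hlt)
    have h2 : (walkOf s t 0 : ℝ) ≤ 0 := by exact_mod_cast ht
    have : (0 : ℝ) ≤ t * (v / 2) := by positivity
    linarith
  obtain ⟨k, hk, hmax⟩ := hfin.exists_maximal ⟨0, by simp⟩
  have hk : walkOf s k 0 ≤ 0 := hk
  have hafter : ∀ t, k < t → 0 < walkOf s t 0 := fun t ht => by
    by_contra! hle
    have := hmax hle ht.le
    omega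
  have hadd : ∀ i, walkOf s (k + i) 0 = walkOf s k 0 + walkOf (shiftSeq k s) i 0 := fun i =>
    congrFun (walkOf_add s k i) 0
  obtain ⟨C, hC⟩ := exists_nat_ge ((m : ℝ) + 1 + 2 / v)
  have hC0 : (0 : ℝ) < C := lt_of_lt_of_le (by positivity) hC
  refine ⟨k, C, by exact_mod_cast hC0, mem_neverR.2 fun M => ⟨fun n hn _ => ?_, fun j => ?_⟩⟩
  · rw [walkOf_zero, Pi.zero_apply]
    have := hafter (k + n) (by omega)
    rw [hadd] at this
    omega
  · set B := ⌊(m : ℝ) + 2 * j / v⌋₊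
    have hsub : visits (walkOf (shiftSeq k s)) M j ≤ B + 1 := by
      rw [← Finset.card_range (B + 1)]
      refine Finset.card_le_card fun i hi => ?_
      simp only [Finset.mem_filter, walkOf_zero, Pi.zero_apply, zero_add] at hi
      rw [Finset.mem_range, Nat.lt_succ_iff]
      refine Nat.le_floor ?_
      rcases le_or_gt m i with hi' | hi'
      · have h1 := h (k + i) (by omega)
        have h2 := hadd i
        rw [hi.2] at h2
        have h3 : (walkOf s (k + i) 0 : ℝ) ≤ j := by
          have : walkOf s (k + i) 0 ≤ j := by omega
          exact_mod_cast this
        have h4 : (i : ℝ) ≤ 2 * j / v := by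
          rw [le_div_iff₀ hv]
          push_cast at h1
          have : (0 : ℝ) ≤ k * (v / 2) := by positivity
          linarith
        have : (0 : ℝ) ≤ m := by positivity
        linarith
      · have h1 : (i : ℝ) ≤ m := by exact_mod_cast hi'.le
        have : (0 : ℝ) ≤ 2 * j / v := by positivity
        linarith
    have h1 : (visits (walkOf (shiftSeq k s)) M j : ℝ) ≤ B + 1 := by exact_mod_cast hsub
    have h2 : (B : ℝ) ≤ m + 2 * j / v := Nat.floor_le (by positivity)
    have h3 : 2 * (j : ℝ) / v = j * (2 / v) := by ring
    have h4 : 0 < 2 / v := by positivity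
    have hj : (0 : ℝ) ≤ j := by positivity
    have hm : (0 : ℝ) ≤ m := by positivity
    calc (visits (walkOf (shiftSeq k s)) M j : ℝ) ≤ m + j * (2 / v) + 1 := by linarith
      _ ≤ C * ((j : ℝ) + 1) := by nlinarith
      _ ≤ C * ((j : ℝ) + 1) ^ 2 := by
        nlinarith [mul_nonneg hC0.le hj, mul_nonneg (mul_nonneg hC0.le hj) hj]

/-- Were all survival events null, so would be the countable union over constants and initial words.
By linear growth this union contains almost all transient paths, which have positive probability
because `v ≠ 0`. -/
lemma IsVelocity.exists_neverR (hv : IsVelocity P v) (hvpos : 0 < v) (hstat : Stationary P)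
    (hell : UniformlyElliptic P κ) :
    ∃ C : ℕ, 0 < C ∧ letterLaw P κ (neverR (C : ℝ)) ≠ 0 := by
  by_contra! hnull
  have h1 : annealed P {X | Tendsto (fun n => X n 0) atTop atTop} ≠ 0 := fun h => by
    have := hv.2 h; linarith
  rw [annealed_eq_map hstat hell, Measure.map_apply measurable_walkOf measurableSet_transient] at h1
  refine h1 (measure_mono_null_ae (t := ⋃ C : {C : ℕ // 0 < C}, ⋃ π : List (Letter d),
    cyl π ∩ shiftSeq π.length ⁻¹' neverR ((C.1 : ℕ) : ℝ)) ?_ ?_)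
  · filter_upwards [hv.ae_tendsto hstat hell] with s hs hsA
    obtain ⟨m, hm⟩ := eventually_linear hvpos (hs hsA)
    obtain ⟨k, C, hC, hk⟩ := exists_neverR_of_linear hvpos hm
    refine Set.mem_iUnion.2 ⟨⟨C, hC⟩, Set.mem_iUnion.2 ⟨prefixWord s k, mem_cyl_prefixWord s k, ?_⟩⟩
    rwa [Set.mem_preimage, length_prefixWord]
  · refine measure_iUnion_null fun C => measure_iUnion_null fun π => le_antisymm ?_ zero_le
    exact (letterLaw_cyl_shift_le hstat hell π (measurableSet_neverR _)).trans (hnull C.1 C.2).le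

end Speed

/-! ### Generating functions of the regeneration times -/

section FiniteMean

variable {d : ℕ} [NeZero d] {P : Measure (Env d)} [IsProbabilityMeasure P] {κ c v : ℝ} {L : ℕ}

/-- The generating function of the position in time of the `n`-th regeneration. -/
def genFun (P : Measure (Env d)) (κ c : ℝ) (L : ℕ) (z : ℝ≥0∞) (n : ℕ) : ℝ≥0∞ :=
  ∑' w : {w : List (Block d c L) // w.length = n}, blockProb P κ w.1 * z ^ (flat w.1).length

/-- Write `z^ℓ = 1 - (1 - z^ℓ)` for the length `ℓ` of the new block; near independence bounds the
subtracted term from below by half of its independent value. -/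
lemma genFun_succ_le {θ : ℕ → ℝ≥0∞} {ε : ℕ → ℝ} (h : GoodMix P c L θ ε) (hstat : Stationary P)
    (hell : UniformlyElliptic P κ) (hZ : letterLaw P κ (neverR c) ≠ 0) {z : ℝ≥0∞} (hz : z ≤ 1)
    (n : ℕ) : genFun P κ c L z (n + 1) +
      2⁻¹ * (∑' b : {b : List (Block d c L) // b.length = 1},
        blockProb P κ b.1 * (1 - z ^ (flat b.1).length)) * genFun P κ c L z n ≤
      genFun P κ c L z n := by
  set ψ := ∑' b : {b : List (Block d c L) // b.length = 1},
    blockProb P κ b.1 * (1 - z ^ (flat b.1).length)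
  have key : ∀ w : List (Block d c L),
      (∑' b : {b : List (Block d c L) // b.length = 1},
        blockProb P κ (w ++ b.1) * z ^ (flat b.1).length) + 2⁻¹ * ψ * blockProb P κ w ≤
        blockProb P κ w := by
    intro w
    have h1 : 2⁻¹ * ψ * blockProb P κ w ≤ ∑' b : {b : List (Block d c L) // b.length = 1},
        blockProb P κ (w ++ b.1) * (1 - z ^ (flat b.1).length) := by
      rw [show 2⁻¹ * ψ * blockProb P κ w = 2⁻¹ * blockProb P κ w * ψ by ring, ← ENNReal.tsum_mul_left]
      refine ENNReal.tsum_le_tsum fun b => ?_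
      obtain ⟨b, hb⟩ := b
      obtain ⟨b, rfl⟩ := List.length_eq_one_iff.1 hb
      rw [← mul_assoc]
      refine mul_le_mul_left ?_ _
      rw [mul_assoc]
      refine (mul_le_mul_right (h.blockProb_append hstat hell hZ w b).2 _).trans (le_of_eq ?_)
      rw [← mul_assoc, ENNReal.inv_mul_cancel two_ne_zero ENNReal.ofNat_ne_top, one_mul]
    refine (add_le_add_right h1 _).trans (le_of_eq ?_)
    rw [← ENNReal.tsum_add, ← tsum_blockProb_append h.toMixBound hstat hell hZ w 1]
    refine tsum_congr fun b => ?_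
    rw [← mul_add, add_tsub_cancel_of_le (pow_le_one' hz _), mul_one]
  have e : genFun P κ c L z (n + 1) = ∑' w : {w : List (Block d c L) // w.length = n},
      (∑' b : {b : List (Block d c L) // b.length = 1},
        blockProb P κ (w.1 ++ b.1) * z ^ (flat b.1).length) * z ^ (flat w.1).length := by
    rw [genFun, ← (appendEquiv (Block d c L) n 1).tsum_eq, ENNReal.tsum_prod']
    refine tsum_congr fun w => ?_
    rw [← ENNReal.tsum_mul_right]
    refine tsum_congr fun b => ?_
    change blockProb P κ (w.1 ++ b.1) * z ^ (flat (w.1 ++ b.1)).length = _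
    rw [flat_append, List.length_append, pow_add]
    ring
  rw [e]
  simp only [genFun]
  rw [← ENNReal.tsum_mul_left, ← ENNReal.tsum_add]
  refine ENNReal.tsum_le_tsum fun w => ?_
  rw [← mul_assoc, ← add_mul]
  exact mul_le_mul_left (key w.1) _

/-- The one-step contraction telescopes, starting from `genFun` at `0`, which is at most `1`. -/
lemma sum_genFun_le {θ : ℕ → ℝ≥0∞} {ε : ℕ → ℝ} (h : GoodMix P c L θ ε) (hstat : Stationary P)
    (hell : UniformlyElliptic P κ) (hZ : letterLaw P κ (neverR c) ≠ 0) {z : ℝ≥0∞} (hz : z ≤ 1)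
    (n : ℕ) : 2⁻¹ * (∑' b : {b : List (Block d c L) // b.length = 1},
        blockProb P κ b.1 * (1 - z ^ (flat b.1).length)) *
      ∑ k ∈ Finset.range n, genFun P κ c L z k ≤ 1 := by
  set ψ := ∑' b : {b : List (Block d c L) // b.length = 1},
    blockProb P κ b.1 * (1 - z ^ (flat b.1).length)
  have key : genFun P κ c L z n + 2⁻¹ * ψ * ∑ k ∈ Finset.range n, genFun P κ c L z k ≤
      genFun P κ c L z 0 := by
    induction n with
    | zero => simp
    | succ n ih =>
      refine le_trans ?_ ih
      rw [Finset.sum_range_succ, mul_add, add_comm (2⁻¹ * ψ * _), ← add_assoc]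
      exact add_le_add_left (genFun_succ_le h hstat hell hZ hz n) _
  refine (le_add_self.trans key).trans ?_
  rw [genFun, ← tsum_blockProb h.toMixBound hstat hell hZ 0]
  exact ENNReal.tsum_le_tsum fun w => mul_le_of_le_one_right' (pow_le_one' hz _)

/-- The function `z ^ τ_k` of the path, as a sum over lists of `k` blocks. -/
def blockSum (c : ℝ) (L : ℕ) (z : ℝ≥0∞) (k : ℕ) (s : ℕ → Letter d) : ℝ≥0∞ :=
  ∑' w : {w : List (Block d c L) // w.length = k},
    (blockEvent w.1).indicator (fun _ => z ^ (flat w.1).length) s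

lemma measurable_blockSum {z : ℝ≥0∞} (k : ℕ) : Measurable (blockSum (d := d) c L z k) :=
  Measurable.tsum fun w => measurable_const.indicator (measurableSet_blockEvent w.1)

lemma lintegral_tsum_indicator {α ι : Type*} [MeasurableSpace α] [Countable ι] (μ : Measure α)
    {A : ι → Set α} (hA : ∀ i, MeasurableSet (A i)) (a : ι → ℝ≥0∞) :
    ∫⁻ s, ∑' i, (A i).indicator (fun _ => a i) s ∂μ = ∑' i, a i * μ (A i) := by
  rw [lintegral_tsum fun i => (measurable_const.indicator (hA i)).aemeasurable]
  exact tsum_congr fun i => lintegral_indicator_const (hA i) _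

lemma lintegral_blockSum (hell : UniformlyElliptic P κ) (hZ : letterLaw P κ (neverR c) ≠ 0)
    {z : ℝ≥0∞} (k : ℕ) : ∫⁻ s, blockSum c L z k s ∂letterLaw P κ =
      letterLaw P κ (neverR c) * genFun P κ c L z k := by
  have := isProbabilityMeasure_letterLaw (P := P) hell
  have hZ' : letterLaw P κ (neverR c) ≠ ∞ := measure_ne_top _ _
  have h := lintegral_tsum_indicator (letterLaw P κ)
    (fun w : {w : List (Block d c L) // w.length = k} => measurableSet_blockEvent w.1)
    (fun w => z ^ (flat w.1).length)
  refine h.trans ?_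
  rw [genFun, ← ENNReal.tsum_mul_left]
  refine tsum_congr fun w => ?_
  rw [blockProb, mul_comm (z ^ _), ← mul_assoc, ← mul_assoc, ENNReal.mul_inv_cancel hZ hZ', one_mul]

-- On `H` the path is above level `JL` from time `m` on. If `N` of the levels up to `JL` are
-- regeneration levels, the `N`-th regeneration therefore occurs before `m`, and each of `z^{τ_0},
-- …, z^{τ_N}` is at least `z^m`.
open scoped Classical in
lemma le_sum_genFun (hell : UniformlyElliptic P κ) (hZ : letterLaw P κ (neverR c) ≠ 0) {z : ℝ≥0∞}
    (hz : z ≤ 1) (J m : ℕ) {H : Set (ℕ → Letter d)} (hHm : MeasurableSet H)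
    (hH : ∀ s ∈ H, ∀ n, m ≤ n → ((J * L : ℕ) : ℤ) < walkOf s n 0) :
    z ^ m * ∑ j ∈ Finset.range J, letterLaw P κ (regenAtLevel c L (j * L + L) ∩ H) ≤
      letterLaw P κ (neverR c) * ∑ k ∈ Finset.range (J + 1), genFun P κ c L z k := by
  have := isProbabilityMeasure_letterLaw (P := P) hell
  have hZ' : letterLaw P κ (neverR c) ≠ ∞ := measure_ne_top _ _
  have e1 : letterLaw P κ (neverR c) * ∑ k ∈ Finset.range (J + 1), genFun P κ c L z k =
      ∫⁻ s, ∑ k ∈ Finset.range (J + 1), blockSum c L z k s ∂letterLaw P κ := by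
    have hk : ∀ k, Measurable (blockSum (d := d) c L z k) ∧
        ∫⁻ s, blockSum c L z k s ∂letterLaw P κ = letterLaw P κ (neverR c) * genFun P κ c L z k :=
      fun k => ⟨measurable_blockSum k, lintegral_blockSum hell hZ k⟩
    rw [Finset.mul_sum, lintegral_finsetSum (Finset.range (J + 1)) fun (k : ℕ) _ => (hk k).1]
    exact Finset.sum_congr rfl fun k _ => (hk k).2.symm
  have e2 : z ^ m * ∑ j ∈ Finset.range J, letterLaw P κ (regenAtLevel c L (j * L + L) ∩ H) =
      ∫⁻ s, ∑ j ∈ Finset.range J,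
        (regenAtLevel c L (j * L + L) ∩ H).indicator (fun _ => z ^ m) s ∂letterLaw P κ := by
    have hm : ∀ j, MeasurableSet (regenAtLevel c L (j * L + L) ∩ H) :=
      fun j => (measurableSet_regenAtLevel c L _).inter hHm
    rw [lintegral_finsetSum _ fun j _ => measurable_const.indicator (hm j), Finset.mul_sum]
    exact Finset.sum_congr rfl fun j _ => (lintegral_indicator_const (hm j) _).symm
  rw [e1, e2]
  refine lintegral_mono fun s => ?_
  by_cases hs : s ∈ neverR c ∩ H
  · obtain ⟨n, hn, hlev⟩ := regenTime_card_le (L := L) hs.1 J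
    set N := ((Finset.range J).filter fun j => s ∈ regenAtLevel c L (j * L + L)).card with hN
    have hNJ : N ≤ J := (Finset.card_filter_le _ _).trans (by simp)
    have hnm : n < m := by
      by_contra! hle
      have := hH s hs.2 n hle
      omega
    obtain ⟨w, hw, hsw⟩ := exists_blockEvent hs.1 hn
    have hlen := regenTime_eq_of_mem_blockEvent hsw
    rw [hw, hn] at hlen
    have hlen : n = (flat w).length := by exact_mod_cast hlen
    have h1 : ∑ j ∈ Finset.range J, (regenAtLevel c L (j * L + L) ∩ H).indicator
        (fun _ => z ^ m) s = N * z ^ m := by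
      rw [hN, Finset.card_filter, Nat.cast_sum, Finset.sum_mul]
      refine Finset.sum_congr rfl fun j _ => ?_
      by_cases hj : s ∈ regenAtLevel c L (j * L + L)
      · rw [Set.indicator_of_mem (Set.mem_inter hj hs.2), if_pos hj]; simp
      · rw [Set.indicator_of_notMem fun h' => hj h'.1, if_neg hj]; simp
    have h2 : ∀ k ∈ Finset.range (N + 1), z ^ m ≤ blockSum c L z k s := by
      intro k hk
      have hk : k ≤ N := Nat.lt_succ_iff.1 (Finset.mem_range.1 hk)
      have hmem : s ∈ blockEvent (w.take k) := by
        refine blockEvent_append_subset (w.take k) (w.drop k) ?_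
        rwa [List.take_append_drop]
      refine le_trans ?_ (ENNReal.le_tsum ⟨w.take k, by simp [hw, hk]⟩)
      rw [Set.indicator_of_mem hmem]
      refine pow_le_pow_right_of_le_one' hz ?_
      have : (flat w).length = (flat (w.take k)).length + (flat (w.drop k)).length := by
        rw [← List.length_append, ← flat_append, List.take_append_drop]
      change (flat (w.take k)).length ≤ m
      omega
    rw [h1]
    calc (N : ℝ≥0∞) * z ^ m ≤ ∑ k ∈ Finset.range (N + 1), z ^ m := by
          rw [Finset.sum_const, Finset.card_range, nsmul_eq_mul]
          gcongr
          exact N.le_succ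
      _ ≤ _ := (Finset.sum_le_sum h2).trans
          (Finset.sum_le_sum_of_subset (Finset.range_mono (by omega)))
  · have h0 : ∑ j ∈ Finset.range J, (regenAtLevel c L (j * L + L) ∩ H).indicator
        (fun _ => z ^ m) s = 0 := by
      refine Finset.sum_eq_zero fun j _ => Set.indicator_of_notMem (fun h' => hs ⟨h'.1.1, h'.2⟩) _
    rw [h0]
    exact zero_le

end FiniteMean

/-! ### Finiteness of the mean regeneration time -/

section FiniteMean

variable {d : ℕ} [NeZero d] {P : Measure (Env d)} [IsProbabilityMeasure P] {κ c v : ℝ} {L : ℕ}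

lemma measurableSet_walkOf_gt (v : ℝ) (m : ℕ) :
    MeasurableSet {s : ℕ → Letter d | ∀ n, m ≤ n → n * v < (walkOf s n 0 : ℝ)} := by
  have : {s : ℕ → Letter d | ∀ n, m ≤ n → n * v < (walkOf s n 0 : ℝ)} =
      ⋂ n : ℕ, ⋂ _ : m ≤ n, {s | n * v < (walkOf s n 0 : ℝ)} := by ext; simp
  rw [this]
  refine MeasurableSet.iInter fun n => MeasurableSet.iInter fun _ =>
    measurableSet_lt measurable_const ?_
  have h : Measurable fun s : ℕ → Letter d => walkOf s n 0 := (measurable_pi_apply 0).comp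
    ((measurable_pi_apply n).comp measurable_walkOf)
  exact (measurable_of_countable fun z : ℤ => (z : ℝ)).comp h

lemma tendsto_measure_not_linear {μ : Measure (ℕ → Letter d)} [IsFiniteMeasure μ]
    {A : Set (ℕ → Letter d)} (hA : MeasurableSet A)
    (h : ∀ᵐ s ∂μ, s ∈ A → ∃ m : ℕ, ∀ n, m ≤ n → n * v < (walkOf s n 0 : ℝ)) :
    Tendsto (fun m => μ (A \ {s | ∀ n, m ≤ n → n * v < (walkOf s n 0 : ℝ)})) atTop (𝓝 0) := by
  have h1 := tendsto_measure_iInter_atTop (μ := μ)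
    (s := fun m : ℕ => A \ {s | ∀ n, m ≤ n → n * v < (walkOf s n 0 : ℝ)})
    (fun m => (hA.diff (measurableSet_walkOf_gt v m)).nullMeasurableSet)
    (fun m m' hmm s hs => ⟨hs.1, fun h' => hs.2 fun n hn => h' n (hmm.trans hn)⟩)
    ⟨0, measure_ne_top _ _⟩
  have h2 : μ (⋂ m : ℕ, A \ {s | ∀ n, m ≤ n → n * v < (walkOf s n 0 : ℝ)}) = 0 := by
    rw [measure_eq_zero_iff_ae_notMem]
    filter_upwards [h] with s hs hmem
    rw [Set.mem_iInter] at hmem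
    obtain ⟨m, hm⟩ := hs (hmem 0).1
    exact (hmem m).2 hm
  rwa [h2] at h1

/-- Bernoulli's inequality gives `1 - (J/(J+1))^m ≥ m/(J+m)`, which is at least `m/(2J)` since `m ≤
J`. -/
lemma half_div_le {J m : ℕ} (hJ : 0 < J) (hm : m ≤ J) :
    (m : ℝ) ≤ 2 * J * (1 - ((J : ℝ) / (J + 1)) ^ m) := by
  have hJ0 : (0 : ℝ) < J := by exact_mod_cast hJ
  have hmJ : (m : ℝ) ≤ J := by exact_mod_cast hm
  have h1 : 1 + m * (1 / (J : ℝ)) ≤ (1 + 1 / J) ^ m := one_add_mul_le_pow (by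
    have : (0 : ℝ) < 1 / J := by positivity
    linarith) m
  have h2 : ((J : ℝ) / (J + 1)) ^ m * (1 + 1 / J) ^ m = 1 := by
    rw [← mul_pow]
    have : (J : ℝ) / (J + 1) * (1 + 1 / J) = 1 := by field_simp
    rw [this, one_pow]
  set y := ((J : ℝ) / (J + 1)) ^ m with hy
  have hy0 : 0 < y := by positivity
  have h3 : y * (1 + m * (1 / (J : ℝ))) ≤ 1 := by
    exact (mul_le_mul_of_nonneg_left h1 hy0.le).trans h2.le
  have h4 : y * (J + m) ≤ J := by
    have : y * (1 + m * (1 / (J : ℝ))) * J = y * (J + m) := by field_simp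
    nlinarith
  have hm0 : (0 : ℝ) ≤ m := by positivity
  have h5 : m * (J + m) ≤ 2 * J * (1 - y) * (J + m) := by nlinarith
  exact le_of_mul_le_mul_right h5 (by positivity)

lemma exp_le_div_pow {J : ℕ} (hJ : 0 < J) (a : ℕ) :
    Real.exp (-a) ≤ ((J : ℝ) / (J + 1)) ^ (a * J) := by
  have hJ0 : (0 : ℝ) < J := by exact_mod_cast hJ
  have h1 : (J : ℝ) / (J + 1) = (1 + 1 / (J : ℝ))⁻¹ := by field_simp
  have h2 := Real.add_one_le_exp (1 / (J : ℝ))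
  rw [h1, inv_pow, Real.exp_neg]
  refine inv_anti₀ (by positivity) ?_
  calc (1 + 1 / (J : ℝ)) ^ (a * J) ≤ Real.exp (1 / J) ^ (a * J) :=
        pow_le_pow_left₀ (by positivity) (by linarith) _
    _ = Real.exp a := by
        rw [← Real.exp_nat_mul]; congr 1; push_cast; field_simp

/-- With `z = J/(J+1)`, the sum of the generating functions up to `J` is at least a multiple of `J`
by the regeneration levels and the speed, and at most `2 / E(1 - z^τ)`. So `J E(1 - z^τ)` is
bounded, and it dominates truncations of `Eτ`. -/
theorem tsum_length_lt_top {θ : ℕ → ℝ≥0∞} {ε : ℕ → ℝ} (h : GoodMix P c L θ ε)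
    (hstat : Stationary P) (hell : UniformlyElliptic P κ)
    (hZ : letterLaw P κ (neverR c) ≠ 0) (hv : IsVelocity P v) (hvpos : 0 < v) :
    ∑' b : {b : List (Block d c L) // b.length = 1}, blockProb P κ b.1 * (flat b.1).length < ∞ := by
  have := isProbabilityMeasure_letterLaw (P := P) hell
  have hκ := hell.1
  set Q := letterLaw P κ
  set Z := Q (neverR c) with hZdef
  set ρ := ENNReal.ofReal (κ / 2) ^ L * Z * (θ 0)⁻¹ with hρ
  have hρ0 : ρ ≠ 0 := mul_ne_zero (mul_ne_zero (pow_ne_zero _ (by simpa using hκ)) hZ)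
    (ENNReal.inv_ne_zero.2 (h.ne_top 0))
  have hZ' : Z ≠ ∞ := measure_ne_top _ _
  have hρ' : ρ ≠ ∞ := ENNReal.mul_ne_top (ENNReal.mul_ne_top
    (ENNReal.pow_ne_top ENNReal.ofReal_ne_top) hZ') (ENNReal.inv_ne_top.2 (h.ne_zero 0))
  -- Half of the bound for regeneration at a given level; the other half is given up for paths that
  -- are not yet above the linear barrier.
  set η := ρ * Z / 2 with hη
  have hη0 : η ≠ 0 := ENNReal.div_ne_zero.2 ⟨mul_ne_zero hρ0 hZ, ENNReal.ofNat_ne_top⟩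
  have hη' : η ≠ ∞ := ENNReal.div_ne_top (ENNReal.mul_ne_top hρ' hZ') two_ne_zero
  set H : ℕ → Set (ℕ → Letter d) := fun m => {s | ∀ n, m ≤ n → n * (v / 2) < (walkOf s n 0 : ℝ)}
    with hH
  have hlim := tendsto_measure_not_linear (μ := Q) (v := v / 2) (measurableSet_neverR c) (by
    filter_upwards [hv.ae_tendsto hstat hell] with s hs hsR
    exact eventually_linear hvpos (hs (tendsto_of_mem_neverR hsR)))
  obtain ⟨m₀, hm₀⟩ := eventually_atTop.1 (hlim.eventually (gt_mem_nhds hη0.bot_lt))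
  -- `a` is chosen with `a · v/2 ≥ L`, so that from time `aJ` on the path lies above level `JL`.
  obtain ⟨a, ha⟩ := exists_nat_ge (max 1 (2 * L / v))
  have ha1 : 1 ≤ a := by exact_mod_cast (le_max_left _ _).trans ha
  have haL : L ≤ a * (v / 2) := by
    have := (le_max_right _ _).trans ha
    rw [div_le_iff₀ hvpos] at this
    linarith
  have hreg : ∀ J, m₀ ≤ J → ∀ j, η ≤ Q (regenAtLevel c L (j * L + L) ∩ H (a * J)) := by
    intro J hJ j
    have h1 := letterLaw_regenAtLevel_ge h.toMixBound hstat hell (j * L)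
    have h2 : Q (neverR c \ H (a * J)) ≤ η := (hm₀ (a * J) (hJ.trans (Nat.le_mul_of_pos_left J ha1))).le
    have h3 : Q (regenAtLevel c L (j * L + L)) ≤
        Q (regenAtLevel c L (j * L + L) ∩ H (a * J)) + Q (neverR c \ H (a * J)) := by
      refine (measure_le_inter_add_sdiff Q _ (H (a * J))).trans (add_le_add_right ?_ _)
      exact measure_mono (Set.sdiff_subset_sdiff_left Set.inter_subset_left)
    have h4 : η + η ≤ Q (regenAtLevel c L (j * L + L) ∩ H (a * J)) + η := by
      rw [hη, ENNReal.add_halves]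
      exact h1.trans (h3.trans (add_le_add_right h2 _))
    exact (ENNReal.add_le_add_iff_right hη').1 h4
  set β := ENNReal.ofReal (Real.exp (-a)) with hβ
  have hβ0 : β ≠ 0 := by simp [hβ, Real.exp_pos]
  have hβ' : β ≠ ∞ := ENNReal.ofReal_ne_top
  set zr : ℕ → ℝ := fun J => (J : ℝ) / (J + 1) with hzr
  have hz0 : ∀ J, 0 ≤ zr J := fun J => by positivity
  have hz1 : ∀ J, zr J ≤ 1 := fun J => by
    rw [hzr, div_le_one (by positivity)]; linarith
  set ψ : ℕ → ℝ≥0∞ := fun J => ∑' b : {b : List (Block d c L) // b.length = 1},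
    blockProb P κ b.1 * (1 - ENNReal.ofReal (zr J) ^ (flat b.1).length) with hψ
  have hψle : ∀ J, 1 ≤ J → m₀ ≤ J → 2⁻¹ * ψ J * (β * (J * η)) ≤ 1 := by
    intro J hJ1 hJ
    have hz : ENNReal.ofReal (zr J) ≤ 1 := by simpa using hz1 J
    have h1 := sum_genFun_le h hstat hell hZ hz (J + 1)
    have h2 := le_sum_genFun (L := L) hell hZ hz J (a * J) (measurableSet_walkOf_gt (v / 2) (a * J))
      (fun s hs n hn => by
        have h3 := hs n hn
        have h4 : ((a * J : ℕ) : ℝ) ≤ n := by exact_mod_cast hn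
        have h5 : ((J * L : ℕ) : ℝ) ≤ n * (v / 2) := by
          push_cast at h4 ⊢
          have h6 : (J : ℝ) * L ≤ J * (a * (v / 2)) := mul_le_mul_of_nonneg_left haL (by positivity)
          have h7 : (a : ℝ) * J * (v / 2) ≤ n * (v / 2) :=
            mul_le_mul_of_nonneg_right h4 (by positivity)
          linarith
        exact_mod_cast h5.trans_lt h3)
    have h3 : β ≤ ENNReal.ofReal (zr J) ^ (a * J) := by
      rw [← ENNReal.ofReal_pow (hz0 J)]
      exact ENNReal.ofReal_le_ofReal (exp_le_div_pow hJ1 a)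
    have h4 : (J : ℝ≥0∞) * η ≤ ∑ j ∈ Finset.range J,
        Q (regenAtLevel c L (j * L + L) ∩ H (a * J)) := by
      have := Finset.sum_le_sum fun j (_ : j ∈ Finset.range J) => hreg J hJ j
      simpa using this
    have h5 : β * (J * η) ≤ ∑ k ∈ Finset.range (J + 1), genFun P κ c L (ENNReal.ofReal (zr J)) k :=
      (mul_le_mul' h3 h4).trans (h2.trans (mul_le_of_le_one_left' prob_le_one))
    exact (mul_le_mul_right h5 _).trans h1
  have hbound : ∀ J, 1 ≤ J → m₀ ≤ J → 2 * J * ψ J ≤ 4 * (β * η)⁻¹ := by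
    intro J hJ1 hJ
    have h1 := hψle J hJ1 hJ
    have hβη : β * η ≠ 0 := mul_ne_zero hβ0 hη0
    have hβη' : β * η ≠ ∞ := ENNReal.mul_ne_top hβ' hη'
    calc 2 * J * ψ J = 4 * (2⁻¹ * ψ J * (J * ((β * η) * (β * η)⁻¹))) := by
          rw [ENNReal.mul_inv_cancel hβη hβη', mul_one]
          rw [show 4 * (2⁻¹ * ψ J * J) = 2 * (2 * 2⁻¹) * (J * ψ J) by ring,
            ENNReal.mul_inv_cancel two_ne_zero ENNReal.ofNat_ne_top]
          ring
      _ = 4 * ((2⁻¹ * ψ J * (β * (J * η))) * (β * η)⁻¹) := by ring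
      _ ≤ 4 * (1 * (β * η)⁻¹) := mul_le_mul_right (mul_le_mul_left h1 _) _
      _ = _ := by rw [one_mul]
  refine lt_of_le_of_lt (b := 4 * (β * η)⁻¹) ?_ (ENNReal.mul_lt_top (by simp)
    (ENNReal.inv_lt_top.2 (mul_ne_zero hβ0 hη0).bot_lt))
  rw [ENNReal.tsum_eq_iSup_sum]
  refine iSup_le fun S => ?_
  -- For a finite part of the sum, `J` exceeds all block lengths, so each length is at most `2J(1 -
  -- z^length)`.
  set J := max (max 1 m₀) (S.sup fun b => (flat b.1).length) with hJ
  refine le_trans ?_ (hbound J (by omega) (by omega))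
  simp only [hψ]
  rw [← ENNReal.tsum_mul_left]
  refine le_trans (Finset.sum_le_sum fun b hb => ?_) (ENNReal.sum_le_tsum S)
  have hbJ : (flat b.1).length ≤ J :=
    (Finset.le_sup (f := fun b : {b : List (Block d c L) // b.length = 1} => (flat b.1).length) hb).trans
      (le_max_right _ _)
  have h1 := half_div_le (by omega : 0 < J) hbJ
  rw [mul_left_comm]
  refine mul_le_mul_right ?_ _
  have h2 := ENNReal.ofReal_le_ofReal h1
  rw [ENNReal.ofReal_natCast, ENNReal.ofReal_mul (by positivity), ENNReal.ofReal_mul (by positivity),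
    ENNReal.ofReal_sub _ (by positivity), ENNReal.ofReal_pow (hz0 J)] at h2
  simpa using h2

end FiniteMean

/-! ### Displacements of lists of blocks -/

section BlockMeasure

variable {d : ℕ} [NeZero d] {P : Measure (Env d)} [IsProbabilityMeasure P] {κ c v : ℝ} {L : ℕ}

/-- The distribution of the displacement under weights on the lists of `n` blocks. -/
def dispMeasure (f : List (Block d c L) → ℝ≥0∞) (n : ℕ) : Measure (Site d) :=
  Measure.sum fun w : {w : List (Block d c L) // w.length = n} =>
    f w.1 • Measure.dirac (wordDisp (flat w.1))

instance (f : List (Block d c L) → ℝ≥0∞) (n : ℕ) : SFinite (dispMeasure f n) := by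
  unfold dispMeasure; infer_instance

lemma lintegral_dispMeasure (f : List (Block d c L) → ℝ≥0∞) (n : ℕ) (g : Site d → ℝ≥0∞) :
    ∫⁻ x, g x ∂dispMeasure f n =
      ∑' w : {w : List (Block d c L) // w.length = n}, f w.1 * g (wordDisp (flat w.1)) := by
  rw [dispMeasure, lintegral_sum_measure]
  refine tsum_congr fun w => ?_
  rw [lintegral_smul_measure, lintegral_dirac, smul_eq_mul]

lemma dispMeasure_apply (f : List (Block d c L) → ℝ≥0∞) (n : ℕ) (A : Set (Site d)) :
    dispMeasure f n A = ∑' w : {w : List (Block d c L) // w.length = n},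
      f w.1 * A.indicator 1 (wordDisp (flat w.1)) := by
  rw [← lintegral_dispMeasure, lintegral_indicator_one (Set.to_countable A).measurableSet]

lemma le_dispMeasure (f : List (Block d c L) → ℝ≥0∞) (w : List (Block d c L)) :
    f w ≤ dispMeasure f w.length {wordDisp (flat w)} := by
  rw [dispMeasure_apply]
  refine le_trans (le_of_eq ?_) (ENNReal.le_tsum ⟨w, rfl⟩)
  simp

lemma lintegral_dispMeasure_conv (f g : List (Block d c L) → ℝ≥0∞) (j k : ℕ)
    (φ : Site d → ℝ≥0∞) : ∫⁻ x, φ x ∂((dispMeasure f j).conv (dispMeasure g k)) =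
      ∑' w : {w : List (Block d c L) // w.length = j + k},
        f (w.1.take j) * g (w.1.drop j) * φ (wordDisp (flat w.1)) := by
  rw [Measure.lintegral_conv (measurable_of_countable φ)]
  simp only [lintegral_dispMeasure]
  rw [← (appendEquiv (Block d c L) j k).tsum_eq, ENNReal.tsum_prod']
  refine tsum_congr fun a => ?_
  rw [← ENNReal.tsum_mul_left]
  refine tsum_congr fun b => ?_
  change _ = f ((a.1 ++ b.1).take j) * g ((a.1 ++ b.1).drop j) * φ (wordDisp (flat (a.1 ++ b.1)))
  rw [List.take_left' a.2, List.drop_left' a.2, flat_append, wordDisp_append]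
  ring

/-- The walk `e₁, e_i, e₁, e₁, …` whose coins show `1` from time `N` on. -/
def fastSeq (i : Fin d) (N : ℕ) : ℕ → Letter d :=
  fun n => (if n = 1 then (i, true) else (0, true), decide (N ≤ n))

lemma walkOf_fastSeq_one (i : Fin d) (N : ℕ) : walkOf (fastSeq i N) 1 = Pi.single 0 1 := by
  rw [walkOf_succ, walkOf_zero, zero_add]; simp [fastSeq, Step.vec]

lemma walkOf_fastSeq (i : Fin d) (N n : ℕ) :
    walkOf (fastSeq i N) (n + 2) = ((n + 1 : ℕ) : ℤ) • Pi.single 0 1 + Pi.single i 1 := by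
  induction n with
  | zero =>
    rw [walkOf_succ, walkOf_fastSeq_one]
    simp [fastSeq, Step.vec]
  | succ n ih =>
    rw [show n + 1 + 2 = (n + 2) + 1 by ring, walkOf_succ, ih]
    have : (fastSeq i N (n + 2)).1.vec = Pi.single 0 1 := by
      simp [fastSeq, Step.vec]
    rw [this]
    push_cast
    module

lemma walkOf_fastSeq_level (i : Fin d) (N n : ℕ) :
    walkOf (fastSeq i N) (n + 2) 0 = n + 1 + if i = 0 then 1 else 0 := by
  rw [walkOf_fastSeq]
  simp [Pi.single_apply, eq_comm]

/-- The coins before time `N` show `0`, so no attempt can be complete before `N + L` and the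
minimality condition is void. If `i ≠ 0`, the sideways step repeats a level, and `N ≥ 3` is needed
for a strict record at `N`. -/
lemma blockSeq_fastSeq (hc : 1 ≤ c) (hL : 1 ≤ L) {i : Fin d} {N : ℕ} (hN : 2 ≤ N)
    (hiN : i = 0 ∨ 3 ≤ N) : BlockSeq c L (fastSeq i N) (N + L) := by
  have hlev : ∀ t, 2 ≤ t → walkOf (fastSeq i N) t 0 = t - 1 + if i = 0 then 1 else 0 := by
    intro t ht
    obtain ⟨k, rfl⟩ : ∃ k, t = k + 2 := ⟨t - 2, by omega⟩
    rw [walkOf_fastSeq_level]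
    push_cast
    ring
  have h1 : walkOf (fastSeq i N) 1 0 = 1 := by rw [walkOf_fastSeq_one]; simp
  have h0 : walkOf (fastSeq i N) 0 0 = 0 := by simp
  refine ⟨okUpTo_of_level hc fun t ht _ => ?_, ⟨by omega, fun m hm => ?_, fun k hk hkL => ⟨?_, ?_⟩⟩,
    fun n hn hA => ?_⟩
  · rw [h0]
    rcases eq_or_ne t 1 with rfl | h
    · rw [h1]; simp
    · rw [hlev t (by omega)]; split_ifs <;> omega
  · rw [Nat.add_sub_cancel] at hm ⊢
    rw [hlev N hN]
    rcases Nat.lt_or_ge m 2 with h | h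
    · have : walkOf (fastSeq i N) m 0 ≤ 1 := by
        interval_cases m
        · rw [h0]; simp
        · rw [h1]
      rcases hiN with h' | h'
      · rw [if_pos h']
        omega
      · split_ifs <;> omega
    · rw [hlev m h]; split_ifs <;> omega
  · simp only [coinsOf, fastSeq, decide_eq_true_eq]; omega
  · rw [walkOf_succ, add_sub_cancel_left]
    have : N + L - k ≠ 1 := by omega
    simp only [fastSeq, if_neg this]
    rfl
  · have h2 := (hA.2.2 L hL le_rfl).1
    simp only [coinsOf, fastSeq, decide_eq_true_eq] at h2
    have := hA.1
    omega

/-- The weight of the word is bounded below pointwise, and what remains is the mean survival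
probability `Z`, which cancels. -/
lemma blockProb_singleton_ge (hstat : Stationary P) (hell : UniformlyElliptic P κ)
    (hZ : letterLaw P κ (neverR c) ≠ 0) (b : Block d c L) :
    ENNReal.ofReal (κ / 2) ^ b.1.length ≤ blockProb P κ [b] := by
  have := isProbabilityMeasure_letterLaw (P := P) hell
  rw [blockProb_eq hstat hell _ 0]
  simp only [flat_cons, flat_nil, List.append_nil]
  have h1 : ENNReal.ofReal (κ / 2) ^ b.1.length * letterLaw P κ (neverR c) ≤
      ∫⁻ ω, wordWeight κ b.1 0 ω * survive κ c (0 + wordDisp b.1) ω ∂P := by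
    have hm : Measurable (survive κ c (0 + wordDisp b.1) : Env d → ℝ≥0∞) := measurable_survive ..
    rw [← lintegral_survive hstat hell (0 + wordDisp b.1), ← lintegral_const_mul _ hm]
    exact lintegral_mono fun ω => mul_le_mul_left (wordWeight_ge hell.2.1 _ _ _) _
  refine le_trans (le_of_eq ?_) (mul_le_mul_right h1 _)
  rw [mul_left_comm, ENNReal.inv_mul_cancel hZ (measure_ne_top _ _), mul_one]

lemma dispMeasure_one_ge (hstat : Stationary P) (hell : UniformlyElliptic P κ)
    (hZ : letterLaw P κ (neverR c) ≠ 0) {s : ℕ → Letter d} {m : ℕ} (hs : BlockSeq c L s m) :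
    ENNReal.ofReal (κ / 2) ^ m ≤
      dispMeasure (blockProb (c := c) (L := L) P κ) 1 {walkOf s m} := by
  have h1 := blockProb_singleton_ge hstat hell hZ ⟨_, hs.isBlock⟩
  rw [length_prefixWord] at h1
  refine h1.trans ((le_dispMeasure _ _).trans (le_of_eq ?_))
  simp only [flat_cons, flat_nil, List.append_nil]
  rfl

lemma one_le_of_neverR (hZ : letterLaw P κ (neverR c) ≠ 0) : 1 ≤ c := by
  obtain ⟨s, hs⟩ := nonempty_of_measure_ne_zero hZ
  exact (mem_neverR.1 hs 0).one_le

/-- Mapping lists of blocks to displacements turns concatenation into convolution, so the renewal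
equation for words becomes the one in `renewal_local_bound`. Two explicit fast blocks, of lengths `2
+ L` and `3 + L`, end at sites differing by `e_i`. -/
theorem exists_dispMeasure_le {θ : ℕ → ℝ≥0∞} {ε : ℕ → ℝ} (h : GoodMix P c L θ ε)
    (hstat : Stationary P) (hell : UniformlyElliptic P κ)
    (hZ : letterLaw P κ (neverR c) ≠ 0) :
    ∃ C : ℝ, 0 < C ∧ ∀ n, 1 ≤ n → ∀ x,
      dispMeasure (blockProb (c := c) (L := L) P κ) n {x} ≤
        ENNReal.ofReal (C * (n : ℝ) ^ (-(d : ℝ) / 2)) := by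
  obtain ⟨U, hU⟩ := h.exists_renewal_fun hstat hell hZ
  have hκ := hell.1
  have hd : (1 : ℝ) ≤ d := by exact_mod_cast NeZero.one_le
  have hκ1 : κ / 2 ≤ 1 := by
    have h1 := hell.2.1
    have h2 : 1 / (2 * (d : ℝ)) ≤ 1 := by
      rw [div_le_one (by positivity)]; linarith
    linarith
  set G := dispMeasure (blockProb (c := c) (L := L) P κ) with hGdef
  have hG : ∀ n, IsProbabilityMeasure (G n) := fun n => ⟨by
    rw [hGdef, dispMeasure_apply]
    simpa using tsum_blockProb h.toMixBound hstat hell hZ n⟩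
  have hUf : ∀ n, 1 ≤ n → IsFiniteMeasure (dispMeasure U n) := fun n hn => ⟨by
    have hle : dispMeasure U n Set.univ ≤ G n Set.univ := by
      rw [hGdef, dispMeasure_apply, dispMeasure_apply]
      refine ENNReal.tsum_le_tsum fun w => mul_le_mul_left ?_ _
      rw [hU w.1 (by rw [w.2]; exact hn)]
      exact le_self_add
    exact hle.trans_lt (measure_lt_top _ _)⟩
  have hren : ∀ n, 1 ≤ n → G n = dispMeasure U n +
      (2⁻¹ : ℝ≥0∞) • ∑ j ∈ Finset.Ico 1 n, (dispMeasure U j).conv (G (n - j)) := by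
    intro n hn
    refine Measure.ext_of_lintegral _ fun φ hφ => ?_
    rw [lintegral_add_measure, lintegral_smul_measure, lintegral_finsetSum_measure, hGdef,
      lintegral_dispMeasure, lintegral_dispMeasure, smul_eq_mul]
    have hj : ∀ j ∈ Finset.Ico 1 n, ∫⁻ x, φ x ∂((dispMeasure U j).conv
        (dispMeasure (blockProb (c := c) (L := L) P κ) (n - j))) =
        ∑' w : {w : List (Block d c L) // w.length = n},
          U (w.1.take j) * blockProb P κ (w.1.drop j) * φ (wordDisp (flat w.1)) := by
      intro j hj
      have := lintegral_dispMeasure_conv U (blockProb P κ) j (n - j) φ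
      rwa [Nat.add_sub_cancel' (Finset.mem_Ico.1 hj).2.le] at this
    rw [Finset.sum_congr rfl hj, ← Summable.tsum_finsetSum fun _ _ => ENNReal.summable,
      ← ENNReal.tsum_mul_left, ← ENNReal.tsum_add]
    refine tsum_congr fun w => ?_
    rw [hU w.1 (by rw [w.2]; exact hn), w.2, add_mul, mul_assoc, Finset.sum_mul]
  have hc := one_le_of_neverR hZ
  have hp : ∀ m, m ≤ L + 3 → ∀ s, BlockSeq c L s m → (κ / 2) ^ (L + 3) ≤ (G 1).real {walkOf s m} := by
    intro m hm s hs
    have h1 := dispMeasure_one_ge hstat hell hZ hs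
    rw [← ENNReal.ofReal_pow (by positivity)] at h1
    exact (pow_le_pow_of_le_one (by positivity) hκ1 hm).trans
      ((ENNReal.ofReal_le_iff_le_toReal (measure_ne_top (G 1) _)).1 h1)
  refine renewal_local_bound (fun n _ => hG n) hUf hren (p := (κ / 2) ^ (L + 3)) (by positivity)
    fun i => ⟨walkOf (fastSeq 0 2) (2 + L),
      hp _ (by omega) _ (blockSeq_fastSeq hc h.pos le_rfl (Or.inl rfl)), ?_⟩
  have e : walkOf (fastSeq (0 : Fin d) 2) (2 + L) + Pi.single i 1 = walkOf (fastSeq i 3) (3 + L) := by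
    rw [show 2 + L = L + 2 by ring, show 3 + L = (L + 1) + 2 by ring, walkOf_fastSeq, walkOf_fastSeq]
    push_cast
    module
  rw [e]
  exact hp _ (by omega) _ (blockSeq_fastSeq hc h.pos (by norm_num) (Or.inr le_rfl))

end BlockMeasure

/-! ### Back to the original probability space -/

section Transfer

variable {d : ℕ} [NeZero d] {P : Measure (Env d)} [IsProbabilityMeasure P] {κ c v : ℝ} {L : ℕ}

lemma ae_letters (hstat : Stationary P) (hell : UniformlyElliptic P κ) :
    ∀ᵐ p ∂coinAnnealed P κ, p.2 = walkOf (letters p) ∧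
      (timeR c p.2 = ⊤ ↔ letters p ∈ neverR c) ∧
      ∀ n, regTime c L n p = regenTime c L (letters p) n := by
  filter_upwards [ae_walk_eq hstat hell] with p hp
  refine ⟨hp, by rw [hp]; rfl, fun n => ?_⟩
  have e := tau_coinsOf_walkOf c L (letters p) n
  rw [← hp] at e
  rw [regTime, ← e]
  exact tau_congr (ε := p.1.2) (ε' := coinsOf (letters p)) (X := p.2) c (fun t => rfl) n

lemma measurableSet_timeR_snd (c : ℝ) :
    MeasurableSet {p : (Env d × Coins d) × Walk d | timeR c p.2 = ⊤} :=
  measurable_snd (measurableSet_timeR_eq_top c)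

lemma coinAnnealed_timeR (hstat : Stationary P) (hell : UniformlyElliptic P κ) :
    coinAnnealed P κ {p | timeR c p.2 = ⊤} = letterLaw P κ (neverR c) := by
  rw [letterLaw, Measure.map_apply measurable_letters (measurableSet_neverR c)]
  refine measure_congr ?_
  filter_upwards [ae_letters (c := c) (L := 0) hstat hell] with p hp
  exact propext hp.2.1

/-- As an upper bound this needs measurability of `F` only, so the events of the theorem need not be
shown measurable. -/
lemma hatP_le (hstat : Stationary P) (hell : UniformlyElliptic P κ)
    {A : Set ((Env d × Coins d) × Walk d)} {F : Set (ℕ → Letter d)} (hF : MeasurableSet F)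
    (h : ∀ᵐ p ∂coinAnnealed P κ, timeR c p.2 = ⊤ → p ∈ A → letters p ∈ F) :
    hatP P κ c A ≤ (letterLaw P κ (neverR c))⁻¹ * letterLaw P κ F := by
  rw [hatP, cond_apply (measurableSet_timeR_snd c), coinAnnealed_timeR hstat hell]
  refine mul_le_mul_right ?_ _
  rw [letterLaw, Measure.map_apply measurable_letters hF]
  refine measure_mono_ae ?_
  filter_upwards [h] with p hp hpA
  exact hp hpA.1 hpA.2

lemma ae_regTime_lt_top {θ : ℕ → ℝ≥0∞} (hθ : MixBound P c L θ) (hstat : Stationary P)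
    (hell : UniformlyElliptic P κ) (hZ : letterLaw P κ (neverR c) ≠ 0) (n : ℕ) :
    ∀ᵐ s ∂letterLaw P κ, s ∈ neverR c → regenTime c L s n < ⊤ := by
  have h := letterLaw_regenTime_eq_top hθ hstat hell hZ n
  rw [ae_iff]
  refine measure_mono_null (fun s hs => ?_) h
  simp only [Set.mem_ofPred_eq, Classical.not_imp, not_lt, top_le_iff] at hs ⊢
  exact hs

lemma ae_hatP_regTime_lt_top {θ : ℕ → ℝ≥0∞} (hθ : MixBound P c L θ) (hstat : Stationary P)
    (hell : UniformlyElliptic P κ) (hZ : letterLaw P κ (neverR c) ≠ 0) (n : ℕ) :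
    ∀ᵐ p ∂hatP P κ c, regTime c L n p < ⊤ := by
  have h1 : ∀ᵐ p ∂coinAnnealed P κ, letters p ∈ neverR c → regenTime c L (letters p) n < ⊤ :=
    ae_of_ae_map measurable_letters.aemeasurable (ae_regTime_lt_top hθ hstat hell hZ n)
  have h2 : hatP P κ c {p | ¬ regTime c L n p < ⊤} ≤ _ :=
    hatP_le hstat hell (F := ∅) MeasurableSet.empty (by
      filter_upwards [h1, ae_letters (c := c) (L := L) hstat hell] with p hp hp' hR hA
      refine hA ?_
      rw [hp'.2.2]
      exact hp (hp'.2.1.1 hR))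
  rw [measure_empty, mul_zero] at h2
  exact ae_iff.2 (le_antisymm h2 zero_le)

lemma hatP_regAt_le (hstat : Stationary P) (hell : UniformlyElliptic P κ) (n : ℕ) (x : Site d) :
    hatP P κ c (regAt c L n x) ≤ dispMeasure (blockProb (c := c) (L := L) P κ) n {x} := by
  have h := hatP_le (c := c) (A := regAt c L n x) hstat hell (F := ⋃ w : {w : List (Block d c L) //
      w.length = n ∧ wordDisp (flat w) = x}, blockEvent w.1)
    (MeasurableSet.iUnion fun w => measurableSet_blockEvent _) (by
      filter_upwards [ae_letters (c := c) (L := L) hstat hell] with p hp hR hA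
      obtain ⟨m, h1, h2⟩ := hA
      rw [hp.2.2] at h1
      obtain ⟨w, hw, hpw⟩ := exists_blockEvent (hp.2.1.1 hR) h1
      have h3 := regenTime_eq_of_mem_blockEvent hpw
      rw [hw, h1] at h3
      have h3 : m = (flat w).length := by exact_mod_cast h3
      refine Set.mem_iUnion.2 ⟨⟨w, hw, ?_⟩, hpw⟩
      rw [← h2, hp.1, h3, walkOf_eq_wordDisp hpw.1 le_rfl, List.take_length])
  refine h.trans ((mul_le_mul_right (measure_iUnion_le _) _).trans ?_)
  rw [← ENNReal.tsum_mul_left, dispMeasure_apply]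
  let e : {w : List (Block d c L) // w.length = n ∧ wordDisp (flat w) = x} →
    {w : List (Block d c L) // w.length = n} := fun w => ⟨w.1, w.2.1⟩
  have he : Function.Injective e := fun w w' h => Subtype.ext (congrArg (fun u => u.1) h)
  refine le_trans (ENNReal.tsum_le_tsum fun w => ?_) (ENNReal.tsum_comp_le_tsum_of_injective he _)
  simp only [e, w.2.2]
  simp [blockProb]

/-- The sites visited by a word, the last one excluded. -/
def visitSet (π : List (Letter d)) : Finset (Site d) :=
  (Finset.range π.length).image fun t => wordDisp (π.take t)

/-- The probability that a given displacement is visited during the first block. -/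
def visitFun (P : Measure (Env d)) (κ c : ℝ) (L : ℕ) (z : Site d) : ℝ≥0∞ :=
  ∑' b : {b : List (Block d c L) // b.length = 1},
    blockProb P κ b.1 * (visitSet (flat b.1) : Set (Site d)).indicator 1 z

/-- A block visits at most as many sites as it has letters. -/
lemma tsum_visitFun_le : ∑' z, visitFun P κ c L z ≤
    ∑' b : {b : List (Block d c L) // b.length = 1}, blockProb P κ b.1 * (flat b.1).length := by
  simp only [visitFun]
  rw [ENNReal.tsum_comm]
  refine ENNReal.tsum_le_tsum fun b => ?_
  rw [ENNReal.tsum_mul_left]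
  refine mul_le_mul_right ?_ _
  have : ∑' z, (visitSet (flat b.1) : Set (Site d)).indicator (1 : Site d → ℝ≥0∞) z =
      (visitSet (flat b.1)).card := by
    rw [← tsum_subtype]
    simp
  rw [this]
  exact_mod_cast Finset.card_image_le.trans (by simp)

/-- The visit takes place in block `n + 1`, at a displacement from the position after `n` blocks;
the factor `2` makes that block independent of the earlier ones. -/
lemma hatP_visitedIn_le {θ : ℕ → ℝ≥0∞} {ε : ℕ → ℝ} (h : GoodMix P c L θ ε)
    (hstat : Stationary P) (hell : UniformlyElliptic P κ) (hZ : letterLaw P κ (neverR c) ≠ 0)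
    (n : ℕ) (x : Site d) : hatP P κ c (visitedIn c L (n + 1) x) ≤
      2 * ∫⁻ y, visitFun P κ c L (x - y) ∂dispMeasure (blockProb (c := c) (L := L) P κ) n := by
  have hfin : ∀ᵐ p ∂coinAnnealed P κ, letters p ∈ neverR c → regenTime c L (letters p) (n + 1) < ⊤ :=
    ae_of_ae_map measurable_letters.aemeasurable
      (ae_regTime_lt_top h.toMixBound hstat hell hZ (n + 1))
  have h1 := hatP_le (c := c) (A := visitedIn c L (n + 1) x) hstat hell
    (F := ⋃ a : {w : List (Block d c L) // w.length = n},
      ⋃ b : {b : List (Block d c L) // b.length = 1},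
        ⋃ _ : x - wordDisp (flat a.1) ∈ visitSet (flat b.1), blockEvent (a.1 ++ b.1))
    (MeasurableSet.iUnion fun a => MeasurableSet.iUnion fun b => MeasurableSet.iUnion fun _ =>
      measurableSet_blockEvent _) (by
      filter_upwards [ae_letters (c := c) (L := L) hstat hell, hfin] with p hp hpf hR hA
      obtain ⟨m, h1, h2, h3⟩ := hA
      rw [hp.2.2] at h1 h2
      rw [Nat.add_sub_cancel] at h1
      have hs := hp.2.1.1 hR
      obtain ⟨k, hk⟩ := ENat.ne_top_iff_exists.1 (hpf hs).ne
      obtain ⟨w, hw, hpw⟩ := exists_blockEvent hs hk.symm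
      have e : w.take n ++ w.drop n = w := List.take_append_drop _ _
      have hln : (w.take n).length = n := by simp [hw]
      have h4 := regenTime_eq_of_mem_blockEvent hpw
      rw [← e] at hpw
      have h5 := regenTime_eq_of_mem_blockEvent (blockEvent_append_subset _ _ hpw)
      rw [hw] at h4
      rw [hln] at h5
      rw [h5] at h1
      rw [h4] at h2
      have h1 : (flat (w.take n)).length ≤ m := by exact_mod_cast h1
      have h2 : m < (flat w).length := by exact_mod_cast h2
      have h6 : flat w = flat (w.take n) ++ flat (w.drop n) := by rw [← flat_append, e]
      have h7 : (flat w).length = (flat (w.take n)).length + (flat (w.drop n)).length := by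
        rw [h6, List.length_append]
      refine Set.mem_iUnion.2 ⟨⟨w.take n, hln⟩, Set.mem_iUnion.2 ⟨⟨w.drop n, by simp [hw]⟩,
        Set.mem_iUnion.2 ⟨?_, hpw⟩⟩⟩
      refine Finset.mem_image.2 ⟨m - (flat (w.take n)).length, Finset.mem_range.2 ?_, ?_⟩
      · change _ < (flat (w.drop n)).length
        omega
      · change wordDisp ((flat (w.drop n)).take _) = x - wordDisp (flat (w.take n))
        have h8 : letters p ∈ cyl (flat w) := by
          have := hpw.1
          rwa [e] at this
        rw [← h3, hp.1, walkOf_eq_wordDisp h8 h2.le, h6, List.take_append, List.take_of_length_le h1,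
          wordDisp_append, add_sub_cancel_left])
  refine h1.trans ?_
  rw [lintegral_dispMeasure]
  simp only [visitFun]
  rw [← ENNReal.tsum_mul_left]
  refine (mul_le_mul_right (measure_iUnion_le _) _).trans ?_
  rw [← ENNReal.tsum_mul_left]
  refine ENNReal.tsum_le_tsum fun a => ?_
  refine (mul_le_mul_right (measure_iUnion_le _) _).trans ?_
  rw [← ENNReal.tsum_mul_left, ← ENNReal.tsum_mul_left, ← ENNReal.tsum_mul_left]
  refine ENNReal.tsum_le_tsum fun b => ?_
  by_cases hx : x - wordDisp (flat a.1) ∈ visitSet (flat b.1)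
  · rw [Set.indicator_of_mem (by exact_mod_cast hx), Pi.one_apply, mul_one]
    obtain ⟨b, hb⟩ := b
    obtain ⟨b, rfl⟩ := List.length_eq_one_iff.1 hb
    refine le_trans ?_ (h.blockProb_append hstat hell hZ a.1 b).1
    rw [blockProb]
    exact mul_le_mul_right (measure_mono (Set.iUnion_subset fun _ => subset_rfl)) _
  · simp [hx]

lemma meanTau_eq {θ : ℕ → ℝ≥0∞} (hθ : MixBound P c L θ) (hstat : Stationary P)
    (hell : UniformlyElliptic P κ) (hZ : letterLaw P κ (neverR c) ≠ 0) :
    meanTau P κ c L = ∑' b : {b : List (Block d c L) // b.length = 1},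
      blockProb P κ b.1 * (flat b.1).length := by
  have hfin : ∀ᵐ p ∂coinAnnealed P κ, letters p ∈ neverR c → regenTime c L (letters p) 1 < ⊤ :=
    ae_of_ae_map measurable_letters.aemeasurable (ae_regTime_lt_top hθ hstat hell hZ 1)
  have hm : Measurable fun s : ℕ → Letter d => ∑' b : {b : List (Block d c L) // b.length = 1},
      (blockEvent b.1).indicator (fun _ => ((flat b.1).length : ℝ≥0∞)) s :=
    Measurable.tsum fun b => measurable_const.indicator (measurableSet_blockEvent b.1)
  have e : ∫⁻ p in {p | timeR c p.2 = ⊤}, (regTime c L 1 p : ℝ≥0∞) ∂coinAnnealed P κ =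
      ∫⁻ s, ∑' b : {b : List (Block d c L) // b.length = 1},
        (blockEvent b.1).indicator (fun _ => ((flat b.1).length : ℝ≥0∞)) s ∂letterLaw P κ := by
    rw [letterLaw, lintegral_map hm measurable_letters,
      ← lintegral_indicator (measurableSet_timeR_snd c)]
    refine lintegral_congr_ae ?_
    filter_upwards [ae_letters (c := c) (L := L) hstat hell, hfin] with p hp hpf
    by_cases hR : timeR c p.2 = ⊤
    · rw [Set.indicator_of_mem (by exact hR)]
      have hs := hp.2.1.1 hR
      obtain ⟨k, hk⟩ := ENat.ne_top_iff_exists.1 (hpf hs).ne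
      obtain ⟨w, hw, hpw⟩ := exists_blockEvent hs hk.symm
      have h4 := regenTime_eq_of_mem_blockEvent hpw
      rw [hw] at h4
      rw [tsum_eq_single ⟨w, hw⟩ fun b hb => Set.indicator_of_notMem (fun hb' =>
        hb (Subtype.ext (eq_of_mem_blockEvent hb' hpw (by rw [b.2, hw])))) _,
        Set.indicator_of_mem hpw, hp.2.2, h4]
      simp
    · rw [Set.indicator_of_notMem (by exact hR)]
      symm
      refine ENNReal.tsum_eq_zero.2 fun b => Set.indicator_of_notMem (fun hb => hR ?_) _
      exact hp.2.1.2 (mem_neverR_of_mem_blockEvent hb)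
  rw [meanTau, hatP, ProbabilityTheory.cond, lintegral_smul_measure, e, coinAnnealed_timeR hstat hell,
    lintegral_tsum_indicator _ fun b : {b : List (Block d c L) // b.length = 1} =>
      measurableSet_blockEvent b.1, smul_eq_mul, ← ENNReal.tsum_mul_left]
  refine tsum_congr fun b => ?_
  rw [blockProb]
  ring

end Transfer

/-! ### The heat kernel bounds -/

section HeatKernel

variable {d : ℕ} [NeZero d] {P : Measure (Env d)} [IsProbabilityMeasure P] {κ c : ℝ} {L : ℕ}

/-- The convolution has supremum at most `F g` and sum `F`, and the sum of squares is at most their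
product. -/
lemma tsum_sq_conv_le {μ : Measure (Site d)} [IsProbabilityMeasure μ] {g : ℝ≥0∞}
    (hg : ∀ x, μ {x} ≤ g) (f : Site d → ℝ≥0∞) :
    ∑' x, (2 * ∫⁻ y, f (x - y) ∂μ) ^ 2 ≤ 4 * (∑' z, f z) ^ 2 * g := by
  set F := ∑' z, f z
  have h1 : ∀ x, ∫⁻ y, f (x - y) ∂μ ≤ F * g := fun x => by
    rw [lintegral_countable']
    calc ∑' y, f (x - y) * μ {y} ≤ ∑' y, f (x - y) * g :=
          ENNReal.tsum_le_tsum fun y => mul_le_mul_right (hg y) _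
      _ = F * g := by
          rw [ENNReal.tsum_mul_right]
          exact congrArg (· * g) ((Equiv.subLeft x).tsum_eq f)
  have h2 : ∑' x, ∫⁻ y, f (x - y) ∂μ = F := by
    rw [← lintegral_tsum fun x => (measurable_of_countable _).aemeasurable]
    have : ∀ y, ∑' x, f (x - y) = F := fun y => (Equiv.subRight y).tsum_eq f
    simp [this]
  calc ∑' x, (2 * ∫⁻ y, f (x - y) ∂μ) ^ 2 ≤ ∑' x, 4 * (F * g) * ∫⁻ y, f (x - y) ∂μ := by
        refine ENNReal.tsum_le_tsum fun x => ?_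
        rw [show (2 * ∫⁻ y, f (x - y) ∂μ) ^ 2 =
          4 * (∫⁻ y, f (x - y) ∂μ) * ∫⁻ y, f (x - y) ∂μ by ring]
        exact mul_le_mul_left (mul_le_mul_right (h1 x) _) _
    _ = 4 * F ^ 2 * g := by rw [ENNReal.tsum_mul_left, h2]; ring

theorem heatKernel_bounds {θ : ℕ → ℝ≥0∞} {ε : ℕ → ℝ} (h : GoodMix P c L θ ε)
    (hstat : Stationary P) (hell : UniformlyElliptic P κ) (hZ : letterLaw P κ (neverR c) ≠ 0) :
    ∃ C : ℝ, 0 < C ∧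
      (∀ n : ℕ, 1 ≤ n → ∀ x : Site d,
        hatP P κ c (regAt c L n x) ≤ ENNReal.ofReal (C * (n : ℝ) ^ (-(d : ℝ) / 2))) ∧
      (∀ n : ℕ, 1 ≤ n →
        ∑' x : Site d, (hatP P κ c (visitedIn c L n x)) ^ 2 ≤
          ENNReal.ofReal C * (meanTau P κ c L) ^ 2 *
            ENNReal.ofReal ((n : ℝ) ^ (-(d : ℝ) / 2))) := by
  obtain ⟨C₀, hC₀, hb⟩ := exists_dispMeasure_le h hstat hell hZ
  set G := dispMeasure (blockProb (c := c) (L := L) P κ) with hGdef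
  have hG : ∀ n, IsProbabilityMeasure (G n) := fun n => ⟨by
    rw [hGdef, dispMeasure_apply]
    simpa using tsum_blockProb h.toMixBound hstat hell hZ n⟩
  -- Visits in `[τ_n, τ_{n+1})` involve the law after `n` blocks only. The factor `2^{d/2}` passes
  -- from `n` to `n + 1`, and the value `1` covers `n = 0`.
  set C₁ := max 1 (C₀ * 2 ^ ((d : ℝ) / 2)) with hC₁
  have hC₁0 : 0 < C₁ := lt_of_lt_of_le one_pos (le_max_left _ _)
  have hG' : ∀ n x, G n {x} ≤ ENNReal.ofReal (C₁ * ((n + 1 : ℕ) : ℝ) ^ (-(d : ℝ) / 2)) := by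
    intro n x
    rcases Nat.eq_zero_or_pos n with rfl | hn
    · refine prob_le_one.trans ?_
      rw [← ENNReal.ofReal_one]
      refine ENNReal.ofReal_le_ofReal ?_
      simp [hC₁]
    · refine (hb n hn x).trans (ENNReal.ofReal_le_ofReal ?_)
      have hn0 : (0 : ℝ) < n := by exact_mod_cast hn
      have hn1 : (1 : ℝ) ≤ n := by exact_mod_cast hn
      have h1 : (n : ℝ) ^ (-(d : ℝ) / 2) ≤ 2 ^ ((d : ℝ) / 2) * ((n + 1 : ℕ) : ℝ) ^ (-(d : ℝ) / 2) := by
        have h2 : ((2 * n : ℝ)) ^ (-(d : ℝ) / 2) ≤ ((n + 1 : ℕ) : ℝ) ^ (-(d : ℝ) / 2) := by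
          refine Real.rpow_le_rpow_of_nonpos (by positivity) (by push_cast; linarith) ?_
          have : (0 : ℝ) ≤ d := by positivity
          linarith
        rw [Real.mul_rpow (by norm_num) hn0.le] at h2
        have h3 : (2 : ℝ) ^ ((d : ℝ) / 2) * 2 ^ (-(d : ℝ) / 2) = 1 := by
          rw [← Real.rpow_add (by norm_num), neg_div, add_neg_cancel, Real.rpow_zero]
        calc (n : ℝ) ^ (-(d : ℝ) / 2)
            = 2 ^ ((d : ℝ) / 2) * (2 ^ (-(d : ℝ) / 2) * (n : ℝ) ^ (-(d : ℝ) / 2)) := by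
              rw [← mul_assoc, h3, one_mul]
          _ ≤ _ := mul_le_mul_of_nonneg_left h2 (by positivity)
      calc C₀ * (n : ℝ) ^ (-(d : ℝ) / 2)
          ≤ C₀ * (2 ^ ((d : ℝ) / 2) * ((n + 1 : ℕ) : ℝ) ^ (-(d : ℝ) / 2)) :=
            mul_le_mul_of_nonneg_left h1 hC₀.le
        _ = C₀ * 2 ^ ((d : ℝ) / 2) * ((n + 1 : ℕ) : ℝ) ^ (-(d : ℝ) / 2) := by ring
        _ ≤ _ := mul_le_mul_of_nonneg_right (le_max_right _ _) (by positivity)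
  refine ⟨max C₀ (4 * C₁), lt_of_lt_of_le hC₀ (le_max_left _ _), fun n hn x => ?_, fun n hn => ?_⟩
  · refine (hatP_regAt_le hstat hell n x).trans ((hb n hn x).trans (ENNReal.ofReal_le_ofReal ?_))
    exact mul_le_mul_of_nonneg_right (le_max_left _ _) (by positivity)
  · obtain ⟨m, rfl⟩ : ∃ m, n = m + 1 := ⟨n - 1, by omega⟩
    have h1 : ∑' x : Site d, (hatP P κ c (visitedIn c L (m + 1) x)) ^ 2 ≤
        ∑' x, (2 * ∫⁻ y, visitFun P κ c L (x - y) ∂G m) ^ 2 :=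
      ENNReal.tsum_le_tsum fun x =>
        pow_le_pow_left₀ zero_le (hatP_visitedIn_le h hstat hell hZ m x) 2
    refine h1.trans ((tsum_sq_conv_le (hG' m) _).trans ?_)
    have h2 : ∑' z, visitFun P κ c L z ≤ meanTau P κ c L := by
      rw [meanTau_eq h.toMixBound hstat hell hZ]
      exact tsum_visitFun_le
    rw [ENNReal.ofReal_mul hC₁0.le]
    have h3 : 4 * ENNReal.ofReal C₁ ≤ ENNReal.ofReal (max C₀ (4 * C₁)) := by
      rw [show (4 : ℝ≥0∞) = ENNReal.ofReal 4 by simp, ← ENNReal.ofReal_mul (by norm_num)]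
      exact ENNReal.ofReal_le_ofReal (le_max_right _ _)
    calc 4 * (∑' z, visitFun P κ c L z) ^ 2 *
          (ENNReal.ofReal C₁ * ENNReal.ofReal (((m + 1 : ℕ) : ℝ) ^ (-(d : ℝ) / 2)))
        = (4 * ENNReal.ofReal C₁) * (∑' z, visitFun P κ c L z) ^ 2 *
            ENNReal.ofReal (((m + 1 : ℕ) : ℝ) ^ (-(d : ℝ) / 2)) := by ring
      _ ≤ _ := by gcongr

end HeatKernel

end RWRE

end

/-! ### Assembly of the theorem -/

theorem mainTheorem4 {d : ℕ} [NeZero d] (P : Measure (Env d)) [IsProbabilityMeasure P]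
    (κ r v : ℝ) (hstat : Stationary P) (hell : UniformlyElliptic P κ)
    (hr : 1 ≤ r) (hMarkov : IsMarkovEnv P r) (hmix : MixingCondition P r)
    (hv : IsVelocity P v) (hvpos : 0 < v) :
    (∃ c : ℝ, 0 < c ∧ 0 < annealed P {X | timeR c X = ⊤}) ∧
    ∀ c : ℝ, 0 < annealed P {X | timeR c X = ⊤} →
      ∃ L₀ : ℕ, ∀ L : ℕ, L₀ ≤ L →
        (∀ n : ℕ, ∀ᵐ p ∂hatP P κ c, regTime c L n p < ⊤) ∧
        meanTau P κ c L < ⊤ ∧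
        ∃ C : ℝ, 0 < C ∧
          (∀ n : ℕ, 1 ≤ n → ∀ x : Site d,
            hatP P κ c (regAt c L n x) ≤ ENNReal.ofReal (C * (n : ℝ) ^ (-(d : ℝ) / 2))) ∧
          (∀ n : ℕ, 1 ≤ n →
            ∑' x : Site d, (hatP P κ c (visitedIn c L n x)) ^ 2 ≤
              ENNReal.ofReal C * (meanTau P κ c L) ^ 2 *
                ENNReal.ofReal ((n : ℝ) ^ (-(d : ℝ) / 2))) := by
  refine ⟨?_, fun c hc => ?_⟩
  · obtain ⟨C, hC, h⟩ := hv.exists_neverR hvpos hstat hell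
    exact ⟨C, by exact_mod_cast hC, by rw [annealed_timeR hstat hell]; exact h.bot_lt⟩
  · have hZ : letterLaw P κ (neverR c) ≠ 0 := by
      rw [annealed_timeR hstat hell] at hc; exact hc.ne'
    obtain ⟨L₀, hL₀⟩ := hmix.exists_goodMix c
    refine ⟨L₀, fun L hL => ?_⟩
    obtain ⟨θ, ε, h⟩ := hL₀ L hL
    have hmean := meanTau_eq h.toMixBound hstat hell hZ
    refine ⟨ae_hatP_regTime_lt_top h.toMixBound hstat hell hZ, ?_, ?_⟩
    · rw [hmean]
      exact tsum_length_lt_top h hstat hell hZ hv hvpos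
    · exact heatKernel_bounds h hstat hell hZ
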